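/- **Setting.** *Model.* Algorithms are randomized programs on a word RAM with $w$-bit words (unit cost for arithmetic, bitwise and comparison operations on words, indirect memory access, drawing a uniformly random word, reading an input word, writing an output pair). They never err and halt with probability one; times are expected. *3SUM.* Given $n\ge 1$ integers that fit in a word, decide whether three of them, at different positions, sum to $0$. "3SUM requires $n^{2-o(1)}$ expected time" means: for no $\varepsilon>0$ is there a program that, for some constant $\kappa$ and all $w\ge\kappa(\lfloor\log_2 n\rfloor+1)$, solves 3SUM in expected time $O(n^{2-\varepsilon})$. *DMOG.* A dictionary $D$ is a nonempty list of distinct patterns, each a nonempty string $P$ or of the form $P\{\alpha,\beta\}Q$ with nonempty strings $P,Q$ and $\alpha\le\beta\le\infty$; the gap $\{\alpha,\beta\}$ matches every string of length between $\alpha$ and $\beta$. $|D|$ is the total number of characters of the patterns. After preprocessing $D$ (without knowledge of the text), a text $T$ is given and all pairs ($i$, pattern of $D$ with an occurrence in $T$ ending at location $i$) must be reported; $op$ is the number of these pairs. In the online version the patterns ending at the $i$-th character are reported after that character is read and before the next one is; in the offline version they may be reported in any order after any part of $T$ has been read. Consider any of three kinds of gaps: all equal to $\{0,\infty\}$; all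 equal to one common finite $\{\alpha,\beta\}$; arbitrary finite. Let $N=|D|+|T|+(\text{largest finite gap bound})$. The algorithm comes with constants $\kappa_1<\kappa_2$ and has to work for all word sizes between $\kappa_1(\lfloor\log_2N\rfloor+1)$ and $\kappa_2(\lfloor\log_2N\rfloor+1)$ and all characters in $\{0,\dots,|D|\}$. *Degeneracy.* $G_D$ is the bipartite (multi)graph whose left (right) vertices are the first (second) subpatterns of the gapped patterns of $D$, with one edge for each gapped pattern; $\delta(G_D)$ is the largest minimum degree of a nonempty induced subgraph (and $0$ if there are no gapped patterns). **Theorem 3.** Assume that 3SUM requires $n^{2-o(1)}$ expected time. Consider an online or offline algorithm that solves DMOG for one of the three kinds of gaps, such that * its expected preprocessing time is at most $C\,|D|\,\delta(G_D)^{1-\varepsilon}$ whenever $\delta(G_D)\ge1$, for some constants $C$ and $\varepsilon>0$; * for every nonempty text, started from the preprocessed dictionary, the expected total time spent on $T$ is at most $c\,|T|+r(N)\,op$, where $r$ is sub-polynomial ($r(N)=O(N^{a})$ for every $a>0$) and $c=c(D,T,w)\in[0,\infty]$. Then the amortized expected time $c$ per text character is $\Omega(\delta(G_D)^{1-o(1)})$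 in the following sense: for all $\eta>0$, $x<1/2$, $K$ and $\Delta$ there are a dictionary $D$, a nonempty text $T$ and an admissible word size $w$ with $\delta(G_D)\ge\Delta$, $\delta(G_D)\ge|D|^{x}$, $N\le3|D|$ and $c(D,T,w)>K\,\delta(G_D)^{1-\eta}$. -/

import Mathlib

open scoped NNReal ENNReal

/-! ## The randomized word RAM

Programs are while-programs over a `w`-bit word RAM: registers and `2 ^ w` memory cells hold words
of `w` bits, memory is accessed indirectly, the usual arithmetic, bitwise and comparison operations
on words are available, and a uniformly random word can be drawn.  The input is a stream of words,
the output is a list of pairs of words.  Every elementary step costs one unit of time. -/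

namespace WordRAM

/-- The binary operations on words. Arithmetic is modulo `2 ^ w`; comparisons are unsigned and
give `0` or `1`. -/
inductive BinOp
  | add | sub | mul | div | mod | and | or | xor | shl | shr | eq | lt

def BinOp.eval {w : ℕ} : BinOp → BitVec w → BitVec w → BitVec w
  | .add, a, b => a + b
  | .sub, a, b => a - b
  | .mul, a, b => a * b
  | .div, a, b => a / b
  | .mod, a, b => a % b
  | .and, a, b => a &&& b
  | .or, a, b => a ||| b
  | .xor, a, b => a ^^^ b
  | .shl, a, b => a <<< b
  | .shr, a, b => a >>> b
  | .eq, a, b => if a = b then 1 else 0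
  | .lt, a, b => if a.toNat < b.toNat then 1 else 0

/-- Programs. The numbers `x y z` name registers. -/
inductive Cmd
  /-- do nothing -/
  | skip
  /-- `x := k` (modulo `2 ^ w`) -/
  | const (x k : ℕ)
  /-- `x := w` -/
  | wordSize (x : ℕ)
  /-- `x := y o z` -/
  | op (o : BinOp) (x y z : ℕ)
  /-- `x := mem[y]` -/
  | load (x y : ℕ)
  /-- `mem[x] := y` -/
  | store (x y : ℕ)
  /-- `x :=` a fresh uniformly random word -/
  | rand (x : ℕ)
  /-- `x :=` the next input word and `y := 1`; at the end of the input only `y := 0` -/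
  | read (x y : ℕ)
  /-- output the pair `(x, y)` -/
  | emit (x y : ℕ)
  | seq (c₁ c₂ : Cmd)
  /-- if `x ≠ 0` then `c₁` else `c₂` -/
  | ite (x : ℕ) (c₁ c₂ : Cmd)
  /-- while `x ≠ 0` do `c` -/
  | loop (x : ℕ) (c : Cmd)

/-- An output pair, together with the number of input words that had been read when it was
output. -/
structure Emission (w : ℕ) where
  time : ℕ
  fst : BitVec w
  snd : BitVec w

structure State (w : ℕ) where
  regs : ℕ → BitVec w
  mem : BitVec w → BitVec w
  /-- the part of the input that has not been read yet -/
  input : List (BitVec w)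
  /-- the number of input words read so far -/
  consumed : ℕ
  /-- the output so far, latest first -/
  out : List (Emission w)

/-- The initial state: registers and memory are zero. -/
def State.init {w : ℕ} (inp : List (BitVec w)) : State w :=
  ⟨fun _ => 0, fun _ => 0, inp, 0, []⟩

/-- Keep registers and memory, but start with a new input stream and an empty output. -/
def State.feed {w : ℕ} (s : State w) (inp : List (BitVec w)) : State w :=
  { s with input := inp, consumed := 0, out := [] }

def State.set {w : ℕ} (s : State w) (x : ℕ) (v : BitVec w) : State w :=
  { s with regs := Function.update s.regs x v }

/-- A configuration: the commands that remain to be executed, and the state. It is halted when no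
command remains. -/
abbrev Config (w : ℕ) := List Cmd × State w

noncomputable def step {w : ℕ} : Config w → PMF (Config w)
  | ([], s) => PMF.pure ([], s)
  | (.skip :: k, s) => PMF.pure (k, s)
  | (.const x n :: k, s) => PMF.pure (k, s.set x (BitVec.ofNat w n))
  | (.wordSize x :: k, s) => PMF.pure (k, s.set x (BitVec.ofNat w w))
  | (.op o x y z :: k, s) => PMF.pure (k, s.set x (o.eval (s.regs y) (s.regs z)))
  | (.load x y :: k, s) => PMF.pure (k, s.set x (s.mem (s.regs y)))
  | (.store x y :: k, s) =>
      PMF.pure (k, { s with mem := Function.update s.mem (s.regs x) (s.regs y) })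
  | (.rand x :: k, s) => (PMF.uniformOfFintype (BitVec w)).map fun v => (k, s.set x v)
  | (.read x y :: k, s) =>
      match s.input with
      | [] => PMF.pure (k, s.set y 0)
      | a :: rest =>
          PMF.pure (k, { (s.set x a).set y 1 with input := rest, consumed := s.consumed + 1 })
  | (.emit x y :: k, s) =>
      PMF.pure (k, { s with out := ⟨s.consumed, s.regs x, s.regs y⟩ :: s.out })
  | (.seq c₁ c₂ :: k, s) => PMF.pure (c₁ :: c₂ :: k, s)
  | (.ite x c₁ c₂ :: k, s) => PMF.pure ((if s.regs x ≠ 0 then c₁ else c₂) :: k, s)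
  | (.loop x c :: k, s) => PMF.pure (if s.regs x ≠ 0 then c :: .loop x c :: k else k, s)

/-- The distribution of the configuration after `t` steps. -/
noncomputable def run {w : ℕ} : ℕ → Config w → PMF (Config w)
  | 0, c => PMF.pure c
  | t + 1, c => (step c).bind (run t)

/-- The probability that `c`, started in `s`, halts in the state `s'`. -/
noncomputable def haltProb {w : ℕ} (c : Cmd) (s s' : State w) : ℝ≥0∞ :=
  ⨆ t, run t ([c], s) ([], s')

/-- The expected running time of `c` started in `s`: the sum over all `t` of the probability that
`c` has not halted after `t` steps. -/
noncomputable def expTime {w : ℕ} (c : Cmd) (s : State w) : ℝ≥0∞ :=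
  ∑' t, (run t ([c], s)).toOuterMeasure {cfg | cfg.1 ≠ []}

/-- Started in `s`, the program `c` halts with probability one, and every state in which it can
halt satisfies `post`. -/
def Computes {w : ℕ} (c : Cmd) (s : State w) (post : State w → Prop) : Prop :=
  (∑' s', haltProb c s s') = 1 ∧ ∀ s', haltProb c s s' ≠ 0 → post s'

end WordRAM

open WordRAM

/-! ## 3SUM -/

/-- Three of the given integers (at different positions) sum to zero. Words are read as signed
integers in two's complement, and the sum is taken in `ℤ`. -/
def HasZeroTriple {w : ℕ} (xs : List (BitVec w)) : Prop :=
  ∃ i j k : Fin xs.length, i < j ∧ j < k ∧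
    (xs.get i).toInt + (xs.get j).toInt + (xs.get k).toInt = 0

/-- `P` solves 3SUM on every nonempty list of `n` word-sized integers, without error and in
expected time at most `f n`, on all machines whose words have at least `κ (⌊log₂ n⌋ + 1)` bits.
`P` accepts by writing some output. -/
def SolvesThreeSum (P : Cmd) (κ : ℕ) (f : ℕ → ℝ) : Prop :=
  ∀ (w : ℕ) (xs : List (BitVec w)), xs ≠ [] → κ * (Nat.log 2 xs.length + 1) ≤ w →
    Computes P (State.init xs) (fun s => s.out ≠ [] ↔ HasZeroTriple xs) ∧
    expTime P (State.init xs) ≤ ENNReal.ofReal (f xs.length)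

/-- 3SUM requires `n ^ (2 - o(1))` expected time: no randomized algorithm solves it in expected
time `O(n ^ (2 - ε))` with `ε > 0`. -/
def ThreeSumConjecture : Prop :=
  ∀ ε : ℝ, 0 < ε → ¬ ∃ (P : Cmd) (κ : ℕ) (C : ℝ),
    SolvesThreeSum P κ (fun n => C * (n : ℝ) ^ (2 - ε))

/-! ## Dictionary matching with one gap -/

namespace DMOG

/-- Patterns with at most one gap; characters are natural numbers. `gapped p α β q` is
`p {α, β} q`, where `β = none` stands for `β = ∞`. -/
inductive Pattern
  | plain (p : List ℕ)
  | gapped (p : List ℕ) (α : ℕ) (β : Option ℕ) (q : List ℕ)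

/-- An occurrence of the pattern in the text `T` ends at location `i`, that is, with the `i`-th
character (counted from one). -/
def Pattern.EndsAt (T : List ℕ) (i : ℕ) : Pattern → Prop
  | plain p => p <:+ T.take i
  | gapped p α β q =>
      ∃ g : List ℕ, α ≤ g.length ∧ (∀ b ∈ β, g.length ≤ b) ∧ (p ++ g ++ q) <:+ T.take i

/-- The characters of a pattern. -/
def Pattern.chars : Pattern → List ℕ
  | plain p => p
  | gapped p _ _ q => p ++ q

/-- Subpatterns are nonempty and `α ≤ β`. -/
def Pattern.Valid : Pattern → Prop
  | plain p => p ≠ []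
  | gapped p α β q => p ≠ [] ∧ q ≠ [] ∧ ∀ b ∈ β, α ≤ b

/-- The largest finite gap bound of a pattern (`0` if there is none). -/
def Pattern.bound : Pattern → ℕ
  | plain _ => 0
  | gapped _ α β _ => max α (β.getD 0)

/-- The pattern as part of an input stream. -/
def Pattern.encode : Pattern → List ℕ
  | plain p => 0 :: p.length :: p
  | gapped p α β q =>
      1 :: p.length :: p ++ q.length :: q ++ [α, match β with | none => 0 | some b => b + 1]

abbrev Dictionary := List Pattern

namespace Dictionary

/-- `|D|`, the total length of the patterns. -/
def size (D : Dictionary) : ℕ := (D.map fun P => P.chars.length).sum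

/-- The largest finite gap bound in the dictionary. -/
def bound (D : Dictionary) : ℕ := (D.map Pattern.bound).foldr max 0

def encode (D : Dictionary) : List ℕ := D.flatMap Pattern.encode

/-- The edges of the bipartite multigraph `G_D`, one for each pattern with a gap: it joins the first
subpattern (a left vertex) to the second subpattern (a right vertex). -/
def edges (D : Dictionary) : List (List ℕ × List ℕ) :=
  D.filterMap fun P =>
    match P with
    | .plain _ => none
    | .gapped p _ _ q => some (p, q)

/-- The vertices of `G_D`: left copies of first subpatterns, right copies of second subpatterns. -/
def vertices (D : Dictionary) : Finset (List ℕ ⊕ List ℕ) :=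
  (D.edges.flatMap fun e => [Sum.inl e.1, Sum.inr e.2]).toFinset

/-- The degree of `u` in the subgraph of `G_D` induced by `U`, with multiplicities. -/
def degree (D : Dictionary) (U : Finset (List ℕ ⊕ List ℕ)) (u : List ℕ ⊕ List ℕ) : ℕ :=
  D.edges.countP fun e =>
    Sum.inl e.1 ∈ U ∧ Sum.inr e.2 ∈ U ∧ (u = Sum.inl e.1 ∨ u = Sum.inr e.2)

/-- The degeneracy `δ(G_D)`: the largest minimum degree of a nonempty induced subgraph of `G_D`
(and `0` if `G_D` has no vertices). -/
def degeneracy (D : Dictionary) : ℕ :=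
  D.vertices.powerset.sup fun U => if h : U.Nonempty then U.inf' h (D.degree U) else 0

end Dictionary

/-- The three versions of the problem: all gaps are `{0, ∞}`; all patterns have the same finite
gap bounds; every pattern has its own finite gap bounds. -/
inductive GapKind
  | unbounded | uniform | nonuniform

def GapKind.Allows (D : Dictionary) : GapKind → Prop
  | unbounded => ∀ p α β q, Pattern.gapped p α β q ∈ D → α = 0 ∧ β = none
  | uniform => ∃ a b : ℕ, ∀ p α β q, Pattern.gapped p α β q ∈ D → α = a ∧ β = some b
  | nonuniform => ∀ p α β q, Pattern.gapped p α β q ∈ D → β ≠ none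

/-- An offline algorithm sees the whole text before it answers; an online algorithm must report
the patterns that end at a character before it reads the next character. -/
inductive Mode
  | offline | online

/-- The size of an instance; machine words have `Θ(log N)` bits for this `N`. -/
def instSize (D : Dictionary) (T : List ℕ) : ℕ := D.size + T.length + D.bound

/-- The pairs (location, index of a pattern that ends there) that have to be reported. -/
def occurrences (D : Dictionary) (T : List ℕ) : Set (ℕ × ℕ) :=
  {o | 1 ≤ o.1 ∧ o.1 ≤ T.length ∧ ∃ P, D[o.2]? = some P ∧ P.EndsAt T o.1}

/-- `op`, the size of the output. -/
noncomputable def outSize (D : Dictionary) (T : List ℕ) : ℕ := (occurrences D T).ncard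

/-- A number sequence as an input stream of words. -/
def toWords (w : ℕ) (l : List ℕ) : List (BitVec w) := l.map (BitVec.ofNat w)

/-- An algorithm with preprocessing: `pre` reads the dictionary, and `query`, started with the
registers and the memory that `pre` has left, reads the text. It is meant for machines whose word
size lies between `κ₁ (⌊log₂ N⌋ + 1)` and `κ₂ (⌊log₂ N⌋ + 1)`. -/
structure Algorithm where
  pre : Cmd
  query : Cmd
  κ₁ : ℕ
  κ₂ : ℕ
  lt : κ₁ < κ₂

namespace Algorithm

/-- The instances and word sizes on which the algorithm has to work. Nothing is lost by the
restriction of the alphabet to `{0, …, |D|}`: there are at most `|D|` characters in `D`, and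
one more symbol can stand for all others. -/
structure Admissible (A : Algorithm) (kind : GapKind) (D : Dictionary) (T : List ℕ) (w : ℕ) :
    Prop where
  nonempty : D ≠ []
  nodup : D.Nodup
  valid : ∀ P ∈ D, P.Valid
  kind : kind.Allows D
  alphabet_dict : ∀ P ∈ D, ∀ a ∈ P.chars, a ≤ D.size
  alphabet_text : ∀ a ∈ T, a ≤ D.size
  word_lower : A.κ₁ * (Nat.log 2 (instSize D T) + 1) ≤ w
  word_upper : w ≤ A.κ₂ * (Nat.log 2 (instSize D T) + 1)

/-- The output consists of exactly the occurrences; in the online case, those that end at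
the `i`-th character are reported when exactly `i` characters have been read. -/
def Correct {w : ℕ} (mode : Mode) (D : Dictionary) (T : List ℕ) (s : State w) : Prop :=
  {o | ∃ e ∈ s.out, o = (e.fst.toNat, e.snd.toNat)} = occurrences D T ∧
  (mode = Mode.online → ∀ e ∈ s.out, e.fst.toNat = e.time)

/-- The algorithm solves the given version of the problem, without error. -/
def Solves (A : Algorithm) (kind : GapKind) (mode : Mode) : Prop :=
  ∀ D T w, A.Admissible kind D T w →
    Computes A.pre (State.init (toWords w D.encode)) fun s =>
      Computes A.query (s.feed (toWords w T)) (Correct mode D T)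

/-- The expected preprocessing time. -/
noncomputable def preTime (A : Algorithm) (D : Dictionary) (w : ℕ) : ℝ≥0∞ :=
  expTime A.pre (State.init (toWords w D.encode))

/-- The expected total time spent on the text, over the random choices of both phases. -/
noncomputable def queryTime (A : Algorithm) (D : Dictionary) (T : List ℕ) (w : ℕ) : ℝ≥0∞ :=
  ∑' s, haltProb A.pre (State.init (toWords w D.encode)) s *
    expTime A.query (s.feed (toWords w T))

end Algorithm

/-- A sub-polynomial function: `r n = O(n ^ a)` for every `a > 0`. -/
def SubPolynomial (r : ℕ → ℝ≥0) : Prop :=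
  ∀ a : ℝ, 0 < a → (fun n => (r n : ℝ)) =O[Filter.atTop] fun n : ℕ => (n : ℝ) ^ a

end DMOG

open DMOG

/-! The proof is by contradiction: if the time per character were small on all large dictionaries,
3SUM could be solved in expected time `O(n ^ (2 - 1 / (2 t)))` for some constant `t`. Shift the
input numbers by `2 ^ (w - 1)`, so that a zero triple has the sum `T = 3 * 2 ^ (w - 1)`, and hash
them to `Q = q ^ 2` values, where `q` is a power of two of order `n ^ ((1 + 1 / t) / 2)`. The random
multiplicative hash function is almost linear. Triples of sum `T` have hash sums among three
consecutive residues modulo `Q` (`hashMatch_of_sum`), whereas a triple with another sum passes this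
test with probability at most `36 / Q` (`card_hashMatch_le`). A residue `z = x q + y` is marked if
some third position can complete two positions with hash sum `z`. The dictionary contains for each
marked `z` the pattern "letter `x`, gap, letter `q + y`". For each shift `u < Q` a text of length `2
q` contains `x` if the bucket `u + x q` is nonempty, and later `q + y` if the bucket `y - u` is
nonempty. Both buckets have hash sum `z`, so the reports for `u` are the pairs of nonempty buckets
worth searching (`mem_occurrences_gadget`). Every pair of positions belongs to exactly one `(u, z)`,
hence the `Q` texts find all solutions (`exists_dirtyU_iff`). The reported buckets are searched
exhaustively and each candidate triple is tested exactly, so the hash function influences only the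
time. Preprocessing costs `O(q ^ 3)`, the texts cost `2 q ^ 3 c` apart from the reports, with `c =
O(q ^ (1 - η))`. Reports and searches are charged to matching triples of wrong sum, of which about
`n ^ 3 / Q` are expected (`expected_falseCount_le`), plus a linear number of degenerate ones. True
solutions do no harm, because the search stops at the first one. For `1 / t` small compared with `η`
every term is `O(n ^ (2 - 1 / (2 t)))` (`cost_le_rpow`). Unmarked pairs are encoded with other
letters, and further letters carry a complete bipartite graph. Therefore `|D| = 4 q ^ 2` and the
degeneracy `q` do not depend on the marks (`degeneracy_gadget`), and `q` exceeds `|D| ^ x` for `x <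
1 / 2` and large `q`. On the machine level two points need care. The matching algorithm is only
assumed to work for words of `Θ(log N)` bits, while 3SUM may come with much longer words, so it is
simulated by masking (`ert_comp`). Each text has to start from the memory left by the preprocessing;
time stamps on memory cells restore it without copying. Expected times are handled by the cost
transformer `ert`, which bounds operational expectations in both directions (`expTime_le_ert`,
`ert_le_expTime`). -/

namespace WordRAM

/-! ## Expected cost transformer -/

section Ert

variable {w : ℕ}

/-- The expected value of `κ` times the number of steps plus `f` of the final state. -/
noncomputable def ert (κ : ℝ≥0∞) : Cmd → (State w → ℝ≥0∞) → State w → ℝ≥0∞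
  | .skip, f, s => κ + f s
  | .const x n, f, s => κ + f (s.set x (BitVec.ofNat w n))
  | .wordSize x, f, s => κ + f (s.set x (BitVec.ofNat w w))
  | .op o x y z, f, s => κ + f (s.set x (o.eval (s.regs y) (s.regs z)))
  | .load x y, f, s => κ + f (s.set x (s.mem (s.regs y)))
  | .store x y, f, s => κ + f { s with mem := Function.update s.mem (s.regs x) (s.regs y) }
  | .rand x, f, s => κ + ∑ v : BitVec w, ((2 : ℝ≥0∞) ^ w)⁻¹ * f (s.set x v)
  | .read x y, f, s =>
      κ + match s.input with
      | [] => f (s.set y 0)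
      | a :: rest => f { (s.set x a).set y 1 with input := rest, consumed := s.consumed + 1 }
  | .emit x y, f, s => κ + f { s with out := ⟨s.consumed, s.regs x, s.regs y⟩ :: s.out }
  | .seq c₁ c₂, f, s => κ + ert κ c₁ (ert κ c₂ f) s
  | .ite x c₁ c₂, f, s => κ + if s.regs x ≠ 0 then ert κ c₁ f s else ert κ c₂ f s
  | .loop x c, f, s =>
      (sInf {g : State w → ℝ≥0∞ |
        ∀ s, κ + (if s.regs x ≠ 0 then ert κ c g s else f s) ≤ g s}) s

theorem ert_mono (κ : ℝ≥0∞) (c : Cmd) : ∀ {f g : State w → ℝ≥0∞}, f ≤ g → ert κ c f ≤ ert κ c g := by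
  induction c with
  | skip | const | wordSize | op | load | store | emit =>
    intro f g h s; simp only [ert]; gcongr; exact h _
  | rand x =>
    intro f g h s; simp only [ert]; gcongr; exact h _
  | read x y =>
    intro f g h s; simp only [ert]; gcongr
    cases s.input <;> exact h _
  | seq c₁ c₂ ih₁ ih₂ =>
    intro f g h s; simp only [ert]; gcongr; exact ih₁ (ih₂ h) s
  | ite x c₁ c₂ ih₁ ih₂ =>
    intro f g h s; simp only [ert]; gcongr
    split_ifs
    · exact ih₁ h s
    · exact ih₂ h s
  | loop x c ih =>
    intro f g h s; simp only [ert]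
    refine (sInf_le_sInf ?_ : (sInf _ : State w → ℝ≥0∞) ≤ sInf _) s
    intro k hk
    rw [Set.mem_ofPred_eq] at hk ⊢
    refine fun s => le_trans ?_ (hk s)
    gcongr
    split_ifs
    · exact le_rfl
    · exact h s

/-- Park induction: the loop is a least pre-fixed point, so one function `g` that survives an
unrolling is enough to bound it. No termination argument is needed. -/
theorem ert_loop_le_of {κ : ℝ≥0∞} {x : ℕ} {c : Cmd} {f g : State w → ℝ≥0∞}
    (hg : ∀ s, κ + (if s.regs x ≠ 0 then ert κ c g s else f s) ≤ g s) :
    ert κ (.loop x c) f ≤ g := by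
  intro s
  simp only [ert]
  exact (sInf_le (by rwa [Set.mem_ofPred_eq]) : sInf _ ≤ g) s

/-- Knaster–Tarski: by monotonicity the unrolling of the infimum lies below every pre-fixed point,
hence below their infimum. -/
theorem ert_loop_ge (κ : ℝ≥0∞) (x : ℕ) (c : Cmd) (f : State w → ℝ≥0∞) (s : State w) :
    κ + (if s.regs x ≠ 0 then ert κ c (ert κ (.loop x c) f) s else f s)
      ≤ ert κ (.loop x c) f s := by
  conv_rhs => simp only [ert]
  rw [sInf_apply]
  refine le_iInf fun g => ?_
  have hg := g.2
  rw [Set.mem_ofPred_eq] at hg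
  refine le_trans ?_ (hg s)
  gcongr
  split_ifs
  · exact ert_mono κ c (ert_loop_le_of hg) s
  · exact le_rfl

/-- The unrolled expression is itself a pre-fixed point, by `ert_loop_ge`. -/
theorem ert_loop_le (κ : ℝ≥0∞) (x : ℕ) (c : Cmd) (f : State w → ℝ≥0∞) (s : State w) :
    ert κ (.loop x c) f s ≤
      κ + (if s.regs x ≠ 0 then ert κ c (ert κ (.loop x c) f) s else f s) := by
  refine ert_loop_le_of (g := fun s =>
    κ + (if s.regs x ≠ 0 then ert κ c (ert κ (.loop x c) f) s else f s)) (fun s => ?_) s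
  gcongr
  split_ifs
  · exact ert_mono κ c (fun s => ert_loop_ge κ x c f s) s
  · exact le_rfl

/-- `ert` for a list of commands. -/
noncomputable def ertList (κ : ℝ≥0∞) (f : State w → ℝ≥0∞) : List Cmd → State w → ℝ≥0∞
  | [] => f
  | c :: k => ert κ c (ertList κ f k)

/-- The contribution of the first `t` steps to `ert`. -/
noncomputable def ev (κ : ℝ≥0∞) (t : ℕ) (cfg : Config w) (f : State w → ℝ≥0∞) : ℝ≥0∞ :=
  κ * ∑ i ∈ Finset.range t, (run i cfg).toOuterMeasure {c | c.1 ≠ []} +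
    ∑' s', run t cfg ([], s') * f s'

theorem run_nil (t : ℕ) (s : State w) : run t ([], s) = PMF.pure ([], s) := by
  induction t with
  | zero => rfl
  | succ t ih => simp only [run, step, PMF.pure_bind, ih]

theorem ev_zero_cons (κ : ℝ≥0∞) (c : Cmd) (k : List Cmd) (s : State w) (f : State w → ℝ≥0∞) :
    ev κ 0 (c :: k, s) f = 0 := by
  simp [ev, run, PMF.pure_apply]

theorem ev_nil (κ : ℝ≥0∞) (t : ℕ) (s : State w) (f : State w → ℝ≥0∞) :
    ev κ t ([], s) f = f s := by
  simp only [ev, run_nil]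
  have h1 : (PMF.pure (([], s) : Config w)).toOuterMeasure {c | c.1 ≠ []} = 0 := by
    rw [PMF.toOuterMeasure_pure_apply]; simp
  rw [h1, tsum_eq_single s]
  · simp
  · intro s' hs'
    simp [PMF.pure_apply, hs']

/-- Conditioning on the first step. The term for time `0` is exactly `κ`, because a command is still
pending. -/
theorem ev_succ (κ : ℝ≥0∞) (t : ℕ) (c : Cmd) (k : List Cmd) (s : State w) (f : State w → ℝ≥0∞) :
    ev κ (t + 1) (c :: k, s) f = κ + ∑' cfg, step (c :: k, s) cfg * ev κ t cfg f := by
  have h0 : (run 0 ((c :: k, s) : Config w)).toOuterMeasure {c | c.1 ≠ []} = 1 := by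
    simp only [run]
    rw [PMF.toOuterMeasure_pure_apply]; simp
  simp only [ev]
  rw [Finset.sum_range_succ', h0]
  simp only [run, PMF.toOuterMeasure_bind_apply, PMF.bind_apply]
  simp_rw [mul_add, ENNReal.tsum_add, mul_one, ← ENNReal.tsum_mul_right, ← ENNReal.tsum_mul_left]
  rw [ENNReal.tsum_comm]
  have h1 : κ * ∑ i ∈ Finset.range t, ∑' a, step (c :: k, s) a *
        (run i a).toOuterMeasure {c | c.1 ≠ []} =
      ∑' a, step (c :: k, s) a * (κ * ∑ i ∈ Finset.range t,
        (run i a).toOuterMeasure {c | c.1 ≠ []}) := by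
    rw [← Summable.tsum_finsetSum (fun _ _ => ENNReal.summable), ← ENNReal.tsum_mul_left]
    refine tsum_congr fun a => ?_
    rw [← Finset.mul_sum]; ring
  rw [h1, add_comm _ κ, add_assoc]
  simp only [mul_assoc]

theorem tsum_pure_mul {α : Type*} (a : α) (g : α → ℝ≥0∞) : ∑' b, PMF.pure a b * g b = g a := by
  rw [tsum_eq_single a]
  · simp
  · intro b hb; simp [PMF.pure_apply, hb]

theorem tsum_map_mul {α β : Type*} (p : PMF α) (h : α → β) (g : β → ℝ≥0∞) :
    ∑' b, (p.map h) b * g b = ∑' a, p a * g (h a) := by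
  simp only [PMF.map, PMF.bind_apply, ← ENNReal.tsum_mul_right]
  rw [ENNReal.tsum_comm]
  refine tsum_congr fun a => ?_
  simp only [mul_assoc, ENNReal.tsum_mul_left, Function.comp, tsum_pure_mul]

theorem tsum_step_rand (x : ℕ) (k : List Cmd) (s : State w) (g : Config w → ℝ≥0∞) :
    ∑' cfg, step (.rand x :: k, s) cfg * g cfg =
      ∑ v : BitVec w, ((2 : ℝ≥0∞) ^ w)⁻¹ * g (k, s.set x v) := by
  have hc : Fintype.card (BitVec w) = 2 ^ w := by
    rw [Fintype.card_congr (BitVec.equivFin (m := w)).toEquiv, Fintype.card_fin]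
  simp only [step, tsum_map_mul, PMF.uniformOfFintype_apply, tsum_fintype, hc]
  simp

/-- Truncation after `t` steps makes an induction possible: one machine step corresponds to one
clause of `ert`. For a loop only the inequality `ert_loop_ge` is used. -/
theorem ev_le_ertList (κ : ℝ≥0∞) (f : State w → ℝ≥0∞) (t : ℕ) :
    ∀ (k : List Cmd) (s : State w), ev κ t (k, s) f ≤ ertList κ f k s := by
  induction t with
  | zero =>
    intro k s
    cases k with
    | nil => rw [ev_nil]; rfl
    | cons c k => rw [ev_zero_cons]; exact zero_le
  | succ t ih =>
    intro k s
    cases k with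
    | nil => rw [ev_nil]; rfl
    | cons c k =>
      rw [ev_succ]
      cases c with
      | rand x =>
        rw [tsum_step_rand]; simp only [ertList, ert]; gcongr; exact ih _ _
      | read x y =>
        simp only [ertList, ert, step]
        cases s.input <;> simp only [tsum_pure_mul] <;> gcongr <;> exact ih _ _
      | seq c₁ c₂ =>
        simp only [step, tsum_pure_mul]
        simp only [ertList, ert]; gcongr; exact ih _ _
      | ite x c₁ c₂ =>
        simp only [step, tsum_pure_mul]
        simp only [ertList, ert]; gcongr
        split_ifs <;> exact ih _ _
      | loop x c =>
        simp only [step, tsum_pure_mul]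
        simp only [ertList]
        refine le_trans ?_ (ert_loop_ge _ _ _ _ _)
        gcongr
        split_ifs <;> exact ih _ _
      | _ => simp only [step, tsum_pure_mul]; simp only [ertList, ert]; gcongr; exact ih _ _

theorem run_halt_mono (t : ℕ) : ∀ (cfg : Config w) (s' : State w),
    run t cfg ([], s') ≤ run (t + 1) cfg ([], s') := by
  induction t with
  | zero =>
    rintro ⟨k, s⟩ s'
    cases k with
    | nil => rw [run_nil, run_nil]
    | cons c k => simp [run, PMF.pure_apply]
  | succ t ih =>
    intro cfg s'
    rw [run, run, PMF.bind_apply, PMF.bind_apply]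
    exact ENNReal.tsum_le_tsum fun a => by gcongr; exact ih a s'

theorem run_halt_monotone (cfg : Config w) (s' : State w) :
    Monotone fun t => run t cfg ([], s') :=
  monotone_nat_of_le_succ fun t => run_halt_mono t cfg s'

theorem ev_mono (κ : ℝ≥0∞) (cfg : Config w) (f : State w → ℝ≥0∞) :
    Monotone fun t => ev κ t cfg f := by
  intro t t' h
  simp only [ev]
  gcongr with s'
  exact run_halt_monotone cfg s' h

/-- The operational expected cost of a list of commands. -/
noncomputable def evSup (κ : ℝ≥0∞) (k : List Cmd) (f : State w → ℝ≥0∞) (s : State w) : ℝ≥0∞ :=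
  ⨆ t, ev κ t (k, s) f

theorem evSup_pure {κ : ℝ≥0∞} {c : Cmd} {k k' : List Cmd} {s s' : State w} (f : State w → ℝ≥0∞)
    (h : step (c :: k, s) = PMF.pure (k', s')) :
    κ + evSup κ k' f s' ≤ evSup κ (c :: k) f s := by
  rw [evSup, ENNReal.add_iSup]
  refine iSup_le fun t => ?_
  refine le_trans (le_of_eq ?_) (le_iSup _ (t + 1))
  rw [ev_succ, h, tsum_pure_mul]

theorem evSup_rand (κ : ℝ≥0∞) (x : ℕ) (k : List Cmd) (s : State w) (f : State w → ℝ≥0∞) :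
    κ + ∑ v : BitVec w, ((2 : ℝ≥0∞) ^ w)⁻¹ * evSup κ k f (s.set x v) ≤
      evSup κ (.rand x :: k) f s := by
  simp only [evSup, ENNReal.mul_iSup]
  rw [ENNReal.finsetSum_iSup_of_monotone, ENNReal.add_iSup]
  · refine iSup_le fun t => ?_
    refine le_trans (le_of_eq ?_) (le_iSup _ (t + 1))
    rw [ev_succ, tsum_step_rand]
  · intro v t t' h
    dsimp only
    gcongr
    exact ev_mono _ _ _ h

/-- The operational cost is a pre-fixed point of the loop unrolling, so the least one, which is
`ert`, cannot exceed it. -/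
theorem ert_evSup_le (κ : ℝ≥0∞) (f : State w → ℝ≥0∞) (c : Cmd) : ∀ (k : List Cmd) (s : State w),
    ert κ c (evSup κ k f) s ≤ evSup κ (c :: k) f s := by
  induction c with
  | rand x => intro k s; exact evSup_rand _ _ _ _ _
  | read x y =>
    intro k s
    simp only [ert]
    rcases h : s.input with _ | ⟨a, rest⟩ <;>
    exact evSup_pure _ (by simp only [step, h])
  | seq c₁ c₂ ih₁ ih₂ =>
    intro k s
    simp only [ert]
    refine le_trans ?_ (evSup_pure (k' := c₁ :: c₂ :: k) (s' := s) f rfl)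
    gcongr
    exact (ert_mono _ _ (fun s => ih₂ k s) s).trans (ih₁ _ s)
  | ite x c₁ c₂ ih₁ ih₂ =>
    intro k s
    simp only [ert]
    refine le_trans ?_ (evSup_pure (s' := s) f rfl)
    gcongr
    split_ifs
    · exact ih₁ _ _
    · exact ih₂ _ _
  | loop x c ih =>
    intro k s
    refine ert_loop_le_of (fun s => ?_) s
    refine le_trans ?_ (evSup_pure (s' := s) f rfl)
    gcongr
    split_ifs
    · exact ih _ _
    · exact le_rfl
  | _ => intro k s; exact evSup_pure _ rfl

theorem evSup_nil (κ : ℝ≥0∞) (f : State w → ℝ≥0∞) : evSup κ [] f = f := by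
  funext s; simp [evSup, ev_nil]

/-- This direction serves the given algorithm, whose running time is assumed: it bounds `ert` for
any price `κ` per step. The converse `expTime_le_ert` serves the program that is built here. -/
theorem ert_le_expTime (κ : ℝ≥0∞) (f : State w → ℝ≥0∞) (c : Cmd) (s : State w) :
    ert κ c f s ≤ κ * expTime c s + ∑' s', haltProb c s s' * f s' := by
  have h := ert_evSup_le κ f c [] s
  rw [evSup_nil] at h
  refine h.trans (iSup_le fun t => ?_)
  simp only [ev, expTime]
  gcongr with s'
  · exact ENNReal.sum_le_tsum _
  · exact le_iSup (fun t => run t ([c], s) ([], s')) t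

theorem expTime_le_ert (f : State w → ℝ≥0∞) (c : Cmd) (s : State w) :
    expTime c s ≤ ert 1 c f s := by
  rw [expTime, ENNReal.tsum_eq_iSup_nat]
  refine iSup_le fun t => ?_
  refine le_trans ?_ (ev_le_ertList 1 f t [c] s)
  rw [ev, one_mul]
  exact le_self_add

/-- Bad final states get the value `∞`; a finite expectation then leaves them no probability. -/
theorem post_of_ert_ne_top {c : Cmd} {s : State w} {post : State w → Prop}
    {f : State w → ℝ≥0∞} (hf : ∀ s', ¬ post s' → f s' = ∞) (h : ert 1 c f s ≠ ∞)
    {s' : State w} (hs' : haltProb c s s' ≠ 0) : post s' := by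
  by_contra hp
  obtain ⟨t, ht⟩ : ∃ t, run t ([c], s) ([], s') ≠ 0 := by
    by_contra! h0
    exact hs' (by simp [haltProb, h0])
  refine h (top_le_iff.1 (le_trans ?_ (ev_le_ertList 1 f t [c] s)))
  rw [ev]
  refine le_trans (le_trans ?_ (ENNReal.le_tsum s')) le_add_self
  rw [hf s' hp, ENNReal.mul_top ht]

theorem tsum_halt_add_not_halt (t : ℕ) (cfg : Config w) :
    ∑' s', run t cfg ([], s') + (run t cfg).toOuterMeasure {c | c.1 ≠ []} = 1 := by
  rw [← (run t cfg).tsum_coe, PMF.toOuterMeasure_apply]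
  have : ∑' s', run t cfg ([], s') =
      ∑' c, ({c : Config w | c.1 = []} : Set (Config w)).indicator (run t cfg) c := by
    rw [← tsum_subtype]
    let e : State w ≃ {c : Config w | c.1 = []} :=
      ⟨fun s => ⟨([], s), rfl⟩, fun c => c.1.2, fun s => rfl, fun ⟨⟨k, s⟩, h⟩ => by
        simp only [Set.mem_ofPred_eq] at h; subst h; rfl⟩
    exact e.tsum_eq (fun c : {c : Config w | c.1 = []} => run t cfg c)
  rw [this, ← ENNReal.tsum_add]
  refine tsum_congr fun c => ?_
  by_cases h : c.1 = [] <;> simp [Set.indicator, h]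

theorem tsum_haltProb_le_one (c : Cmd) (s : State w) : ∑' s', haltProb c s s' ≤ 1 := by
  rw [ENNReal.tsum_eq_iSup_sum]
  refine iSup_le fun F => ?_
  simp only [haltProb]
  rw [ENNReal.finsetSum_iSup_of_monotone fun s' => run_halt_monotone _ _]
  refine iSup_le fun t => ?_
  rw [← tsum_halt_add_not_halt t ([c], s)]
  exact (ENNReal.sum_le_tsum F).trans le_self_add

theorem tsum_haltProb_eq_one {c : Cmd} {s : State w} (h : expTime c s ≠ ∞) :
    ∑' s', haltProb c s s' = 1 := by
  refine le_antisymm (tsum_haltProb_le_one c s) ?_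
  -- The expected time is the sum of the probabilities of still running; if it is finite, these
  -- probabilities tend to zero.
  have h0 := ENNReal.tendsto_atTop_zero_of_tsum_ne_top h
  refine ge_of_tendsto' (b := (1 : ℝ≥0∞)) (a := ∑' s', haltProb c s s')
    (f := fun _ : ℕ => ∑' s', haltProb c s s') (x := Filter.atTop) tendsto_const_nhds ?_ |>.trans le_rfl
  intro _
  have h1 : Filter.Tendsto (fun t => ∑' s', haltProb c s s' +
      (run t ([c], s)).toOuterMeasure {c | c.1 ≠ []}) Filter.atTop
      (nhds (∑' s', haltProb c s s' + 0)) := tendsto_const_nhds.add h0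
  rw [add_zero] at h1
  refine ge_of_tendsto' h1 fun t => ?_
  rw [← tsum_halt_add_not_halt t ([c], s)]
  gcongr with s'
  exact le_iSup (fun t => run t ([c], s) ([], s')) t

theorem computes_of_ert {c : Cmd} {s : State w} {post : State w → Prop} {f : State w → ℝ≥0∞}
    (hf : ∀ s', ¬ post s' → f s' = ∞) (h : ert 1 c f s ≠ ∞) : Computes c s post :=
  ⟨tsum_haltProb_eq_one (ne_top_of_le_ne_top h (expTime_le_ert f c s)),
    fun _ hs' => post_of_ert_ne_top hf h hs'⟩

end Ert

end WordRAM

namespace WordRAM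

/-! ## Cost triples -/

section Runs

variable {w : ℕ}

/-- Started in `s`, the program `c` ends in a state that satisfies `Post`, and its expected cost is
at most `B`. -/
def Runs (c : Cmd) (s : State w) (Post : State w → Prop) (B : ℝ≥0∞) : Prop :=
  ∀ (f : State w → ℝ≥0∞) (X : ℝ≥0∞), (∀ s', Post s' → f s' ≤ X) → ert 1 c f s ≤ B + X

theorem Runs.mono {c : Cmd} {s : State w} {P Q : State w → Prop} {B B' : ℝ≥0∞}
    (h : Runs c s P B) (hPQ : ∀ s', P s' → Q s') (hB : B ≤ B') : Runs c s Q B' :=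
  fun f X hf => (h f X fun s' hs' => hf s' (hPQ s' hs')).trans (by gcongr)

theorem Runs.seq {c₁ c₂ : Cmd} {s : State w} {P Q : State w → Prop} {B₁ B₂ : ℝ≥0∞}
    (h₁ : Runs c₁ s P B₁) (h₂ : ∀ s', P s' → Runs c₂ s' Q B₂) :
    Runs (.seq c₁ c₂) s Q (1 + B₁ + B₂) := by
  intro f X hf
  simp only [ert]
  have := h₁ (ert 1 c₂ f) (B₂ + X) (fun s' hs' => h₂ s' hs' f X hf)
  calc _ ≤ 1 + (B₁ + (B₂ + X)) := by gcongr
    _ = _ := by ring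

theorem Runs.ite {x : ℕ} {c₁ c₂ : Cmd} {s : State w} {Q : State w → Prop} {B : ℝ≥0∞}
    (h₁ : s.regs x ≠ 0 → Runs c₁ s Q B) (h₂ : s.regs x = 0 → Runs c₂ s Q B) :
    Runs (.ite x c₁ c₂) s Q (1 + B) := by
  intro f X hf
  simp only [ert]
  rw [add_assoc]
  gcongr
  split_ifs with h
  · exact h₁ h f X hf
  · exact h₂ (not_not.1 h) f X hf

/-- Write to the memory. -/
def State.upd (s : State w) (a v : BitVec w) : State w :=
  { s with mem := Function.update s.mem a v }

@[simp] theorem State.set_regs (s : State w) (x : ℕ) (v : BitVec w) :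
    (s.set x v).regs = Function.update s.regs x v := rfl
@[simp] theorem State.set_mem (s : State w) (x : ℕ) (v : BitVec w) : (s.set x v).mem = s.mem := rfl
@[simp] theorem State.upd_mem (s : State w) (a v : BitVec w) :
    (s.upd a v).mem = Function.update s.mem a v := rfl
@[simp] theorem State.set_input (s : State w) (x : ℕ) (v : BitVec w) :
    (s.set x v).input = s.input := rfl
@[simp] theorem State.upd_input (s : State w) (a v : BitVec w) : (s.upd a v).input = s.input := rfl
@[simp] theorem State.set_consumed (s : State w) (x : ℕ) (v : BitVec w) :
    (s.set x v).consumed = s.consumed := rfl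
@[simp] theorem State.upd_consumed (s : State w) (a v : BitVec w) :
    (s.upd a v).consumed = s.consumed := rfl
@[simp] theorem State.set_out (s : State w) (x : ℕ) (v : BitVec w) : (s.set x v).out = s.out := rfl
@[simp] theorem State.upd_out (s : State w) (a v : BitVec w) : (s.upd a v).out = s.out := rfl
@[simp] theorem State.upd_regs (s : State w) (a v : BitVec w) : (s.upd a v).regs = s.regs := rfl
@[simp] theorem State.set_set (s : State w) (x : ℕ) (v v' : BitVec w) :
    (s.set x v).set x v' = s.set x v' := by simp [State.set]

theorem one_ne_zero_word (hw : w ≠ 0) : (1 : BitVec w) ≠ 0 := by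
  intro e
  have := congrArg BitVec.toNat e
  have h3 : 1 < 2 ^ w := Nat.one_lt_two_pow hw
  simp [Nat.mod_eq_of_lt h3] at this

theorem flag_ne_zero (hw : w ≠ 0) (P : Prop) [Decidable P] :
    (if P then (1 : BitVec w) else 0) ≠ 0 ↔ P := by
  have h10 := one_ne_zero_word hw
  split_ifs with h
  · exact iff_of_true h10 h
  · exact iff_of_false (fun h => h rfl) h

/-- Sequential composition of a list of commands. -/
def block : List Cmd → Cmd
  | [] => .skip
  | [c] => c
  | c :: l => .seq c (block l)

/-- Commands without random choices, loops, input and output. -/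
def Cmd.straight : Cmd → Bool
  | .skip | .const _ _ | .wordSize _ | .op _ _ _ _ | .load _ _ | .store _ _ => true
  | .rand _ | .read _ _ | .emit _ _ | .loop _ _ => false
  | .seq c₁ c₂ | .ite _ c₁ c₂ => c₁.straight && c₂.straight

/-- The effect of a straight command. -/
def det : Cmd → State w → State w
  | .const x n, s => s.set x (BitVec.ofNat w n)
  | .wordSize x, s => s.set x (BitVec.ofNat w w)
  | .op o x y z, s => s.set x (o.eval (s.regs y) (s.regs z))
  | .load x y, s => s.set x (s.mem (s.regs y))
  | .store x y, s => s.upd (s.regs x) (s.regs y)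
  | .seq c₁ c₂, s => det c₂ (det c₁ s)
  | .ite x c₁ c₂, s => if s.regs x ≠ 0 then det c₁ s else det c₂ s
  | _, s => s

/-- A bound on the running time of a straight command. -/
def Cmd.time : Cmd → ℕ
  | .seq c₁ c₂ => 1 + c₁.time + c₂.time
  | .ite _ c₁ c₂ => 1 + max c₁.time c₂.time
  | _ => 1

theorem ert_straight {c : Cmd} (f : State w → ℝ≥0∞) (s : State w) (h : c.straight = true) :
    ert 1 c f s ≤ c.time + f (det c s) := by
  induction c generalizing f s with
  | seq c₁ c₂ ih₁ ih₂ =>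
    simp only [Cmd.straight, Bool.and_eq_true] at h
    simp only [ert, det, Cmd.time]
    calc _ ≤ 1 + (c₁.time + ert 1 c₂ f (det c₁ s)) := by gcongr; exact ih₁ _ _ h.1
      _ ≤ 1 + (c₁.time + (c₂.time + f (det c₂ (det c₁ s)))) := by gcongr; exact ih₂ _ _ h.2
      _ = _ := by push_cast; ring
  | ite x c₁ c₂ ih₁ ih₂ =>
    simp only [Cmd.straight, Bool.and_eq_true] at h
    simp only [ert, det, Cmd.time]
    split_ifs
    · calc _ ≤ 1 + (c₁.time + f (det c₁ s)) := by gcongr; exact ih₁ _ _ h.1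
        _ ≤ _ := by
          push_cast; rw [add_assoc]; gcongr; exact le_max_left _ _
    · calc _ ≤ 1 + (c₂.time + f (det c₂ s)) := by gcongr; exact ih₂ _ _ h.2
        _ ≤ _ := by
          push_cast; rw [add_assoc]; gcongr; exact le_max_right _ _
  | rand | read | emit | loop => simp [Cmd.straight] at h
  | _ => simp [ert, det, Cmd.time, State.upd]

theorem Runs.straight {c : Cmd} {s : State w} (h : c.straight = true) {Post : State w → Prop}
    (hp : Post (det c s)) {B : ℝ≥0∞} (hB : (c.time : ℝ≥0∞) ≤ B) : Runs c s Post B :=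
  fun f _ hf => (ert_straight f s h).trans (add_le_add hB (hf _ hp))

/-- The two states differ at most in the registers `R`. -/
structure Agree (R : List ℕ) (s s' : State w) : Prop where
  regs : ∀ r, r ∉ R → s'.regs r = s.regs r
  mem : s'.mem = s.mem
  input : s'.input = s.input
  consumed : s'.consumed = s.consumed
  out : s'.out = s.out

theorem Agree.refl (R : List ℕ) (s : State w) : Agree R s s :=
  ⟨fun _ _ => rfl, rfl, rfl, rfl, rfl⟩

theorem Agree.mono {R R' : List ℕ} {s s' : State w} (h : Agree R s s') (hR : R ⊆ R') :
    Agree R' s s' :=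
  ⟨fun r hr => h.regs r fun hr' => hr (hR hr'), h.mem, h.input, h.consumed, h.out⟩

theorem Agree.trans {R : List ℕ} {s s' s'' : State w} (h : Agree R s s') (h' : Agree R s' s'') :
    Agree R s s'' :=
  ⟨fun r hr => (h'.regs r hr).trans (h.regs r hr), h'.mem.trans h.mem, h'.input.trans h.input,
    h'.consumed.trans h.consumed, h'.out.trans h.out⟩

theorem Agree.set {R : List ℕ} {s s' : State w} (h : Agree R s s') {x : ℕ} (hx : x ∈ R)
    (v : BitVec w) : Agree R s (s'.set x v) :=
  ⟨fun r hr => by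
    have : r ≠ x := fun e => hr (e ▸ hx)
    simpa [State.set, this] using h.regs r hr, h.mem, h.input, h.consumed, h.out⟩

end Runs

/-! ## Simulation of short words by long words -/

section Simulation

variable {w wA : ℕ}

/-- The `v`-th cell of the `j`-th memory region. -/
def addr (w wA j v : ℕ) : BitVec w := BitVec.ofNat w (j * 2 ^ (wA + 4) + v)

/-- Sixteen regions of `2 ^ (wA + 4)` cells occupy `2 ^ (wA + 8)` addresses; this is the origin of
the `8` in the bound on the word size. -/
theorem addr_inj (hw : wA + 8 ≤ w) {j j' v v' : ℕ} (hj : j < 16) (hj' : j' < 16)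
    (hv : v < 2 ^ (wA + 4)) (hv' : v' < 2 ^ (wA + 4)) :
    addr w wA j v = addr w wA j' v' ↔ j = j' ∧ v = v' := by
  refine ⟨fun h => ?_, fun h => by rw [h.1, h.2]⟩
  have hle : 2 ^ (wA + 4) * 16 ≤ 2 ^ w := by
    rw [show (16 : ℕ) = 2 ^ 4 from rfl, ← pow_add]
    exact Nat.pow_le_pow_right (by norm_num) (by omega)
  have h1 := congrArg BitVec.toNat h
  simp only [addr, BitVec.toNat_ofNat] at h1
  set B := 2 ^ (wA + 4)
  rw [Nat.mod_eq_of_lt (by nlinarith), Nat.mod_eq_of_lt (by nlinarith)] at h1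
  have hj2 : j = j' := by
    have a1 : (j * B + v) / B = j := by
      rw [mul_comm, Nat.mul_add_div (by omega), Nat.div_eq_of_lt hv, add_zero]
    have a2 : (j' * B + v') / B = j' := by
      rw [mul_comm, Nat.mul_add_div (by omega), Nat.div_eq_of_lt hv', add_zero]
    rw [← a1, h1, a2]
  subst hj2
  exact ⟨rfl, by omega⟩

theorem addr_add (j v v' : ℕ) : addr w wA j v + BitVec.ofNat w v' = addr w wA j (v + v') := by
  simp only [addr, ← BitVec.ofNat_add, add_assoc]

theorem and_mask (hw : wA ≤ w) (V : BitVec w) :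
    V &&& BitVec.ofNat w (2 ^ wA - 1) = BitVec.ofNat w (V.toNat % 2 ^ wA) := by
  apply BitVec.eq_of_toNat_eq
  have h : 2 ^ wA ≤ 2 ^ w := Nat.pow_le_pow_right (by norm_num) hw
  have h0 : 0 < 2 ^ wA := by positivity
  have h1 := Nat.mod_lt V.toNat h0
  rw [BitVec.toNat_and, BitVec.toNat_ofNat, BitVec.toNat_ofNat, Nat.mod_eq_of_lt (by omega),
    Nat.mod_eq_of_lt (by omega), Nat.and_two_pow_sub_one_eq_mod]

theorem toNat_widen (hw : wA ≤ w) (v : BitVec wA) : (BitVec.ofNat w v.toNat).toNat = v.toNat := by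
  rw [BitVec.toNat_ofNat]
  exact Nat.mod_eq_of_lt (v.isLt.trans_le (Nat.pow_le_pow_right (by norm_num) hw))

theorem widen_inj (hw : wA ≤ w) {u v : BitVec wA} :
    BitVec.ofNat w u.toNat = BitVec.ofNat w v.toNat ↔ u = v := by
  refine ⟨fun h => BitVec.eq_of_toNat_eq ?_, fun h => by rw [h]⟩
  have := congrArg BitVec.toNat h
  rwa [toNat_widen hw, toNat_widen hw] at this

theorem widen_ne_zero (hw : wA ≤ w) {v : BitVec wA} : BitVec.ofNat w v.toNat ≠ 0 ↔ v ≠ 0 := by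
  have := @widen_inj w wA hw v 0
  rw [show (0 : BitVec wA).toNat = 0 from by simp] at this
  exact not_congr this

/-- For the ring operations and the left shift this holds because `2 ^ wA` divides `2 ^ w`; the
other operations give results that are short already. The comparisons return `1`, which needs at
least one bit. -/
theorem eval_widen (hw : wA ≤ w) (h1 : 1 ≤ wA) (o : BinOp) (a b : BitVec wA) :
    o.eval (BitVec.ofNat w a.toNat) (BitVec.ofNat w b.toNat) &&& BitVec.ofNat w (2 ^ wA - 1) =
      BitVec.ofNat w (o.eval a b).toNat := by
  rw [and_mask hw]
  congr 1
  have hd : 2 ^ wA ∣ 2 ^ w := pow_dvd_pow 2 hw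
  have ha := toNat_widen hw a
  have hb := toNat_widen hw b
  have hla := a.isLt
  have hlb := b.isLt
  have h2 : 1 < 2 ^ wA := Nat.one_lt_two_pow (by omega)
  have h3 : 1 < 2 ^ w := Nat.one_lt_two_pow (by omega)
  cases o with
  | add => simp only [BinOp.eval, BitVec.toNat_add, ha, hb]; rw [Nat.mod_mod_of_dvd _ hd]
  | sub =>
    simp only [BinOp.eval, BitVec.toNat_sub, ha, hb]; rw [Nat.mod_mod_of_dvd _ hd]
    obtain ⟨k, hk⟩ := hd
    have hk0 : 0 < k := by
      rcases Nat.eq_zero_or_pos k with h | h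
      · subst h; simp at hk
      · exact h
    have : 2 ^ w - b.toNat + a.toNat = (2 ^ wA - b.toNat + a.toNat) + 2 ^ wA * (k - 1) := by
      rw [hk, Nat.mul_sub, mul_one]
      have : 2 ^ wA ≤ 2 ^ wA * k := Nat.le_mul_of_pos_right _ hk0
      omega
    rw [this, Nat.add_mul_mod_self_left]
  | mul => simp only [BinOp.eval, BitVec.toNat_mul, ha, hb]; rw [Nat.mod_mod_of_dvd _ hd]
  | div =>
    simp only [BinOp.eval, BitVec.toNat_udiv, ha, hb]
    exact Nat.mod_eq_of_lt ((Nat.div_le_self _ _).trans_lt hla)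
  | mod =>
    simp only [BinOp.eval, BitVec.toNat_umod, ha, hb]
    exact Nat.mod_eq_of_lt ((Nat.mod_le _ _).trans_lt hla)
  | and =>
    simp only [BinOp.eval, BitVec.toNat_and, ha, hb]
    exact Nat.mod_eq_of_lt (Nat.and_le_left.trans_lt hla)
  | or =>
    simp only [BinOp.eval, BitVec.toNat_or, ha, hb]
    exact Nat.mod_eq_of_lt (Nat.or_lt_two_pow hla hlb)
  | xor =>
    simp only [BinOp.eval, BitVec.toNat_xor, ha, hb]
    exact Nat.mod_eq_of_lt (Nat.xor_lt_two_pow hla hlb)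
  | shl =>
    simp only [BinOp.eval, BitVec.shiftLeft_eq', BitVec.toNat_shiftLeft, ha, hb]
    rw [Nat.mod_mod_of_dvd _ hd]
  | shr =>
    simp only [BinOp.eval, BitVec.ushiftRight_eq', BitVec.toNat_ushiftRight, ha, hb]
    exact Nat.mod_eq_of_lt ((Nat.shiftRight_le _ _).trans_lt hla)
  | eq =>
    simp only [BinOp.eval, widen_inj hw]
    split_ifs <;> simp [Nat.mod_eq_of_lt h2, Nat.mod_eq_of_lt h3]
  | lt =>
    simp only [BinOp.eval, ha, hb]
    split_ifs <;> simp [Nat.mod_eq_of_lt h2, Nat.mod_eq_of_lt h3]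

theorem sum_bitVec (w : ℕ) (g : ℕ → ℝ≥0∞) :
    ∑ v : BitVec w, g v.toNat = ∑ i ∈ Finset.range (2 ^ w), g i := by
  rw [← Fin.sum_univ_eq_sum_range]
  exact Fintype.sum_equiv (BitVec.equivFin (m := w)).toEquiv _ _ (fun v => rfl)

theorem sum_range_mul_mod (B m : ℕ) (g : ℕ → ℝ≥0∞) :
    ∑ i ∈ Finset.range (B * m), g (i % B) = m * ∑ i ∈ Finset.range B, g i := by
  induction m with
  | zero => simp
  | succ m ih =>
    rw [Nat.mul_succ, Finset.sum_range_add, ih]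
    have : ∑ x ∈ Finset.range B, g ((B * m + x) % B) = ∑ i ∈ Finset.range B, g i := by
      refine Finset.sum_congr rfl fun x hx => ?_
      rw [Nat.mul_add_mod, Nat.mod_eq_of_lt (Finset.mem_range.1 hx)]
    rw [this]; push_cast; ring

/-- The low bits of a uniform long word are uniform, since each residue has `2 ^ (w - wA)`
preimages. -/
theorem sum_rand_mask (hw : wA ≤ w) (g : BitVec wA → ℝ≥0∞) :
    ∑ V : BitVec w, ((2 : ℝ≥0∞) ^ w)⁻¹ * g (BitVec.ofNat wA V.toNat) =
      ∑ v : BitVec wA, ((2 : ℝ≥0∞) ^ wA)⁻¹ * g v := by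
  have h1 := sum_bitVec w (fun i => g (BitVec.ofNat wA (i % 2 ^ wA)))
  have h2 := sum_bitVec wA (fun i => g (BitVec.ofNat wA i))
  have e1 : ∀ i, BitVec.ofNat wA (i % 2 ^ wA) = BitVec.ofNat wA i := fun i => by
    apply BitVec.eq_of_toNat_eq; simp
  obtain ⟨d, rfl⟩ := Nat.exists_eq_add_of_le hw
  rw [pow_add, sum_range_mul_mod (2 ^ wA) (2 ^ d) (fun i => g (BitVec.ofNat wA i)), ← h2] at h1
  simp only [e1, BitVec.ofNat_toNat, BitVec.setWidth_eq] at h1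
  rw [← Finset.mul_sum, ← Finset.mul_sum]
  simp only [BitVec.ofNat_toNat]
  rw [h1, pow_add, ENNReal.mul_inv (by simp) (by simp)]
  push_cast
  rw [mul_assoc, ← mul_assoc (((2 : ℝ≥0∞) ^ d)⁻¹), ENNReal.inv_mul_cancel (by simp) (by simp),
    one_mul]

end Simulation

end WordRAM

/-! ### The simulating program and the relation between the two machines -/

namespace WordRAM

section Compile

variable {w wA : ℕ}

/-- Bring the content of register `x` back to the short word size. -/
def maskCmd (x : ℕ) : Cmd := .op .and x x 5

/-- The simulation of a program for short words by a program for long words; register `x` is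
kept in register `φ x`. -/
def comp (φ : ℕ → ℕ) : Cmd → Cmd
  | .skip => .skip
  | .const x k => .seq (.const (φ x) k) (maskCmd (φ x))
  | .wordSize x => .op .and (φ x) 6 5
  | .op o x y z => .seq (.op o (φ x) (φ y) (φ z)) (maskCmd (φ x))
  -- A cell is read from the region of the current phase if its stamp in region `3` is current, and
  -- from region `1` otherwise.
  | .load x y => block [.op .add 37 8 (φ y), .load 37 37, .op .eq 37 37 32,
      .ite 37 (.op .add 38 33 (φ y)) (.op .add 38 7 (φ y)), .load (φ x) 38]
  | .store x y => block [.op .add 37 33 (φ x), .store 37 (φ y), .op .add 37 8 (φ x), .store 37 32]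
  | .rand x => .seq (.rand (φ x)) (maskCmd (φ x))
  -- The simulated input lies in region `6`; registers `34` and `35` point to its next word and to
  -- its end.
  | .read x y => block [.op .lt 37 34 35,
      .ite 37 (block [.op .add 38 11 34, .load (φ x) 38, .op .add 34 34 0, .const (φ y) 1])
        (.const (φ y) 0)]
  -- Only second components are kept. Region `4` stamps those already seen, so that region `5` lists
  -- each of them once even if the algorithm repeats itself.
  | .emit _ y => block [.op .add 37 9 (φ y), .load 38 37, .op .eq 38 38 32,
      .ite 38 .skip (block [.store 37 32, .op .add 38 10 36, .store 38 (φ y), .op .add 36 36 0])]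
  | .seq c₁ c₂ => .seq (comp φ c₁) (comp φ c₂)
  | .ite x c₁ c₂ => .ite (φ x) (comp φ c₁) (comp φ c₂)
  | .loop x c => .loop (φ x) (comp φ c)

/-- A bound on the registers that occur in a program. -/
def Cmd.regBound : Cmd → ℕ
  | .skip => 0
  | .const x _ | .wordSize x | .rand x => x + 1
  | .op _ x y z => x + 1 + (y + 1) + (z + 1)
  | .load x y | .store x y | .read x y | .emit x y => x + 1 + (y + 1)
  | .seq c₁ c₂ => c₁.regBound + c₂.regBound
  | .ite x c₁ c₂ => x + 1 + (c₁.regBound + c₂.regBound)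
  | .loop x c => x + 1 + c.regBound

/-- The long-word state `S`, reached from `S₀`, represents the short-word state `s`. Memory written
since the beginning of the phase `cur` is in region `jR` and marked in region `3`; older
memory is in region `1`. The second components of the output are listed in region `5`. -/
structure Sim (M : ℕ) (φ : ℕ → ℕ) (cur jR : ℕ) (S₀ : State w) (s : State wA) (S : State w) :
    Prop where
  regs : ∀ x < M, S.regs (φ x) = BitVec.ofNat w (s.regs x).toNat
  -- During the preprocessing `jR = 1` and both branches agree.
  mem : ∀ v : BitVec wA, (if S.mem (addr w wA 3 v.toNat) = BitVec.ofNat w cur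
    then S.mem (addr w wA jR v.toNat) else S.mem (addr w wA 1 v.toNat)) =
      BitVec.ofNat w (s.mem v).toNat
  ptr : ∃ k, S.regs 34 = BitVec.ofNat w k ∧ S.regs 35 = BitVec.ofNat w (k + s.input.length) ∧
    k + s.input.length < 2 ^ (wA + 4) ∧
    ∀ i (h : i < s.input.length), S.mem (addr w wA 6 (k + i)) = BitVec.ofNat w (s.input[i]).toNat
  -- In phase `0` every cell of region `4` counts as stamped, so that outputs of the preprocessing
  -- are dropped.
  emitted : ∃ l : List ℕ, l.Nodup ∧ S.regs 36 = BitVec.ofNat w l.length ∧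
    (∀ i (h : i < l.length), S.mem (addr w wA 5 i) = BitVec.ofNat w l[i]) ∧
    (∀ v, v ∈ l ↔ cur ≠ 0 ∧ ∃ e ∈ s.out, e.snd.toNat = v) ∧
    ∀ v : BitVec wA, S.mem (addr w wA 4 v.toNat) = BitVec.ofNat w cur ↔ cur = 0 ∨ v.toNat ∈ l
  frame_regs : ∀ r, (∀ x < M, r ≠ φ x) → r ∉ [34, 36, 37, 38] → S.regs r = S₀.regs r
  frame_mem : ∀ j < 16, j ∉ [jR, 3, 4, 5] → ∀ v < 2 ^ (wA + 4),
    S.mem (addr w wA j v) = S₀.mem (addr w wA j v)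
  stamp : ∀ j ∈ [3, 4], ∀ v < 2 ^ (wA + 4),
    S.mem (addr w wA j v) = S₀.mem (addr w wA j v) ∨ S.mem (addr w wA j v) = BitVec.ofNat w cur
  io : S.input = S₀.input ∧ S.consumed = S₀.consumed ∧ S.out = S₀.out

/-- The registers that the simulating program uses as constants. -/
structure SimBase (wA : ℕ) (M : ℕ) (φ : ℕ → ℕ) (cur jR : ℕ) (S₀ : State w) : Prop where
  one_le : 1 ≤ wA
  le : wA + 8 ≤ w
  inj : Function.Injective φ
  ge : ∀ x, 64 ≤ φ x
  region : jR = 1 ∨ jR = 2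
  one : S₀.regs 0 = 1
  mask : S₀.regs 5 = BitVec.ofNat w (2 ^ wA - 1)
  size : S₀.regs 6 = BitVec.ofNat w wA
  r7 : S₀.regs 7 = addr w wA 1 0
  r8 : S₀.regs 8 = addr w wA 3 0
  r9 : S₀.regs 9 = addr w wA 4 0
  r10 : S₀.regs 10 = addr w wA 5 0
  r11 : S₀.regs 11 = addr w wA 6 0
  rcur : S₀.regs 32 = BitVec.ofNat w cur
  r33 : S₀.regs 33 = addr w wA jR 0

variable {M : ℕ} {φ : ℕ → ℕ} {cur jR : ℕ} {S₀ : State w} {s : State wA} {S : State w}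

theorem Sim.const_reg (h : Sim M φ cur jR S₀ s S) (hb : SimBase wA M φ cur jR S₀) {r : ℕ}
    (hr : r < 34) : S.regs r = S₀.regs r := by
  refine h.frame_regs r (fun x _ e => ?_) ?_
  · have := hb.ge x; omega
  · simp; omega

/-- Only the register that represents `x` and auxiliary registers change. -/
theorem Sim.set_of (h : Sim M φ cur jR S₀ s S) (hb : SimBase wA M φ cur jR S₀) {x : ℕ}
    (hx : x < M) (v : BitVec wA) {S' : State w} (hv : S'.regs (φ x) = BitVec.ofNat w v.toNat)
    (hr : ∀ r, r ≠ φ x → r ∉ [37, 38] → S'.regs r = S.regs r) (hm : S'.mem = S.mem)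
    (hio : S'.input = S.input ∧ S'.consumed = S.consumed ∧ S'.out = S.out) :
    Sim M φ cur jR S₀ (s.set x v) S' := by
  have h64 := hb.ge
  have hr' : ∀ r < 37, S'.regs r = S.regs r := fun r h37 =>
    hr r (by have := h64 x; omega) (by simp; omega)
  refine ⟨fun y hy => ?_, ?_, ?_, ?_, fun r h1 h2 => ?_, ?_, ?_, ?_⟩
  · by_cases hxy : y = x
    · subst hxy; simp [State.set, hv]
    · rw [hr _ (fun e => hxy (hb.inj e)) (by have := h64 y; simp; omega), h.regs y hy]
      simp [State.set, hxy]
  · rw [hm]; exact h.mem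
  · rw [hm, hr' 34 (by norm_num), hr' 35 (by norm_num)]; exact h.ptr
  · rw [hm, hr' 36 (by norm_num)]; exact h.emitted
  · rw [hr r (h1 x hx) (by simp at h2 ⊢; tauto)]; exact h.frame_regs r h1 h2
  · rw [hm]; exact h.frame_mem
  · rw [hm]; exact h.stamp
  · rw [hio.1, hio.2.1, hio.2.2]; exact h.io

theorem Sim.tmp_of (h : Sim M φ cur jR S₀ s S) (hb : SimBase wA M φ cur jR S₀) {S' : State w}
    (hr : ∀ r, r ∉ [37, 38] → S'.regs r = S.regs r) (hm : S'.mem = S.mem)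
    (hio : S'.input = S.input ∧ S'.consumed = S.consumed ∧ S'.out = S.out) :
    Sim M φ cur jR S₀ s S' := by
  have h64 := hb.ge
  have hr' : ∀ r < 37, S'.regs r = S.regs r := fun r h37 => hr r (by simp; omega)
  refine ⟨fun y hy => ?_, ?_, ?_, ?_, fun r h1 h2 => ?_, ?_, ?_, ?_⟩
  · rw [hr _ (by have := h64 y; simp; omega), h.regs y hy]
  · rw [hm]; exact h.mem
  · rw [hm, hr' 34 (by norm_num), hr' 35 (by norm_num)]; exact h.ptr
  · rw [hm, hr' 36 (by norm_num)]; exact h.emitted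
  · rw [hr r (by simp at h2 ⊢; tauto)]; exact h.frame_regs r h1 h2
  · rw [hm]; exact h.frame_mem
  · rw [hm]; exact h.stamp
  · rw [hio.1, hio.2.1, hio.2.2]; exact h.io

theorem BitVec.toNat_lt_region (v : BitVec wA) : v.toNat < 2 ^ (wA + 4) :=
  v.isLt.trans_le (Nat.pow_le_pow_right (by norm_num) (by omega))

theorem Sim.const (h : Sim M φ cur jR S₀ s S) (hb : SimBase wA M φ cur jR S₀) {x k : ℕ}
    (hx : x < M) : Sim M φ cur jR S₀ (s.set x (BitVec.ofNat wA k)) (det (comp φ (.const x k)) S) := by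
  have hle := hb.le
  have h64 := hb.ge x
  have h5 : (5 : ℕ) ≠ φ x := by omega
  refine h.set_of hb hx _ ?_ ?_ rfl ⟨rfl, rfl, rfl⟩
  · simp only [comp, maskCmd, det, State.set, Function.update_self, Function.update_of_ne h5,
      BinOp.eval]
    rw [h.const_reg hb (r := 5) (by norm_num), hb.mask, and_mask (by omega)]
    congr 1
    rw [BitVec.toNat_ofNat, BitVec.toNat_ofNat, Nat.mod_mod_of_dvd _ (pow_dvd_pow 2 (by omega))]
  · intro r hr _
    simp [comp, maskCmd, det, State.set, hr]

theorem Sim.wordSize (h : Sim M φ cur jR S₀ s S) (hb : SimBase wA M φ cur jR S₀) {x : ℕ}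
    (hx : x < M) : Sim M φ cur jR S₀ (s.set x (BitVec.ofNat wA wA)) (det (comp φ (.wordSize x)) S) := by
  have hle := hb.le
  refine h.set_of hb hx _ ?_ ?_ rfl ⟨rfl, rfl, rfl⟩
  · simp only [comp, det, State.set, Function.update_self, BinOp.eval]
    rw [h.const_reg hb (by norm_num), h.const_reg hb (r := 5) (by norm_num), hb.mask, hb.size,
      and_mask (by omega)]
    congr 1
    rw [BitVec.toNat_ofNat, BitVec.toNat_ofNat, Nat.mod_mod_of_dvd _ (pow_dvd_pow 2 (by omega))]
  · intro r hr _
    simp [comp, det, State.set, hr]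

theorem Sim.op (h : Sim M φ cur jR S₀ s S) (hb : SimBase wA M φ cur jR S₀) (o : BinOp)
    {x y z : ℕ} (hx : x < M) (hy : y < M) (hz : z < M) :
    Sim M φ cur jR S₀ (s.set x (o.eval (s.regs y) (s.regs z))) (det (comp φ (.op o x y z)) S) := by
  have hle := hb.le
  have h64 := hb.ge x
  have h5 : (5 : ℕ) ≠ φ x := by omega
  refine h.set_of hb hx _ ?_ ?_ rfl ⟨rfl, rfl, rfl⟩
  · simp only [comp, maskCmd, det, State.set, Function.update_self, Function.update_of_ne h5]
    rw [h.const_reg hb (r := 5) (by norm_num), hb.mask, h.regs y hy, h.regs z hz]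
    exact eval_widen (by omega) hb.one_le o _ _
  · intro r hr _
    simp [comp, maskCmd, det, State.set, hr]

theorem Sim.load (h : Sim M φ cur jR S₀ s S) (hb : SimBase wA M φ cur jR S₀)
    {x y : ℕ} (hx : x < M) (hy : y < M) :
    Sim M φ cur jR S₀ (s.set x (s.mem (s.regs y))) (det (comp φ (.load x y)) S) := by
  have hle := hb.le
  have h64 := hb.ge x
  have h64y := hb.ge y
  have n1 : φ y ≠ 37 := by omega
  have n2 : φ x ≠ 37 := by omega
  have n3 : φ x ≠ 38 := by omega
  have n4 : φ y ≠ 38 := by omega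
  have e7 := (h.const_reg hb (r := 7) (by norm_num)).trans hb.r7
  have e8 := (h.const_reg hb (r := 8) (by norm_num)).trans hb.r8
  have e32 := (h.const_reg hb (r := 32) (by norm_num)).trans hb.rcur
  have e33 := (h.const_reg hb (r := 33) (by norm_num)).trans hb.r33
  have hv := h.mem (s.regs y)
  have h10 : (1 : BitVec w) ≠ 0 := one_ne_zero_word (by omega)
  obtain ⟨b, p, hdet⟩ : ∃ b p : BitVec w, det (comp φ (.load x y)) S =
      ((S.set 37 b).set 38 p).set (φ x) (BitVec.ofNat w (s.mem (s.regs y)).toNat) := by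
    rw [← hv]
    by_cases hc : S.mem (addr w wA 3 (s.regs y).toNat) = BitVec.ofNat w cur
    · refine ⟨1, addr w wA jR (s.regs y).toNat, ?_⟩
      simp only [comp, block, det, State.set_regs, State.set_mem, Function.update_self, BinOp.eval,
        Function.update_of_ne n1, e8, h.regs y hy, addr_add, zero_add, hc, if_true,
        Function.update_of_ne (show (32 : ℕ) ≠ 37 by norm_num), e32, ne_eq, h10, not_false_eq_true,
        Function.update_of_ne (show (33 : ℕ) ≠ 37 by norm_num), e33, State.set_set]
    · refine ⟨0, addr w wA 1 (s.regs y).toNat, ?_⟩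
      simp only [comp, block, det, State.set_regs, State.set_mem, Function.update_self, BinOp.eval,
        Function.update_of_ne n1, e8, h.regs y hy, addr_add, zero_add, hc, if_false,
        Function.update_of_ne (show (32 : ℕ) ≠ 37 by norm_num), e32, ne_eq, not_true_eq_false,
        Function.update_of_ne (show (7 : ℕ) ≠ 37 by norm_num), e7, State.set_set]
  rw [hdet]
  refine h.set_of hb hx _ (by simp) ?_ rfl ⟨rfl, rfl, rfl⟩
  intro r hr hr'
  simp only [List.mem_cons, List.not_mem_nil, or_false, not_or] at hr'
  simp [hr, hr']

/-- The first `k` cells of the regions are different from those of other regions. -/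
theorem addr_ne (hw : wA + 8 ≤ w) {j j' v v' : ℕ} (hj : j < 16) (hj' : j' < 16)
    (hv : v < 2 ^ (wA + 4)) (hv' : v' < 2 ^ (wA + 4)) (h : j ≠ j') :
    addr w wA j v ≠ addr w wA j' v' := fun e => h ((addr_inj hw hj hj' hv hv').1 e).1

theorem Sim.store (h : Sim M φ cur jR S₀ s S) (hb : SimBase wA M φ cur jR S₀)
    {x y : ℕ} (hx : x < M) (hy : y < M) :
    Sim M φ cur jR S₀ { s with mem := Function.update s.mem (s.regs x) (s.regs y) }
      (det (comp φ (.store x y)) S) := by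
  have hle := hb.le
  have h64 := hb.ge x
  have h64y := hb.ge y
  have n1 : φ y ≠ 37 := by omega
  have n2 : φ x ≠ 37 := by omega
  have e8 := (h.const_reg hb (r := 8) (by norm_num)).trans hb.r8
  have e32 := (h.const_reg hb (r := 32) (by norm_num)).trans hb.rcur
  have e33 := (h.const_reg hb (r := 33) (by norm_num)).trans hb.r33
  have hjR : jR < 16 := by rcases hb.region with h | h <;> omega
  have hjR3 : jR ≠ 3 := by rcases hb.region with h | h <;> omega
  have hjR4 : jR ≠ 4 := by rcases hb.region with h | h <;> omega
  have hjR5 : jR ≠ 5 := by rcases hb.region with h | h <;> omega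
  have hjR6 : jR ≠ 6 := by rcases hb.region with h | h <;> omega
  set p := (s.regs x).toNat with hp
  have hpl : p < 2 ^ (wA + 4) := BitVec.toNat_lt_region _
  obtain ⟨S', hS', hS'm, hreg, hio⟩ : ∃ S', det (comp φ (.store x y)) S = S' ∧
      S'.mem = Function.update (Function.update S.mem (addr w wA jR p) (S.regs (φ y)))
        (addr w wA 3 p) (BitVec.ofNat w cur) ∧ (∀ r, r ≠ 37 → S'.regs r = S.regs r) ∧
      (S'.input = S.input ∧ S'.consumed = S.consumed ∧ S'.out = S.out) := by
    refine ⟨_, rfl, ?_, fun r hr => ?_, ?_⟩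
    · simp [comp, block, det, BinOp.eval, n1, n2, e8, e32, e33,
        h.regs x hx, addr_add, ← hp, -BitVec.ofNat_toNat]
    · simp [comp, block, det, Function.update_apply, hr]
    · simp [comp, block, det]
  rw [hS']
  have hmem : ∀ j v, j < 16 → v < 2 ^ (wA + 4) → j ≠ jR → j ≠ 3 →
      Function.update (Function.update S.mem (addr w wA jR p) (S.regs (φ y)))
        (addr w wA 3 p) (BitVec.ofNat w cur) (addr w wA j v) = S.mem (addr w wA j v) := by
    intro j v hj hv h1 h2
    rw [Function.update_of_ne (addr_ne hle hj (by norm_num) hv hpl h2),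
      Function.update_of_ne (addr_ne hle hj hjR hv hpl h1)]
  have hmemv : ∀ j v, j < 16 → v < 2 ^ (wA + 4) → v ≠ p →
      Function.update (Function.update S.mem (addr w wA jR p) (S.regs (φ y)))
        (addr w wA 3 p) (BitVec.ofNat w cur) (addr w wA j v) = S.mem (addr w wA j v) := by
    intro j v hj hv h1
    rw [Function.update_of_ne (fun e => h1 ((addr_inj hle hj (by norm_num) hv hpl).1 e).2),
      Function.update_of_ne (fun e => h1 ((addr_inj hle hj hjR hv hpl).1 e).2)]
  obtain ⟨k, hk1, hk2, hk3, hk4⟩ := h.ptr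
  obtain ⟨l, hl1, hl2, hl3, hl4, hl5⟩ := h.emitted
  -- The list has no repetitions and consists of short words, so it never leaves region `5`.
  have hlen : l.length ≤ 2 ^ wA := by
    have : l ⊆ List.range (2 ^ wA) := fun v hv => by
      obtain ⟨_, e, _, he⟩ := (hl4 v).1 hv
      rw [List.mem_range, ← he]; exact e.snd.isLt
    simpa using (hl1.subperm this).length_le
  have hlen' : 2 ^ wA < 2 ^ (wA + 4) := Nat.pow_lt_pow_right (by norm_num) (by omega)
  refine ⟨fun z hz => ?_, fun v => ?_, ⟨k, ?_, ?_, hk3, fun i hi => ?_⟩,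
    ⟨l, hl1, ?_, fun i hi => ?_, hl4, fun v => ?_⟩, fun r h1 h2 => ?_, fun j hj hj' v hv => ?_,
    fun j hj v hv => ?_, by rw [hio.1, hio.2.1, hio.2.2]; exact h.io⟩
  all_goals try rw [hS'm]
  · rw [hreg _ (by have := hb.ge z; omega)]; exact h.regs z hz
  · dsimp only
    have hvl : v.toNat < 2 ^ (wA + 4) := BitVec.toNat_lt_region v
    by_cases hvp : v = s.regs x
    · subst hvp
      rw [Function.update_self, Function.update_self, if_pos rfl, ← hp,
        Function.update_of_ne (addr_ne hle hjR (by norm_num) hpl hpl hjR3), Function.update_self,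
        h.regs y hy]
    · have hvp' : v.toNat ≠ p := fun e => hvp (BitVec.eq_of_toNat_eq e)
      rw [hmemv 3 _ (by norm_num) hvl hvp', hmemv jR _ hjR hvl hvp',
        hmemv 1 _ (by norm_num) hvl hvp', Function.update_of_ne hvp]
      exact h.mem v
  · rw [hreg _ (by norm_num)]; exact hk1
  · rw [hreg _ (by norm_num)]; exact hk2
  · rw [hmem 6 _ (by norm_num) (by dsimp only at hi; omega) hjR6.symm (by norm_num)]; exact hk4 i hi
  · rw [hreg _ (by norm_num)]; exact hl2
  · rw [hmem 5 _ (by norm_num) (by omega) hjR5.symm (by norm_num)]; exact hl3 i hi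
  · rw [hmem 4 _ (by norm_num) (BitVec.toNat_lt_region v) hjR4.symm (by norm_num)]; exact hl5 v
  · simp only [List.mem_cons, List.not_mem_nil, or_false, not_or] at h2
    rw [hreg _ h2.2.2.1]; exact h.frame_regs r h1 (by simp [h2])
  · simp only [List.mem_cons, List.not_mem_nil, or_false, not_or] at hj'
    rw [hmem j v hj hv hj'.1 hj'.2.1]; exact h.frame_mem j hj (by simp [hj']) v hv
  · by_cases hvp : v = p
    · by_cases hj3 : j = 3
      · subst hj3 hvp; right; simp
      · rw [hmem j v (by simp at hj; omega) hv (by simp at hj; omega) hj3]; exact h.stamp j hj v hv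
    · rw [hmemv j v (by simp at hj; omega) hv hvp]; exact h.stamp j hj v hv

theorem Sim.read_nil (h : Sim M φ cur jR S₀ s S) (hb : SimBase wA M φ cur jR S₀)
    {x y : ℕ} (hy : y < M) (hi : s.input = []) :
    Sim M φ cur jR S₀ (s.set y 0) (det (comp φ (.read x y)) S) := by
  have hle := hb.le
  have h64y := hb.ge y
  have n1 : φ y ≠ 37 := by omega
  obtain ⟨k, hk1, hk2, hk3, hk4⟩ := h.ptr
  rw [hi] at hk2
  simp only [List.length_nil, add_zero] at hk2
  refine h.set_of hb hy _ ?_ ?_ ?_ ?_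
  · simp [comp, block, det, State.set, BinOp.eval, hk1, hk2]
  · intro r hr hr'
    simp only [List.mem_cons, List.not_mem_nil, or_false, not_or] at hr'
    simp [comp, block, det, State.set, BinOp.eval, hk1, hk2, hr, hr']
  · simp [comp, block, det, State.set, BinOp.eval, hk1, hk2]
  · simp [comp, block, det, State.set, BinOp.eval, hk1, hk2]

theorem Sim.read_cons (h : Sim M φ cur jR S₀ s S) (hb : SimBase wA M φ cur jR S₀)
    {x y : ℕ} (hx : x < M) (hy : y < M) {a : BitVec wA} {rest : List (BitVec wA)}
    (hi : s.input = a :: rest) :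
    Sim M φ cur jR S₀
      ⟨Function.update (Function.update s.regs x a) y 1, s.mem, rest, s.consumed + 1, s.out⟩
      (det (comp φ (.read x y)) S) := by
  have hle := hb.le
  have h64 := hb.ge x
  have h64y := hb.ge y
  have n1 : φ y ≠ 37 := by omega
  have n2 : φ x ≠ 37 := by omega
  have n3 : φ x ≠ 38 := by omega
  have n4 : φ y ≠ 38 := by omega
  have n5 : φ x ≠ 34 := by omega
  have n6 : φ y ≠ 34 := by omega
  have m1 : 34 ≠ φ x := by omega
  have m2 : 0 ≠ φ x := by omega
  have m3 : 34 ≠ φ y := by omega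
  have e11 := (h.const_reg hb (r := 11) (by norm_num)).trans hb.r11
  have e0 := (h.const_reg hb (r := 0) (by norm_num)).trans hb.one
  obtain ⟨k, hk1, hk2, hk3, hk4⟩ := h.ptr
  rw [hi] at hk2 hk3
  simp only [List.length_cons] at hk2 hk3
  have h3 : 1 < 2 ^ w := Nat.one_lt_two_pow (by omega)
  have h3A : 1 < 2 ^ wA := Nat.one_lt_two_pow (by have := hb.one_le; omega)
  have h10 : (1 : BitVec w) ≠ 0 := one_ne_zero_word (by omega)
  have hlt : 2 ^ (wA + 4) ≤ 2 ^ w := Nat.pow_le_pow_right (by norm_num) (by omega)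
  have hkl : (BitVec.ofNat w k).toNat < (BitVec.ofNat w (k + (rest.length + 1))).toNat := by
    rw [BitVec.toNat_ofNat, BitVec.toNat_ofNat, Nat.mod_eq_of_lt (by omega),
      Nat.mod_eq_of_lt (by omega)]
    omega
  have ha : S.mem (addr w wA 6 k) = BitVec.ofNat w a.toNat := by
    have := hk4 0 (by simp [hi])
    simpa [hi] using this
  have hone : BitVec.ofNat w k + 1 = BitVec.ofNat w (k + 1) := (BitVec.ofNat_add k 1).symm
  obtain ⟨S', hS', hreg, hx', hy', h34, hm, hio⟩ : ∃ S', det (comp φ (.read x y)) S = S' ∧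
      (∀ r, r ≠ φ x → r ≠ φ y → r ∉ [34, 37, 38] → S'.regs r = S.regs r) ∧
      (x ≠ y → S'.regs (φ x) = BitVec.ofNat w a.toNat) ∧ S'.regs (φ y) = 1 ∧
      S'.regs 34 = BitVec.ofNat w (k + 1) ∧ S'.mem = S.mem ∧
      (S'.input = S.input ∧ S'.consumed = S.consumed ∧ S'.out = S.out) := by
    have : det (comp φ (.read x y)) S =
        (((((S.set 37 1).set 38 (addr w wA 6 k))).set (φ x) (BitVec.ofNat w a.toNat)).set 34
          (BitVec.ofNat w (k + 1))).set (φ y) 1 := by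
      simp only [comp, block, det, State.set_regs, State.set_mem, BinOp.eval, hk1, hk2, if_pos hkl,
        ne_eq, h10, not_false_eq_true, if_true, Function.update_self, Function.update_of_ne m1,
        Function.update_of_ne m2, e11, e0,
        Function.update_of_ne (show (34 : ℕ) ≠ 37 by norm_num),
        Function.update_of_ne (show (34 : ℕ) ≠ 38 by norm_num),
        Function.update_of_ne (show (11 : ℕ) ≠ 37 by norm_num),
        Function.update_of_ne (show (0 : ℕ) ≠ 37 by norm_num),
        Function.update_of_ne (show (0 : ℕ) ≠ 38 by norm_num), addr_add, zero_add, ha, hone]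
      rfl
    refine ⟨_, this, fun r h1 h2 h3 => ?_, fun hxy => ?_, by simp, by simp [m3], rfl, rfl, rfl, rfl⟩
    · simp only [List.mem_cons, List.not_mem_nil, or_false, not_or] at h3
      simp [h1, h2, h3]
    · have : φ x ≠ φ y := fun e => hxy (hb.inj e)
      simp [this, n5]
  rw [hS']
  refine ⟨fun z hz => ?_, by rw [hm]; exact h.mem, ⟨k + 1, h34, ?_, ?_, fun i hi' => ?_⟩, ?_,
    fun r h1 h2 => ?_, by rw [hm]; exact h.frame_mem, by rw [hm]; exact h.stamp,
    by rw [hio.1, hio.2.1, hio.2.2]; exact h.io⟩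
  · have h64z := hb.ge z
    by_cases hzy : z = y
    · subst hzy; simp [hy', Nat.mod_eq_of_lt h3A]
    · have hzy' : φ z ≠ φ y := fun e => hzy (hb.inj e)
      by_cases hzx : z = x
      · subst hzx; simp [hx' hzy, hzy]
      · rw [hreg _ (fun e => hzx (hb.inj e)) hzy' (by simp; omega), h.regs z hz]
        simp [hzx, hzy]
  · rw [hreg _ (by omega) (by omega) (by simp), hk2]
    dsimp only
    congr 1; ring
  · dsimp only; omega
  · have := hk4 (i + 1) (by simp [hi]; exact hi')
    rw [hm, show k + 1 + i = k + (i + 1) by ring]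
    simpa [hi] using this
  · rw [hreg _ (by omega) (by omega) (by simp), hm]; exact h.emitted
  · rw [hreg _ (h1 x hx) (h1 y hy) (by simp at h2 ⊢; tauto)]; exact h.frame_regs r h1 h2

end Compile

end WordRAM

/-! ### Simulated output and random words, and the cost of the simulation -/

namespace WordRAM

section Compile

variable {w wA : ℕ} {M : ℕ} {φ : ℕ → ℕ} {cur jR : ℕ} {S₀ : State w} {s : State wA} {S : State w}

theorem Sim.emit (h : Sim M φ cur jR S₀ s S) (hb : SimBase wA M φ cur jR S₀)
    {x y : ℕ} (hy : y < M) :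
    Sim M φ cur jR S₀
      ⟨s.regs, s.mem, s.input, s.consumed, ⟨s.consumed, s.regs x, s.regs y⟩ :: s.out⟩
      (det (comp φ (.emit x y)) S) := by
  have hle := hb.le
  have h64y := hb.ge y
  have n1 : φ y ≠ 37 := by omega
  have n2 : φ y ≠ 38 := by omega
  have e9 := (h.const_reg hb (r := 9) (by norm_num)).trans hb.r9
  have e0 := (h.const_reg hb (r := 0) (by norm_num)).trans hb.one
  have e10 := (h.const_reg hb (r := 10) (by norm_num)).trans hb.r10
  have e32 := (h.const_reg hb (r := 32) (by norm_num)).trans hb.rcur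
  have h10 : (1 : BitVec w) ≠ 0 := one_ne_zero_word (by omega)
  obtain ⟨l, hl1, hl2, hl3, hl4, hl5⟩ := h.emitted
  set p := (s.regs y).toNat with hp
  have hpl : p < 2 ^ (wA + 4) := BitVec.toNat_lt_region _
  -- A current stamp means that this is phase `0` or that the value is listed; in both cases the
  -- list stays as it is.
  by_cases hc : S.mem (addr w wA 4 p) = BitVec.ofNat w cur
  · have hS : det (comp φ (.emit x y)) S = (S.set 37 (addr w wA 4 p)).set 38 1 := by
      simp only [comp, block, det, State.set_regs, State.set_mem, Function.update_self, BinOp.eval,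
        e9, h.regs y hy, addr_add, zero_add, ← hp, hc, if_true,
        Function.update_of_ne (show (32 : ℕ) ≠ 37 by norm_num),
        Function.update_of_ne (show (32 : ℕ) ≠ 38 by norm_num), e32, ne_eq, h10, not_false_eq_true,
        State.set_set]
    have h' : Sim M φ cur jR S₀ s ((S.set 37 (addr w wA 4 p)).set 38 1) := by
      refine h.tmp_of hb (fun r hr => ?_) rfl ⟨rfl, rfl, rfl⟩
      simp only [List.mem_cons, List.not_mem_nil, or_false, not_or] at hr
      simp [hr]
    rw [hS]
    refine ⟨h'.regs, h'.mem, h'.ptr, ?_, h'.frame_regs, h'.frame_mem, h'.stamp, h'.io⟩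
    obtain ⟨l, hl1, hl2, hl3, hl4, hl5⟩ := h'.emitted
    refine ⟨l, hl1, hl2, hl3, fun v => ?_, hl5⟩
    rw [hl4]
    refine and_congr_right fun hcur => ?_
    simp only [List.mem_cons, exists_eq_or_imp]
    refine ⟨Or.inr, ?_⟩
    rintro (rfl | hv)
    · exact ((hl4 _).1 (((hl5 (s.regs y)).1 hc).resolve_left hcur)).2
    · exact hv
  · have hcl : ¬ (cur = 0 ∨ p ∈ l) := fun e => hc ((hl5 (s.regs y)).2 e)
    rw [not_or] at hcl
    have hone : BitVec.ofNat w l.length + 1 = BitVec.ofNat w (l.length + 1) :=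
      (BitVec.ofNat_add _ 1).symm
    obtain ⟨S', hS', hreg, h36, hm, hio⟩ : ∃ S', det (comp φ (.emit x y)) S = S' ∧
        (∀ r, r ∉ [36, 37, 38] → S'.regs r = S.regs r) ∧
        S'.regs 36 = BitVec.ofNat w (l.length + 1) ∧
        S'.mem = Function.update (Function.update S.mem (addr w wA 4 p) (BitVec.ofNat w cur))
          (addr w wA 5 l.length) (BitVec.ofNat w p) ∧
        (S'.input = S.input ∧ S'.consumed = S.consumed ∧ S'.out = S.out) := by
      refine ⟨(((((S.set 37 (addr w wA 4 p)).set 38 0).upd (addr w wA 4 p)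
        (BitVec.ofNat w cur)).set 38 (addr w wA 5 l.length)).upd (addr w wA 5 l.length)
        (BitVec.ofNat w p)).set 36 (BitVec.ofNat w (l.length + 1)), ?_, fun r hr => ?_, ?_, ?_, ?_⟩
      · simp only [comp, block, det, State.set_regs, State.set_mem, Function.update_self,
          BinOp.eval, Function.update_of_ne n1, Function.update_of_ne n2, e9, h.regs y hy,
          addr_add, zero_add, ← hp, hc, if_false,
          Function.update_of_ne (show (32 : ℕ) ≠ 37 by norm_num),
          Function.update_of_ne (show (32 : ℕ) ≠ 38 by norm_num),
          Function.update_of_ne (show (37 : ℕ) ≠ 38 by norm_num),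
          Function.update_of_ne (show (0 : ℕ) ≠ 38 by norm_num),
          Function.update_of_ne (show (0 : ℕ) ≠ 37 by norm_num),
          Function.update_of_ne (show (36 : ℕ) ≠ 38 by norm_num),
          Function.update_of_ne (show (36 : ℕ) ≠ 37 by norm_num),
          Function.update_of_ne (show (10 : ℕ) ≠ 38 by norm_num),
          Function.update_of_ne (show (10 : ℕ) ≠ 37 by norm_num), e10, e0, hl2, hone,
          e32, ne_eq, not_true_eq_false, State.set_set, State.upd_regs]
      · simp only [List.mem_cons, List.not_mem_nil, or_false, not_or] at hr
        simp [hr]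
      · simp
      · simp
      · simp
    rw [hS']
    have hjR : jR < 16 := by rcases hb.region with h | h <;> omega
    have hjR3 : jR ≠ 3 := by rcases hb.region with h | h <;> omega
    have hjR4 : jR ≠ 4 := by rcases hb.region with h | h <;> omega
    have hjR5 : jR ≠ 5 := by rcases hb.region with h | h <;> omega
    have hlen : l.length < 2 ^ (wA + 4) := by
      have hsub : l ⊆ List.range (2 ^ wA) := fun v hv => by
        obtain ⟨_, e, _, he⟩ := (hl4 v).1 hv
        rw [List.mem_range, ← he]; exact e.snd.isLt
      have h1 : l.length ≤ 2 ^ wA := by simpa using (hl1.subperm hsub).length_le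
      have : 2 ^ wA < 2 ^ (wA + 4) := Nat.pow_lt_pow_right (by norm_num) (by omega)
      omega
    have hmem : ∀ j v, j < 16 → v < 2 ^ (wA + 4) → j ≠ 4 → j ≠ 5 →
        S'.mem (addr w wA j v) = S.mem (addr w wA j v) := by
      intro j v hj hv h1 h2
      rw [hm, Function.update_of_ne (addr_ne hle hj (by norm_num) hv hlen h2),
        Function.update_of_ne (addr_ne hle hj (by norm_num) hv hpl h1)]
    have hmem4 : ∀ v, v < 2 ^ (wA + 4) → S'.mem (addr w wA 4 v) =
        if v = p then BitVec.ofNat w cur else S.mem (addr w wA 4 v) := by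
      intro v hv
      rw [hm, Function.update_of_ne (addr_ne hle (by norm_num) (by norm_num) hv hlen (by norm_num))]
      split_ifs with hvp
      · rw [hvp, Function.update_self]
      · rw [Function.update_of_ne
          (fun e => hvp ((addr_inj hle (by norm_num) (by norm_num) hv hpl).1 e).2)]
    refine ⟨fun z hz => ?_, fun v => ?_, ?_, ⟨l ++ [p], ?_, ?_, fun i hi => ?_, fun v => ?_,
      fun v => ?_⟩, fun r h1 h2 => ?_, fun j hj hj' v hv => ?_, fun j hj v hv => ?_,
      by rw [hio.1, hio.2.1, hio.2.2]; exact h.io⟩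
    · rw [hreg _ (by have := hb.ge z; simp; omega)]; exact h.regs z hz
    · have hvl : v.toNat < 2 ^ (wA + 4) := BitVec.toNat_lt_region v
      rw [hmem _ _ (by norm_num) hvl (by norm_num) (by norm_num), hmem _ _ hjR hvl hjR4 hjR5,
        hmem _ _ (by norm_num) hvl (by norm_num) (by norm_num)]
      exact h.mem v
    · obtain ⟨k, hk1, hk2, hk3, hk4⟩ := h.ptr
      refine ⟨k, ?_, ?_, hk3, fun i hi => ?_⟩
      · rw [hreg _ (by simp)]; exact hk1
      · rw [hreg _ (by simp)]; exact hk2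
      · rw [hmem _ _ (by norm_num) (by dsimp only at hi; omega) (by norm_num) (by norm_num)]
        exact hk4 i hi
    · rw [List.nodup_append]
      exact ⟨hl1, by simp, by rintro a ha b hb' rfl; simp at hb'; exact hcl.2 (hb' ▸ ha)⟩
    · rw [h36]; simp
    · rw [hm]
      simp only [List.length_append, List.length_singleton] at hi
      rcases Nat.lt_succ_iff_lt_or_eq.1 hi with hi' | rfl
      · rw [Function.update_of_ne (fun e => hi'.ne
            ((addr_inj hle (by norm_num) (by norm_num) (by omega) hlen).1 e).2),
          Function.update_of_ne
            (addr_ne hle (by norm_num) (by norm_num) (by omega) hpl (by norm_num)), hl3 i hi',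
          List.getElem_append_left hi']
      · rw [Function.update_self]; simp
    · rw [List.mem_append, List.mem_singleton, hl4]
      simp only [List.mem_cons, exists_eq_or_imp, ← hp]
      constructor
      · rintro (⟨h1, h2⟩ | rfl)
        · exact ⟨h1, Or.inr h2⟩
        · exact ⟨hcl.1, Or.inl rfl⟩
      · rintro ⟨h1, rfl | h2⟩
        · exact Or.inr rfl
        · exact Or.inl ⟨h1, h2⟩
    · rw [hmem4 _ (BitVec.toNat_lt_region v), List.mem_append, List.mem_singleton]
      split_ifs with hvp
      · simp [hvp]
      · rw [hl5]; simp [hvp]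
    · simp only [List.mem_cons, List.not_mem_nil, or_false, not_or] at h2
      rw [hreg r (by simp [h2])]; exact h.frame_regs r h1 (by simp [h2])
    · simp only [List.mem_cons, List.not_mem_nil, or_false, not_or] at hj'
      rw [hmem j v hj hv hj'.2.2.1 hj'.2.2.2]; exact h.frame_mem j hj (by simp [hj']) v hv
    · simp only [List.mem_cons, List.not_mem_nil, or_false] at hj
      rcases hj with rfl | rfl
      · rw [hmem 3 v (by norm_num) hv (by norm_num) (by norm_num)]
        exact h.stamp 3 (by simp) v hv
      · rw [hmem4 v hv]
        split_ifs
        · exact Or.inr rfl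
        · exact h.stamp 4 (by simp) v hv

theorem Sim.rand (h : Sim M φ cur jR S₀ s S) (hb : SimBase wA M φ cur jR S₀) {x : ℕ}
    (hx : x < M) (V : BitVec w) : Sim M φ cur jR S₀ (s.set x (BitVec.ofNat wA V.toNat))
      (det (maskCmd (φ x)) (S.set (φ x) V)) := by
  have hle := hb.le
  have h64 := hb.ge x
  have h5 : (5 : ℕ) ≠ φ x := by omega
  refine h.set_of hb hx _ ?_ ?_ rfl ⟨rfl, rfl, rfl⟩
  · simp only [maskCmd, det, State.set_regs, Function.update_self, Function.update_of_ne h5,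
      BinOp.eval]
    rw [h.const_reg hb (by norm_num), hb.mask, and_mask (by omega), BitVec.toNat_ofNat]
  · intro r hr _
    simp [maskCmd, det, hr]

theorem sum_inv_word (w : ℕ) : ∑ _v : BitVec w, ((2 : ℝ≥0∞) ^ w)⁻¹ = 1 := by
  have hc : Fintype.card (BitVec w) = 2 ^ w := by
    rw [Fintype.card_congr (BitVec.equivFin (m := w)).toEquiv, Fintype.card_fin]
  rw [Finset.sum_const, Finset.card_univ, hc, nsmul_eq_mul]
  push_cast
  exact ENNReal.mul_inv_cancel (by simp) (by simp)

/-- Induction on the program. A primitive command becomes a few commands of total cost at most `30`,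
so price `1` on the long machine is compared with price `30` on the short one. Comparing `ert` on
both sides avoids any coupling of the two random processes. -/
theorem ert_comp (hb : SimBase wA M φ cur jR S₀) (c : Cmd) :
    ∀ (_ : c.regBound ≤ M) {f : State w → ℝ≥0∞} {F : State wA → ℝ≥0∞}
      (_ : ∀ s S, Sim M φ cur jR S₀ s S → f S ≤ F s) (s : State wA) (S : State w),
      Sim M φ cur jR S₀ s S → ert 1 (comp φ c) f S ≤ ert 30 c F s := by
  have key : ∀ (c : Cmd) (f : State w → ℝ≥0∞) (X : ℝ≥0∞) (S : State w), c.straight = true →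
      c.time ≤ 30 → f (det c S) ≤ X → ert 1 c f S ≤ 30 + X := by
    intro c f X S h1 h2 h3
    refine (ert_straight f S h1).trans (add_le_add ?_ h3)
    exact_mod_cast h2
  induction c with
  | skip =>
    intro hc f F hf s S h
    exact key _ _ _ _ rfl (by simp [comp, Cmd.time]) (hf _ _ h)
  | const x k =>
    intro hc f F hf s S h
    simp only [Cmd.regBound] at hc
    exact key _ _ _ _ rfl (by simp [comp, Cmd.time, maskCmd]) (hf _ _ (h.const hb (by omega)))
  | wordSize x =>
    intro hc f F hf s S h
    simp only [Cmd.regBound] at hc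
    exact key _ _ _ _ rfl (by simp [comp, Cmd.time]) (hf _ _ (h.wordSize hb (by omega)))
  | op o x y z =>
    intro hc f F hf s S h
    simp only [Cmd.regBound] at hc
    exact key _ _ _ _ rfl (by simp [comp, Cmd.time, maskCmd])
      (hf _ _ (h.op hb o (by omega) (by omega) (by omega)))
  | load x y =>
    intro hc f F hf s S h
    simp only [Cmd.regBound] at hc
    exact key _ _ _ _ rfl (by simp [comp, block, Cmd.time])
      (hf _ _ (h.load hb (by omega) (by omega)))
  | store x y =>
    intro hc f F hf s S h
    simp only [Cmd.regBound] at hc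
    exact key _ _ _ _ rfl (by simp [comp, block, Cmd.time])
      (hf _ _ (h.store hb (by omega) (by omega)))
  | rand x =>
    intro hc f F hf s S h
    simp only [Cmd.regBound] at hc
    have hle := hb.le
    simp only [comp, ert]
    calc 1 + (1 + ∑ v : BitVec w, ((2 : ℝ≥0∞) ^ w)⁻¹ * ert 1 (maskCmd (φ x)) f (S.set (φ x) v))
        ≤ 1 + (1 + ∑ v : BitVec w, ((2 : ℝ≥0∞) ^ w)⁻¹ *
            (1 + F (s.set x (BitVec.ofNat wA v.toNat)))) := by
          gcongr with v
          refine (ert_straight f _ rfl).trans ?_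
          simp only [maskCmd, Cmd.time, Nat.cast_one]
          gcongr
          exact hf _ _ (h.rand hb (by omega) v)
      _ = 3 + ∑ v : BitVec wA, ((2 : ℝ≥0∞) ^ wA)⁻¹ * F (s.set x v) := by
          simp only [mul_add, mul_one, Finset.sum_add_distrib, sum_inv_word]
          rw [sum_rand_mask (by omega) (fun v => F (s.set x v)), ← add_assoc, ← add_assoc]
          norm_num
      _ ≤ _ := by gcongr; norm_num
  | read x y =>
    intro hc f F hf s S h
    simp only [Cmd.regBound] at hc
    simp only [ert]
    rcases hi : s.input with _ | ⟨a, rest⟩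
    · exact key _ _ _ _ rfl (by simp [comp, block, Cmd.time])
        (hf _ _ (h.read_nil hb (by omega) hi))
    · exact key _ _ _ _ rfl (by simp [comp, block, Cmd.time])
        (hf _ _ (h.read_cons hb (by omega) (by omega) hi))
  | emit x y =>
    intro hc f F hf s S h
    simp only [Cmd.regBound] at hc
    exact key _ _ _ _ rfl (by simp [comp, block, Cmd.time])
      (hf _ _ (h.emit hb (by omega)))
  | seq c₁ c₂ ih₁ ih₂ =>
    intro hc f F hf s S h
    simp only [Cmd.regBound] at hc
    simp only [comp, ert]
    exact add_le_add (by norm_num)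
      (ih₁ (by omega) (fun s S hs => ih₂ (by omega) hf s S hs) s S h)
  | ite x c₁ c₂ ih₁ ih₂ =>
    intro hc f F hf s S h
    simp only [Cmd.regBound] at hc
    have hle := hb.le
    simp only [comp, ert, h.regs x (by omega), widen_ne_zero (show wA ≤ w by omega)]
    refine add_le_add (by norm_num) ?_
    split_ifs
    · exact ih₁ (by omega) hf s S h
    · exact ih₂ (by omega) hf s S h
  | loop x c ih =>
    intro hc f F hf s S h
    simp only [Cmd.regBound] at hc
    have hle := hb.le
    set G := ert 30 (.loop x c) F with hG
    -- A long state may represent several short states or none. The infimum over all represented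
    -- states is a function of the long state alone, and it is the pre-fixed point for Park
    -- induction.
    have hpre : ∀ S', 1 + (if S'.regs (φ x) ≠ 0 then ert 1 (comp φ c)
        (fun S' => ⨅ (s' : State wA) (_ : Sim M φ cur jR S₀ s' S'), G s') S' else f S') ≤
        ⨅ (s' : State wA) (_ : Sim M φ cur jR S₀ s' S'), G s' := by
      intro S'
      refine le_iInf fun s' => le_iInf fun h' => ?_
      refine le_trans ?_ (ert_loop_ge 30 x c F s')
      simp only [h'.regs x (by omega), widen_ne_zero (show wA ≤ w by omega)]
      refine add_le_add (by norm_num) ?_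
      split_ifs
      · exact ih (by omega) (F := G) (fun s₁ S₁ h₁ => iInf_le_of_le s₁ (iInf_le (fun _ => G s₁) h₁)) s' S' h'
      · exact hf _ _ h'
    exact (ert_loop_le_of hpre S).trans (iInf_le_of_le s (iInf_le (fun _ => G s) h))

theorem ert_comp_le (hb : SimBase wA M φ cur jR S₀) {c : Cmd} (hc : c.regBound ≤ M)
    {f : State w → ℝ≥0∞} {F : State wA → ℝ≥0∞}
    (hf : ∀ s S, Sim M φ cur jR S₀ s S → f S ≤ F s) {s : State wA} {S : State w}
    (h : Sim M φ cur jR S₀ s S) :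
    ert 1 (comp φ c) f S ≤ 30 * expTime c s + ∑' s', haltProb c s s' * F s' :=
  (ert_comp hb c hc hf s S h).trans (ert_le_expTime _ _ _ _)

theorem Runs.comp (hb : SimBase wA M φ cur jR S₀) {c : Cmd} (hc : c.regBound ≤ M)
    {s : State wA} {S : State w} (h : Sim M φ cur jR S₀ s S) {post : State wA → Prop}
    (hpost : Computes c s post) :
    Runs (comp φ c) S (fun S' => ∃ s', post s' ∧ Sim M φ cur jR S₀ s' S') (30 * expTime c s) := by
  classical
  intro f X hf
  refine (ert_comp_le hb hc (F := fun s' => if post s' then X else ∞)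
    (fun s' S' h' => ?_) h).trans ?_
  · split_ifs with hp
    · exact hf _ ⟨s', hp, h'⟩
    · exact le_top
  · gcongr
    calc _ ≤ ∑' s', haltProb c s s' * X := by
          refine ENNReal.tsum_le_tsum fun s' => ?_
          by_cases h0 : haltProb c s s' = 0
          · simp [h0]
          · simp [hpost.2 s' h0]
      _ = X := by rw [ENNReal.tsum_mul_right, hpost.1, one_mul]

end Compile

end WordRAM

/-! ## Multiplicative hashing -/

section Hash

/-- The upper `s` bits of `(4 a + 1) X` modulo `2 ^ (w + 2)`. -/
def mulHash (w s a X : ℕ) : ℕ := ((4 * a + 1) * (X / 4) + a * (X % 4)) % 2 ^ w / 2 ^ (w - s)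

/-- Writing `X = 4 (X / 4) + X % 4`, the quotient of `(4 a + 1) X` by `4` is the expression in
`mulHash`. So a hash function modulo `2 ^ (w + 2)` can be evaluated with `w`-bit words. -/
theorem mulHash_eq {w s : ℕ} (hs : s ≤ w) (a X : ℕ) :
    mulHash w s a X = (4 * a + 1) * X % 2 ^ (w + 2) / 2 ^ (w + 2 - s) := by
  have h1 : (4 * a + 1) * X = 4 * ((4 * a + 1) * (X / 4) + a * (X % 4)) + X % 4 := by
    conv_lhs => rw [← Nat.div_add_mod X 4]
    ring
  have h2 : (4 * a + 1) * X / 4 = (4 * a + 1) * (X / 4) + a * (X % 4) := by omega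
  rw [mulHash, ← h2, show w + 2 - s = 2 + (w - s) by omega, pow_add 2 2 (w - s), ← Nat.div_div_eq_div_mul,
    pow_add 2 w 2, mul_comm (2 ^ w) (2 ^ 2)]
  congr 1
  rw [show (2 : ℕ) ^ 2 = 4 from rfl, Nat.mod_mul_right_div_self]

theorem mulHash_lt {w s : ℕ} (hs : s ≤ w) (a X : ℕ) : mulHash w s a X < 2 ^ s := by
  rw [mulHash, Nat.div_lt_iff_lt_mul (by positivity), ← pow_add, show s + (w - s) = w by omega]
  exact Nat.mod_lt _ (by positivity)

/-- The smallest hash sum of triples of sum `T`. -/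
def hashBase (w s a T : ℕ) : ℕ := (mulHash w s a T + 2 ^ s - 2) % 2 ^ s

/-- The hash values are those of a triple of sum `T`. -/
def HashMatch (w s a T X Y Z : ℕ) : Prop :=
  ∃ e < 3, (mulHash w s a X + mulHash w s a Y + mulHash w s a Z) % 2 ^ s =
    (hashBase w s a T + e) % 2 ^ s

/-- An integer identity: `ρ` consists of the bits below the hash value and `k` of the overflow. It
allows hash sums to be compared by linear arithmetic. -/
theorem mulHash_decomp {w s : ℕ} (hs : s ≤ w) (a X : ℕ) : ∃ k ρ : ℤ, 0 ≤ ρ ∧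
    ρ < 2 ^ (w + 2 - s) ∧ ((4 * a + 1) * X : ℤ) =
      mulHash w s a X * 2 ^ (w + 2 - s) + ρ + k * 2 ^ (w + 2) := by
  set V := (4 * a + 1) * X
  refine ⟨(V / 2 ^ (w + 2) : ℕ), (V % 2 ^ (w + 2) % 2 ^ (w + 2 - s) : ℕ), by positivity, ?_, ?_⟩
  · have := Nat.mod_lt (V % 2 ^ (w + 2)) (show 0 < 2 ^ (w + 2 - s) by positivity)
    exact_mod_cast this
  · have h1 := Nat.div_add_mod V (2 ^ (w + 2))
    have h2 := Nat.div_add_mod (V % 2 ^ (w + 2)) (2 ^ (w + 2 - s))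
    rw [← mulHash_eq hs a X] at h2
    have h3 : (V : ℤ) = (4 * a + 1) * X := by simp [V]
    rw [← h3]
    zify at h1 h2
    push_cast
    linear_combination -h1 - h2

theorem hashBase_cast {w s : ℕ} (hs : 1 ≤ s) (a T : ℕ) :
    (hashBase w s a T : ℤ) ≡ mulHash w s a T - 2 [ZMOD 2 ^ s] := by
  have h2 : 2 ≤ 2 ^ s := by
    calc 2 = 2 ^ 1 := rfl
      _ ≤ 2 ^ s := Nat.pow_le_pow_right (by norm_num) hs
  rw [hashBase]
  push_cast [Nat.sub_add_cancel, show 2 ≤ mulHash w s a T + 2 ^ s by omega]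
  refine (Int.mod_modEq _ _).trans ?_
  rw [Int.modEq_iff_dvd]
  exact ⟨-1, by ring⟩

/-- The three low parts add up to less than three units of the hash value, and the low part of `T`
is less than one unit. Hence the hash sum falls short of the hash value of `T` by `0`, `1` or `2`.
-/
theorem hashMatch_of_sum {w s : ℕ} (hs : s ≤ w) (h1 : 1 ≤ s) (a : ℕ) {T X Y Z : ℕ}
    (h : X + Y + Z = T) : HashMatch w s a T X Y Z := by
  obtain ⟨k₁, ρ₁, a₁, b₁, c₁⟩ := mulHash_decomp hs a X
  obtain ⟨k₂, ρ₂, a₂, b₂, c₂⟩ := mulHash_decomp hs a Y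
  obtain ⟨k₃, ρ₃, a₃, b₃, c₃⟩ := mulHash_decomp hs a Z
  obtain ⟨k, ρ, a₀, b₀, c₀⟩ := mulHash_decomp hs a T
  set W : ℤ := 2 ^ (w + 2 - s) with hW
  have hWpos : 0 < W := by positivity
  have hM : (2 : ℤ) ^ (w + 2) = 2 ^ s * W := by
    rw [hW, ← pow_add]; congr 1; omega
  have hsum : ((4 * a + 1) * X : ℤ) + (4 * a + 1) * Y + (4 * a + 1) * Z = (4 * a + 1) * T := by
    rw [← h]; push_cast; ring
  rw [c₁, c₂, c₃, c₀, hM] at hsum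
  set D : ℤ := (mulHash w s a X : ℤ) + mulHash w s a Y + mulHash w s a Z - mulHash w s a T +
    (k₁ + k₂ + k₃ - k) * 2 ^ s with hD
  have hDW : D * W = ρ - ρ₁ - ρ₂ - ρ₃ := by rw [hD]; linear_combination hsum
  have hD1 : D < 1 := by
    by_contra hcon
    have : 1 * W ≤ D * W := mul_le_mul_of_nonneg_right (by omega) hWpos.le
    omega
  have hD2 : -3 < D := by
    by_contra hcon
    have : D * W ≤ -3 * W := mul_le_mul_of_nonneg_right (by omega) hWpos.le
    omega
  refine ⟨(D + 2).toNat, by omega, ?_⟩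
  have : ((mulHash w s a X + mulHash w s a Y + mulHash w s a Z : ℕ) : ℤ) ≡
      ((hashBase w s a T + (D + 2).toNat : ℕ) : ℤ) [ZMOD (2 ^ s : ℕ)] := by
    push_cast
    have h3 : ((D + 2).toNat : ℤ) = D + 2 := Int.toNat_of_nonneg (by omega)
    rw [h3]
    refine Int.ModEq.trans ?_ ((hashBase_cast h1 a T).symm.add_right _)
    rw [Int.modEq_iff_dvd]
    exact ⟨k₁ + k₂ + k₃ - k, by rw [hD]; ring⟩
  exact Int.natCast_modEq_iff.1 this

/-- The same carries read backwards: a match confines `(4 a + 1) (X + Y + Z - T)` to a short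
interval modulo `2 ^ (w + 2)`. -/
theorem residue_of_hashMatch {w s : ℕ} (hs : s ≤ w) (h1 : 1 ≤ s) {a T X Y Z : ℕ}
    (h : HashMatch w s a T X Y Z) : ∃ r : ℤ, -3 * 2 ^ (w + 2 - s) < r ∧ r < 3 * 2 ^ (w + 2 - s) ∧
      (2 : ℤ) ^ (w + 2) ∣ (4 * a + 1) * ((X : ℤ) + Y + Z - T) - r := by
  obtain ⟨e, he, h⟩ := h
  obtain ⟨k₁, ρ₁, a₁, b₁, c₁⟩ := mulHash_decomp hs a X
  obtain ⟨k₂, ρ₂, a₂, b₂, c₂⟩ := mulHash_decomp hs a Y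
  obtain ⟨k₃, ρ₃, a₃, b₃, c₃⟩ := mulHash_decomp hs a Z
  obtain ⟨k, ρ, a₀, b₀, c₀⟩ := mulHash_decomp hs a T
  have h2 : ((mulHash w s a X + mulHash w s a Y + mulHash w s a Z : ℕ) : ℤ) ≡
      ((hashBase w s a T + e : ℕ) : ℤ) [ZMOD (2 ^ s : ℕ)] := Int.natCast_modEq_iff.2 h
  push_cast at h2
  have h3 := h2.trans ((hashBase_cast h1 a T).add_right (e : ℤ))
  obtain ⟨m, hm⟩ := h3.symm.dvd
  set W : ℤ := 2 ^ (w + 2 - s) with hW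
  have hWpos : 0 < W := by positivity
  have hM : (2 : ℤ) ^ (w + 2) = 2 ^ s * W := by
    rw [hW, ← pow_add]; congr 1; omega
  have he' : (e : ℤ) = 0 ∨ (e : ℤ) = 1 ∨ (e : ℤ) = 2 := by omega
  refine ⟨((e : ℤ) - 2) * W + (ρ₁ + ρ₂ + ρ₃ - ρ), ?_, ?_, ⟨k₁ + k₂ + k₃ - k + m, ?_⟩⟩
  · rcases he' with h | h | h <;> rw [h] <;> linarith
  · rcases he' with h | h | h <;> rw [h] <;> linarith
  · rw [hM] at c₁ c₂ c₃ c₀ ⊢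
    linear_combination c₁ + c₂ + c₃ - c₀ + W * hm

/-- Let `t = X + Y + Z - T = 2 ^ j o` with `o` odd. For a bad multiplier the residue `r` of `(4 a +
1) t` is a nonzero multiple of `2 ^ j` in `(-3 W, 3 W)`, where `W = 2 ^ (w + 2 - s)`. It determines
`a` modulo `2 ^ (w - j)`, and what is left of `a` is a number below `2 ^ j`. Since `r` is a multiple
of `2 ^ j`, the sum of the two numbers encodes `a` injectively; it lies in an interval of length `9
W`. -/
theorem card_hashMatch_le {w s : ℕ} (hs : s ≤ w) (h1 : 1 ≤ s) {T X Y Z : ℕ}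
    (hX : X < 2 ^ w) (hY : Y < 2 ^ w) (hZ : Z < 2 ^ w) (hT : 2 * T = 3 * 2 ^ w)
    (hne : X + Y + Z ≠ T) (A : Finset ℕ)
    (hA : ∀ a ∈ A, a < 2 ^ w ∧ HashMatch w s a T X Y Z) :
    A.card ≤ 9 * 2 ^ (w + 2 - s) := by
  set t : ℤ := (X : ℤ) + Y + Z - T with ht
  have ht0 : t ≠ 0 := by omega
  -- `T` is the middle of the range `[0, 3 * 2 ^ w)` of the sums, so `|t|` is at most `3 * 2 ^ w /
  -- 2`. The two extra bits of the modulus keep `t` nonzero modulo `2 ^ (w + 2)`.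
  have htabs : t.natAbs < 2 ^ (w + 1) := by
    have : 2 ^ (w + 1) = 2 * 2 ^ w := by ring
    omega
  obtain ⟨j, m, hm, hjm⟩ := Nat.exists_eq_two_pow_mul_odd (Int.natAbs_ne_zero.2 ht0)
  have hj : j ≤ w := by
    by_contra hcon
    have h2 : 2 ^ (w + 1) ≤ 2 ^ j := Nat.pow_le_pow_right (by norm_num) (by omega)
    have h3 : 2 ^ j * 1 ≤ 2 ^ j * m := Nat.mul_le_mul_left _ hm.pos
    omega
  obtain ⟨o, ho, hto⟩ : ∃ o : ℤ, Odd o ∧ t = 2 ^ j * o := by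
    rcases Int.natAbs_eq t with h | h
    · exact ⟨m, by exact_mod_cast hm, by rw [h, hjm]; push_cast; ring⟩
    · exact ⟨-m, Odd.neg (by exact_mod_cast hm), by rw [h, hjm]; push_cast; ring⟩
  have hcop : ∀ n : ℕ, IsCoprime ((2 : ℤ) ^ n) o := fun n =>
    IsCoprime.pow_left (Int.isCoprime_iff_gcd_eq_one.2 (by
      obtain ⟨c, hc⟩ := ho
      rw [hc, Int.gcd_comm]
      simp))
  have hr : ∀ a : ℕ, ∃ r : ℤ, a ∈ A → -3 * 2 ^ (w + 2 - s) < r ∧ r < 3 * 2 ^ (w + 2 - s) ∧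
      (2 : ℤ) ^ (w + 2) ∣ (4 * a + 1) * t - r := fun a => by
    by_cases ha : a ∈ A
    · obtain ⟨r, h⟩ := residue_of_hashMatch hs h1 (hA a ha).2
      exact ⟨r, fun _ => h⟩
    · exact ⟨0, fun h => absurd h ha⟩
  choose r hr using hr
  set W : ℤ := 2 ^ (w + 2 - s) with hW
  have hdvd : ∀ a ∈ A, (2 : ℤ) ^ j ∣ r a := fun a ha => by
    have h2 := (pow_dvd_pow (2 : ℤ) (show j ≤ w + 2 by omega)).trans (hr a ha).2.2
    have h3 : (2 : ℤ) ^ j ∣ (4 * a + 1) * t := by rw [hto]; exact ⟨(4 * a + 1) * o, by ring⟩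
    have := dvd_sub h3 h2
    rwa [sub_sub_cancel] at this
  have hrne : ∀ a ∈ A, r a ≠ 0 := fun a ha h0 => by
    have h2 := (hr a ha).2.2
    rw [h0, sub_zero] at h2
    have hc : IsCoprime ((2 : ℤ) ^ (w + 2)) (4 * (a : ℤ) + 1) :=
      IsCoprime.pow_left ⟨-2 * a, 1, by ring⟩
    have h3 : (2 : ℤ) ^ (w + 2) ≤ |t| :=
      Int.le_of_dvd (abs_pos.2 ht0) ((dvd_abs _ _).2 (hc.dvd_of_dvd_mul_left h2))
    have h4 : |t| < 2 ^ (w + 1) := by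
      rw [Int.abs_eq_natAbs]; exact_mod_cast htabs
    have : (2 : ℤ) ^ (w + 2) = 2 * 2 ^ (w + 1) := by ring
    have : (0 : ℤ) < 2 ^ (w + 1) := by positivity
    omega
  have hjW : ∀ a ∈ A, (2 : ℤ) ^ j < 3 * W := fun a ha => by
    have h2 : (2 : ℤ) ^ j ≤ |r a| :=
      Int.le_of_dvd (abs_pos.2 (hrne a ha)) ((dvd_abs _ _).2 (hdvd a ha))
    have h3 : |r a| < 3 * W := abs_lt.2 ⟨by linarith [(hr a ha).1], (hr a ha).2.1⟩
    omega
  have hd : ∀ a ∈ A, (a / 2 ^ (w - j) : ℕ) < 2 ^ j := fun a ha => by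
    rw [Nat.div_lt_iff_lt_mul (by positivity), ← pow_add, show j + (w - j) = w by omega]
    exact (hA a ha).1
  have hWpos : 0 < W := by positivity
  have hcard : A.card ≤ (Finset.Ioo (-3 * W) (6 * W)).card := by
    refine Finset.card_le_card_of_injOn (fun a => r a + (a / 2 ^ (w - j) : ℕ)) ?_ ?_
    · intro a ha
      rw [Finset.mem_coe, Finset.mem_Ioo]
      have h2 := hr a ha
      have h3 : ((a / 2 ^ (w - j) : ℕ) : ℤ) < 2 ^ j := by exact_mod_cast hd a ha
      have h4 := hjW a ha
      constructor
      · have : (0 : ℤ) ≤ ((a / 2 ^ (w - j) : ℕ) : ℤ) := by positivity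
        linarith [h2.1]
      · linarith [h2.2.1]
    · intro a ha b hb hab
      have hab' : r a + (a / 2 ^ (w - j) : ℕ) = r b + (b / 2 ^ (w - j) : ℕ) := hab
      have h3 : ((a / 2 ^ (w - j) : ℕ) : ℤ) < 2 ^ j := by exact_mod_cast hd a ha
      have h4 : ((b / 2 ^ (w - j) : ℕ) : ℤ) < 2 ^ j := by exact_mod_cast hd b hb
      -- The residues are multiples of `2 ^ j`, and by `hab'` they differ by less than `2 ^ j`.
      have h5 : r a = r b := by
        obtain ⟨c, hc⟩ := dvd_sub (hdvd a ha) (hdvd b hb)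
        have h6 : c = 0 := by
          have hp : (0 : ℤ) < 2 ^ j := by positivity
          have n1 : (0 : ℤ) ≤ ((a / 2 ^ (w - j) : ℕ) : ℤ) := Int.natCast_nonneg _
          have n2 : (0 : ℤ) ≤ ((b / 2 ^ (w - j) : ℕ) : ℤ) := Int.natCast_nonneg _
          have e1 : (2 : ℤ) ^ j * c < 2 ^ j * 1 := by rw [← hc]; linarith
          have e2 : (2 : ℤ) ^ j * (-1) < 2 ^ j * c := by rw [← hc]; linarith
          have := lt_of_mul_lt_mul_left e1 hp.le
          have := lt_of_mul_lt_mul_left e2 hp.le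
          omega
        rw [h6, mul_zero] at hc
        omega
      have h6 : (a / 2 ^ (w - j) : ℕ) = b / 2 ^ (w - j) := by omega
      -- Equal residues make `4 (a - b) 2 ^ j o` divisible by `2 ^ (w + 2)`; cancel `2 ^ (j + 2)`
      -- and the odd factor.
      have h7 : (2 : ℤ) ^ (w - j) ∣ (a : ℤ) - b := by
        have e1 := dvd_sub (hr a ha).2.2 (hr b hb).2.2
        rw [h5, hto] at e1
        have e2 : (2 : ℤ) ^ (w + 2) = 2 ^ (j + 2) * 2 ^ (w - j) := by
          rw [← pow_add]; congr 1; omega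
        have e3 : (4 * (a : ℤ) + 1) * (2 ^ j * o) - r b - ((4 * b + 1) * (2 ^ j * o) - r b) =
          2 ^ (j + 2) * (((a : ℤ) - b) * o) := by ring
        rw [e2, e3] at e1
        exact (hcop _).dvd_of_dvd_mul_right (Int.dvd_of_mul_dvd_mul_left (by positivity) e1)
      have h8 : a % 2 ^ (w - j) = b % 2 ^ (w - j) := by
        have : ((b : ℕ) : ℤ) ≡ a [ZMOD (2 ^ (w - j) : ℕ)] := by
          rw [Int.modEq_iff_dvd]; exact_mod_cast h7
        exact (Int.natCast_modEq_iff.1 this).symm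
      rw [← Nat.div_add_mod a (2 ^ (w - j)), ← Nat.div_add_mod b (2 ^ (w - j)), h6, h8]
  rw [Int.card_Ioo] at hcard
  have : (9 * 2 ^ (w + 2 - s) : ℕ) = 9 * W := by rw [hW]; push_cast; ring
  omega

end Hash

namespace DMOG

/-! ## The dictionary of a set of pairs -/

section Gadget

/-- First character of the `j`-th pattern. -/
def leftChar (q : ℕ) (mark : ℕ → Bool) (j : ℕ) : ℕ :=
  if j < q * q then (if mark j then 0 else 2 * q) + j / q else 3 * q + j / q

/-- Second character of the `j`-th pattern. -/
def rightChar (q : ℕ) (mark : ℕ → Bool) (j : ℕ) : ℕ :=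
  if j < q * q then (if mark j then q else 3 * q) + j % q else 5 * q + j % q

/-- The patterns `j < q ^ 2` encode the marked pairs `(j / q, j % q)` and, disjointly, the unmarked
ones; the other patterns form a complete bipartite graph. -/
def gadget (q : ℕ) (β : Option ℕ) (mark : ℕ → Bool) : Dictionary :=
  (List.range (2 * (q * q))).map fun j =>
    .gapped [leftChar q mark j] 0 β [rightChar q mark j]

/-- The text that contains the characters `x` with `pA x`, and then `q + y` with `pB y`. -/
def gadgetText (q : ℕ) (pA pB : ℕ → Bool) : List ℕ :=
  (List.range (2 * q)).map fun i =>
    if i < q then (if pA i then i else 6 * q) else if pB (i - q) then i else 6 * q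

variable {q : ℕ} {β : Option ℕ} {mark : ℕ → Bool}

theorem div_mod_facts (hq : 0 < q) {j : ℕ} (hj : j < 2 * (q * q)) :
    j % q < q ∧ j / q < 2 * q ∧ (j < q * q ↔ j / q < q) :=
  ⟨Nat.mod_lt _ hq, (Nat.div_lt_iff_lt_mul hq).2 (by linarith), (Nat.div_lt_iff_lt_mul hq).symm⟩

/-- Six disjoint ranges of `q` letters each are in use: for marked, unmarked and complete pairs the
left letters start at `0`, `2 q`, `4 q` and the right letters at `q`, `3 q`, `5 q`. In the complete
part `j / q` is at least `q`, hence the offset `3 q` in `leftChar`. -/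
theorem leftChar_inj (hq : 0 < q) {j k : ℕ} (hj : j < 2 * (q * q)) (hk : k < 2 * (q * q))
    (h : leftChar q mark j = leftChar q mark k) : j / q = k / q := by
  obtain ⟨a1, a2, a3⟩ := div_mod_facts hq hj
  obtain ⟨b1, b2, b3⟩ := div_mod_facts hq hk
  simp only [leftChar, a3, b3] at h
  generalize j / q = d at *
  generalize k / q = d' at *
  split_ifs at h <;> omega

theorem rightChar_inj (hq : 0 < q) {j k : ℕ} (hj : j < 2 * (q * q)) (hk : k < 2 * (q * q))
    (h : rightChar q mark j = rightChar q mark k) : j % q = k % q ∧ (j / q < q ↔ k / q < q) := by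
  obtain ⟨a1, a2, a3⟩ := div_mod_facts hq hj
  obtain ⟨b1, b2, b3⟩ := div_mod_facts hq hk
  simp only [rightChar, a3, b3] at h
  generalize j / q = d at *
  generalize k / q = d' at *
  generalize j % q = m at *
  generalize k % q = m' at *
  split_ifs at h <;> constructor <;> omega

theorem eq_of_div_mod {j k : ℕ} (h1 : j / q = k / q) (h2 : j % q = k % q) : j = k := by
  rw [← Nat.div_add_mod j q, ← Nat.div_add_mod k q, h1, h2]

theorem gadget_length : (gadget q β mark).length = 2 * (q * q) := by simp [gadget]

theorem gadget_getElem? (j : ℕ) : (gadget q β mark)[j]? = if j < 2 * (q * q) then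
    some (.gapped [leftChar q mark j] 0 β [rightChar q mark j]) else none := by
  simp only [gadget, List.getElem?_map]
  split_ifs with h
  · simp [List.getElem?_range h]
  · simp [Nat.not_lt.1 h]

theorem mem_gadget {P : Pattern} (h : P ∈ gadget q β mark) :
    ∃ j < 2 * (q * q), P = .gapped [leftChar q mark j] 0 β [rightChar q mark j] := by
  simp only [gadget, List.mem_map, List.mem_range] at h
  obtain ⟨j, hj, rfl⟩ := h
  exact ⟨j, hj, rfl⟩

theorem gadget_size : (gadget q β mark).size = 4 * (q * q) := by
  have : (fun P : Pattern => P.chars.length) ∘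
      (fun j => Pattern.gapped [leftChar q mark j] 0 β [rightChar q mark j]) = fun _ => 2 := by
    funext j; simp [Pattern.chars]
  simp only [Dictionary.size, gadget, List.map_map, this, List.map_const', List.sum_replicate,
    List.length_range]
  simp; ring

theorem gadget_nodup (hq : 0 < q) : (gadget q β mark).Nodup := by
  refine List.Nodup.map_on (fun j hj k hk h => ?_) List.nodup_range
  simp only [Pattern.gapped.injEq, List.cons.injEq, and_true, true_and] at h
  rw [List.mem_range] at hj hk
  exact eq_of_div_mod (leftChar_inj hq hj hk h.1) (rightChar_inj hq hj hk h.2).1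

theorem gadget_valid {P : Pattern} (h : P ∈ gadget q β mark) : P.Valid := by
  obtain ⟨j, _, rfl⟩ := mem_gadget h
  simp [Pattern.Valid]

theorem gadget_alphabet (hq : 2 ≤ q) {P : Pattern} (h : P ∈ gadget q β mark) {a : ℕ}
    (ha : a ∈ P.chars) : a ≤ 4 * (q * q) := by
  obtain ⟨j, hj, rfl⟩ := mem_gadget h
  obtain ⟨a1, a2, a3⟩ := div_mod_facts (by omega) hj
  have hqq : 2 * q ≤ q * q := Nat.mul_le_mul_right q hq
  simp only [Pattern.chars, List.cons_append, List.nil_append, List.mem_cons, List.not_mem_nil,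
    or_false, leftChar, rightChar] at ha
  rcases ha with rfl | rfl <;> split_ifs <;> omega

theorem gadgetText_length (pA pB : ℕ → Bool) : (gadgetText q pA pB).length = 2 * q := by
  simp [gadgetText]

theorem gadgetText_alphabet (hq : 2 ≤ q) {pA pB : ℕ → Bool} {a : ℕ}
    (ha : a ∈ gadgetText q pA pB) : a ≤ 4 * (q * q) := by
  simp only [gadgetText, List.mem_map, List.mem_range] at ha
  obtain ⟨i, hi, rfl⟩ := ha
  have hqq : 2 * q ≤ q * q := Nat.mul_le_mul_right q hq
  split_ifs <;> omega

theorem gadgetText_getElem? (pA pB : ℕ → Bool) (i : ℕ) : (gadgetText q pA pB)[i]? =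
    if i < 2 * q then some (if i < q then (if pA i then i else 6 * q)
      else if pB (i - q) then i else 6 * q) else none := by
  simp only [gadgetText, List.getElem?_map]
  split_ifs with h <;> simp_all

theorem gadget_bound (hq : 0 < q) : (gadget q β mark).bound = β.getD 0 := by
  have h : ∀ n, 0 < n → ((List.range n).map fun _ => β.getD 0).foldr max 0 = β.getD 0 := by
    intro n hn
    induction n with
    | zero => omega
    | succ n ih =>
      rcases Nat.eq_zero_or_pos n with rfl | h
      · simp
      · rw [List.range_succ_eq_map, List.map_cons, List.map_map, List.foldr_cons]
        have := ih h
        simp only [Function.comp_def] at this ⊢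
        rw [this, max_self]
  have := h (2 * (q * q)) (by positivity)
  simpa [Dictionary.bound, gadget, Function.comp_def, Pattern.bound] using this

theorem gadget_edges : (gadget q β mark).edges =
    (List.range (2 * (q * q))).map fun j => ([leftChar q mark j], [rightChar q mark j]) := by
  simp [Dictionary.edges, gadget, List.filterMap_map, List.filterMap_eq_map']

theorem degree_gadget (U : Finset (List ℕ ⊕ List ℕ)) (u : List ℕ ⊕ List ℕ) :
    (gadget q β mark).degree U u = ((Finset.range (2 * (q * q))).filter fun j =>
      Sum.inl [leftChar q mark j] ∈ U ∧ Sum.inr [rightChar q mark j] ∈ U ∧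
        (u = Sum.inl [leftChar q mark j] ∨ u = Sum.inr [rightChar q mark j])).card := by
  rw [Dictionary.degree, gadget_edges, List.countP_map]
  simp only [Finset.card, Finset.filter, Finset.range, Multiset.range, Multiset.filter_coe,
    Multiset.coe_card, List.countP_eq_length_filter, Function.comp_def]

/-- A left letter fixes `j / q`; a right letter fixes `j % q` and the half of the index range.
Either way at most `q` patterns remain. -/
theorem degree_gadget_le (hq : 0 < q) (U : Finset (List ℕ ⊕ List ℕ)) (u : List ℕ ⊕ List ℕ) :
    (gadget q β mark).degree U u ≤ q := by
  rw [degree_gadget]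
  conv_rhs => rw [← Finset.card_range q]
  cases u with
  | inl l =>
    refine Finset.card_le_card_of_injOn (fun j => j % q)
      (fun j _ => Finset.mem_coe.2 (Finset.mem_range.2 (Nat.mod_lt _ hq))) ?_
    intro j hj k hk h
    simp only [Finset.coe_filter, Finset.mem_range, Set.mem_ofPred_eq, Sum.inl.injEq,
      reduceCtorEq, or_false] at hj hk
    have : leftChar q mark j = leftChar q mark k := by
      have := hj.2.2.2.symm.trans hk.2.2.2
      simpa using this
    exact eq_of_div_mod (leftChar_inj hq hj.1 hk.1 this) h
  | inr l =>
    refine Finset.card_le_card_of_injOn (fun j => j / q % q)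
      (fun j _ => Finset.mem_coe.2 (Finset.mem_range.2 (Nat.mod_lt _ hq))) ?_
    intro j hj k hk h
    simp only [Finset.coe_filter, Finset.mem_range, Set.mem_ofPred_eq, Sum.inr.injEq,
      reduceCtorEq, false_or] at hj hk
    have : rightChar q mark j = rightChar q mark k := by
      have := hj.2.2.2.symm.trans hk.2.2.2
      simpa using this
    obtain ⟨h1, h2⟩ := rightChar_inj hq hj.1 hk.1 this
    have a2 := (div_mod_facts hq hj.1).2.1
    have b2 := (div_mod_facts hq hk.1).2.1
    refine eq_of_div_mod ?_ h1
    have h' : j / q % q = k / q % q := h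
    by_cases hlt : j / q < q
    · rwa [Nat.mod_eq_of_lt hlt, Nat.mod_eq_of_lt (h2.1 hlt)] at h'
    · have hlt' := mt h2.2 hlt
      rw [Nat.mod_eq_sub_mod (by omega), Nat.mod_eq_sub_mod (a := k / q) (by omega),
        Nat.mod_eq_of_lt (by omega), Nat.mod_eq_of_lt (by omega)] at h'
      omega

/-- No degree exceeds `q`, and the patterns with `j ≥ q ^ 2` form a complete bipartite graph with
`q` vertices on each side. The marks play no role, which is the purpose of these extra patterns. -/
theorem degeneracy_gadget (hq : 0 < q) : (gadget q β mark).degeneracy = q := by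
  apply le_antisymm
  · refine Finset.sup_le fun U _ => ?_
    split_ifs with h
    · obtain ⟨u, hu⟩ := h
      exact (Finset.inf'_le _ hu).trans (degree_gadget_le hq U u)
    · exact Nat.zero_le _
  · have hj : ∀ x < q, ∀ y < q, q * q + (q * x + y) < 2 * (q * q) ∧
        leftChar q mark (q * q + (q * x + y)) = 4 * q + x ∧
        rightChar q mark (q * q + (q * x + y)) = 5 * q + y := by
      intro x hx y hy
      have h1 : q * x + y < q * q := by
        calc q * x + y < q * x + q := by omega
          _ = q * (x + 1) := by ring
          _ ≤ q * q := Nat.mul_le_mul_left _ hx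
      have h2 : q * q + (q * x + y) = q * (q + x) + y := by ring
      refine ⟨by omega, ?_, ?_⟩
      · rw [leftChar, if_neg (by omega), h2, Nat.mul_add_div hq, Nat.div_eq_of_lt hy]; ring
      · rw [rightChar, if_neg (by omega), h2, Nat.mul_add_mod, Nat.mod_eq_of_lt hy]
    set U : Finset (List ℕ ⊕ List ℕ) := ((Finset.range q).image fun x => Sum.inl [4 * q + x]) ∪
      ((Finset.range q).image fun y => Sum.inr [5 * q + y]) with hU
    have hl : ∀ x < q, Sum.inl [4 * q + x] ∈ U := fun x hx => by simp [hU, hx]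
    have hr : ∀ y < q, Sum.inr [5 * q + y] ∈ U := fun y hy => by simp [hU, hy]
    have hne : U.Nonempty := ⟨_, hl 0 hq⟩
    have hsub : U ∈ (gadget q β mark).vertices.powerset := by
      rw [Finset.mem_powerset]
      intro u hu
      simp only [hU, Finset.mem_union, Finset.mem_image, Finset.mem_range] at hu
      simp only [Dictionary.vertices, gadget_edges, List.mem_toFinset, List.mem_flatMap,
        List.mem_map, List.mem_range]
      rcases hu with ⟨x, hx, rfl⟩ | ⟨y, hy, rfl⟩
      · obtain ⟨h1, h2, h3⟩ := hj x hx 0 hq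
        exact ⟨_, ⟨_, h1, rfl⟩, by rw [h2]; simp⟩
      · obtain ⟨h1, h2, h3⟩ := hj 0 hq y hy
        exact ⟨_, ⟨_, h1, rfl⟩, by rw [h3]; simp⟩
    refine le_trans ?_ (Finset.le_sup hsub)
    rw [dif_pos hne]
    refine Finset.le_inf' _ _ fun u hu => ?_
    rw [degree_gadget]
    conv_lhs => rw [← Finset.card_range q]
    simp only [hU, Finset.mem_union, Finset.mem_image, Finset.mem_range] at hu
    rcases hu with ⟨x, hx, rfl⟩ | ⟨y, hy, rfl⟩
    · refine Finset.card_le_card_of_injOn (fun y => q * q + (q * x + y)) (fun y hy => ?_)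
        (fun y _ z _ h => by simpa using h)
      rw [Finset.mem_coe, Finset.mem_range] at hy
      obtain ⟨h1, h2, h3⟩ := hj x hx y hy
      rw [Finset.mem_coe, Finset.mem_filter, Finset.mem_range, h2, h3]
      exact ⟨h1, hl x hx, hr y hy, Or.inl rfl⟩
    · refine Finset.card_le_card_of_injOn (fun x => q * q + (q * x + y)) (fun x hx => ?_)
        (fun x _ z _ h => by simpa [hq.ne'] using h)
      rw [Finset.mem_coe, Finset.mem_range] at hx
      obtain ⟨h1, h2, h3⟩ := hj x hx y hy
      rw [Finset.mem_coe, Finset.mem_filter, Finset.mem_range, h2, h3]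
      exact ⟨h1, hl x hx, hr y hy, Or.inr rfl⟩

/-- A finite gap bound not below the length of the text is no restriction, so all kinds of gaps
behave like `{0, ∞}`. Locations count from one and list indices from zero. -/
theorem endsAt_iff {T : List ℕ} {i : ℕ} {c₁ c₂ : ℕ} (hβ : ∀ b ∈ β, T.length ≤ b) :
    (Pattern.gapped [c₁] 0 β [c₂]).EndsAt T (i + 1) ∧ i < T.length ↔
      ∃ k < i, T[k]? = some c₁ ∧ T[i]? = some c₂ := by
  simp only [Pattern.EndsAt, zero_le, true_and]
  constructor
  · rintro ⟨⟨g, hg, pre, hpre⟩, hi⟩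
    have hlen := congrArg List.length hpre
    simp only [List.length_append, List.length_singleton, List.length_take] at hlen
    have hk : ∀ k, k < i + 1 → T[k]? = (pre ++ ([c₁] ++ g ++ [c₂]))[k]? := fun k hk => by
      rw [hpre, List.getElem?_take_of_lt hk]
    refine ⟨pre.length, by omega, ?_, ?_⟩
    · rw [hk _ (by omega)]; simp
    · rw [hk _ (by omega), show i = pre.length + (g.length + 1) by omega]; simp
  · rintro ⟨k, hk, h1, h2⟩
    have hi : i < T.length := by
      by_contra hcon
      rw [List.getElem?_eq_none (by omega)] at h2; simp at h2
    refine ⟨⟨(T.take i).drop (k + 1), fun b hb => ?_, T.take k, ?_⟩, hi⟩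
    · have := hβ b hb
      simp only [List.length_drop, List.length_take]; omega
    · have e1 : T.take (i + 1) = T.take i ++ [c₂] := by
        rw [List.take_add_one, h2]; rfl
      have e2 : T.take k ++ [c₁] = (T.take i).take (k + 1) := by
        rw [List.take_take, min_eq_left (by omega), List.take_add_one, h1]; rfl
      rw [e1, ← List.append_assoc, ← List.append_assoc, e2, List.take_append_drop]

/-- The text contains only letters below `2 q`, each at the index equal to itself, and the filler `6
q`, which no pattern uses. So only marked patterns can occur, and their left letters come before all
right letters. -/
theorem mem_occurrences_gadget (hq : 2 ≤ q) (hβ : ∀ b ∈ β, 2 * q ≤ b) (pA pB : ℕ → Bool)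
    (o : ℕ × ℕ) : o ∈ occurrences (gadget q β mark) (gadgetText q pA pB) ↔
      o.2 < q * q ∧ mark o.2 ∧ pA (o.2 / q) ∧ pB (o.2 % q) ∧ o.1 = q + o.2 % q + 1 := by
  obtain ⟨i, j⟩ := o
  have hmem : (i, j) ∈ occurrences (gadget q β mark) (gadgetText q pA pB) ↔ 1 ≤ i ∧ i ≤ 2 * q ∧
      ∃ P, (gadget q β mark)[j]? = some P ∧ P.EndsAt (gadgetText q pA pB) i := by
    simp only [occurrences, gadgetText_length]; rfl
  have hβ' : ∀ b ∈ β, (gadgetText q pA pB).length ≤ b := by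
    rw [gadgetText_length]; exact hβ
  rw [hmem, gadget_getElem?]
  dsimp only
  constructor
  · rintro ⟨h1, h2, P, h3, h4⟩
    split_ifs at h3 with hj
    simp only [Option.some.injEq] at h3
    subst h3
    obtain ⟨i, rfl⟩ : ∃ i', i = i' + 1 := ⟨i - 1, by omega⟩
    obtain ⟨k, hk, h5, h6⟩ := (endsAt_iff hβ').1 ⟨h4, by rw [gadgetText_length]; omega⟩
    obtain ⟨a1, a2, a3⟩ := div_mod_facts (q := q) (by omega) hj
    rw [gadgetText_getElem?, if_pos (by omega)] at h5 h6
    simp only [Option.some.injEq, leftChar, rightChar, a3] at h5 h6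
    by_cases hd : j / q < q
    · simp only [hd, if_true] at h5 h6
      by_cases hm : mark j
      · simp only [hm, if_true, zero_add] at h5 h6
        have e1 : k = j / q ∧ pA k := by split_ifs at h5 <;> first | omega | simp_all
        have e2 : i = q + j % q ∧ pB (i - q) := by split_ifs at h6 <;> first | omega | simp_all
        refine ⟨a3.2 hd, hm, e1.1 ▸ e1.2, ?_, by omega⟩
        have := e2.2
        rwa [e2.1, Nat.add_sub_cancel_left] at this
      · exfalso
        simp only [hm, if_false, Bool.false_eq_true] at h5 h6
        split_ifs at h5 h6 <;> omega
    · exfalso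
      simp only [hd, if_false] at h5 h6
      split_ifs at h5 h6 <;> omega
  · rintro ⟨hj, hm, hA, hB, rfl⟩
    have hj2 : j < 2 * (q * q) := by omega
    obtain ⟨a1, a2, a3⟩ := div_mod_facts (q := q) (by omega) hj2
    have hd := a3.1 hj
    refine ⟨by omega, by omega, _, by rw [if_pos hj2], ?_⟩
    refine ((endsAt_iff hβ').2 ⟨j / q, by omega, ?_, ?_⟩).1
    · rw [gadgetText_getElem?, if_pos (by omega)]
      simp [leftChar, hj, hm, hd, hA]
    · rw [gadgetText_getElem?, if_pos (by omega)]
      simp [rightChar, hj, hm, hB]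

theorem outSize_gadget (hq : 2 ≤ q) (hβ : ∀ b ∈ β, 2 * q ≤ b) (pA pB : ℕ → Bool) :
    outSize (gadget q β mark) (gadgetText q pA pB) =
      ((Finset.range (q * q)).filter fun j => mark j ∧ pA (j / q) ∧ pB (j % q)).card := by
  have : occurrences (gadget q β mark) (gadgetText q pA pB) = (fun j => (q + j % q + 1, j)) ''
      (((Finset.range (q * q)).filter fun j => mark j ∧ pA (j / q) ∧ pB (j % q) : Finset ℕ) :
        Set ℕ) := by
    ext o
    rw [mem_occurrences_gadget hq hβ]
    obtain ⟨i, j⟩ := o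
    simp only [Finset.coe_filter, Finset.mem_range, Set.mem_image, Set.mem_ofPred_eq,
      Prod.mk.injEq]
    constructor
    · rintro ⟨h1, h2, h3, h4, h5⟩; exact ⟨j, ⟨h1, h2, h3, h4⟩, h5.symm, rfl⟩
    · rintro ⟨j', ⟨h1, h2, h3, h4⟩, h5, rfl⟩; exact ⟨h1, h2, h3, h4, h5.symm⟩
  rw [outSize, this, Set.ncard_image_of_injective _ (fun a b h => (Prod.mk.inj h).2),
    Set.ncard_coe_finset]

/-- The last word of the encoding of a pattern. -/
def gapWord (β : Option ℕ) : ℕ := match β with | none => 0 | some b => b + 1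

/-- Blocks of constant length make the encoded dictionary addressable: word `t` of pattern `j`
stands at `k * j + t`. -/
theorem flatMap_range_getElem? {k : ℕ} (f : ℕ → List ℕ) (hf : ∀ j, (f j).length = k) (n : ℕ) :
    ((List.range n).flatMap f).length = k * n ∧ ∀ j < n, ∀ t < k,
      ((List.range n).flatMap f)[k * j + t]? = (f j)[t]? := by
  induction n with
  | zero => simp
  | succ n ih =>
    rw [List.range_succ, List.flatMap_append]
    simp only [List.flatMap_cons, List.flatMap_nil, List.append_nil]
    refine ⟨by rw [List.length_append, ih.1, hf]; ring, fun j hj t ht => ?_⟩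
    rcases Nat.lt_succ_iff_lt_or_eq.1 hj with h | rfl
    · rw [List.getElem?_append_left, ih.2 j h t ht]
      rw [ih.1]
      calc k * j + t < k * j + k := by omega
        _ = k * (j + 1) := by ring
        _ ≤ k * n := Nat.mul_le_mul_left _ h
    · rw [List.getElem?_append_right (by rw [ih.1]; omega), ih.1, Nat.add_sub_cancel_left]

theorem gadget_encode : (gadget q β mark).encode = (List.range (2 * (q * q))).flatMap fun j =>
    [1, 1, leftChar q mark j, 1, rightChar q mark j, 0, gapWord β] := by
  rw [Dictionary.encode, gadget, List.flatMap_map]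
  rfl

end Gadget

end DMOG

/-! ### Loop rules with early exit -/

namespace WordRAM

section Loops

variable {w : ℕ}

theorem Runs.loop_exit {x : ℕ} {c : Cmd} {s : State w} {Post : State w → Prop} (hx : s.regs x = 0)
    (hp : Post s) : Runs (.loop x c) s Post 1 := by
  intro f X hf
  refine (ert_loop_le _ _ _ _ _).trans ?_
  simp only [hx, ne_eq, not_true_eq_false, if_false]
  gcongr; exact hf s hp

theorem Runs.loop_step {x : ℕ} {c : Cmd} {s : State w} {P Post : State w → Prop} {B B' : ℝ≥0∞}
    (hx : s.regs x ≠ 0) (h : Runs c s P B) (h' : ∀ s', P s' → Runs (.loop x c) s' Post B') :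
    Runs (.loop x c) s Post (1 + B + B') := by
  intro f X hf
  refine (ert_loop_le _ _ _ _ _).trans ?_
  simp only [hx, ne_eq, not_false_eq_true, if_true]
  calc _ ≤ 1 + (B + (B' + X)) := by
        gcongr
        exact h _ _ fun s' hs' => h' s' hs' f X hf
    _ = _ := by ring

theorem ofNat_ne_zero {i : ℕ} (h : 0 < i) (hi : i < 2 ^ w) : BitVec.ofNat w i ≠ 0 := by
  intro e
  have := congrArg BitVec.toNat e
  simp [Nat.mod_eq_of_lt hi] at this
  omega

/-- A loop whose body decreases the counter `r`. -/
theorem Runs.downto {r n : ℕ} {body : Cmd} (Inv : ℕ → State w → Prop) (B : ℕ → ℝ≥0∞)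
    (hn : n < 2 ^ w) (hreg : ∀ i s, Inv i s → s.regs r = BitVec.ofNat w i)
    (hbody : ∀ i < n, ∀ s, Inv (i + 1) s → Runs body s (Inv i) (B i)) {s : State w}
    (hs : Inv n s) : Runs (.loop r body) s (Inv 0) (∑ i ∈ Finset.range n, (B i + 1) + 1) := by
  induction n generalizing s with
  | zero =>
    simp only [Finset.range_zero, Finset.sum_empty, zero_add]
    exact Runs.loop_exit (by rw [hreg 0 s hs]; rfl) hs
  | succ n ih =>
    have := Runs.loop_step (by rw [hreg _ s hs]; exact ofNat_ne_zero (by omega) hn)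
      (hbody n (by omega) s hs)
      (fun s' hs' => ih (by omega) (fun i hi => hbody i (by omega)) hs')
    refine this.mono (fun _ h => h) (le_of_eq ?_)
    rw [Finset.sum_range_succ]; ring

/-- Apart from the registers `R` and the flag `39`, nothing changes; the flag is raised if `d`. -/
structure Out (R : List ℕ) (d : Prop) (s s' : State w) : Prop where
  agree : Agree (39 :: R) s s'
  neg : ¬ d → s'.regs 39 = s.regs 39
  pos : d → s'.regs 39 = 1

theorem Out.agree_of_not {R : List ℕ} {d : Prop} {s s' : State w} (h : Out R d s s') (hd : ¬ d) :
    Agree R s s' :=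
  ⟨fun r hr => by
    by_cases h39 : r = 39
    · subst h39; exact h.neg hd
    · exact h.agree.regs r (by simp [h39, hr]), h.agree.mem, h.agree.input, h.agree.consumed,
      h.agree.out⟩

theorem Out.of_agree {R : List ℕ} {d : Prop} {s s' : State w} (h : Agree R s s') (h39 : 39 ∉ R)
    (hd : ¬ d) : Out R d s s' :=
  ⟨h.mono (by simp), fun _ => h.regs 39 h39, fun h => absurd h hd⟩

theorem Out.trans_left {R : List ℕ} {d : Prop} {s s' s'' : State w} (h : Agree R s s')
    (h39 : 39 ∉ R) (h' : Out R d s' s'') : Out R d s s'' :=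
  ⟨(h.mono (by simp)).trans h'.agree, fun hd => (h'.neg hd).trans (h.regs 39 h39), h'.pos⟩

theorem Out.trans_right {R : List ℕ} {d : Prop} {s s' s'' : State w} (h : Out R d s s')
    (h39 : 39 ∉ R) (h' : Agree R s' s'') : Out R d s s'' :=
  ⟨h.agree.trans (h'.mono (by simp)), fun hd => (h'.regs 39 h39).trans (h.neg hd),
    fun hd => (h'.regs 39 h39).trans (h.pos hd)⟩

theorem Out.mono {R R' : List ℕ} {d : Prop} {s s' : State w} (h : Out R d s s') (hR : R ⊆ R') :
    Out R' d s s' :=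
  ⟨h.agree.mono (by intro x hx; simp at hx ⊢; exact hx.imp id fun h => hR h), h.neg, h.pos⟩

theorem Out.congr {R : List ℕ} {d d' : Prop} {s s' : State w} (h : Out R d s s') (hd : d ↔ d') :
    Out R d' s s' := ⟨h.agree, fun h' => h.neg (mt hd.1 h'), fun h' => h.pos (hd.2 h')⟩

/-- Process the items of a list until the flag `39` is raised. -/
def forEach (p : ℕ) (body adv : Cmd) : Cmd :=
  .loop p (.seq body (.ite 39 (.const p 0) adv))

-- An item that raises the flag may cost the large amount `X`, but it ends the loop, so `X` is paid
-- once in total. `J` hands over what the body has established to the step that advances to the next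
-- item.
open Classical in
theorem Runs.forEach {p : ℕ} {R : List ℕ} {body adv : Cmd} {full : List ℕ}
    {enc : List ℕ → BitVec w} {d : ℕ → Prop} {B : ℕ → ℝ≥0∞} {X ka : ℝ≥0∞} {s₀ : State w}
    (J : ℕ → List ℕ → State w → Prop) (hw : w ≠ 0) (h0 : s₀.regs 39 = 0) (hp : p ∈ R)
    (h39 : 39 ∉ R) (henc0 : enc [] = 0) (henc : ∀ a l, (a :: l) <:+ full → enc (a :: l) ≠ 0)
    (hbody : ∀ a l, (a :: l) <:+ full → ∀ s, Agree R s₀ s → s.regs p = enc (a :: l) →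
      Runs body s (fun s' => Out R (d a) s s' ∧ J a l s') (B a + if d a then X else 0))
    (hadv : ∀ a l, (a :: l) <:+ full → ∀ s, Agree R s₀ s → J a l s →
      Runs adv s (fun s' => Agree R s s' ∧ s'.regs p = enc l) ka) :
    ∀ s, Agree R s₀ s → s.regs p = enc full → Runs (forEach p body adv) s
      (Out R (∃ a ∈ full, d a) s₀)
      ((full.map fun a => B a + if d a then 0 else ka + 5).sum + 1 +
        if ∃ a ∈ full, d a then X + 5 else 0) := by
  have key : ∀ l, l <:+ full → ∀ s, Agree R s₀ s → s.regs p = enc l →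
      Runs (WordRAM.forEach p body adv) s (Out R (∃ a ∈ l, d a) s₀)
      ((l.map fun a => B a + if d a then 0 else ka + 5).sum + 1 +
        if ∃ a ∈ l, d a then X + 5 else 0) := by
    intro l
    induction l with
    | nil =>
      intro _ s hs hps
      refine (Runs.loop_exit (by rw [hps, henc0]) (Out.of_agree hs h39 (by simp))).mono
        (fun _ h => h) (by simp)
    | cons a l ih =>
      intro hsuf s hs hps
      have hsuf' : l <:+ full := (List.suffix_cons a l).trans hsuf
      by_cases hd : d a
      · have hex : ∃ b ∈ a :: l, d b := ⟨a, by simp, hd⟩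
        have hb := hbody a l hsuf s hs hps
        rw [if_pos hd] at hb
        have h1 : Runs (.seq body (.ite 39 (.const p 0) adv)) s
            (fun s' => Out R (∃ b ∈ a :: l, d b) s₀ s' ∧ s'.regs p = 0) (1 + (B a + X) + 2) := by
          refine hb.seq fun s' hs' => ?_
          have h2 : Runs (.const p 0) s'
              (fun s' => Out R (∃ b ∈ a :: l, d b) s₀ s' ∧ s'.regs p = 0) 1 :=
            Runs.straight rfl ⟨(Out.trans_left hs h39 (hs'.1.congr (iff_of_true hd hex))).trans_right
              h39 ((Agree.refl R s').set hp _), by simp [det]⟩ (by simp [Cmd.time])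
          refine (Runs.ite (fun _ => h2) (fun h => ?_)).mono (fun _ h => h) (by norm_num)
          rw [hs'.1.pos hd] at h; exact absurd h (one_ne_zero_word hw)
        refine (Runs.loop_step (by rw [hps]; exact henc a l hsuf) h1 (fun s' hs' =>
          Runs.loop_exit hs'.2 hs'.1)).mono (fun _ h => h) ?_
        rw [if_pos hex, List.map_cons, List.sum_cons, if_pos hd, add_zero]
        calc 1 + (1 + (B a + X) + 2) + 1 = B a + 0 + 0 + (X + 5) := by ring
          _ ≤ _ := by gcongr <;> exact zero_le
      · have hb := hbody a l hsuf s hs hps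
        rw [if_neg hd, add_zero] at hb
        have h1 : Runs (.seq body (.ite 39 (.const p 0) adv)) s
            (fun s' => Agree R s₀ s' ∧ s'.regs p = enc l) (1 + B a + (1 + ka)) := by
          refine hb.seq fun s' hs' => ?_
          have hag := hs.trans (hs'.1.agree_of_not hd)
          refine Runs.ite (fun h => ?_) (fun _ => ?_)
          · exact absurd ((hag.regs 39 h39).trans h0) h
          · exact (hadv a l hsuf s' hag hs'.2).mono (fun s'' h => ⟨hag.trans h.1, h.2⟩) le_rfl
        have hiff : (∃ b ∈ a :: l, d b) ↔ ∃ b ∈ l, d b := by simp [hd]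
        refine (Runs.loop_step (by rw [hps]; exact henc a l hsuf) h1 (fun s' hs' =>
          ih hsuf' s' hs'.1 hs'.2)).mono (fun _ h => h.congr hiff.symm) ?_
        simp only [hiff, List.map_cons, List.sum_cons]
        calc 1 + (1 + B a + (1 + ka)) + ((l.map fun a => B a + if d a then 0 else ka + 5).sum + 1 +
              if ∃ a ∈ l, d a then X + 5 else 0)
            = (B a + (ka + 3) + (l.map fun a => B a + if d a then 0 else ka + 5).sum + 1 +
              if ∃ a ∈ l, d a then X + 5 else 0) := by ring
          _ ≤ _ := by rw [if_neg hd]; gcongr; norm_num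
  exact key full List.suffix_rfl

end Loops

/-! ## The instance data -/

/-- The parameters of the reduction: `n` numbers `X i`, the hash multiplier `a`, tables of size
`2 ^ (2 σ)`, the word size `wA` of the simulated machine. -/
structure Env (w : ℕ) where
  wA : ℕ
  σ : ℕ
  n : ℕ
  X : ℕ → ℕ
  a : ℕ
  β : Option ℕ
  hw : wA + 8 ≤ w
  hσ : 2 * σ + 3 ≤ wA
  σ_pos : 1 ≤ σ
  hn : n ≤ 2 ^ (2 * σ)
  hX : ∀ i, X i < 2 ^ w
  hβ : β = none ∨ β = some (2 * 2 ^ σ)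

namespace Env

variable {w : ℕ} (E : Env w)

def q : ℕ := 2 ^ E.σ
def Q : ℕ := 2 ^ (2 * E.σ)
/-- The offset of the numbers makes the sum of a zero triple equal to `T`. -/
def T (_E : Env w) : ℕ := 3 * 2 ^ (w - 1)
def H (i : ℕ) : ℕ := mulHash w (2 * E.σ) E.a (E.X i)
def t0 : ℕ := hashBase w (2 * E.σ) E.a E.T

theorem Q_eq : E.Q = E.q * E.q := by rw [Q, q, ← pow_add]; congr 1; ring
theorem two_le_q : 2 ≤ E.q := by
  calc 2 = 2 ^ 1 := rfl
    _ ≤ 2 ^ E.σ := Nat.pow_le_pow_right (by norm_num) E.σ_pos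
theorem H_lt (i : ℕ) : E.H i < E.Q :=
  mulHash_lt (by have := E.hσ; have := E.hw; omega) _ _
theorem Q_pos : 0 < E.Q := by unfold Q; positivity
theorem eight_Q_le : 8 * E.Q ≤ 2 ^ E.wA := by
  calc 8 * E.Q = 2 ^ (2 * E.σ + 3) := by rw [Q, pow_add]; ring
    _ ≤ _ := Nat.pow_le_pow_right (by norm_num) E.hσ
theorem region_eq : 2 ^ (E.wA + 4) = 16 * 2 ^ E.wA := by rw [pow_add]; ring
theorem word_ge : 256 * 2 ^ E.wA ≤ 2 ^ w := by
  calc 256 * 2 ^ E.wA = 2 ^ (E.wA + 8) := by rw [pow_add]; ring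
    _ ≤ _ := Nat.pow_le_pow_right (by norm_num) E.hw
theorem n_le : E.n ≤ E.Q := E.hn
theorem w_ne_zero (E : Env w) : w ≠ 0 := by have := E.hw; omega

/-- The positions below `i` with hash value `h`, in decreasing order. -/
def chain (h : ℕ) : ℕ → List ℕ
  | 0 => []
  | i + 1 => if E.H i = h then i :: chain h i else chain h i

theorem mem_chain {h i j : ℕ} : j ∈ E.chain h i ↔ j < i ∧ E.H j = h := by
  induction i with
  | zero => simp [chain]
  | succ i ih =>
    rw [chain]
    split_ifs with hi
    · rw [List.mem_cons, ih]
      constructor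
      · rintro (rfl | h)
        · exact ⟨by omega, hi⟩
        · exact ⟨by omega, h.2⟩
      · rintro ⟨h1, h2⟩
        rcases Nat.lt_succ_iff_lt_or_eq.1 h1 with h | h
        · exact Or.inr ⟨h, h2⟩
        · exact Or.inl h
    · rw [ih]
      refine ⟨fun h => ⟨by omega, h.2⟩, fun h => ⟨?_, h.2⟩⟩
      rcases Nat.lt_succ_iff_lt_or_eq.1 h.1 with h' | h'
      · exact h'
      · exact absurd (h' ▸ h.2) hi

/-- What follows `j` in a chain depends on `j` alone. This is why one pointer per position stores
all chains. -/
theorem chain_suffix {h i j : ℕ} {l : List ℕ} (hs : (j :: l) <:+ E.chain h i) :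
    j < i ∧ E.H j = h ∧ l = E.chain h j := by
  induction i with
  | zero => simp [chain] at hs
  | succ i ih =>
    rw [chain] at hs
    split_ifs at hs with hi
    · rcases List.suffix_cons_iff.1 hs with h1 | h1
      · rw [List.cons.injEq] at h1
        obtain ⟨rfl, rfl⟩ := h1
        exact ⟨by omega, hi, rfl⟩
      · have := ih h1; exact ⟨by omega, this.2⟩
    · have := ih hs; exact ⟨by omega, this.2⟩

theorem sum_chain (h i : ℕ) (B : ℕ → ℝ≥0∞) : ((E.chain h i).map B).sum =
    ∑ j ∈ Finset.range i, if E.H j = h then B j else 0 := by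
  induction i with
  | zero => simp [chain]
  | succ i ih =>
    rw [chain, Finset.sum_range_succ, ← ih]
    split_ifs
    · rw [List.map_cons, List.sum_cons, add_comm]
    · rw [add_zero]

/-- The representation of a chain in memory. -/
def enc (w : ℕ) : List ℕ → BitVec w
  | [] => 0
  -- The shift by one keeps `0` free as the end mark.
  | j :: _ => BitVec.ofNat w (j + 1)

/-- The constants in the registers. -/
structure Consts (s : State w) : Prop where
  r0 : s.regs 0 = BitVec.ofNat w 1
  r1 : s.regs 1 = BitVec.ofNat w E.n
  r2 : s.regs 2 = BitVec.ofNat w E.q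
  r3 : s.regs 3 = BitVec.ofNat w E.Q
  r4 : s.regs 4 = BitVec.ofNat w (E.Q - 1)
  r5 : s.regs 5 = BitVec.ofNat w (2 ^ E.wA - 1)
  r6 : s.regs 6 = BitVec.ofNat w E.wA
  r7 : s.regs 7 = addr w E.wA 1 0
  r8 : s.regs 8 = addr w E.wA 3 0
  r9 : s.regs 9 = addr w E.wA 4 0
  r10 : s.regs 10 = addr w E.wA 5 0
  r11 : s.regs 11 = addr w E.wA 6 0
  r12 : s.regs 12 = addr w E.wA 7 0
  r13 : s.regs 13 = addr w E.wA 8 0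
  r14 : s.regs 14 = addr w E.wA 2 0
  r15 : s.regs 15 = BitVec.ofNat w (3 * 2 ^ (w - 3))
  r16 : s.regs 16 = BitVec.ofNat w E.t0
  r17 : s.regs 17 = BitVec.ofNat w E.a
  r18 : s.regs 18 = BitVec.ofNat w (4 * E.a + 1)
  r19 : s.regs 19 = BitVec.ofNat w (w - 2 * E.σ)
  r20 : s.regs 20 = BitVec.ofNat w (DMOG.gapWord E.β)
  r21 : s.regs 21 = BitVec.ofNat w (6 * E.q)
  r22 : s.regs 22 = BitVec.ofNat w 3
  r23 : s.regs 23 = BitVec.ofNat w 2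

theorem Consts.congr {E : Env w} {s s' : State w} (h : E.Consts s)
    (hr : ∀ r < 32, s'.regs r = s.regs r) : E.Consts s' := by
  obtain ⟨⟩ := h
  constructor <;> rw [hr _ (by norm_num)] <;> assumption

/-- The tables in memory. -/
structure Tables (s : State w) : Prop where
  hi : ∀ i < E.n, s.mem (addr w E.wA 0 (2 * i)) = BitVec.ofNat w (E.X i / 4)
  lo : ∀ i < E.n, s.mem (addr w E.wA 0 (2 * i + 1)) = BitVec.ofNat w (E.X i % 4)
  head : ∀ h < E.Q, s.mem (addr w E.wA 7 h) = enc w (E.chain h E.n)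
  next : ∀ i < E.n, s.mem (addr w E.wA 8 i) = enc w (E.chain (E.H i) i)

theorem Tables.congr {E : Env w} {s s' : State w} (h : E.Tables s)
    (hm : ∀ j ∈ [0, 7, 8], ∀ v < 2 ^ (E.wA + 4),
      s'.mem (addr w E.wA j v) = s.mem (addr w E.wA j v)) : E.Tables s' := by
  have h1 := E.n_le
  have h2 := E.eight_Q_le
  have h3 := E.region_eq
  refine ⟨fun i hi => ?_, fun i hi => ?_, fun i hi => ?_, fun i hi => ?_⟩
  · rw [hm 0 (by simp) _ (by omega)]; exact h.hi i hi
  · rw [hm 0 (by simp) _ (by omega)]; exact h.lo i hi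
  · rw [hm 7 (by simp) _ (by omega)]; exact h.head i hi
  · rw [hm 8 (by simp) _ (by omega)]; exact h.next i hi

/-- Constants and tables. -/
structure Static (s : State w) : Prop where
  consts : E.Consts s
  tables : E.Tables s

theorem Static.agree {E : Env w} {R : List ℕ} {s s' : State w} (h : E.Static s)
    (ha : Agree R s s') (hR : ∀ r ∈ R, 32 ≤ r) : E.Static s' :=
  ⟨h.consts.congr fun r hr => ha.regs r fun hr' => by have := hR r hr'; omega,
    h.tables.congr fun j _ v _ => by rw [ha.mem]⟩

open Classical in
/-- The loop over the positions with a given hash value. -/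
theorem runs_chain {E : Env w} {p j h : ℕ} {R : List ℕ} {body : Cmd} {d : ℕ → Prop}
    {B : ℕ → ℝ≥0∞} {X : ℝ≥0∞} {s₀ : State w} (hst : E.Static s₀) (h0 : s₀.regs 39 = 0)
    (hR : ∀ r ∈ R, 32 ≤ r) (h39 : 39 ∉ R) (hp : p ∈ R) (h51 : 51 ∈ R)
    (hbody : ∀ a < E.n, E.H a = h → ∀ s, Agree R s₀ s → s.regs p = BitVec.ofNat w (a + 1) →
      Runs body s (fun s' => Out R (d a) s s' ∧ s'.regs j = BitVec.ofNat w a)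
        (B a + if d a then X else 0))
    {s : State w} (hs : Agree R s₀ s) (hps : s.regs p = enc w (E.chain h E.n)) :
    Runs (forEach p body (.seq (.op .add 51 13 j) (.load p 51))) s
      (Out R (∃ a < E.n, E.H a = h ∧ d a) s₀)
      ((∑ a ∈ Finset.range E.n, if E.H a = h then B a + (if d a then 0 else 8) else 0) + 1 +
        if ∃ a < E.n, E.H a = h ∧ d a then X + 5 else 0) := by
  have hn := E.n_le
  have hQ := E.eight_Q_le
  have hwd := E.word_ge
  have hiff : (∃ a ∈ E.chain h E.n, d a) ↔ ∃ a < E.n, E.H a = h ∧ d a := by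
    simp only [mem_chain, and_assoc]
  refine (Runs.forEach (B := B) (X := X) (d := d) (ka := 3)
    (fun a l s => s.regs j = BitVec.ofNat w a) E.w_ne_zero h0 hp h39 rfl
    (fun a l hsuf => ?_) (fun a l hsuf s hs hps => ?_) (fun a l hsuf s hs hJ => ?_) s hs hps).mono
    (fun s' hs' => hs'.congr hiff) ?_
  · exact ofNat_ne_zero (by omega) (by have := (E.chain_suffix hsuf).1; omega)
  · obtain ⟨h1, h2, _⟩ := E.chain_suffix hsuf
    exact hbody a h1 h2 s hs hps
  · obtain ⟨h1, h2, rfl⟩ := E.chain_suffix hsuf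
    have hst' := hst.agree hs hR
    refine Runs.straight rfl ⟨(((Agree.refl R s).set h51 _).set hp _), ?_⟩ (by norm_num [Cmd.time])
    simp only [det, State.set_regs, Function.update_self, BinOp.eval, State.set_mem, hJ,
      hst'.consts.r13, addr_add, zero_add]
    rw [hst'.tables.next a h1, h2]
  · rw [sum_chain]
    simp only [hiff]
    gcongr
    norm_num

end Env

end WordRAM

/-! ### Word arithmetic and the exact test of a triple -/

namespace WordRAM

section Arith

variable {w : ℕ}

theorem add_ofNat (a b : ℕ) : BitVec.ofNat w a + BitVec.ofNat w b = BitVec.ofNat w (a + b) :=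
  (BitVec.ofNat_add a b).symm

theorem mul_ofNat (a b : ℕ) : BitVec.ofNat w a * BitVec.ofNat w b = BitVec.ofNat w (a * b) := by
  apply BitVec.eq_of_toNat_eq; simp

theorem sub_ofNat {a b : ℕ} (h : b ≤ a) :
    BitVec.ofNat w a - BitVec.ofNat w b = BitVec.ofNat w (a - b) := by
  rw [sub_eq_iff_eq_add, add_ofNat, Nat.sub_add_cancel h]

theorem toNat_ofNat_lt {a : ℕ} (ha : a < 2 ^ w) : (BitVec.ofNat w a).toNat = a := by
  rw [BitVec.toNat_ofNat, Nat.mod_eq_of_lt ha]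

theorem div_ofNat {a b : ℕ} (ha : a < 2 ^ w) (hb : b < 2 ^ w) :
    BitVec.ofNat w a / BitVec.ofNat w b = BitVec.ofNat w (a / b) := by
  apply BitVec.eq_of_toNat_eq
  rw [BitVec.toNat_udiv, toNat_ofNat_lt ha, toNat_ofNat_lt hb,
    toNat_ofNat_lt ((Nat.div_le_self _ _).trans_lt ha)]

theorem mod_ofNat {a b : ℕ} (ha : a < 2 ^ w) (hb : b < 2 ^ w) :
    BitVec.ofNat w a % BitVec.ofNat w b = BitVec.ofNat w (a % b) := by
  apply BitVec.eq_of_toNat_eq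
  rw [BitVec.toNat_umod, toNat_ofNat_lt ha, toNat_ofNat_lt hb,
    toNat_ofNat_lt ((Nat.mod_le _ _).trans_lt ha)]

theorem and_ofNat {k : ℕ} (hk : k ≤ w) (a : ℕ) :
    BitVec.ofNat w a &&& BitVec.ofNat w (2 ^ k - 1) = BitVec.ofNat w (a % 2 ^ k) := by
  rw [and_mask hk, BitVec.toNat_ofNat, Nat.mod_mod_of_dvd _ (pow_dvd_pow 2 hk)]

theorem shr_ofNat {a k : ℕ} (ha : a < 2 ^ w) (hk : k < 2 ^ w) :
    BitVec.ofNat w a >>> BitVec.ofNat w k = BitVec.ofNat w (a / 2 ^ k) := by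
  apply BitVec.eq_of_toNat_eq
  rw [BitVec.ushiftRight_eq', BitVec.toNat_ushiftRight, toNat_ofNat_lt ha, toNat_ofNat_lt hk,
    toNat_ofNat_lt ((Nat.div_le_self _ _).trans_lt ha), Nat.shiftRight_eq_div_pow]

theorem shl_ofNat {k : ℕ} (a : ℕ) (hk : k < 2 ^ w) :
    BitVec.ofNat w a <<< BitVec.ofNat w k = BitVec.ofNat w (a * 2 ^ k) := by
  apply BitVec.eq_of_toNat_eq
  rw [BitVec.shiftLeft_eq', BitVec.toNat_shiftLeft, toNat_ofNat_lt hk, BitVec.toNat_ofNat,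
    BitVec.toNat_ofNat, Nat.shiftLeft_eq]
  simp

theorem ofNat_inj {a b : ℕ} (ha : a < 2 ^ w) (hb : b < 2 ^ w) :
    BitVec.ofNat w a = BitVec.ofNat w b ↔ a = b := by
  refine ⟨fun h => ?_, fun h => by rw [h]⟩
  have := congrArg BitVec.toNat h
  rwa [toNat_ofNat_lt ha, toNat_ofNat_lt hb] at this

theorem ofNat_eq_zero {a : ℕ} (ha : a < 2 ^ w) : BitVec.ofNat w a = 0 ↔ a = 0 :=
  ofNat_inj (b := 0) ha (by positivity)

end Arith

namespace Env

variable {w : ℕ} (E : Env w)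

theorem and_Q (a : ℕ) :
    BitVec.ofNat w a &&& BitVec.ofNat w (E.Q - 1) = BitVec.ofNat w (a % E.Q) :=
  and_ofNat (by have := E.hw; have := E.hσ; omega) a

/-- The position `c` completes `a`, `b` to a zero triple. -/
def Good (a b c : ℕ) : Prop := E.X a + E.X b + E.X c = E.T ∧ c ≠ a ∧ c ≠ b

/-- The hash value of the third position. -/
def τ (e z : ℕ) : ℕ := (E.t0 + e + E.Q - z) % E.Q

theorem τ_lt (e z : ℕ) : E.τ e z < E.Q := Nat.mod_lt _ E.Q_pos

/-- Test whether position `50` completes the positions `46`, `48`. -/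
def testC : Cmd :=
  .seq (block [.op .add 51 50 50, .load 52 51, .op .add 51 51 0, .load 53 51, .op .add 52 52 60,
    .op .add 52 52 62, .op .add 53 53 61, .op .add 53 53 63, .op .and 54 53 22, .op .shr 53 53 23,
    .op .add 52 52 53, .op .eq 52 52 15])
  (.ite 54 .skip (.ite 52 (.seq (.op .eq 54 50 46) (.ite 54 .skip
    (.seq (.op .eq 54 50 48) (.ite 54 .skip (.const 39 1))))) .skip))

/-- The registers hold the number at position `a`. -/
def Holds (a r r₁ r₂ : ℕ) (s : State w) : Prop :=
  s.regs r = BitVec.ofNat w a ∧ s.regs r₁ = BitVec.ofNat w (E.X a / 4) ∧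
    s.regs r₂ = BitVec.ofNat w (E.X a % 4)

theorem Holds.agree {E : Env w} {a r r₁ r₂ : ℕ} {s s' : State w} {R : List ℕ}
    (h : E.Holds a r r₁ r₂ s) (ha : Agree R s s') (h0 : r ∉ R) (h1 : r₁ ∉ R) (h2 : r₂ ∉ R) :
    E.Holds a r r₁ r₂ s' := by
  rw [Holds, ha.regs _ h0, ha.regs _ h1, ha.regs _ h2]; exact h

theorem addr_zero (wA v : ℕ) : addr w wA 0 v = BitVec.ofNat w v := by simp [addr]

/-- A sum of three words may overflow. Since `4` divides `T`, the test can be made on the two lowest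
bits and, with the carry, on the quotients by `4`, whose sum fits in a word. -/
theorem sum_eq_T_iff {a b c : ℕ} : E.X a + E.X b + E.X c = E.T ↔
    (E.X c % 4 + E.X a % 4 + E.X b % 4) % 4 = 0 ∧
    E.X c / 4 + E.X a / 4 + E.X b / 4 + (E.X c % 4 + E.X a % 4 + E.X b % 4) / 4 =
      3 * 2 ^ (w - 3) := by
  have : E.T = 4 * (3 * 2 ^ (w - 3)) := by
    have h8 := E.hw
    rw [T, show w - 1 = 2 + (w - 3) by omega, pow_add]; ring
  omega

theorem runs_testC {s : State w} (hst : E.Static s) {a b c : ℕ} (hc : c < E.n)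
    (ha : E.Holds a 46 60 61 s) (hb : E.Holds b 48 62 63 s) (han : a < E.n) (hbn : b < E.n)
    (h50 : s.regs 50 = BitVec.ofNat w c) :
    Runs testC s (Out [51, 52, 53, 54] (E.Good a b c) s) 40 := by
  have hw8 := E.hw
  have hn := E.n_le
  have hQ := E.eight_Q_le
  have hwd := E.word_ge
  have hw0 := E.w_ne_zero
  have hP : 2 ^ w = 8 * 2 ^ (w - 3) := by
    rw [show (8 : ℕ) = 2 ^ 3 from rfl, ← pow_add]; congr 1; omega
  have hXa := E.hX a
  have hXb := E.hX b
  have hXc := E.hX c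
  obtain ⟨ha1, ha2, ha3⟩ := ha
  obtain ⟨hb1, hb2, hb3⟩ := hb
  have d1 := hst.tables.hi c hc
  have d2 := hst.tables.lo c hc
  rw [addr_zero, two_mul] at d1 d2
  set r := E.X c % 4 + E.X a % 4 + E.X b % 4 with hr
  set S := E.X c / 4 + E.X a / 4 + E.X b / 4 + r / 4 with hS
  have hand : BitVec.ofNat w r &&& 3#w = BitVec.ofNat w (r % 4) :=
    and_ofNat (k := 2) (by omega) r
  have hshr : BitVec.ofNat w r >>> 2#w = BitVec.ofNat w (r / 4) :=
    shr_ofNat (k := 2) (by omega) (by omega)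
  have hsum := E.sum_eq_T_iff (a := a) (b := b) (c := c)
  rw [← hr, ← hS] at hsum
  have hfirst : Runs (block [.op .add 51 50 50, .load 52 51, .op .add 51 51 0, .load 53 51,
      .op .add 52 52 60, .op .add 52 52 62, .op .add 53 53 61, .op .add 53 53 63,
      .op .and 54 53 22, .op .shr 53 53 23, .op .add 52 52 53, .op .eq 52 52 15]) s
      (fun s' => Agree [51, 52, 53, 54] s s' ∧ s'.regs 54 = BitVec.ofNat w (r % 4) ∧
        s'.regs 52 = if S = 3 * 2 ^ (w - 3) then 1 else 0) 23 := by
    refine Runs.straight rfl ⟨?_, ?_, ?_⟩ (by norm_num [block, Cmd.time])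
    · simp only [block, det]
      repeat refine Agree.set ?_ (by simp) _
      exact Agree.refl _ _
    · simp only [block, det, BinOp.eval, State.set_regs, State.set_mem, Function.update_apply,
        Nat.reduceEqDiff, reduceIte, h50, add_ofNat, d1, d2, hst.consts.r0, hst.consts.r22,
        ha2, ha3, hb2, hb3, ← hr, hand, OfNat.zero_ne_ofNat]
    · simp only [block, det, BinOp.eval, State.set_regs, State.set_mem, Function.update_apply,
        Nat.reduceEqDiff, reduceIte, h50, add_ofNat, d1, d2, hst.consts.r0, hst.consts.r23,
        ha2, ha3, hb2, hb3, ← hr, hshr, ← hS, hst.consts.r15, OfNat.zero_ne_ofNat]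
      simp only [ofNat_inj (w := w) (a := S) (b := 3 * 2 ^ (w - 3)) (by omega) (by omega)]
  have hskip : ∀ s', Agree [51, 52, 53, 54] s s' → ¬ E.Good a b c →
      Runs .skip s' (Out [51, 52, 53, 54] (E.Good a b c) s) 1 := fun s' hs' hg =>
    Runs.straight rfl (Out.of_agree hs' (by simp) hg) (by simp [Cmd.time])
  refine (hfirst.seq (B₂ := 16) fun s' ⟨h1, h2, h3⟩ => ?_).mono (fun _ h => h) (by norm_num)
  have e50 : s'.regs 50 = BitVec.ofNat w c := (h1.regs 50 (by simp)).trans h50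
  have e46 : s'.regs 46 = BitVec.ofNat w a := (h1.regs 46 (by simp)).trans ha1
  have e48 : s'.regs 48 = BitVec.ofNat w b := (h1.regs 48 (by simp)).trans hb1
  have hr4 : BitVec.ofNat w (r % 4) = 0 ↔ r % 4 = 0 := ofNat_eq_zero (by omega)
  have hfl : ∀ (P : Prop) [Decidable P], (if P then (1 : BitVec w) else 0) = 0 ↔ ¬ P :=
    fun P _ => not_iff_not.1 ((flag_ne_zero hw0 P).trans not_not.symm)
  refine (Runs.ite (B := 12) (fun h => ?_) (fun h => ?_)).mono (fun _ h => h) (by norm_num)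
  · refine (hskip s' h1 fun hg => ?_).mono (fun _ h => h) (by norm_num)
    rw [h2, ne_eq, hr4] at h
    exact h (hsum.1 hg.1).1
  rw [h2, hr4] at h
  refine (Runs.ite (B := 11) (fun h' => ?_) (fun h' => ?_)).mono (fun _ h => h) (by norm_num)
  swap
  · refine (hskip s' h1 fun hg => ?_).mono (fun _ h => h) (by norm_num)
    rw [h3, hfl] at h'
    exact h' (hsum.1 hg.1).2
  rw [h3, ne_eq, hfl, not_not] at h'
  have hT := hsum.2 ⟨h, h'⟩
  have hq : Runs (.op .eq 54 50 46) s' (fun s'' => Agree [51, 52, 53, 54] s s'' ∧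
      s''.regs 54 = if c = a then 1 else 0) 1 := by
    refine Runs.straight rfl ⟨h1.set (by simp) _, ?_⟩ (by simp [Cmd.time])
    simp only [det, State.set_regs, Function.update_self, BinOp.eval, e50, e46,
      ofNat_inj (w := w) (a := c) (b := a) (by omega) (by omega)]
  refine (hq.seq (B₂ := 9) fun s₂ ⟨g1, g2⟩ => ?_).mono (fun _ h => h) (by norm_num)
  refine (Runs.ite (B := 8) (fun h' => ?_) (fun h' => ?_)).mono (fun _ h => h) (by norm_num)
  · refine (hskip s₂ g1 fun hg => ?_).mono (fun _ h => h) (by norm_num)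
    rw [g2, ne_eq, hfl, not_not] at h'
    exact hg.2.1 h'
  rw [g2, hfl] at h'
  have hq' : Runs (.op .eq 54 50 48) s₂ (fun s'' => Agree [51, 52, 53, 54] s s'' ∧
      s''.regs 54 = if c = b then 1 else 0) 1 := by
    refine Runs.straight rfl ⟨g1.set (by simp) _, ?_⟩ (by simp [Cmd.time])
    simp only [det, State.set_regs, Function.update_self, BinOp.eval, g1.regs 50 (by simp), h50,
      g1.regs 48 (by simp), hb1, ofNat_inj (w := w) (a := c) (b := b) (by omega) (by omega)]
  refine (hq'.seq (B₂ := 6) fun s₃ ⟨k1, k2⟩ => ?_).mono (fun _ h => h) (by norm_num)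
  refine (Runs.ite (B := 5) (fun h'' => ?_) (fun h'' => ?_)).mono (fun _ h => h) (by norm_num)
  · refine (hskip s₃ k1 fun hg => ?_).mono (fun _ h => h) (by norm_num)
    rw [k2, ne_eq, hfl, not_not] at h''
    exact hg.2.2 h''
  rw [k2, hfl] at h''
  refine Runs.straight rfl ⟨?_, fun hg => absurd ⟨hT, h', h''⟩ hg, fun _ => ?_⟩
    (by norm_num [Cmd.time])
  · exact (k1.mono (by simp)).set (by simp) _
  · simp [det]

end Env

end WordRAM

/-! ### Searching the buckets of a reported pair -/

namespace WordRAM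

namespace Env

variable {w : ℕ} (E : Env w)

/-- The positions `a`, `b` belong to a zero triple. -/
def Dirty (a b : ℕ) : Prop := a ≠ b ∧ ∃ c < E.n, E.Good a b c

theorem eq_sub_mod {Q z c m : ℕ} (hz : z < Q) (hc : c < Q) :
    (z + c) % Q = m % Q ↔ c = (m + Q - z) % Q := by
  have h1 : z + (m + Q - z) = m + Q := by omega
  have h2 : (z + (m + Q - z)) % Q = m % Q := by rw [h1, Nat.add_mod_right]
  rw [← h2]
  constructor
  · intro h
    have := Nat.ModEq.add_left_cancel' (n := Q) z h
    rwa [Nat.ModEq, Nat.mod_eq_of_lt hc] at this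
  · intro h
    rw [Nat.add_mod z (m + Q - z), ← h, Nat.add_mod z c, Nat.mod_eq_of_lt hc]

/-- Once the hash sum `z` of two positions is known, the matching third positions fill exactly three
buckets. The search visits these buckets, and `z` is marked when one of them is nonempty. -/
theorem hashMatch_iff {a b c z : ℕ} (hz : (E.H a + E.H b) % E.Q = z) :
    HashMatch w (2 * E.σ) E.a E.T (E.X a) (E.X b) (E.X c) ↔ ∃ e < 3, E.H c = E.τ e z := by
  refine exists_congr fun e => and_congr_right fun _ => ?_
  rw [τ, ← eq_sub_mod (hz ▸ Nat.mod_lt _ E.Q_pos) (E.H_lt c), ← hz, Nat.mod_add_mod]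
  rfl

theorem good_match {a b c z : ℕ} (hz : (E.H a + E.H b) % E.Q = z) (h : E.Good a b c) :
    ∃ e < 3, E.H c = E.τ e z :=
  (E.hashMatch_iff hz).1 (hashMatch_of_sum (by have := E.hw; have := E.hσ; omega)
    (by have := E.σ_pos; omega) _ h.1)

/-- The cost of visiting the candidates for the third position. -/
noncomputable def costC (e z : ℕ) : ℝ≥0∞ :=
  ∑ c ∈ Finset.range E.n, if E.H c = E.τ e z then 50 else 0

def bodyC : Cmd := .seq (.op .sub 50 49 0) testC

def chainC (e : ℕ) : Cmd :=
  .seq (block [.const 51 e, .op .add 51 16 51, .op .add 51 51 3, .op .sub 51 51 42,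
    .op .and 51 51 4, .op .add 51 12 51, .load 49 51])
  (forEach 49 bodyC (.seq (.op .add 51 13 50) (.load 49 51)))

open Classical in
theorem runs_chainC {s : State w} (hst : E.Static s) {a b z e : ℕ} (he : e < 3)
    (ha : E.Holds a 46 60 61 s) (hb : E.Holds b 48 62 63 s) (han : a < E.n) (hbn : b < E.n)
    (hz : s.regs 42 = BitVec.ofNat w z) (hzQ : z < E.Q) (h39 : s.regs 39 = 0) :
    Runs (chainC e) s (Out [49, 50, 51, 52, 53, 54]
      (∃ c < E.n, E.H c = E.τ e z ∧ E.Good a b c) s) (25 + E.costC e z) := by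
  have hfirst : Runs (block [.const 51 e, .op .add 51 16 51, .op .add 51 51 3, .op .sub 51 51 42,
      .op .and 51 51 4, .op .add 51 12 51, .load 49 51]) s
      (fun s' => Agree [49, 50, 51, 52, 53, 54] s s' ∧
        s'.regs 49 = enc w (E.chain (E.τ e z) E.n)) 13 := by
    refine Runs.straight rfl ⟨?_, ?_⟩ (by norm_num [block, Cmd.time])
    · simp only [block, det]
      repeat refine Agree.set ?_ (by simp) _
      exact Agree.refl _ _
    · simp only [block, det, BinOp.eval, State.set_regs, State.set_mem, Function.update_apply,
        Nat.reduceEqDiff, reduceIte, hst.consts.r3, hst.consts.r4, hst.consts.r12, hst.consts.r16,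
        hz, add_ofNat]
      rw [sub_ofNat (by omega), and_Q, addr_add, zero_add, ← hst.tables.head _ (E.τ_lt e z)]
      rfl
  refine (hfirst.seq fun s₁ ⟨hs₁, h49⟩ => E.runs_chain (j := 50) (h := E.τ e z)
    (d := fun c => E.Good a b c) (B := fun _ => 42) (X := 0) hst h39 (by simp) (by simp)
    (by simp) (by simp) (fun c hc hH s₂ hs₂ hps => ?_) hs₁ h49).mono (fun _ h => h) ?_
  · have hsub : Runs (.op .sub 50 49 0) s₂ (fun s' => Agree [50] s₂ s' ∧
        s'.regs 50 = BitVec.ofNat w c) 1 := by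
      refine Runs.straight rfl ⟨(Agree.refl _ _).set (by simp) _, ?_⟩ (by simp [Cmd.time])
      simp only [det, State.set_regs, Function.update_self, BinOp.eval, hps,
        hs₂.regs 0 (by simp), hst.consts.r0]
      rw [sub_ofNat (by omega), Nat.add_sub_cancel]
    refine (hsub.seq fun s₃ ⟨hs₃, h50⟩ => ((E.runs_testC (a := a) (b := b)
      ((hst.agree hs₂ (by simp)).agree hs₃ (by simp)) hc
      ((ha.agree hs₂ (by simp) (by simp) (by simp)).agree hs₃ (by simp) (by simp) (by simp))
      ((hb.agree hs₂ (by simp) (by simp) (by simp)).agree hs₃ (by simp) (by simp) (by simp))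
      han hbn h50).mono (fun s' hs' => And.intro
        (Out.trans_left (hs₃.mono (by simp)) (by simp) (hs'.mono (by simp)))
        ((hs'.agree.regs 50 (by simp)).trans h50)) le_rfl)).mono (fun _ h => h) ?_
    norm_num
  · have h1 : ∀ c ∈ Finset.range E.n, (if E.H c = E.τ e z then (42 : ℝ≥0∞) +
        (if E.Good a b c then 0 else 8) else 0) ≤ if E.H c = E.τ e z then 50 else 0 := by
      intro c _
      split_ifs <;> norm_num
    calc _ ≤ 1 + 13 + (E.costC e z + 1 + 5) := by
          gcongr
          · exact Finset.sum_le_sum h1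
          · split_ifs <;> norm_num
      _ ≤ 25 + E.costC e z := by
          rw [show (1 : ℝ≥0∞) + 13 + (E.costC e z + 1 + 5) = 20 + E.costC e z by ring]
          gcongr; norm_num

open Classical in
/-- The cost of visiting the candidates that complete `a` and `b`. -/
noncomputable def costP (a b z : ℕ) : ℝ≥0∞ :=
  if a = b then 0 else E.costC 0 z + E.costC 1 z + E.costC 2 z

def pairBody : Cmd :=
  .seq (block [.op .sub 48 47 0, .op .add 51 48 48, .load 62 51, .op .add 51 51 0, .load 63 51,
    .op .eq 54 46 48])
  (.ite 54 .skip (.seq (chainC 0) (.ite 39 .skip (.seq (chainC 1) (.ite 39 .skip (chainC 2))))))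

abbrev regsP : List ℕ := [48, 49, 50, 51, 52, 53, 54, 62, 63]

theorem runs_pairBody {s : State w} (hst : E.Static s) {a b z : ℕ}
    (ha : E.Holds a 46 60 61 s) (han : a < E.n) (hbn : b < E.n)
    (h47 : s.regs 47 = BitVec.ofNat w (b + 1))
    (hz : s.regs 42 = BitVec.ofNat w z) (hzQ : (E.H a + E.H b) % E.Q = z) (h39 : s.regs 39 = 0) :
    Runs pairBody s (fun s' => Out regsP (E.Dirty a b) s s' ∧ s'.regs 48 = BitVec.ofNat w b)
      (100 + E.costP a b z) := by
  have hn := E.n_le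
  have hQ := E.eight_Q_le
  have hwd := E.word_ge
  have hw0 := E.w_ne_zero
  have d1 := hst.tables.hi b hbn
  have d2 := hst.tables.lo b hbn
  rw [addr_zero, two_mul] at d1 d2
  have hfl : ∀ (P : Prop) [Decidable P], (if P then (1 : BitVec w) else 0) = 0 ↔ ¬ P :=
    fun P _ => not_iff_not.1 ((flag_ne_zero hw0 P).trans not_not.symm)
  have hfirst : Runs (block [.op .sub 48 47 0, .op .add 51 48 48, .load 62 51, .op .add 51 51 0,
      .load 63 51, .op .eq 54 46 48]) s
      (fun s' => Agree regsP s s' ∧ E.Holds b 48 62 63 s' ∧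
        s'.regs 54 = if a = b then 1 else 0) 11 := by
    have hsub : BitVec.ofNat w (b + 1) - BitVec.ofNat w 1 = BitVec.ofNat w b := by
      rw [sub_ofNat (by omega), Nat.add_sub_cancel]
    refine Runs.straight rfl ⟨?_, ⟨?_, ?_, ?_⟩, ?_⟩ (by norm_num [block, Cmd.time])
    · simp only [block, det]
      repeat refine Agree.set ?_ (by simp) _
      exact Agree.refl _ _
    all_goals
      simp only [block, det, BinOp.eval, State.set_regs, State.set_mem, Function.update_apply,
        Nat.reduceEqDiff, reduceIte, hst.consts.r0, h47, hsub, add_ofNat, d1, d2, ha.1,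
        ofNat_inj (w := w) (a := a) (b := b) (by omega) (by omega), OfNat.zero_ne_ofNat]
  have hzQ' : z < E.Q := hzQ ▸ Nat.mod_lt _ E.Q_pos
  set P : State w → Prop := fun s' => Out regsP (E.Dirty a b) s s' ∧ s'.regs 48 = BitVec.ofNat w b
    with hP
  set I : State w → Prop := fun s' => Agree regsP s s' ∧ E.Holds b 48 62 63 s' with hI
  -- Each bucket has two outcomes: a triple is found and the flag raised, or only scratch registers
  -- have changed and this bucket is excluded. If all three are excluded, `good_match` shows that
  -- the pair is not dirty.
  have hchain : ∀ s₁, I s₁ → ∀ e < 3, a ≠ b → Runs (chainC e) s₁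
      (fun s₂ => (P s₂ ∧ s₂.regs 39 = 1 ∧ E.Dirty a b) ∨
        (I s₂ ∧ s₂.regs 39 = 0 ∧ ¬ ∃ c < E.n, E.H c = E.τ e z ∧ E.Good a b c))
      (25 + E.costC e z) := by
    intro s₁ hs₁ e he hab
    refine (E.runs_chainC (hst.agree hs₁.1 (by simp)) he (ha.agree hs₁.1 (by simp) (by simp)
      (by simp)) hs₁.2 han hbn (by rw [hs₁.1.regs 42 (by simp), hz]) hzQ'
      (by rw [hs₁.1.regs 39 (by simp), h39])).mono (fun s₂ hs₂ => ?_) le_rfl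
    by_cases hd : ∃ c < E.n, E.H c = E.τ e z ∧ E.Good a b c
    · have hD : E.Dirty a b := ⟨hab, by obtain ⟨c, h1, _, h2⟩ := hd; exact ⟨c, h1, h2⟩⟩
      exact Or.inl ⟨⟨(Out.trans_left hs₁.1 (by simp) (hs₂.mono (by simp))).congr
        (iff_of_true hd hD), by rw [hs₂.agree.regs 48 (by simp), hs₁.2.1]⟩, hs₂.pos hd, hD⟩
    · have hag := hs₂.agree_of_not hd
      exact Or.inr ⟨⟨hs₁.1.trans (hag.mono (by simp)),
        hs₁.2.agree hag (by simp) (by simp) (by simp)⟩,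
        by rw [hag.regs 39 (by simp), hs₁.1.regs 39 (by simp), h39], hd⟩
  have hskip : ∀ s', P s' → Runs .skip s' P 1 := fun s' hs' =>
    Runs.straight rfl hs' (by simp [Cmd.time])
  have hdone : ∀ s', I s' → ¬ E.Dirty a b → P s' := fun s' hs' hd =>
    ⟨Out.of_agree hs'.1 (by simp) hd, hs'.2.1⟩
  have hcont : ∀ (C : Cmd) (B : ℝ≥0∞) (e : ℕ), 1 ≤ B → ∀ s₂, ((P s₂ ∧ s₂.regs 39 = 1 ∧ E.Dirty a b) ∨
        (I s₂ ∧ s₂.regs 39 = 0 ∧ ¬ ∃ c < E.n, E.H c = E.τ e z ∧ E.Good a b c)) →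
      ((¬ ∃ c < E.n, E.H c = E.τ e z ∧ E.Good a b c) → ∀ s₃, I s₃ → Runs C s₃ P B) →
      Runs (.ite 39 .skip C) s₂ P (1 + B) := by
    intro C B e hB s₂ hs₂ hC
    refine Runs.ite (fun h => ?_) (fun h => ?_)
    · rcases hs₂ with h' | h'
      · exact (hskip s₂ h'.1).mono (fun _ h => h) hB
      · exact absurd h'.2.1 h
    · rcases hs₂ with h' | h'
      · rw [h'.2.1] at h; exact absurd h (one_ne_zero_word hw0)
      · exact hC h'.2.2 s₂ h'.1
  refine (hfirst.seq (B₂ := 83 + E.costP a b z) fun s₁ ⟨h1, h2, h3⟩ => ?_).mono (fun _ h => h) ?_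
  swap
  · rw [← add_assoc]; gcongr; norm_num
  by_cases hab : a = b
  · refine (Runs.ite (B := 1) (fun _ => ?_) (fun h => ?_)).mono (fun _ h => h) ?_
    · exact hskip s₁ (hdone s₁ ⟨h1, h2⟩ fun h => h.1 hab)
    · rw [h3, if_pos hab] at h; exact absurd h (one_ne_zero_word hw0)
    · calc (1 : ℝ≥0∞) + 1 ≤ 83 := by norm_num
        _ ≤ _ := le_self_add
  rw [costP, if_neg hab]
  refine (Runs.ite (B := 82 + (E.costC 0 z + E.costC 1 z + E.costC 2 z)) (fun h => ?_)
    (fun _ => ?_)).mono (fun _ h => h) ?_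
  · rw [h3, if_neg hab] at h; exact absurd rfl h
  · refine ((hchain s₁ ⟨h1, h2⟩ 0 (by norm_num) hab).seq (B₂ := 1 + (1 + (25 + E.costC 1 z) +
      (1 + (25 + E.costC 2 z)))) fun s₂ hs₂ => hcont _ _ 0 ?_ s₂ hs₂ fun hd0 s₃ hs₃ =>
      (hchain s₃ hs₃ 1 (by norm_num) hab).seq fun s₄ hs₄ => hcont _ _ 1 ?_ s₄ hs₄ fun hd1 s₅ hs₅ =>
      (hchain s₅ hs₅ 2 (by norm_num) hab).mono (fun s₆ hs₆ => ?_) le_rfl).mono (fun _ h => h) ?_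
    · rw [add_assoc]; exact le_self_add
    · calc (1 : ℝ≥0∞) ≤ 25 := by norm_num
        _ ≤ _ := le_self_add
    · rcases hs₆ with h' | h'
      · exact h'.1
      · refine hdone s₆ h'.1 fun hD => ?_
        obtain ⟨c, hc, hg⟩ := hD.2
        obtain ⟨e, he, hH⟩ := E.good_match hzQ hg
        interval_cases e
        · exact hd0 ⟨c, hc, hH, hg⟩
        · exact hd1 ⟨c, hc, hH, hg⟩
        · exact h'.2.2 ⟨c, hc, hH, hg⟩
    · rw [show (1 : ℝ≥0∞) + (25 + E.costC 0 z) + (1 + (1 + (25 + E.costC 1 z) +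
        (1 + (25 + E.costC 2 z)))) = 79 + (E.costC 0 z + E.costC 1 z + E.costC 2 z) by ring]
      gcongr; norm_num
  · rw [← add_assoc]; gcongr; norm_num

end Env

end WordRAM

namespace WordRAM

namespace Env

variable {w : ℕ} (E : Env w)

/-- The hash values of the first and second position. -/
def hA (u z : ℕ) : ℕ := (u + z / E.q * E.q) % E.Q
def hB (u z : ℕ) : ℕ := (z % E.q + E.Q - u) % E.Q

theorem hA_lt (u z : ℕ) : E.hA u z < E.Q := Nat.mod_lt _ E.Q_pos
theorem hB_lt (u z : ℕ) : E.hB u z < E.Q := Nat.mod_lt _ E.Q_pos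

/-- The shift `u` cancels. Varying it moves the two parts of `z = x q + y` through all pairs of
buckets with hash sum `z`. -/
theorem hA_add_hB {u z : ℕ} (hu : u ≤ E.Q) (hz : z < E.Q) : (E.hA u z + E.hB u z) % E.Q = z := by
  rw [hA, hB, ← Nat.add_mod]
  have := Nat.div_add_mod' z E.q
  rw [show u + z / E.q * E.q + (z % E.q + E.Q - u) = z + E.Q by omega, Nat.add_mod_right,
    Nat.mod_eq_of_lt hz]

/-- The largest cost of a pair of positions. -/
noncomputable def costTop : ℝ≥0∞ := 120 + 150 * E.n

theorem costC_le (e z : ℕ) : E.costC e z ≤ 50 * E.n := by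
  calc _ ≤ ∑ c ∈ Finset.range E.n, (50 : ℝ≥0∞) := by
        refine Finset.sum_le_sum fun c _ => ?_
        split_ifs <;> simp
    _ = _ := by simp [mul_comm]

theorem costP_le (a b z : ℕ) : E.costP a b z ≤ 150 * E.n := by
  rw [costP]
  split_ifs
  · exact zero_le
  · calc _ ≤ 50 * (E.n : ℝ≥0∞) + 50 * E.n + 50 * E.n := by gcongr <;> exact E.costC_le _ _
      _ = _ := by ring

-- Dirty pairs have weight zero because the search ends at the first of them; its cost is covered by
-- a single `costTop`.
open Classical in
noncomputable def weight (z a b : ℕ) : ℝ≥0∞ :=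
  if E.Dirty a b then 0 else 110 + E.costP a b z

open Classical in
/-- The cost of visiting the second positions. -/
noncomputable def costB (u z a : ℕ) : ℝ≥0∞ :=
  ∑ b ∈ Finset.range E.n, if E.H b = E.hB u z then E.weight z a b else 0

def DirtyB (u z a : ℕ) : Prop := ∃ b < E.n, E.H b = E.hB u z ∧ E.Dirty a b

def chainB : Cmd :=
  .seq (block [.op .add 47 44 3, .op .sub 47 47 40, .op .and 47 47 4, .op .add 47 12 47,
    .load 47 47]) (forEach 47 pairBody (.seq (.op .add 51 13 48) (.load 47 51)))

abbrev regsB : List ℕ := [47, 48, 49, 50, 51, 52, 53, 54, 62, 63]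

open Classical in
theorem runs_chainB {s : State w} (hst : E.Static s) {u z a : ℕ} (hu : u ≤ E.Q) (hzQ : z < E.Q)
    (ha : E.Holds a 46 60 61 s) (han : a < E.n) (hH : E.H a = E.hA u z)
    (h40 : s.regs 40 = BitVec.ofNat w u) (h42 : s.regs 42 = BitVec.ofNat w z)
    (h44 : s.regs 44 = BitVec.ofNat w (z % E.q)) (h39 : s.regs 39 = 0) :
    Runs chainB s (Out regsB (E.DirtyB u z a) s)
      (11 + E.costB u z a + if E.DirtyB u z a then E.costTop + 5 else 0) := by
  have hfirst : Runs (block [.op .add 47 44 3, .op .sub 47 47 40, .op .and 47 47 4,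
      .op .add 47 12 47, .load 47 47]) s
      (fun s' => Agree regsB s s' ∧ s'.regs 47 = enc w (E.chain (E.hB u z) E.n)) 9 := by
    refine Runs.straight rfl ⟨?_, ?_⟩ (by norm_num [block, Cmd.time])
    · simp only [block, det]
      repeat refine Agree.set ?_ (by simp) _
      exact Agree.refl _ _
    · simp only [block, det, BinOp.eval, State.set_regs, State.set_mem, Function.update_apply,
        Nat.reduceEqDiff, reduceIte, hst.consts.r3, hst.consts.r4, hst.consts.r12, h40, h44,
        add_ofNat]
      rw [sub_ofNat (by omega), and_Q, addr_add, zero_add, ← hst.tables.head _ (E.hB_lt u z)]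
      rfl
  refine (hfirst.seq fun s₁ ⟨hs₁, h47⟩ => E.runs_chain (j := 48) (h := E.hB u z)
    (d := fun b => E.Dirty a b) (B := fun b => if E.Dirty a b then 0 else 102 + E.costP a b z)
    (X := E.costTop) hst h39 (by simp) (by simp)
    (by simp) (by simp) (fun b hb hHb s₂ hs₂ hps => ?_) hs₁ h47).mono (fun _ h => h) ?_
  · refine (E.runs_pairBody (hst.agree hs₂ (by simp)) (ha.agree hs₂ (by simp) (by simp) (by simp))
      han hb hps (by rw [hs₂.regs 42 (by simp), h42]) (by rw [hH, hHb, E.hA_add_hB hu hzQ])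
      (by rw [hs₂.regs 39 (by simp), h39])).mono
      (fun s' hs' => ⟨hs'.1.mono (by simp), hs'.2⟩) ?_
    split_ifs
    · rw [zero_add, costTop]
      exact add_le_add (by norm_num) (E.costP_le _ _ _)
    · rw [add_zero]; gcongr; norm_num
  · rw [costB, DirtyB, ← add_assoc]
    have h1 : ∀ b ∈ Finset.range E.n, (if E.H b = E.hB u z then ((if E.Dirty a b then 0 else
        102 + E.costP a b z) + if E.Dirty a b then 0 else 8) else 0) ≤
        if E.H b = E.hB u z then E.weight z a b else 0 := by
      intro b _
      split_ifs with h1 h2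
      · simp
      · rw [weight, if_neg h2, add_right_comm]; gcongr; norm_num
      · rfl
    refine add_le_add ?_ (le_of_eq (by congr))
    calc _ ≤ (1 : ℝ≥0∞) + 9 + (∑ b ∈ Finset.range E.n, if E.H b = E.hB u z then
          E.weight z a b else 0) + 1 := by
          rw [← add_assoc]; gcongr _ + ?_ + _
          exact Finset.sum_le_sum h1
      _ = _ := by ring

open Classical in
/-- The cost of visiting the first positions. -/
noncomputable def costA (u z : ℕ) : ℝ≥0∞ :=
  ∑ a ∈ Finset.range E.n, if E.H a = E.hA u z then
    (if E.DirtyB u z a then 0 else 32) + E.costB u z a else 0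

def DirtyA (u z : ℕ) : Prop := ∃ a < E.n, E.H a = E.hA u z ∧ E.DirtyB u z a

def bodyA : Cmd :=
  .seq (block [.op .sub 46 45 0, .op .add 51 46 46, .load 60 51, .op .add 51 51 0, .load 61 51])
    chainB

def chainA : Cmd :=
  .seq (block [.op .mul 45 43 2, .op .add 45 40 45, .op .and 45 45 4, .op .add 45 12 45,
    .load 45 45]) (forEach 45 bodyA (.seq (.op .add 51 13 46) (.load 45 51)))

abbrev regsA : List ℕ := [45, 46, 47, 48, 49, 50, 51, 52, 53, 54, 60, 61, 62, 63]

open Classical in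
theorem runs_chainA {s : State w} (hst : E.Static s) {u z : ℕ} (hu : u ≤ E.Q) (hzQ : z < E.Q)
    (h40 : s.regs 40 = BitVec.ofNat w u) (h42 : s.regs 42 = BitVec.ofNat w z)
    (h43 : s.regs 43 = BitVec.ofNat w (z / E.q))
    (h44 : s.regs 44 = BitVec.ofNat w (z % E.q)) (h39 : s.regs 39 = 0) :
    Runs chainA s (Out regsA (E.DirtyA u z) s)
      (11 + E.costA u z + if E.DirtyA u z then E.costTop + 40 else 0) := by
  have hn := E.n_le
  have hQ := E.eight_Q_le
  have hwd := E.word_ge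
  have hfirst : Runs (block [.op .mul 45 43 2, .op .add 45 40 45, .op .and 45 45 4,
      .op .add 45 12 45, .load 45 45]) s
      (fun s' => Agree regsA s s' ∧ s'.regs 45 = enc w (E.chain (E.hA u z) E.n)) 9 := by
    refine Runs.straight rfl ⟨?_, ?_⟩ (by norm_num [block, Cmd.time])
    · simp only [block, det]
      repeat refine Agree.set ?_ (by simp) _
      exact Agree.refl _ _
    · simp only [block, det, BinOp.eval, State.set_regs, State.set_mem, Function.update_apply,
        Nat.reduceEqDiff, reduceIte, hst.consts.r2, hst.consts.r4, hst.consts.r12, h40, h43,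
        add_ofNat, mul_ofNat]
      rw [and_Q, addr_add, zero_add, ← hst.tables.head _ (E.hA_lt u z)]
      rfl
  refine (hfirst.seq fun s₁ ⟨hs₁, h45⟩ => E.runs_chain (j := 46) (h := E.hA u z)
    (d := fun a => E.DirtyB u z a)
    (B := fun a => (if E.DirtyB u z a then 0 else 24) + E.costB u z a)
    (X := E.costTop + 30) hst h39 (by simp) (by simp)
    (by simp) (by simp) (fun a hna hHa s₂ hs₂ hps => ?_) hs₁ h45).mono (fun _ h => h) ?_
  · have d1 := hst.tables.hi a hna
    have d2 := hst.tables.lo a hna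
    rw [addr_zero, two_mul, ← hs₂.mem] at d1 d2
    have hst₂ := hst.agree hs₂ (by simp)
    have hload : Runs (block [.op .sub 46 45 0, .op .add 51 46 46, .load 60 51, .op .add 51 51 0,
        .load 61 51]) s₂ (fun s' => Agree regsA s₂ s' ∧ E.Holds a 46 60 61 s') 9 := by
      have hsub : BitVec.ofNat w (a + 1) - BitVec.ofNat w 1 = BitVec.ofNat w a := by
        rw [sub_ofNat (by omega), Nat.add_sub_cancel]
      refine Runs.straight rfl ⟨?_, ?_, ?_, ?_⟩ (by norm_num [block, Cmd.time])
      · simp only [block, det]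
        repeat refine Agree.set ?_ (by simp) _
        exact Agree.refl _ _
      all_goals
        simp only [block, det, BinOp.eval, State.set_regs, State.set_mem, Function.update_apply,
          Nat.reduceEqDiff, reduceIte, hst₂.consts.r0, hps, hsub, add_ofNat, d1, d2,
          OfNat.zero_ne_ofNat]
    refine (hload.seq fun s₃ ⟨hs₃, hH⟩ => (E.runs_chainB (hst₂.agree hs₃ (by simp)) hu hzQ hH hna
      hHa (by rw [hs₃.regs 40 (by simp), hs₂.regs 40 (by simp), h40])
      (by rw [hs₃.regs 42 (by simp), hs₂.regs 42 (by simp), h42])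
      (by rw [hs₃.regs 44 (by simp), hs₂.regs 44 (by simp), h44])
      (by rw [hs₃.regs 39 (by simp), hs₂.regs 39 (by simp), h39])).mono
      (fun s' hs' => And.intro (Out.trans_left hs₃ (by simp) (hs'.mono (by simp)))
        ((hs'.agree.regs 46 (by simp)).trans hH.1)) le_rfl).mono (fun _ h => h) ?_
    split_ifs
    · rw [show (1 : ℝ≥0∞) + 9 + (11 + E.costB u z a + (E.costTop + 5)) =
        0 + E.costB u z a + (E.costTop + 26) by ring]
      gcongr; norm_num
    · rw [show (1 : ℝ≥0∞) + 9 + (11 + E.costB u z a + 0) = 21 + E.costB u z a + 0 by ring]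
      gcongr; norm_num
  · rw [costA, DirtyA]
    have h1 : ∀ a ∈ Finset.range E.n, (if E.H a = E.hA u z then ((if E.DirtyB u z a then 0 else
        24) + E.costB u z a + if E.DirtyB u z a then 0 else 8) else 0) ≤
        if E.H a = E.hA u z then (if E.DirtyB u z a then 0 else 32) + E.costB u z a else 0 := by
      intro b _
      split_ifs with h1 h2
      · simp
      · rw [add_right_comm]; gcongr; norm_num
      · rfl
    rw [← add_assoc]
    refine add_le_add ?_ ?_
    · calc _ ≤ (1 : ℝ≥0∞) + 9 + (∑ a ∈ Finset.range E.n, if E.H a = E.hA u z then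
            (if E.DirtyB u z a then 0 else 32) + E.costB u z a else 0) + 1 := by
            rw [← add_assoc]; gcongr _ + ?_ + _
            exact Finset.sum_le_sum h1
        _ = _ := by ring
    · split_ifs
      · rw [add_assoc]; gcongr; norm_num
      · rfl

open Classical in
/-- The cost of checking a list of candidates. -/
noncomputable def costL (u : ℕ) (l : List ℕ) : ℝ≥0∞ :=
  (l.map fun z => (if E.DirtyA u z then 0 else 32) + E.costA u z).sum

def bodyL : Cmd :=
  .seq (block [.op .sub 41 36 0, .op .add 41 10 41, .load 42 41, .op .div 43 42 2,
    .op .mod 44 42 2]) chainA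

/-- Check the list of candidates in region `5`. -/
def checkList : Cmd := forEach 36 bodyL (.op .sub 36 36 0)

abbrev regsL : List ℕ :=
  [36, 41, 42, 43, 44, 45, 46, 47, 48, 49, 50, 51, 52, 53, 54, 60, 61, 62, 63]

open Classical in
theorem runs_checkList {s : State w} (hst : E.Static s) {u : ℕ} {l : List ℕ} (hu : u ≤ E.Q)
    (hl : ∀ z ∈ l, z < E.Q) (hlen : l.length ≤ E.Q)
    (h40 : s.regs 40 = BitVec.ofNat w u) (h36 : s.regs 36 = BitVec.ofNat w l.length)
    (hmem : ∀ i (h : i < l.length), s.mem (addr w E.wA 5 i) = BitVec.ofNat w l[i])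
    (h39 : s.regs 39 = 0) :
    Runs checkList s (Out regsL (∃ z ∈ l, E.DirtyA u z) s)
      (1 + E.costL u l + if ∃ z ∈ l, E.DirtyA u z then E.costTop + 75 else 0) := by
  have hQ := E.eight_Q_le
  have hwd := E.word_ge
  have hqQ : E.q ≤ E.Q := by rw [Q_eq]; exact Nat.le_mul_of_pos_left _ (by have := E.two_le_q; omega)
  have hex : (∃ z ∈ l.reverse, E.DirtyA u z) ↔ ∃ z ∈ l, E.DirtyA u z := by simp
  -- Register `36` holds the number of remaining entries, so the list is processed from its end.
  refine (Runs.forEach (full := l.reverse) (enc := fun l => BitVec.ofNat w l.length)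
    (d := fun z => E.DirtyA u z) (R := regsL)
    (B := fun z => (if E.DirtyA u z then 0 else 24) + E.costA u z) (X := E.costTop + 70) (ka := 1)
    (fun _ l s => s.regs 36 = BitVec.ofNat w (l.length + 1)) E.w_ne_zero h39 (by simp) (by simp)
    rfl (fun a l' hsuf => ?_) (fun a l' hsuf s₂ hs₂ hps => ?_) (fun a l' hsuf s₂ hs₂ hJ => ?_) s
    (Agree.refl _ _) (by simpa using h36)).mono (fun _ h => h.congr hex) ?_
  · have := hsuf.length_le
    rw [List.length_reverse, List.length_cons] at this
    exact ofNat_ne_zero (by simp) (by simp only [List.length_cons]; omega)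
  · have hlen' := hsuf.length_le
    rw [List.length_reverse, List.length_cons] at hlen'
    obtain ⟨pre, hpre⟩ := hsuf
    have hl' : l = l'.reverse ++ (a :: pre.reverse) := by
      rw [← List.reverse_inj, ← hpre]; simp
    have hget : l[l'.length]'(by omega) = a := by
      simp [hl']
    have ha : a < E.Q := hl a (by rw [hl']; simp)
    have hst₂ := hst.agree hs₂ (by simp)
    have h36' : s₂.regs 36 = BitVec.ofNat w (l'.length + 1) := by simpa using hps
    have hm : s₂.mem (addr w E.wA 5 l'.length) = BitVec.ofNat w a := by
      rw [hs₂.mem, hmem _ (by omega), hget]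
    have hload : Runs (block [.op .sub 41 36 0, .op .add 41 10 41, .load 42 41, .op .div 43 42 2,
        .op .mod 44 42 2]) s₂ (fun s' => Agree [41, 42, 43, 44] s₂ s' ∧
        s'.regs 42 = BitVec.ofNat w a ∧ s'.regs 43 = BitVec.ofNat w (a / E.q) ∧
        s'.regs 44 = BitVec.ofNat w (a % E.q)) 9 := by
      have hsub : BitVec.ofNat w (l'.length + 1) - BitVec.ofNat w 1 = BitVec.ofNat w l'.length := by
        rw [sub_ofNat (by omega), Nat.add_sub_cancel]
      refine Runs.straight rfl ⟨?_, ?_, ?_, ?_⟩ (by norm_num [block, Cmd.time])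
      · simp only [block, det]
        repeat refine Agree.set ?_ (by simp) _
        exact Agree.refl _ _
      all_goals
        simp only [block, det, BinOp.eval, State.set_regs, State.set_mem, Function.update_apply,
          Nat.reduceEqDiff, reduceIte, hst₂.consts.r0, hst₂.consts.r10, hst₂.consts.r2, h36', hsub,
          addr_add, zero_add, hm, div_ofNat (w := w) (a := a) (b := E.q) (by omega) (by omega),
          mod_ofNat (w := w) (a := a) (b := E.q) (by omega) (by omega)]
    refine (hload.seq fun s₃ ⟨hs₃, e42, e43, e44⟩ => (E.runs_chainA (hst₂.agree hs₃ (by simp)) hu ha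
      (by rw [hs₃.regs 40 (by simp), hs₂.regs 40 (by simp), h40]) e42 e43 e44
      (by rw [hs₃.regs 39 (by simp), hs₂.regs 39 (by simp), h39])).mono
      (fun s' hs' => And.intro (Out.trans_left (hs₃.mono (by simp)) (by simp) (hs'.mono (by simp)))
        (by rw [hs'.agree.regs 36 (by simp), hs₃.regs 36 (by simp), h36'])) le_rfl).mono
      (fun _ h => h) ?_
    split_ifs
    · rw [show (1 : ℝ≥0∞) + 9 + (11 + E.costA u a + (E.costTop + 40)) =
        0 + E.costA u a + (E.costTop + 61) by ring]
      gcongr; norm_num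
    · rw [show (1 : ℝ≥0∞) + 9 + (11 + E.costA u a + 0) = 21 + E.costA u a + 0 by ring]
      gcongr; norm_num
  · have hlen' := hsuf.length_le
    rw [List.length_reverse, List.length_cons] at hlen'
    refine Runs.straight rfl ⟨(Agree.refl _ _).set (by simp) _, ?_⟩ (by simp [Cmd.time])
    simp only [det, State.set_regs, Function.update_self, BinOp.eval, hJ,
      hs₂.regs 0 (by simp), hst.consts.r0]
    rw [sub_ofNat (by omega), Nat.add_sub_cancel]
  · simp only [hex]
    rw [List.map_reverse, List.sum_reverse, costL]
    refine add_le_add ((add_comm _ _).trans_le (add_le_add le_rfl ?_)) ?_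
    · refine List.sum_le_sum fun z _ => ?_
      split_ifs with h2
      · simp
      · rw [add_right_comm]; gcongr; norm_num
    · split_ifs
      · rw [add_assoc]; gcongr; norm_num
      · rfl

end Env

end WordRAM

/-! ### Random choices, sequencing and memory frames -/

namespace WordRAM

section Frame

variable {w : ℕ}

theorem Runs.rand_seq {x : ℕ} {c : Cmd} {s : State w} {Post : State w → Prop}
    {B : BitVec w → ℝ≥0∞} (h : ∀ v, Runs c (s.set x v) Post (B v)) :
    Runs (.seq (.rand x) c) s Post (2 + ∑ v : BitVec w, ((2 : ℝ≥0∞) ^ w)⁻¹ * B v) := by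
  intro f X hf
  simp only [ert]
  have h1 : ∑ v : BitVec w, ((2 : ℝ≥0∞) ^ w)⁻¹ * X = X := by
    have hc : Fintype.card (BitVec w) = 2 ^ w := by
      rw [Fintype.card_congr (BitVec.equivFin (m := w)).toEquiv, Fintype.card_fin]
    rw [Finset.sum_const, Finset.card_univ, hc, nsmul_eq_mul, ← mul_assoc]
    push_cast
    rw [ENNReal.mul_inv_cancel (by simp) (by simp), one_mul]
  calc _ ≤ 1 + (1 + ∑ v : BitVec w, ((2 : ℝ≥0∞) ^ w)⁻¹ * (B v + X)) := by
        gcongr with v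
        exact h v f X hf
    _ = _ := by
        simp only [mul_add, Finset.sum_add_distrib, h1]
        rw [show (2 : ℝ≥0∞) = 1 + 1 by norm_num]; ring

/-- The cost of the rest may depend on the final state of the simulated program and is averaged over
the distribution of that state. This is how the expectation over both phases in `queryTime` arises.
-/
theorem Runs.comp_seq {wA M : ℕ} {φ : ℕ → ℕ} {cur jR : ℕ} {S₀ S : State w} {s : State wA}
    (hb : SimBase wA M φ cur jR S₀) {c d : Cmd} (hc : c.regBound ≤ M)
    (h : Sim M φ cur jR S₀ s S) {post : State wA → Prop} (hpost : Computes c s post)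
    {Post : State w → Prop} {B : State wA → ℝ≥0∞}
    (hd : ∀ s' S', post s' → Sim M φ cur jR S₀ s' S' → Runs d S' Post (B s')) :
    Runs (.seq (WordRAM.comp φ c) d) S Post
      (1 + 30 * expTime c s + ∑' s', haltProb c s s' * B s') := by
  classical
  intro f X hf
  simp only [ert]
  refine (add_le_add le_rfl (ert_comp_le hb hc (F := fun s' => if post s' then B s' + X else ∞)
    (fun s' S' h' => ?_) h)).trans ?_
  · split_ifs with hp
    · exact hd s' S' hp h' f X hf
    · exact le_top
  · rw [add_assoc, add_assoc]
    gcongr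
    calc _ ≤ ∑' s', (haltProb c s s' * B s' + haltProb c s s' * X) := by
          refine ENNReal.tsum_le_tsum fun s' => ?_
          by_cases h0 : haltProb c s s' = 0
          · simp [h0]
          · simp [hpost.2 s' h0, mul_add]
      _ = _ := by rw [ENNReal.tsum_add, ENNReal.tsum_mul_right, hpost.1, one_mul]

/-- The two states differ at most in the registers `R` and the memory regions `J`. -/
structure Frame (wA : ℕ) (R J : List ℕ) (s s' : State w) : Prop where
  regs : ∀ r, r ∉ R → s'.regs r = s.regs r
  mem : ∀ j < 16, j ∉ J → ∀ v < 2 ^ (wA + 4), s'.mem (addr w wA j v) = s.mem (addr w wA j v)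
  input : s'.input = s.input
  consumed : s'.consumed = s.consumed
  out : s'.out = s.out

variable {wA : ℕ}

theorem Frame.refl (R J : List ℕ) (s : State w) : Frame wA R J s s :=
  ⟨fun _ _ => rfl, fun _ _ _ _ _ => rfl, rfl, rfl, rfl⟩

theorem Frame.trans {R J : List ℕ} {s s' s'' : State w} (h : Frame wA R J s s')
    (h' : Frame wA R J s' s'') : Frame wA R J s s'' :=
  ⟨fun r hr => (h'.regs r hr).trans (h.regs r hr),
    fun j hj hJ v hv => (h'.mem j hj hJ v hv).trans (h.mem j hj hJ v hv), h'.input.trans h.input,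
    h'.consumed.trans h.consumed, h'.out.trans h.out⟩

theorem Frame.mono {R R' J J' : List ℕ} {s s' : State w} (h : Frame wA R J s s') (hR : R ⊆ R')
    (hJ : J ⊆ J') : Frame wA R' J' s s' :=
  ⟨fun r hr => h.regs r fun hr' => hr (hR hr'), fun j hj hj' => h.mem j hj fun h => hj' (hJ h),
    h.input, h.consumed, h.out⟩

theorem Agree.frame {R J : List ℕ} {s s' : State w} (h : Agree R s s') : Frame wA R J s s' :=
  ⟨h.regs, fun _ _ _ _ _ => by rw [h.mem], h.input, h.consumed, h.out⟩

theorem upd_mem_addr (hw : wA + 8 ≤ w) (s : State w) {j j' v v' : ℕ} (hj : j < 16) (hj' : j' < 16)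
    (hv : v < 2 ^ (wA + 4)) (hv' : v' < 2 ^ (wA + 4)) (x : BitVec w) :
    (s.upd (addr w wA j v) x).mem (addr w wA j' v') =
      if j' = j ∧ v' = v then x else s.mem (addr w wA j' v') := by
  simp only [State.upd_mem, Function.update_apply, addr_inj hw hj' hj hv' hv]

theorem Frame.upd {R J : List ℕ} {s s' : State w} (h : Frame wA R J s s') (hw : wA + 8 ≤ w)
    {j v : ℕ} (hj : j < 16) (hJ : j ∈ J) (hv : v < 2 ^ (wA + 4)) (x : BitVec w) :
    Frame wA R J s (s'.upd (addr w wA j v) x) :=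
  ⟨h.regs, fun j' hj' hJ' v' hv' => by
    rw [upd_mem_addr hw s' hj hj' hv hv', if_neg (fun e : j' = j ∧ v' = v => hJ' (e.1 ▸ hJ)),
      h.mem j' hj' hJ' v' hv'],
    h.input, h.consumed, h.out⟩

end Frame

/-! ### Writing the text and the dictionary -/

namespace Env

variable {w : ℕ} (E : Env w)

theorem Static.frame {E : Env w} {R J : List ℕ} {s s' : State w} (h : E.Static s)
    (ha : Frame E.wA R J s s') (hR : ∀ r ∈ R, 32 ≤ r) (hJ : ∀ j ∈ J, j ∉ [0, 7, 8]) :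
    E.Static s' :=
  ⟨h.consts.congr fun r hr => ha.regs r fun hr' => by have := hR r hr'; omega,
    h.tables.congr fun j hj v hv => ha.mem j (by simp at hj; omega) (fun h => hJ j h hj) v hv⟩

/-- Some position has the hash value `h`. -/
def Hit (h : ℕ) : Prop := ∃ a < E.n, E.H a = h

theorem enc_chain_eq_zero (h : ℕ) : enc w (E.chain h E.n) = 0 ↔ ¬ E.Hit h := by
  have h1 := E.n_le
  have h2 := E.eight_Q_le
  have h3 := E.word_ge
  have hmem := fun a => E.mem_chain (h := h) (i := E.n) (j := a)
  rcases hl : E.chain h E.n with _ | ⟨a, l⟩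
  · refine iff_of_true rfl fun ⟨a, ha⟩ => ?_
    have := (hmem a).2 ha
    simp [hl] at this
  · have ha : a < E.n ∧ E.H a = h := (hmem a).1 (by simp [hl])
    refine iff_of_false ?_ fun h => h ⟨a, ha⟩
    exact ofNat_ne_zero (by omega) (by omega)

-- For `z = x q + y` the two flags ask whether the buckets `hA u z` and `hB u z` are nonempty. The
-- first bucket depends only on `x` and the second only on `y`, which makes the question a matching
-- problem.
open Classical in
noncomputable def pA (u x : ℕ) : Bool := decide (E.Hit ((u + x * E.q) % E.Q))
open Classical in
noncomputable def pB (u y : ℕ) : Bool := decide (E.Hit ((y + E.Q - u) % E.Q))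
-- Marks do not depend on `u`, so a single dictionary serves all texts.
open Classical in
noncomputable def mark (z : ℕ) : Bool := decide (∃ e < 3, E.Hit (E.τ e z))

/-- Write the character in register `p` to the text if there is a position with the hash value in
register `42`. -/
def putChar (p : ℕ) : Cmd :=
  .seq (block [.op .and 42 42 4, .op .add 42 12 42, .load 42 42])
    (.seq (.ite 42 (.op .or 43 p p) (.op .or 43 21 21)) (block [.op .add 44 11 p, .store 44 43]))

open Classical in
theorem runs_putChar {s : State w} (hst : E.Static s) {p h v : ℕ} (hp : p ∉ [42, 43, 44])
    (h42 : s.regs 42 = BitVec.ofNat w h) (hpv : s.regs p = BitVec.ofNat w v) :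
    Runs (putChar p) s (Agree [42, 43, 44] (s.upd (addr w E.wA 6 v)
      (BitVec.ofNat w (if E.Hit (h % E.Q) then v else 6 * E.q)))) 13 := by
  have hfirst : Runs (block [.op .and 42 42 4, .op .add 42 12 42, .load 42 42]) s
      (fun s' => Agree [42, 43, 44] s s' ∧ s'.regs 42 = enc w (E.chain (h % E.Q) E.n)) 5 := by
    refine Runs.straight rfl ⟨?_, ?_⟩ (by norm_num [block, Cmd.time])
    · simp only [block, det]
      repeat refine Agree.set ?_ (by simp) _
      exact Agree.refl _ _
    · simp only [block, det, BinOp.eval, State.set_regs, State.set_mem, Function.update_apply,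
        Nat.reduceEqDiff, reduceIte, hst.consts.r4, hst.consts.r12, h42, and_Q, addr_add, zero_add]
      rw [← hst.tables.head _ (Nat.mod_lt h E.Q_pos)]
  refine (hfirst.seq (B₂ := 6) fun s₁ ⟨h1, h2⟩ => ?_).mono (fun _ h => h) (by norm_num)
  have hpv₁ : s₁.regs p = BitVec.ofNat w v := (h1.regs p hp).trans hpv
  have h21 : s₁.regs 21 = BitVec.ofNat w (6 * E.q) := (h1.regs 21 (by simp)).trans hst.consts.r21
  have hsel : Runs (.ite 42 (.op .or 43 p p) (.op .or 43 21 21)) s₁ (fun s' => Agree [42, 43, 44] s s'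
      ∧ s'.regs 43 = BitVec.ofNat w (if E.Hit (h % E.Q) then v else 6 * E.q)) 2 := by
    refine (Runs.ite (B := 1) (fun h0 => ?_) (fun h0 => ?_)).mono (fun _ h => h) (by norm_num)
    · rw [h2, ne_eq, enc_chain_eq_zero, not_not] at h0
      refine Runs.straight rfl ⟨h1.set (by simp) _, ?_⟩ (by simp [Cmd.time])
      simp [det, BinOp.eval, hpv₁, h0]
    · rw [h2, enc_chain_eq_zero] at h0
      refine Runs.straight rfl ⟨h1.set (by simp) _, ?_⟩ (by simp [Cmd.time])
      simp [det, BinOp.eval, h21, h0]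
  refine (hsel.seq (B₂ := 3) fun s₂ ⟨g1, g2⟩ => ?_).mono (fun _ h => h) (by norm_num)
  refine Runs.straight rfl ?_ (by norm_num [block, Cmd.time])
  have g11 : s₂.regs 11 = addr w E.wA 6 0 := (g1.regs 11 (by simp)).trans hst.consts.r11
  have gp : s₂.regs p = BitVec.ofNat w v := (g1.regs p hp).trans hpv
  refine ⟨fun r hr => ?_, ?_, g1.input, g1.consumed, g1.out⟩
  · have := g1.regs r hr
    simp only [List.mem_cons, List.not_mem_nil, or_false, not_or] at hr
    simp [block, det, hr, this]
  · simp only [block, det, BinOp.eval, State.set_regs, State.set_mem, Function.update_apply,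
        Nat.reduceEqDiff, reduceIte, g11, gp, addr_add, zero_add, g2, State.upd_mem, g1.mem]

def textBody : Cmd :=
  .seq (block [.op .sub 41 41 0, .op .mul 42 41 2, .op .add 42 40 42]) (.seq (putChar 41)
    (.seq (block [.op .add 42 41 3, .op .sub 42 42 40, .op .add 45 2 41]) (putChar 45)))

/-- Write the text for the candidate in register `40`. -/
def textCmd : Cmd := .seq (.op .or 41 2 2) (.loop 41 textBody)

noncomputable def text (u : ℕ) : List ℕ := DMOG.gadgetText E.q (E.pA u) (E.pB u)

theorem runs_textCmd {s : State w} (hst : E.Static s) {u : ℕ} (hu : u ≤ E.Q)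
    (h40 : s.regs 40 = BitVec.ofNat w u) :
    Runs textCmd s (fun s' => Frame E.wA [41, 42, 43, 44, 45] [6] s s' ∧
      ∀ v (h : v < (E.text u).length), s'.mem (addr w E.wA 6 v) = BitVec.ofNat w (E.text u)[v])
      (3 + 50 * E.q) := by
  classical
  have hQ := E.eight_Q_le
  have hwd := E.word_ge
  have hreg := E.region_eq
  have hqQ : E.q ≤ E.Q := by
    rw [Q_eq]; exact Nat.le_mul_of_pos_left _ (by have := E.two_le_q; omega)
  set Inv : ℕ → State w → Prop := fun i s' => Frame E.wA [41, 42, 43, 44, 45] [6] s s' ∧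
    s'.regs 41 = BitVec.ofNat w i ∧ ∀ x, i ≤ x → x < E.q →
      s'.mem (addr w E.wA 6 x) = BitVec.ofNat w (if E.pA u x then x else 6 * E.q) ∧
      s'.mem (addr w E.wA 6 (E.q + x)) =
        BitVec.ofNat w (if E.pB u x then E.q + x else 6 * E.q) with hInv
  have hbody : ∀ i < E.q, ∀ s₁, Inv (i + 1) s₁ → Runs textBody s₁ (Inv i) 49 := by
    intro i hi s₁ ⟨hf, h41, hx⟩
    have hst₁ := hst.frame hf (by simp) (by simp)
    have h40₁ : s₁.regs 40 = BitVec.ofNat w u := (hf.regs 40 (by simp)).trans h40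
    have hsub : BitVec.ofNat w (i + 1) - BitVec.ofNat w 1 = BitVec.ofNat w i := by
      rw [sub_ofNat (by omega), Nat.add_sub_cancel]
    have r1 : Runs (block [.op .sub 41 41 0, .op .mul 42 41 2, .op .add 42 40 42]) s₁
        (fun s' => Agree [41, 42] s₁ s' ∧ s'.regs 41 = BitVec.ofNat w i ∧
          s'.regs 42 = BitVec.ofNat w (u + i * E.q)) 5 := by
      refine Runs.straight rfl ⟨?_, ?_, ?_⟩ (by norm_num [block, Cmd.time])
      · simp only [block, det]
        repeat refine Agree.set ?_ (by simp) _
        exact Agree.refl _ _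
      all_goals
        simp only [block, det, BinOp.eval, State.set_regs, Function.update_apply,
          Nat.reduceEqDiff, reduceIte, hst₁.consts.r0, hst₁.consts.r2, h40₁, h41, hsub, mul_ofNat,
          add_ofNat]
    refine (r1.seq (B₂ := 35) fun s₂ ⟨a1, a2, a3⟩ => ?_).mono (fun _ h => h) (by norm_num)
    have f2 : Frame E.wA [41, 42, 43, 44, 45] [6] s s₂ :=
      hf.trans (a1.frame.mono (by simp) (List.nil_subset _))
    refine ((E.runs_putChar (hst₁.agree a1 (by simp)) (by simp) a3 a2).seq (B₂ := 20)
      fun s₃ b1 => ?_).mono (fun _ h => h) (by norm_num)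
    have f3 : Frame E.wA [41, 42, 43, 44, 45] [6] s s₃ :=
      (f2.upd E.hw (by norm_num) (by simp) (by omega) _).trans
        (b1.frame.mono (by simp) (List.nil_subset _))
    have hst₃ := hst.frame f3 (by simp) (by simp)
    have h40₃ : s₃.regs 40 = BitVec.ofNat w u := (f3.regs 40 (by simp)).trans h40
    have h41₃ : s₃.regs 41 = BitVec.ofNat w i := (b1.regs 41 (by simp)).trans a2
    have r2 : Runs (block [.op .add 42 41 3, .op .sub 42 42 40, .op .add 45 2 41]) s₃
        (fun s' => Agree [42, 45] s₃ s' ∧ s'.regs 42 = BitVec.ofNat w (i + E.Q - u) ∧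
          s'.regs 45 = BitVec.ofNat w (E.q + i)) 5 := by
      refine Runs.straight rfl ⟨?_, ?_, ?_⟩ (by norm_num [block, Cmd.time])
      · simp only [block, det]
        repeat refine Agree.set ?_ (by simp) _
        exact Agree.refl _ _
      all_goals
        simp only [block, det, BinOp.eval, State.set_regs, Function.update_apply,
          Nat.reduceEqDiff, reduceIte, hst₃.consts.r3, hst₃.consts.r2, h40₃, h41₃,
          add_ofNat, sub_ofNat (w := w) (show u ≤ i + E.Q by omega)]
    refine (r2.seq (B₂ := 13) fun s₄ ⟨c1, c2, c3⟩ => ?_).mono (fun _ h => h) (by norm_num)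
    have f4 : Frame E.wA [41, 42, 43, 44, 45] [6] s s₄ :=
      f3.trans (c1.frame.mono (by simp) (List.nil_subset _))
    refine (E.runs_putChar (hst₃.agree c1 (by simp)) (by simp) c2 c3).mono (fun s₅ d1 => ?_) le_rfl
    refine ⟨(f4.upd E.hw (by norm_num) (by simp) (by omega) _).trans
        (d1.frame.mono (by simp) (List.nil_subset _)), ?_, fun x hix hxq => ?_⟩
    · rw [d1.regs 41 (by simp), State.upd_regs, c1.regs 41 (by simp), h41₃]
    · have hm : ∀ v < 2 * E.q, s₅.mem (addr w E.wA 6 v) = if v = E.q + i then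
          BitVec.ofNat w (if E.Hit ((i + E.Q - u) % E.Q) then E.q + i else 6 * E.q) else if v = i
          then BitVec.ofNat w (if E.Hit ((u + i * E.q) % E.Q) then i else 6 * E.q) else
          s₁.mem (addr w E.wA 6 v) := by
        intro v hv
        rw [d1.mem, upd_mem_addr E.hw _ (by norm_num) (by norm_num) (by omega) (by omega), c1.mem,
          b1.mem, upd_mem_addr E.hw _ (by norm_num) (by norm_num) (by omega) (by omega), a1.mem]
        simp only [true_and]
      rw [hm x (by omega), hm (E.q + x) (by omega), if_neg (by omega : ¬ x = E.q + i)]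
      by_cases hxi : x = i
      · subst hxi
        rw [if_pos rfl, if_pos rfl]
        simp only [pA, pB, decide_eq_true_eq]
        exact ⟨trivial, trivial⟩
      · rw [if_neg hxi, if_neg (by omega : ¬ E.q + x = E.q + i), if_neg (by omega : ¬ E.q + x = i)]
        exact hx x (by omega) hxq
  have hstart : Runs (.op .or 41 2 2) s (Inv E.q) 1 := by
    refine Runs.straight rfl ⟨?_, ?_, fun x h1 h2 => absurd h1 (by omega)⟩ (by simp [Cmd.time])
    · exact ((Agree.refl [41] s).set (by simp) _).frame.mono (by simp) (List.nil_subset _)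
    · simp [det, BinOp.eval, hst.consts.r2]
  refine (hstart.seq fun s₁ hs₁ => Runs.downto (n := E.q) Inv (fun _ => 49) (by have := E.Q_pos; omega)
    (fun i s hs => hs.2.1) hbody hs₁).mono (fun s' hs' => ⟨hs'.1, fun v hv => ?_⟩) ?_
  · have hv' : v < 2 * E.q := by rwa [text, DMOG.gadgetText_length] at hv
    simp only [text, DMOG.gadgetText, List.getElem_map, List.getElem_range]
    by_cases hvq : v < E.q
    · rw [if_pos hvq]; exact (hs'.2.2 v (Nat.zero_le _) hvq).1
    · rw [if_neg hvq]
      have := (hs'.2.2 (v - E.q) (Nat.zero_le _) (by omega)).2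
      rwa [show E.q + (v - E.q) = v by omega] at this
  · rw [Finset.sum_const, Finset.card_range, nsmul_eq_mul]
    rw [show (1 : ℝ≥0∞) + 1 + (E.q * (49 + 1) + 1) = (1 + 1 + 1) + (49 + 1) * E.q by ring]
    norm_num

end Env

end WordRAM

namespace WordRAM

namespace Env

variable {w : ℕ} (E : Env w)

/-- The `t`-th word of the encoding of the `j`-th pattern. -/
noncomputable def dictWord (j t : ℕ) : ℕ :=
  match t with
  | 2 => DMOG.leftChar E.q E.mark j
  | 4 => DMOG.rightChar E.q E.mark j
  | 5 => 0
  | 6 => DMOG.gapWord E.β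
  | _ => 1

/-- Register `46` becomes nonzero if the pair in register `41` is marked. -/
def markCmd : Cmd := block [.op .add 45 16 3, .op .sub 45 45 41, .op .and 47 45 4,
  .op .add 47 12 47,
  .load 46 47, .op .add 45 45 0, .op .and 47 45 4, .op .add 47 12 47, .load 47 47, .op .or 46 46 47,
  .op .add 45 45 0, .op .and 47 45 4, .op .add 47 12 47, .load 47 47, .op .or 46 46 47]

theorem or_eq_zero_word (a b : BitVec w) : a ||| b = 0 ↔ a = 0 ∧ b = 0 := by
  constructor
  · intro h
    constructor <;> ext i hi
    · have := congrArg (fun v : BitVec w => v.getLsbD i) h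
      simp at this
      simp [← BitVec.getLsbD_eq_getElem, this]
    · have := congrArg (fun v : BitVec w => v.getLsbD i) h
      simp at this
      simp [← BitVec.getLsbD_eq_getElem, this]
  · rintro ⟨rfl, rfl⟩; simp

/-- The heads of the three buckets are combined by a bitwise `or`, which vanishes only if all three
buckets are empty. -/
theorem runs_markCmd {s : State w} (hst : E.Static s) {j : ℕ} (hj : j < E.Q)
    (h41 : s.regs 41 = BitVec.ofNat w j) :
    Runs markCmd s (fun s' => Agree [45, 46, 47] s s' ∧ (s'.regs 46 ≠ 0 ↔ E.mark j)) 29 := by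
  have e0 : E.t0 + E.Q - j = E.t0 + 0 + E.Q - j := by omega
  have e1 : E.t0 + E.Q - j + 1 = E.t0 + 1 + E.Q - j := by omega
  have e2 : E.t0 + 1 + E.Q - j + 1 = E.t0 + 2 + E.Q - j := by omega
  have hh : ∀ e, s.mem (addr w E.wA 7 ((E.t0 + e + E.Q - j) % E.Q)) =
      enc w (E.chain (E.τ e j) E.n) := fun e => hst.tables.head _ (E.τ_lt e j)
  refine Runs.straight rfl ⟨?_, ?_⟩ (by norm_num [markCmd, block, Cmd.time])
  · simp only [markCmd, block, det]
    repeat refine Agree.set ?_ (by simp) _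
    exact Agree.refl _ _
  · simp only [markCmd, block, det, BinOp.eval, State.set_regs, State.set_mem,
      Function.update_apply,
      Nat.reduceEqDiff, reduceIte, hst.consts.r0, hst.consts.r3, hst.consts.r4, hst.consts.r12,
      hst.consts.r16, h41, add_ofNat, sub_ofNat (w := w) (show j ≤ E.t0 + E.Q by omega), e1, e2,
      and_Q, addr_add, zero_add, OfNat.zero_ne_ofNat]
    rw [e0, hh, hh, hh, ne_eq, or_eq_zero_word, or_eq_zero_word, enc_chain_eq_zero,
      enc_chain_eq_zero, enc_chain_eq_zero]
    simp only [mark, decide_eq_true_eq]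
    constructor
    · intro h
      by_contra hc
      exact h ⟨⟨fun h0 => hc ⟨0, by norm_num, h0⟩, fun h0 => hc ⟨1, by norm_num, h0⟩⟩,
        fun h0 => hc ⟨2, by norm_num, h0⟩⟩
    · rintro ⟨e, he, hE⟩ ⟨⟨h0, h1⟩, h2⟩
      interval_cases e
      · exact h0 hE
      · exact h1 hE
      · exact h2 hE

/-- Registers `43`, `44` receive the characters of the pattern in register `41`. -/
def charsCmd : Cmd :=
  .seq (.op .lt 42 41 3) (.seq (.ite 42
    (.seq markCmd (.ite 46 (block [.const 43 0, .op .or 44 2 2])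
      (block [.op .add 43 2 2, .op .add 44 43 2])))
    (block [.op .add 45 2 2, .op .add 43 45 2, .op .add 44 43 45]))
    (block [.op .div 45 41 2, .op .add 43 43 45, .op .mod 45 41 2, .op .add 44 44 45]))

abbrev regsD : List ℕ := [41, 42, 43, 44, 45, 46, 47]

theorem runs_charsCmd {s : State w} (hst : E.Static s) {j : ℕ} (hj : j < 2 * E.Q)
    (h41 : s.regs 41 = BitVec.ofNat w j) :
    Runs charsCmd s (fun s' => Agree [42, 43, 44, 45, 46, 47] s s' ∧
      s'.regs 43 = BitVec.ofNat w (DMOG.leftChar E.q E.mark j) ∧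
      s'.regs 44 = BitVec.ofNat w (DMOG.rightChar E.q E.mark j)) 50 := by
  have hQ := E.eight_Q_le
  have hwd := E.word_ge
  have hqQ : E.q ≤ E.Q := by
    rw [Q_eq]; exact Nat.le_mul_of_pos_left _ (by have := E.two_le_q; omega)
  set lo : ℕ := if j < E.Q then (if E.mark j then 0 else 2 * E.q) else 3 * E.q with hlo
  set ro : ℕ := if j < E.Q then (if E.mark j then E.q else 3 * E.q) else 5 * E.q with hro
  have hlt : Runs (.op .lt 42 41 3) s (fun s' => Agree [42, 43, 44, 45, 46, 47] s s' ∧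
      s'.regs 42 = if j < E.Q then 1 else 0) 1 := by
    refine Runs.straight rfl ⟨(Agree.refl _ _).set (by simp) _, ?_⟩ (by simp [Cmd.time])
    simp only [det, State.set_regs, Function.update_self, BinOp.eval, h41, hst.consts.r3,
      toNat_ofNat_lt (w := w) (a := j) (by omega), toNat_ofNat_lt (w := w) (a := E.Q) (by omega)]
  refine (hlt.seq (B₂ := 48) fun s₁ ⟨h1, h2⟩ => ?_).mono (fun _ h => h) (by norm_num)
  have hsel : ∀ C : Cmd, C.straight = true → C.time ≤ 5 → ∀ s₂,
      Agree [42, 43, 44, 45, 46, 47] s s₂ → Agree [42, 43, 44, 45, 46, 47] s₂ (det C s₂) →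
      (det C s₂).regs 43 = BitVec.ofNat w lo → (det C s₂).regs 44 = BitVec.ofNat w ro →
      Runs C s₂ (fun s' => Agree [42, 43, 44, 45, 46, 47] s s' ∧
      s'.regs 43 = BitVec.ofNat w lo ∧ s'.regs 44 = BitVec.ofNat w ro) 5 :=
    fun C hC ht s₂ hs₂ hag h3 h4 => Runs.straight hC ⟨hs₂.trans hag, h3, h4⟩ (by exact_mod_cast ht)
  have hoff : Runs (.ite 42
    (.seq markCmd (.ite 46 (block [.const 43 0, .op .or 44 2 2])
      (block [.op .add 43 2 2, .op .add 44 43 2])))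
    (block [.op .add 45 2 2, .op .add 43 45 2, .op .add 44 43 45])) s₁
    (fun s' => Agree [42, 43, 44, 45, 46, 47] s s' ∧
      s'.regs 43 = BitVec.ofNat w lo ∧ s'.regs 44 = BitVec.ofNat w ro) 38 := by
    refine (Runs.ite (B := 37) (fun h0 => ?_) (fun h0 => ?_)).mono (fun _ h => h) (by norm_num)
    · rw [h2, flag_ne_zero E.w_ne_zero] at h0
      refine ((E.runs_markCmd (hst.agree h1 (by simp)) h0
        ((h1.regs 41 (by simp)).trans h41)).seq (B₂ := 6) fun s₂ ⟨g1, g2⟩ => ?_).mono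
        (fun _ h => h) (by norm_num)
      have hs₂ := h1.trans (g1.mono (by simp))
      have hst₂ := hst.agree hs₂ (by simp)
      refine (Runs.ite (B := 5) (fun hm => ?_) (fun hm => ?_)).mono (fun _ h => h) (by norm_num)
      · rw [g2] at hm
        refine hsel _ rfl (by simp [block, Cmd.time]) s₂ hs₂ ?_ ?_ ?_
        · simp only [block, det]
          repeat refine Agree.set ?_ (by simp) _
          exact Agree.refl _ _
        all_goals simp [block, det, BinOp.eval, hlo, hro, h0, hm, hst₂.consts.r2]
      · rw [← not_not (a := s₂.regs 46 = 0), ← ne_eq, g2] at hm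
        refine hsel _ rfl (by simp [block, Cmd.time]) s₂ hs₂ ?_ ?_ ?_
        · simp only [block, det]
          repeat refine Agree.set ?_ (by simp) _
          exact Agree.refl _ _
        all_goals simp [block, det, BinOp.eval, hlo, hro, h0, hm, hst₂.consts.r2,
          add_ofNat]; congr 1; ring
    · rw [← not_not (a := s₁.regs 42 = 0), ← ne_eq, h2, flag_ne_zero E.w_ne_zero] at h0
      have hst₁ := hst.agree h1 (by simp)
      refine (hsel _ rfl (by simp [block, Cmd.time]) s₁ h1 ?_ ?_ ?_).mono (fun _ h => h)
        (by norm_num)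
      · simp only [block, det]
        repeat refine Agree.set ?_ (by simp) _
        exact Agree.refl _ _
      all_goals simp [block, det, BinOp.eval, hlo, hro, h0, hst₁.consts.r2,
        add_ofNat]; congr 1; ring
  refine (hoff.seq (B₂ := 7) fun s₂ ⟨g1, g2, g3⟩ => ?_).mono (fun _ h => h) (by norm_num)
  have hst₂ := hst.agree g1 (by simp)
  have g41 := (g1.regs 41 (by simp)).trans h41
  refine Runs.straight rfl ⟨g1.trans ?_, ?_, ?_⟩ (by norm_num [block, Cmd.time])
  · simp only [block, det]
    repeat refine Agree.set ?_ (by simp) _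
    exact Agree.refl _ _
  · simp only [block, det, BinOp.eval, State.set_regs, Function.update_apply,
      Nat.reduceEqDiff, reduceIte, hst₂.consts.r2, g41, g2, g3, add_ofNat,
      div_ofNat (w := w) (a := j) (b := E.q) (by omega) (by omega)]
    rw [DMOG.leftChar, ← Q_eq, hlo]
    congr 1
    split_ifs <;> rfl
  · simp only [block, det, BinOp.eval, State.set_regs, Function.update_apply,
      Nat.reduceEqDiff, reduceIte, hst₂.consts.r2, g41, g2, g3, add_ofNat,
      mod_ofNat (w := w) (a := j) (b := E.q) (by omega) (by omega)]
    rw [DMOG.rightChar, ← Q_eq, hro]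
    congr 1
    split_ifs <;> rfl

def storeCmd : Cmd := block [.const 45 7, .op .mul 45 45 41, .op .add 45 11 45, .store 45 0,
  .op .add 45 45 0, .store 45 0, .op .add 45 45 0, .store 45 43, .op .add 45 45 0, .store 45 0,
  .op .add 45 45 0, .store 45 44, .op .add 45 45 0, .const 47 0, .store 45 47, .op .add 45 45 0,
  .store 45 20]

def dictBody : Cmd := .seq (.op .sub 41 41 0) (.seq charsCmd storeCmd)

/-- Write the encoding of the dictionary. -/
def dictCmd : Cmd := .seq (.op .add 41 3 3) (.loop 41 dictBody)

noncomputable def dict : DMOG.Dictionary := DMOG.gadget E.q E.β E.mark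

theorem dict_encode : E.dict.encode.length = 14 * E.Q ∧ ∀ j < 2 * E.Q, ∀ t < 7,
    E.dict.encode[7 * j + t]? = some (E.dictWord j t) := by
  obtain ⟨h1, h2⟩ := DMOG.flatMap_range_getElem? (k := 7) (fun j => [1, 1,
    DMOG.leftChar E.q E.mark j, 1, DMOG.rightChar E.q E.mark j, 0, DMOG.gapWord E.β])
    (fun _ => rfl) (2 * E.Q)
  rw [dict, DMOG.gadget_encode, ← Q_eq]
  refine ⟨by rw [h1]; ring, fun j hj t ht => ?_⟩
  rw [h2 j hj t ht]
  interval_cases t <;> rfl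

theorem runs_storeCmd {s : State w} (hst : E.Static s) {j : ℕ} (hj : j < 2 * E.Q)
    (h41 : s.regs 41 = BitVec.ofNat w j)
    (h43 : s.regs 43 = BitVec.ofNat w (DMOG.leftChar E.q E.mark j))
    (h44 : s.regs 44 = BitVec.ofNat w (DMOG.rightChar E.q E.mark j)) :
    Runs storeCmd s (fun s' => Frame E.wA [45, 47] [6] s s' ∧
      (∀ t < 7, s'.mem (addr w E.wA 6 (7 * j + t)) = BitVec.ofNat w (E.dictWord j t)) ∧
      ∀ v < 14 * E.Q, (∀ t < 7, v ≠ 7 * j + t) →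
        s'.mem (addr w E.wA 6 v) = s.mem (addr w E.wA 6 v)) 40 := by
  have hQ := E.eight_Q_le
  have hwd := E.word_ge
  have hreg := E.region_eq
  have hdet : ∃ r : BitVec w, ∃ r', det storeCmd s = ((((((((s.upd (addr w E.wA 6 (7 * j))
      (BitVec.ofNat w (E.dictWord j 0))).upd (addr w E.wA 6 (7 * j + 1))
      (BitVec.ofNat w (E.dictWord j 1))).upd (addr w E.wA 6 (7 * j + 2))
      (BitVec.ofNat w (E.dictWord j 2))).upd (addr w E.wA 6 (7 * j + 3))
      (BitVec.ofNat w (E.dictWord j 3))).upd (addr w E.wA 6 (7 * j + 4))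
      (BitVec.ofNat w (E.dictWord j 4))).upd (addr w E.wA 6 (7 * j + 5))
      (BitVec.ofNat w (E.dictWord j 5))).upd (addr w E.wA 6 (7 * j + 6))
      (BitVec.ofNat w (E.dictWord j 6))).set 45 r).set 47 r' := by
    refine ⟨addr w E.wA 6 (7 * j + 6), BitVec.ofNat w 0, ?_⟩
    simp only [storeCmd, block, det, BinOp.eval, State.set_regs, State.upd_regs,
      Function.update_apply, Nat.reduceEqDiff, reduceIte, hst.consts.r0, hst.consts.r11,
      hst.consts.r20, h41, h43, h44, mul_ofNat, addr_add, zero_add, OfNat.zero_ne_ofNat,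
      add_assoc, Nat.reduceAdd]
    simp only [State.upd, State.set, dictWord, State.mk.injEq, and_true]
    funext r
    simp only [Function.update_apply]
    split_ifs <;> first | rfl | omega
  obtain ⟨r, r', hdet⟩ := hdet
  have hm : ∀ v < 14 * E.Q, (det storeCmd s).mem (addr w E.wA 6 v) =
      if v = 7 * j + 6 then BitVec.ofNat w (E.dictWord j 6) else
      if v = 7 * j + 5 then BitVec.ofNat w (E.dictWord j 5) else
      if v = 7 * j + 4 then BitVec.ofNat w (E.dictWord j 4) else
      if v = 7 * j + 3 then BitVec.ofNat w (E.dictWord j 3) else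
      if v = 7 * j + 2 then BitVec.ofNat w (E.dictWord j 2) else
      if v = 7 * j + 1 then BitVec.ofNat w (E.dictWord j 1) else
      if v = 7 * j then BitVec.ofNat w (E.dictWord j 0) else s.mem (addr w E.wA 6 v) := by
    intro v hv
    rw [hdet, State.set_mem, State.set_mem]
    iterate 7 rw [upd_mem_addr E.hw _ (by norm_num) (by norm_num) (by omega) (by omega)]
    simp only [true_and]
  refine Runs.straight rfl ⟨?_, fun t ht => ?_, fun v hv hne => ?_⟩
    (by norm_num [storeCmd, block, Cmd.time])
  · rw [hdet]
    refine Frame.trans ?_ (((Agree.refl [45, 47] _).set (by simp) _).set (by simp) _).frame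
    iterate 7 refine Frame.upd ?_ E.hw (by norm_num) (by simp) (by omega) _
    exact Frame.refl _ _ _
  · rw [hm _ (by omega)]
    interval_cases t <;> simp
  · rw [hm v hv]
    have := hne 0 (by norm_num)
    rw [if_neg (hne 6 (by norm_num)), if_neg (hne 5 (by norm_num)), if_neg (hne 4 (by norm_num)),
      if_neg (hne 3 (by norm_num)), if_neg (hne 2 (by norm_num)), if_neg (hne 1 (by norm_num)),
      if_neg (by simpa using this)]

theorem runs_dictCmd {s : State w} (hst : E.Static s) :
    Runs dictCmd s (fun s' => Frame E.wA regsD [6] s s' ∧ ∀ v (h : v < E.dict.encode.length),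
      s'.mem (addr w E.wA 6 v) = BitVec.ofNat w (E.dict.encode)[v]) (3 + 200 * E.Q) := by
  have hQ := E.eight_Q_le
  have hwd := E.word_ge
  have hQ0 := E.Q_pos
  set Inv : ℕ → State w → Prop := fun i s' => Frame E.wA regsD [6] s s' ∧
    s'.regs 41 = BitVec.ofNat w i ∧ ∀ j, i ≤ j → j < 2 * E.Q → ∀ t < 7,
      s'.mem (addr w E.wA 6 (7 * j + t)) = BitVec.ofNat w (E.dictWord j t) with hInv
  have hbody : ∀ i < 2 * E.Q, ∀ s₁, Inv (i + 1) s₁ → Runs dictBody s₁ (Inv i) 99 := by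
    intro i hi s₁ ⟨hf, h41, hx⟩
    have hst₁ := hst.frame hf (by simp) (by simp)
    have r1 : Runs (.op .sub 41 41 0) s₁ (fun s' => Agree [41] s₁ s' ∧
        s'.regs 41 = BitVec.ofNat w i) 1 := by
      refine Runs.straight rfl ⟨(Agree.refl _ _).set (by simp) _, ?_⟩ (by simp [Cmd.time])
      simp only [det, State.set_regs, Function.update_self, BinOp.eval, h41, hst₁.consts.r0]
      rw [sub_ofNat (by omega), Nat.add_sub_cancel]
    refine (r1.seq (B₂ := 91) fun s₂ ⟨a1, a2⟩ => ?_).mono (fun _ h => h) (by norm_num)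
    have hst₂ := hst₁.agree a1 (by simp)
    refine ((E.runs_charsCmd hst₂ hi a2).seq (B₂ := 40) fun s₃ ⟨b1, b2, b3⟩ => ?_).mono
      (fun _ h => h) (by norm_num)
    have h41₃ := (b1.regs 41 (by simp)).trans a2
    refine (E.runs_storeCmd (hst₂.agree b1 (by simp)) hi h41₃ b2 b3).mono
      (fun s₄ ⟨c1, c2, c3⟩ => ⟨?_, (c1.regs 41 (by simp)).trans h41₃, fun j hij hj t ht => ?_⟩)
      le_rfl
    · exact ((hf.trans (a1.frame.mono (by simp) (List.nil_subset _))).trans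
        (b1.frame.mono (by simp) (List.nil_subset _))).trans (c1.mono (by simp) (by simp))
    · rcases Nat.eq_or_lt_of_le hij with rfl | hlt
      · exact c2 t ht
      · rw [c3 _ (by omega) (fun t' ht' => by omega), b1.mem, a1.mem]
        exact hx j hlt hj t ht
  have hstart : Runs (.op .add 41 3 3) s (Inv (2 * E.Q)) 1 := by
    refine Runs.straight rfl ⟨?_, ?_, fun x h1 h2 => absurd h1 (by omega)⟩ (by simp [Cmd.time])
    · exact ((Agree.refl [41] s).set (by simp) _).frame.mono (by simp) (List.nil_subset _)
    · simp [det, BinOp.eval, hst.consts.r3, add_ofNat, two_mul]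
  refine (hstart.seq fun s₁ hs₁ => Runs.downto (n := 2 * E.Q) Inv (fun _ => 99) (by omega)
    (fun i s hs => hs.2.1) hbody hs₁).mono (fun s' hs' => ⟨hs'.1, fun v hv => ?_⟩) ?_
  · rw [E.dict_encode.1] at hv
    have h1 := E.dict_encode.2 (v / 7) (by omega) (v % 7) (Nat.mod_lt _ (by norm_num))
    have h2 := hs'.2.2 (v / 7) (Nat.zero_le _) (by omega) (v % 7) (Nat.mod_lt _ (by norm_num))
    simp only [Nat.div_add_mod] at h1 h2
    rw [h2, List.getElem_of_getElem? h1 |>.2]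
  · rw [Finset.sum_const, Finset.card_range, nsmul_eq_mul]
    push_cast
    rw [show (1 : ℝ≥0∞) + 1 + (2 * E.Q * (99 + 1) + 1) = (1 + 1 + 1) + (2 * (99 + 1)) * E.Q by ring]
    norm_num

/-- Copy the registers of the first phase to those of the second phase. -/
def copyRegs : ℕ → Cmd
  | 0 => .skip
  | M + 1 => .seq (copyRegs M) (.op .or (65 + 2 * M) (64 + 2 * M) (64 + 2 * M))

theorem copyRegs_straight (M : ℕ) : (copyRegs M).straight = true ∧ (copyRegs M).time = 1 + 2 * M := by
  induction M with
  | zero => exact ⟨rfl, rfl⟩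
  | succ M ih => simp [copyRegs, Cmd.straight, Cmd.time, ih]; ring

theorem det_copyRegs (M : ℕ) (s : State w) :
    (∀ r, (∀ x < M, r ≠ 65 + 2 * x) → (det (copyRegs M) s).regs r = s.regs r) ∧
    (∀ x < M, (det (copyRegs M) s).regs (65 + 2 * x) = s.regs (64 + 2 * x)) ∧
    (det (copyRegs M) s).mem = s.mem ∧ (det (copyRegs M) s).input = s.input ∧
    (det (copyRegs M) s).consumed = s.consumed ∧ (det (copyRegs M) s).out = s.out := by
  induction M with
  | zero => simp [copyRegs, det]
  | succ M ih =>
    obtain ⟨h1, h2, h3, h4⟩ := ih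
    simp only [copyRegs, det, State.set_regs, State.set_mem, BinOp.eval, BitVec.or_self]
    refine ⟨fun r hr => ?_, fun x hx => ?_, h3, h4⟩
    · rw [Function.update_of_ne (hr M (by omega)), h1 r fun x hx => hr x (by omega)]
    · rcases Nat.lt_succ_iff_lt_or_eq.1 hx with h | rfl
      · rw [Function.update_of_ne (by omega), h2 x h]
      · rw [Function.update_self, h1 _ fun x _ => by omega]

end Env

end WordRAM

/-! ### One query: simulation on the text and search of the reports -/

namespace WordRAM

namespace Env

open DMOG

variable {w : ℕ} (E : Env w)

/-- Two interleaved banks of registers: the even one keeps the result of the preprocessing, the odd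
one is the working copy of the current query. -/
def φ₀ (x : ℕ) : ℕ := 64 + 2 * x
def φ₁ (x : ℕ) : ℕ := 65 + 2 * x

open Classical in
/-- The pairs that are reported for the text of `u`. -/
noncomputable def cand (u : ℕ) : Finset ℕ :=
  (Finset.range E.Q).filter fun z => E.mark z ∧ E.pA u (z / E.q) ∧ E.pB u (z % E.q)

def DirtyU (u : ℕ) : Prop := ∃ z ∈ E.cand u, E.DirtyA u z

open Classical in
/-- The cost of checking the pairs that are reported for the text of `u`. -/
noncomputable def costU (u : ℕ) : ℝ≥0∞ :=
  ∑ z ∈ E.cand u, ((if E.DirtyA u z then 0 else 32) + E.costA u z)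

/-- The index of the pattern determines the location, so nothing is lost by keeping only second
components. Online and offline correctness can thus be treated alike. -/
theorem mem_correct {u : ℕ} {mode : Mode} {s : State E.wA}
    (h : Algorithm.Correct mode E.dict (E.text u) s) (v : ℕ) :
    (∃ e ∈ s.out, e.snd.toNat = v) ↔ v ∈ E.cand u := by
  have hβ : ∀ b ∈ E.β, 2 * E.q ≤ b := by
    intro b hb
    rcases E.hβ with h | h <;> rw [h] at hb
    · simp at hb
    · simp only [Option.mem_def, Option.some.injEq] at hb; rw [← hb]; rfl
  have hocc := fun o => mem_occurrences_gadget (mark := E.mark) E.two_le_q hβ (E.pA u) (E.pB u) o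
  have h1 := h.1
  simp only [cand, Finset.mem_filter, Finset.mem_range]
  constructor
  · rintro ⟨e, he, rfl⟩
    have h2 : (e.fst.toNat, e.snd.toNat) ∈ occurrences E.dict (E.text u) := by
      rw [← h1]; exact ⟨e, he, rfl⟩
    have := (hocc _).1 h2
    rw [← Q_eq] at this
    exact ⟨this.1, this.2.1, this.2.2.1, this.2.2.2.1⟩
  · rintro ⟨h2, h3, h4, h5⟩
    rw [Q_eq] at h2
    have := (hocc (E.q + v % E.q + 1, v)).2 ⟨h2, h3, h4, h5, rfl⟩
    change _ ∈ occurrences E.dict (E.text u) at this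
    rw [← h1] at this
    obtain ⟨e, he, h6⟩ := this
    exact ⟨e, he, (Prod.mk.inj h6).2.symm⟩

/-- The state between two queries; the stamps up to `m` have not been used. -/
structure Ready (M : ℕ) (sA : State E.wA) (i m : ℕ) (S : State w) : Prop where
  static : E.Static S
  r40 : S.regs 40 = BitVec.ofNat w i
  regs : ∀ x < M, S.regs (φ₀ x) = BitVec.ofNat w (sA.regs x).toNat
  mem : ∀ v : BitVec E.wA, S.mem (addr w E.wA 1 v.toNat) = BitVec.ofNat w (sA.mem v).toNat
  -- The texts are processed with decreasing `u` and stamp `u + 1`. Hence a cell is unstamped or has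
  -- a stamp larger than all those to come, and zero is never a query stamp.
  stamp : ∀ j ∈ [3, 4], ∀ v < 2 ^ (E.wA + 4), ∃ k, S.mem (addr w E.wA j v) = BitVec.ofNat w k ∧
    (k = 0 ∨ m < k) ∧ k ≤ E.Q
  out : S.out = []

theorem Ready.frame {E : Env w} {M : ℕ} {sA : State E.wA} {i m : ℕ} {R J : List ℕ} {S S' : State w}
    (h : E.Ready M sA i m S) (hf : Frame E.wA R J S S')
    (hR : ∀ r ∈ R, 32 ≤ r ∧ r < 64 ∧ r ≠ 40) (hJ : ∀ j ∈ J, j ∉ [0, 1, 3, 4, 7, 8]) :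
    E.Ready M sA i m S' := by
  refine ⟨h.static.frame hf (fun r hr => (hR r hr).1) fun j hj hj' => hJ j hj ?_,
    (hf.regs 40 fun h => (hR 40 h).2.2 rfl).trans h.r40, fun x hx => ?_, fun v => ?_,
    fun j hj v hv => ?_, hf.out.trans h.out⟩
  · simp at hj' ⊢; omega
  · rw [hf.regs _ fun h => by have := (hR _ h).2.1; simp only [φ₀] at this; omega]
    exact h.regs x hx
  · rw [hf.mem 1 (by norm_num) (fun h => hJ 1 h (by simp)) _ (BitVec.toNat_lt_region v)]
    exact h.mem v
  · rw [hf.mem j (by simp at hj; omega) (fun h => hJ j h (by simp at hj ⊢; omega)) v hv]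
    exact h.stamp j hj v hv

def querySetup : Cmd := block [.op .add 32 40 0, .op .or 33 14 14, .const 34 0, .op .add 35 2 2,
  .const 36 0]

def queryCmd (M : ℕ) (query : Cmd) : Cmd :=
  .seq textCmd (.seq (.seq querySetup (copyRegs M)) (.seq (comp φ₁ query) checkList))

theorem char_lt {u : ℕ} {a : ℕ} (h : a ∈ E.text u) : a < 2 ^ E.wA := by
  have h1 := gadgetText_alphabet E.two_le_q h
  have h2 := E.eight_Q_le
  have h3 := E.Q_pos
  rw [← Q_eq] at h1
  omega

open Classical in
theorem runs_queryCmd {M : ℕ} {query : Cmd} (hM : query.regBound ≤ M) {mode : Mode}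
    {sA : State E.wA} {u : ℕ} (hu : u < E.Q) {S : State w} (hS : E.Ready M sA u (u + 1) S)
    (h39 : S.regs 39 = 0) (hq : Computes query (sA.feed (toWords E.wA (E.text u)))
      (Algorithm.Correct mode E.dict (E.text u))) :
    Runs (queryCmd M query) S (fun S' => E.Ready M sA u u S' ∧
        S'.regs 39 = if E.DirtyU u then 1 else 0)
      (30 + 2 * M + 50 * E.q + 30 * expTime query (sA.feed (toWords E.wA (E.text u))) + E.costU u +
        if E.DirtyU u then E.costTop + 75 else 0) := by
  have hQ := E.eight_Q_le
  have hwd := E.word_ge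
  have hreg := E.region_eq
  have hQ0 := E.Q_pos
  have hqQ : E.q ≤ E.Q := by
    rw [Q_eq]; exact Nat.le_mul_of_pos_left _ (by have := E.two_le_q; omega)
  set sQ := sA.feed (toWords E.wA (E.text u)) with hsQ
  have hinner : ∀ S₁, Frame E.wA [41, 42, 43, 44, 45] [6] S S₁ ∧
      (∀ v (h : v < (E.text u).length), S₁.mem (addr w E.wA 6 v) = BitVec.ofNat w (E.text u)[v]) →
      Runs (.seq (.seq querySetup (copyRegs M)) (.seq (comp φ₁ query) checkList)) S₁
      (fun S' => E.Ready M sA u u S' ∧ S'.regs 39 = if E.DirtyU u then 1 else 0)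
      (1 + (1 + 9 + (1 + 2 * M)) + (1 + 30 * expTime query sQ + (1 + E.costU u +
        if E.DirtyU u then E.costTop + 75 else 0))) := by
    intro S₁ ⟨hf₁, htext⟩
    have hS₁ := hS.frame hf₁ (by simp) (by simp)
    have h39₁ : S₁.regs 39 = 0 := (hf₁.regs 39 (by simp)).trans h39
    have r1 : Runs querySetup S₁ (fun S' => Agree [32, 33, 34, 35, 36] S₁ S' ∧
        S'.regs 32 = BitVec.ofNat w (u + 1) ∧ S'.regs 33 = addr w E.wA 2 0 ∧
        S'.regs 34 = BitVec.ofNat w 0 ∧ S'.regs 35 = BitVec.ofNat w (2 * E.q) ∧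
        S'.regs 36 = BitVec.ofNat w 0) 9 := by
      refine Runs.straight rfl ⟨?_, ?_, ?_, ?_, ?_, ?_⟩ (by norm_num [querySetup, block, Cmd.time])
      · simp only [querySetup, block, det]
        repeat refine Agree.set ?_ (by simp) _
        exact Agree.refl _ _
      all_goals
        simp only [querySetup, block, det, BinOp.eval, State.set_regs, Function.update_apply,
          Nat.reduceEqDiff, reduceIte, hS₁.static.consts.r0, hS₁.r40,
          hS₁.static.consts.r14, hS₁.static.consts.r2, add_ofNat, BitVec.or_self, two_mul]
    have r2 : Runs (.seq querySetup (copyRegs M)) S₁ (fun S' => E.Ready M sA u (u + 1) S' ∧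
        S'.regs 39 = 0 ∧ SimBase E.wA M φ₁ (u + 1) 2 S' ∧ Sim M φ₁ (u + 1) 2 S' sQ S')
        (1 + 9 + (1 + 2 * M)) := by
      refine r1.seq fun S₂ ⟨a, a32, a33, a34, a35, a36⟩ => ?_
      have hS₂ : E.Ready M sA u (u + 1) S₂ := hS₁.frame (J := []) a.frame (by simp) (by simp)
      obtain ⟨c1, c2, c3, c4, c5, c6⟩ := det_copyRegs M S₂
      have c1' : ∀ r < 65, (det (copyRegs M) S₂).regs r = S₂.regs r := fun r hr =>
        c1 r fun x _ => by omega
      have hS₃ : E.Ready M sA u (u + 1) (det (copyRegs M) S₂) := by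
        refine ⟨⟨hS₂.static.consts.congr fun r hr => c1' r (by omega),
          hS₂.static.tables.congr fun j _ v _ => by rw [c3]⟩, (c1' 40 (by norm_num)).trans hS₂.r40,
          fun x hx => ?_, ?_, ?_, c6.trans hS₂.out⟩
        · rw [c1 _ fun y _ => by simp only [φ₀]; omega]; exact hS₂.regs x hx
        · rw [c3]; exact hS₂.mem
        · rw [c3]; exact hS₂.stamp
      -- No cell has the stamp of this query yet. So the simulated memory is the one left by the
      -- preprocessing, and the list of reports is empty, without any cleaning.
      have hstamp : ∀ j ∈ [3, 4], ∀ v : BitVec E.wA,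
          (det (copyRegs M) S₂).mem (addr w E.wA j v.toNat) ≠ BitVec.ofNat w (u + 1) := by
        intro j hj v
        obtain ⟨k, h1, h2, h3⟩ := hS₂.stamp j hj v.toNat (BitVec.toNat_lt_region v)
        rw [c3, h1]
        intro e
        rw [ofNat_inj (by omega) (by omega)] at e
        omega
      refine Runs.straight (copyRegs_straight M).1 ⟨hS₃, ?_, ⟨?_, E.hw, ?_, ?_, Or.inr rfl, ?_, ?_,
        ?_, ?_, ?_, ?_, ?_, ?_, ?_, ?_⟩, ⟨fun x hx => ?_, fun v => ?_, ?_, ?_, fun _ _ _ => rfl,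
        fun _ _ _ _ _ => rfl, fun _ _ _ _ => Or.inl rfl, ⟨rfl, rfl, rfl⟩⟩⟩
        (by rw [(copyRegs_straight M).2]; push_cast; rfl)
      · rw [c1' 39 (by norm_num), a.regs 39 (by simp), h39₁]
      · have := E.hσ; omega
      · intro x y h; simp only [φ₁] at h; omega
      · intro x; simp only [φ₁]; omega
      · exact hS₃.static.consts.r0
      · exact hS₃.static.consts.r5
      · exact hS₃.static.consts.r6
      · exact hS₃.static.consts.r7
      · exact hS₃.static.consts.r8
      · exact hS₃.static.consts.r9
      · exact hS₃.static.consts.r10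
      · exact hS₃.static.consts.r11
      · rw [c1' 32 (by norm_num), a32]
      · rw [c1' 33 (by norm_num), a33]
      · rw [φ₁, c2 x hx]; exact hS₂.regs x hx
      · rw [if_neg (hstamp 3 (by simp) v)]; exact hS₃.mem v
      · have hlen : sQ.input.length = 2 * E.q := by
          simp [hsQ, State.feed, toWords, text, gadgetText_length]
        refine ⟨0, by rw [c1' 34 (by norm_num), a34], by
          rw [c1' 35 (by norm_num), a35, hlen, zero_add], by omega, fun i hi => ?_⟩
        have hi' : i < (E.text u).length := by simpa [hsQ, State.feed, toWords] using hi
        rw [c3, a.mem, zero_add, htext i hi']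
        have : sQ.input[i] = BitVec.ofNat E.wA (E.text u)[i] := by simp [hsQ, State.feed, toWords]
        rw [this, toNat_ofNat_lt (E.char_lt (List.getElem_mem hi'))]
      · refine ⟨[], List.nodup_nil, by rw [c1' 36 (by norm_num), a36]; rfl, by simp, fun v => ?_,
          fun v => ?_⟩
        · simp [hsQ, State.feed]
        · exact iff_of_false (hstamp 4 (by simp) v) (by simp)
    refine r2.seq fun S₃ ⟨hS₃, h39₃, hb, hsim⟩ => ?_
    refine (Runs.comp hb hM hsim hq).seq fun S₄ ⟨s', hs', hsim'⟩ => ?_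
    have hr : ∀ r ≤ 64, r ∉ [34, 36, 37, 38] → S₄.regs r = S₃.regs r := fun r hr h =>
      hsim'.frame_regs r (fun x _ => by simp only [φ₁]; omega) h
    have hm : ∀ j ∈ [0, 1, 7, 8], ∀ v < 2 ^ (E.wA + 4),
        S₄.mem (addr w E.wA j v) = S₃.mem (addr w E.wA j v) := fun j hj v hv =>
      hsim'.frame_mem j (by simp at hj; omega) (by simp at hj ⊢; omega) v hv
    have hS₄ : E.Ready M sA u u S₄ := by
      refine ⟨⟨hS₃.static.consts.congr fun r h => hr r (by omega) (by simp; omega),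
        hS₃.static.tables.congr fun j hj v hv => hm j (by simp at hj ⊢; omega) v hv⟩,
        (hr 40 (by norm_num) (by simp)).trans hS₃.r40, fun x hx => ?_, fun v => ?_,
        fun j hj v hv => ?_, hsim'.io.2.2.trans hS₃.out⟩
      · rw [hsim'.frame_regs _ (fun y _ => by simp only [φ₁, φ₀]; omega)
          (by simp [φ₀]; omega)]
        exact hS₃.regs x hx
      · rw [hm 1 (by simp) _ (BitVec.toNat_lt_region v)]; exact hS₃.mem v
      · rcases hsim'.stamp j hj v hv with h | h
        · obtain ⟨k, h1, h2, h3⟩ := hS₃.stamp j hj v hv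
          exact ⟨k, h.trans h1, by omega, h3⟩
        · exact ⟨u + 1, h, by omega, by omega⟩
    obtain ⟨l, hl1, hl2, hl3, hl4, _⟩ := hsim'.emitted
    have hl : ∀ v, v ∈ l ↔ v ∈ E.cand u := fun v => by
      rw [hl4, E.mem_correct hs']; simp
    have hlF : l.toFinset = E.cand u := by ext v; simp [hl]
    have hlt : ∀ z ∈ l, z < E.Q := fun z hz => by
      have := (hl z).1 hz
      simp only [cand, Finset.mem_filter, Finset.mem_range] at this
      exact this.1
    have hdirty : (∃ z ∈ l, E.DirtyA u z) ↔ E.DirtyU u := by simp only [hl, DirtyU]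
    have h39₄ : S₄.regs 39 = 0 := (hr 39 (by norm_num) (by simp)).trans h39₃
    refine (E.runs_checkList hS₄.static (l := l) hu.le hlt ?_ hS₄.r40 hl2 hl3 h39₄).mono
      (fun S₅ hS₅ => ⟨?_, ?_⟩) ?_
    · rw [← List.toFinset_card_of_nodup hl1, ← Finset.card_range E.Q]
      exact Finset.card_le_card fun z hz => Finset.mem_range.2 (hlt z (List.mem_toFinset.1 hz))
    · exact hS₄.frame (J := []) hS₅.agree.frame (by simp) (by simp)
    · split_ifs with hd
      · exact hS₅.pos (hdirty.2 hd)
      · exact (hS₅.neg (mt hdirty.1 hd)).trans h39₄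
    · simp only [hdirty]
      rw [costU, costL, ← hlF, List.sum_toFinset _ hl1]
  refine ((E.runs_textCmd hS.static hu.le hS.r40).seq hinner).mono (fun _ h => h) ?_
  rw [show (1 : ℝ≥0∞) + (3 + 50 * E.q) + (1 + (1 + 9 + (1 + 2 * M)) + (1 + 30 * expTime query sQ +
    (1 + E.costU u + if E.DirtyU u then E.costTop + 75 else 0))) = (1 + 3 + 1 + 1 + 9 + 1 + 1 + 1) +
    2 * M + 50 * E.q + 30 * expTime query sQ + E.costU u +
    if E.DirtyU u then E.costTop + 75 else 0 by ring]
  gcongr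
  norm_num

end Env

end WordRAM

/-! ### Preprocessing followed by all queries -/

namespace WordRAM

namespace Env

open DMOG

variable {w : ℕ} (E : Env w)

/-- No zero triple is found before the text of `u` is processed. -/
def Visited (u : ℕ) : Prop := ¬ ∃ u' < E.Q, u < u' ∧ E.DirtyU u'

open Classical in
noncomputable def queryCost (M : ℕ) (query : Cmd) (sA : State E.wA) (u : ℕ) : ℝ≥0∞ :=
  if E.Visited u then 30 + 2 * M + 50 * E.q +
    30 * expTime query (sA.feed (toWords E.wA (E.text u))) + E.costU u +
      if E.DirtyU u then E.costTop + 75 else 0 else 0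

def queriesBody (M : ℕ) (query : Cmd) : Cmd :=
  .seq (.op .sub 40 40 0) (.ite 39 .skip (queryCmd M query))

def queriesCmd (M : ℕ) (query : Cmd) : Cmd :=
  .seq (.loop 40 (queriesBody M query)) (.ite 39 (.emit 0 0) .skip)

theorem runs_emit {s : State w} {x y : ℕ} {Post : State w → Prop}
    (h : Post ⟨s.regs, s.mem, s.input, s.consumed, ⟨s.consumed, s.regs x, s.regs y⟩ :: s.out⟩) :
    Runs (.emit x y) s Post 1 := by
  intro f X hf
  simp only [ert]
  gcongr
  exact hf _ h

/-- Once a zero triple has been found, the remaining texts are skipped at constant cost, which is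
why `queryCost` vanishes on unvisited `u`. -/
theorem runs_queriesCmd {M : ℕ} {query : Cmd} (hM : query.regBound ≤ M) {mode : Mode}
    {sA : State E.wA} {S : State w} (hS : E.Ready M sA E.Q E.Q S) (h39 : S.regs 39 = 0)
    (hq : ∀ u < E.Q, Computes query (sA.feed (toWords E.wA (E.text u)))
      (Algorithm.Correct mode E.dict (E.text u))) :
    Runs (queriesCmd M query) S (fun S' => S'.out ≠ [] ↔ ∃ u < E.Q, E.DirtyU u)
      (4 + ∑ u ∈ Finset.range E.Q, (6 + E.queryCost M query sA u)) := by
  classical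
  have hQ := E.eight_Q_le
  have hwd := E.word_ge
  have hQ0 := E.Q_pos
  set Inv : ℕ → State w → Prop := fun i S' => E.Ready M sA i i S' ∧
    S'.regs 39 = if ∃ u < E.Q, i ≤ u ∧ E.DirtyU u then 1 else 0 with hInv
  have hbody : ∀ u < E.Q, ∀ S₁, Inv (u + 1) S₁ → Runs (queriesBody M query) S₁ (Inv u)
      (5 + E.queryCost M query sA u) := by
    intro u hu S₁ ⟨h1, h2⟩
    have hsub : Runs (.op .sub 40 40 0) S₁ (fun S' => E.Ready M sA u (u + 1) S' ∧
        S'.regs 39 = S₁.regs 39) 1 := by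
      have h40 : (det (.op .sub 40 40 0) S₁).regs 40 = BitVec.ofNat w u := by
        simp only [det, State.set_regs, Function.update_self, BinOp.eval, h1.r40,
          h1.static.consts.r0]
        rw [sub_ofNat (by omega), Nat.add_sub_cancel]
      have hr : ∀ r ≠ 40, (det (.op .sub 40 40 0) S₁).regs r = S₁.regs r := fun r hr => by
        simp [det, hr]
      refine Runs.straight rfl ⟨⟨⟨h1.static.consts.congr fun r h => hr r (by omega),
        h1.static.tables.congr fun j _ v _ => rfl⟩, h40, fun x hx => ?_, h1.mem, h1.stamp, h1.out⟩,
        hr 39 (by norm_num)⟩ (by simp [Cmd.time])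
      rw [hr _ (by simp only [φ₀]; omega)]; exact h1.regs x hx
    have hiff : (∃ u' < E.Q, u ≤ u' ∧ E.DirtyU u') ↔
        (∃ u' < E.Q, u + 1 ≤ u' ∧ E.DirtyU u') ∨ E.DirtyU u := by
      constructor
      · rintro ⟨u', h1, h2, h3⟩
        rcases Nat.eq_or_lt_of_le h2 with rfl | h
        · exact Or.inr h3
        · exact Or.inl ⟨u', h1, h, h3⟩
      · rintro (⟨u', h1, h2, h3⟩ | h)
        · exact ⟨u', h1, by omega, h3⟩
        · exact ⟨u, hu, le_rfl, h⟩
    refine (hsub.seq (B₂ := 2 + E.queryCost M query sA u) fun S₂ ⟨h3, h4⟩ => ?_).mono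
      (fun _ h => h) ?_
    · by_cases hv : ∃ u' < E.Q, u + 1 ≤ u' ∧ E.DirtyU u'
      · rw [if_pos hv] at h2
        refine (Runs.ite (B := 1) (fun _ => ?_) (fun h => ?_)).mono (fun _ h => h) ?_
        · refine Runs.straight rfl ⟨⟨h3.static, h3.r40, h3.regs, h3.mem, fun j hj v hv => ?_,
            h3.out⟩, ?_⟩ (by simp [Cmd.time])
          · obtain ⟨k, h1, h2, h3⟩ := h3.stamp j hj v hv
            exact ⟨k, h1, by omega, h3⟩
          · simp only [det]
            rw [h4, h2, if_pos (hiff.2 (Or.inl hv))]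
        · rw [h4, h2] at h
          exact absurd h (one_ne_zero_word E.w_ne_zero)
        · calc (1 : ℝ≥0∞) + 1 = 2 := by norm_num
            _ ≤ _ := le_self_add
      · rw [if_neg hv] at h2
        refine (Runs.ite (B := E.queryCost M query sA u) (fun h => ?_) (fun _ => ?_)).mono
          (fun _ h => h) ?_
        · rw [h4, h2] at h; exact absurd rfl h
        · rw [queryCost, if_pos (show E.Visited u from hv)]
          refine (E.runs_queryCmd hM hu h3 (h4.trans h2) (hq u hu)).mono
            (fun S₃ h => ⟨h.1, ?_⟩) le_rfl
          rw [h.2]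
          simp only [hiff, hv, false_or]
        · gcongr; norm_num
    · rw [← add_assoc]; gcongr; norm_num
  have hstart : Inv E.Q S := by
    refine ⟨hS, ?_⟩
    rw [if_neg (by rintro ⟨u, h1, h2, _⟩; omega), h39]
  refine ((Runs.downto (n := E.Q) Inv _ (by omega) (fun i s hs => hs.1.r40) hbody hstart).seq
    (B₂ := 2) fun S' ⟨h1, h2⟩ => ?_).mono (fun _ h => h) ?_
  · have h2' : S'.regs 39 = if ∃ u < E.Q, E.DirtyU u then 1 else 0 := by
      rw [h2]; simp
    refine (Runs.ite (B := 1) (fun h => ?_) (fun h => ?_)).mono (fun _ h => h) (by norm_num)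
    · rw [h2', flag_ne_zero E.w_ne_zero] at h
      exact runs_emit (iff_of_true (by simp) h)
    · rw [← not_not (a := S'.regs 39 = 0), ← ne_eq, h2', flag_ne_zero E.w_ne_zero] at h
      refine Runs.straight rfl (iff_of_false ?_ h) (by simp [Cmd.time])
      simp [det, h1.out]
  · have : ∀ u, (5 : ℝ≥0∞) + E.queryCost M query sA u + 1 = 6 + E.queryCost M query sA u := by
      intro u; rw [add_right_comm]; norm_num
    simp only [this]
    rw [show ∀ x : ℝ≥0∞, 1 + (x + 1) + 2 = 1 + 1 + 2 + x from fun x => by ring]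
    norm_num

def preSetup : Cmd := block [.const 32 0, .op .or 33 7 7, .const 34 0, .const 35 14,
  .op .mul 35 35 3, .const 36 0, .op .or 40 3 3]

/-- Everything that follows the construction of the tables. -/
def mainCmd (M : ℕ) (pre query : Cmd) : Cmd :=
  .seq dictCmd (.seq preSetup (.seq (comp φ₀ pre) (queriesCmd M query)))

theorem dict_lt {a : ℕ} (h : a ∈ E.dict.encode) : a < 2 ^ E.wA := by
  have h2 := E.eight_Q_le
  have h3 := E.Q_pos
  have h4 := E.two_le_q
  have h5 : 2 * E.q ≤ E.Q := by rw [Q_eq]; exact Nat.mul_le_mul_right _ h4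
  rw [dict, gadget_encode, List.mem_flatMap] at h
  obtain ⟨j, hj, h⟩ := h
  rw [List.mem_range, ← Q_eq] at hj
  have hg : gapWord E.β ≤ 2 * E.q + 1 := by
    rcases E.hβ with h | h <;> simp [h, gapWord, q]
  have hd : j / E.q < 2 * E.q :=
    (Nat.div_lt_iff_lt_mul (by omega)).2 (by rw [Q_eq] at hj; linarith)
  have hmod := Nat.mod_lt j (show 0 < E.q by omega)
  simp only [List.mem_cons, List.not_mem_nil, or_false] at h
  rcases h with rfl | rfl | rfl | rfl | rfl | rfl | rfl
  · omega
  · omega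
  · rw [leftChar]; split_ifs <;> omega
  · omega
  · rw [rightChar]; split_ifs <;> omega
  · omega
  · omega

theorem runs_mainCmd {M : ℕ} {pre query : Cmd} (hMp : pre.regBound ≤ M) (hM : query.regBound ≤ M)
    {mode : Mode} {S : State w} (hst : E.Static S) (h39 : S.regs 39 = 0)
    (h64 : ∀ r, 48 ≤ r → S.regs r = 0)
    (hzero : ∀ j ∈ [1, 3, 4], ∀ v < 2 ^ (E.wA + 4), S.mem (addr w E.wA j v) = 0)
    (hout : S.out = [])
    (hc : Computes pre (State.init (toWords E.wA E.dict.encode)) fun sA => ∀ u < E.Q,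
      Computes query (sA.feed (toWords E.wA (E.text u)))
        (Algorithm.Correct mode E.dict (E.text u))) :
    Runs (mainCmd M pre query) S (fun S' => S'.out ≠ [] ↔ ∃ u < E.Q, E.DirtyU u)
      (30 + 200 * E.Q + 30 * expTime pre (State.init (toWords E.wA E.dict.encode)) +
        ∑' sA, haltProb pre (State.init (toWords E.wA E.dict.encode)) sA *
          (4 + ∑ u ∈ Finset.range E.Q, (6 + E.queryCost M query sA u))) := by
  have hQ := E.eight_Q_le
  have hwd := E.word_ge
  have hreg := E.region_eq
  have hQ0 := E.Q_pos
  refine ((E.runs_dictCmd hst).seq (Q := fun S' => S'.out ≠ [] ↔ ∃ u < E.Q, E.DirtyU u)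
    (B₂ := 1 + 13 + (1 + 30 * expTime pre (State.init (toWords E.wA E.dict.encode)) +
        ∑' sA, haltProb pre (State.init (toWords E.wA E.dict.encode)) sA *
          (4 + ∑ u ∈ Finset.range E.Q, (6 + E.queryCost M query sA u))))
    fun S₁ ⟨hf, hdict⟩ => ?_).mono (fun _ h => h) ?_
  swap
  · rw [show ∀ a b c : ℝ≥0∞, 1 + (3 + a) + (1 + 13 + (1 + b + c)) = (1 + 3 + 1 + 13 + 1) + a + b + c
      from fun a b c => by ring]
    gcongr
    norm_num
  have hst₁ := hst.frame hf (by simp) (by simp)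
  have h64₁ : ∀ r, 48 ≤ r → S₁.regs r = 0 := fun r hr =>
    (hf.regs r (by simp; omega)).trans (h64 r hr)
  have h39₁ : S₁.regs 39 = 0 := (hf.regs 39 (by simp)).trans h39
  have hzero₁ : ∀ j ∈ [1, 3, 4], ∀ v < 2 ^ (E.wA + 4), S₁.mem (addr w E.wA j v) = 0 :=
    fun j hj v hv => (hf.mem j (by simp at hj; omega) (by simp at hj ⊢; omega) v hv).trans
      (hzero j hj v hv)
  have r1 : Runs preSetup S₁ (fun S' => Agree [32, 33, 34, 35, 36, 40] S₁ S' ∧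
      S'.regs 32 = BitVec.ofNat w 0 ∧ S'.regs 33 = addr w E.wA 1 0 ∧
      S'.regs 34 = BitVec.ofNat w 0 ∧ S'.regs 35 = BitVec.ofNat w (14 * E.Q) ∧
      S'.regs 36 = BitVec.ofNat w 0 ∧ S'.regs 40 = BitVec.ofNat w E.Q) 13 := by
    refine Runs.straight rfl ⟨?_, ?_, ?_, ?_, ?_, ?_, ?_⟩ (by norm_num [preSetup, block, Cmd.time])
    · simp only [preSetup, block, det]
      repeat refine Agree.set ?_ (by simp) _
      exact Agree.refl _ _
    all_goals
      simp only [preSetup, block, det, BinOp.eval, State.set_regs, Function.update_apply,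
        Nat.reduceEqDiff, reduceIte, hst₁.consts.r7, hst₁.consts.r3,
        mul_ofNat, BitVec.or_self]
  refine r1.seq fun S₂ ⟨a, a32, a33, a34, a35, a36, a40⟩ => ?_
  have hst₂ := hst₁.agree a (by simp)
  have h64₂ : ∀ r, 48 ≤ r → S₂.regs r = 0 := fun r hr =>
    (a.regs r (by simp; omega)).trans (h64₁ r hr)
  have hzero₂ : ∀ j ∈ [1, 3, 4], ∀ v < 2 ^ (E.wA + 4), S₂.mem (addr w E.wA j v) = 0 :=
    fun j hj v hv => by rw [a.mem]; exact hzero₁ j hj v hv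
  -- The preprocessing is phase `0`: the untouched regions `3` and `4` already hold its stamp, and
  -- it writes directly to region `1`.
  have hb : SimBase E.wA M φ₀ 0 1 S₂ := by
    refine ⟨by have := E.hσ; omega, E.hw, fun x y h => by simp only [φ₀] at h; omega,
      fun x => by simp only [φ₀]; omega, Or.inl rfl, hst₂.consts.r0, hst₂.consts.r5,
      hst₂.consts.r6, hst₂.consts.r7, hst₂.consts.r8, hst₂.consts.r9, hst₂.consts.r10,
      hst₂.consts.r11, a32, a33⟩
  have hsim : Sim M φ₀ 0 1 S₂ (State.init (toWords E.wA E.dict.encode)) S₂ := by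
    refine ⟨fun x hx => ?_, fun v => ?_, ?_, ?_, fun _ _ _ => rfl,
        fun _ _ _ _ _ => rfl, fun _ _ _ _ => Or.inl rfl, ⟨rfl, rfl, rfl⟩⟩
    · rw [h64₂ _ (by simp only [φ₀]; omega)]; simp [State.init]
    · rw [ite_self, hzero₂ 1 (by simp) _ (BitVec.toNat_lt_region v)]; simp [State.init]
    · have hlen : (State.init (toWords E.wA E.dict.encode)).input.length = 14 * E.Q := by
        simp [State.init, toWords, E.dict_encode.1]
      refine ⟨0, a34, by rw [a35, hlen, zero_add], by omega, fun i hi => ?_⟩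
      have hi' : i < E.dict.encode.length := by simpa [State.init, toWords] using hi
      rw [a.mem, zero_add, hdict i hi']
      have : (State.init (toWords E.wA E.dict.encode)).input[i] =
          BitVec.ofNat E.wA E.dict.encode[i] := by simp [State.init, toWords]
      rw [this, toNat_ofNat_lt (E.dict_lt (List.getElem_mem hi'))]
    · refine ⟨[], List.nodup_nil, a36, by simp, by simp, fun v => iff_of_true ?_ (Or.inl rfl)⟩
      exact hzero₂ 4 (by simp) _ (BitVec.toNat_lt_region v)
  refine Runs.comp_seq hb hMp hsim hc fun sA S₃ hsA hsim' => ?_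
  have hr : ∀ r < 64, r ∉ [34, 36, 37, 38] → S₃.regs r = S₂.regs r := fun r hr h =>
    hsim'.frame_regs r (fun x _ => by simp only [φ₀]; omega) h
  have hm : ∀ j ∈ [0, 7, 8], ∀ v < 2 ^ (E.wA + 4),
      S₃.mem (addr w E.wA j v) = S₂.mem (addr w E.wA j v) := fun j hj v hv =>
    hsim'.frame_mem j (by simp at hj; omega) (by simp at hj ⊢; omega) v hv
  refine E.runs_queriesCmd hM ⟨⟨hst₂.consts.congr fun r h => hr r (by omega) (by simp; omega),
    hst₂.tables.congr hm⟩, (hr 40 (by norm_num) (by simp)).trans a40, hsim'.regs, fun v => ?_,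
    fun j hj v hv => ⟨0, ?_, Or.inl rfl, Nat.zero_le _⟩, ?_⟩ ?_ hsA
  · have := hsim'.mem v; rwa [ite_self] at this
  · rcases hsim'.stamp j hj v hv with h | h
    · rw [h]; exact hzero₂ j (by simp at hj ⊢; omega) v hv
    · exact h
  · rw [hsim'.io.2.2, a.out, hf.out, hout]
  · rw [hr 39 (by norm_num) (by simp), a.regs 39 (by simp), h39₁]

end Env

end WordRAM

/-! ### The random hash function and the bucket chains -/

namespace WordRAM

namespace Env

open DMOG

variable {w : ℕ} (E : Env w)

/-- The constants that do not depend on the hash function. -/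
structure Consts₀ (s : State w) : Prop where
  r0 : s.regs 0 = BitVec.ofNat w 1
  r1 : s.regs 1 = BitVec.ofNat w E.n
  r2 : s.regs 2 = BitVec.ofNat w E.q
  r3 : s.regs 3 = BitVec.ofNat w E.Q
  r4 : s.regs 4 = BitVec.ofNat w (E.Q - 1)
  r5 : s.regs 5 = BitVec.ofNat w (2 ^ E.wA - 1)
  r6 : s.regs 6 = BitVec.ofNat w E.wA
  r7 : s.regs 7 = addr w E.wA 1 0
  r8 : s.regs 8 = addr w E.wA 3 0
  r9 : s.regs 9 = addr w E.wA 4 0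
  r10 : s.regs 10 = addr w E.wA 5 0
  r11 : s.regs 11 = addr w E.wA 6 0
  r12 : s.regs 12 = addr w E.wA 7 0
  r13 : s.regs 13 = addr w E.wA 8 0
  r14 : s.regs 14 = addr w E.wA 2 0
  r15 : s.regs 15 = BitVec.ofNat w (3 * 2 ^ (w - 3))
  r19 : s.regs 19 = BitVec.ofNat w (w - 2 * E.σ)
  r20 : s.regs 20 = BitVec.ofNat w (gapWord E.β)
  r21 : s.regs 21 = BitVec.ofNat w (6 * E.q)
  r22 : s.regs 22 = BitVec.ofNat w 3
  r23 : s.regs 23 = BitVec.ofNat w 2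

/-- The numbers, split into their lowest two bits and the rest, are in region `0`. -/
structure Data (s : State w) : Prop where
  hi : ∀ i < E.n, s.mem (addr w E.wA 0 (2 * i)) = BitVec.ofNat w (E.X i / 4)
  lo : ∀ i < E.n, s.mem (addr w E.wA 0 (2 * i + 1)) = BitVec.ofNat w (E.X i % 4)

/-- Registers and memory regions that have not been used. -/
structure Fresh (wA : ℕ) (s : State w) : Prop where
  r39 : s.regs 39 = 0
  regs : ∀ r, 48 ≤ r → s.regs r = 0
  mem : ∀ j < 16, 1 ≤ j → ∀ v < 2 ^ (wA + 4), s.mem (addr w wA j v) = 0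
  out : s.out = []

/-- Another hash function. -/
def withMul (a : ℕ) : Env w := { E with a := a }

/-- Compute the constants of the hash function with multiplier in register `17`. -/
def hashCmd : Cmd := block [.const 41 4, .op .mul 18 41 17, .op .add 18 18 0, .op .mul 41 18 15,
  .op .shr 41 41 19, .op .add 41 41 3, .op .sub 41 41 23, .op .and 16 41 4]

theorem shr_hash {k : ℕ} (hk : k < 2 ^ w) (V : ℕ) :
    BitVec.ofNat w V >>> BitVec.ofNat w k = BitVec.ofNat w (V % 2 ^ w / 2 ^ k) := by
  rw [show BitVec.ofNat w V = BitVec.ofNat w (V % 2 ^ w) by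
    apply BitVec.eq_of_toNat_eq; simp]
  exact shr_ofNat (Nat.mod_lt _ (by positivity)) hk

theorem runs_hashCmd {s : State w} {v : BitVec w} (hc : E.Consts₀ s) :
    Runs hashCmd (s.set 17 v) (fun s' => (E.withMul v.toNat).Consts s' ∧
      Agree [16, 17, 18, 41] s s') 15 := by
  have hw8 := E.hw
  have hQ := E.eight_Q_le
  have hwd := E.word_ge
  have hww : w < 2 ^ w := Nat.lt_two_pow_self
  have hv : v = BitVec.ofNat w v.toNat := by simp
  have hag : Agree [16, 17, 18, 41] s (det hashCmd (s.set 17 v)) := by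
    simp only [hashCmd, block, det]
    repeat refine Agree.set ?_ (by simp) _
    exact Agree.refl _ _
  have hr : ∀ r, r ∉ [16, 17, 18, 41] → (det hashCmd (s.set 17 v)).regs r = s.regs r := hag.regs
  -- `T` itself does not fit in a word, but it is divisible by `4`, so only the quotient enters the
  -- hash value.
  have hT : mulHash w (2 * E.σ) v.toNat E.T =
      ((4 * v.toNat + 1) * (3 * 2 ^ (w - 3))) % 2 ^ w / 2 ^ (w - 2 * E.σ) := by
    have : E.T = 4 * (3 * 2 ^ (w - 3)) := by
      rw [T, show w - 1 = 2 + (w - 3) by omega, pow_add]; ring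
    rw [mulHash, this, Nat.mul_div_cancel_left _ (by norm_num), Nat.mul_mod_right, mul_zero,
      add_zero]
  have h2Q : 2 ≤ E.Q := by
    rw [Q_eq]; have := E.two_le_q; nlinarith
  have hσ := E.hσ
  refine Runs.straight rfl ⟨⟨(hr 0 (by simp)).trans hc.r0, (hr 1 (by simp)).trans hc.r1,
    (hr 2 (by simp)).trans hc.r2, (hr 3 (by simp)).trans hc.r3, (hr 4 (by simp)).trans hc.r4,
    (hr 5 (by simp)).trans hc.r5, (hr 6 (by simp)).trans hc.r6, (hr 7 (by simp)).trans hc.r7,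
    (hr 8 (by simp)).trans hc.r8, (hr 9 (by simp)).trans hc.r9, (hr 10 (by simp)).trans hc.r10,
    (hr 11 (by simp)).trans hc.r11, (hr 12 (by simp)).trans hc.r12, (hr 13 (by simp)).trans hc.r13,
    (hr 14 (by simp)).trans hc.r14, (hr 15 (by simp)).trans hc.r15, ?_, ?_, ?_,
    (hr 19 (by simp)).trans hc.r19, (hr 20 (by simp)).trans hc.r20,
    (hr 21 (by simp)).trans hc.r21, (hr 22 (by simp)).trans hc.r22,
    (hr 23 (by simp)).trans hc.r23⟩, hag⟩ (by norm_num [hashCmd, block, Cmd.time])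
  · simp only [hashCmd, block, det, BinOp.eval, State.set_regs, Function.update_apply,
      Nat.reduceEqDiff, reduceIte, hc.r0, hc.r15, hc.r19, hc.r3, hc.r4,
      hc.r23, OfNat.zero_ne_ofNat]
    rw [hv, mul_ofNat, add_ofNat, mul_ofNat, shr_hash (by omega), ← hT, add_ofNat,
      sub_ofNat (by omega), and_Q]
    simp only [BitVec.ofNat_toNat, BitVec.setWidth_eq]
    rfl
  · simp only [hashCmd, block, det, BinOp.eval, State.set_regs, Function.update_apply,
      Nat.reduceEqDiff, reduceIte]
    exact hv
  · simp only [hashCmd, block, det, BinOp.eval, State.set_regs, Function.update_apply,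
      Nat.reduceEqDiff, reduceIte, hc.r0, OfNat.zero_ne_ofNat]
    rw [hv, mul_ofNat, add_ofNat]
    simp only [BitVec.ofNat_toNat, BitVec.setWidth_eq]
    rfl

def insertBody : Cmd := block [.op .sub 41 41 0, .op .add 43 42 42, .load 44 43, .op .add 43 43 0,
  .load 45 43, .op .mul 44 18 44, .op .mul 45 17 45, .op .add 44 44 45, .op .shr 44 44 19,
  .op .add 45 12 44, .load 46 45, .op .add 43 13 42, .store 43 46, .op .add 42 42 0, .store 45 42]

/-- Distribute the positions to the lists of their hash values. -/
def insertCmd : Cmd := .seq (.seq (.op .or 41 1 1) (.const 42 0)) (.loop 41 insertBody)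

abbrev regsI : List ℕ := [41, 42, 43, 44, 45, 46]

/-- Positions are prepended in increasing order: the old head of the bucket becomes the successor of
`i`. Register `41` counts the remaining positions and register `42` is the current one. -/
theorem runs_insertCmd {s : State w} (hc : E.Consts s) (hd : E.Data s)
    (hz : ∀ v < 2 ^ (E.wA + 4), s.mem (addr w E.wA 7 v) = 0) :
    Runs insertCmd s (fun s' => E.Static s' ∧ Frame E.wA regsI [7, 8] s s') (6 + 32 * E.n) := by
  have hn := E.n_le
  have hQ := E.eight_Q_le
  have hwd := E.word_ge
  have hreg := E.region_eq
  have hQ0 := E.Q_pos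
  have hw8 := E.hw
  have hww : w < 2 ^ w := Nat.lt_two_pow_self
  set Inv : ℕ → State w → Prop := fun r s' => Frame E.wA regsI [7, 8] s s' ∧
    s'.regs 41 = BitVec.ofNat w r ∧ s'.regs 42 = BitVec.ofNat w (E.n - r) ∧
    (∀ h < E.Q, s'.mem (addr w E.wA 7 h) = enc w (E.chain h (E.n - r))) ∧
    ∀ i < E.n - r, s'.mem (addr w E.wA 8 i) = enc w (E.chain (E.H i) i) with hInv
  have hbody : ∀ r < E.n, ∀ s₁, Inv (r + 1) s₁ → Runs insertBody s₁ (Inv r) 30 := by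
    intro r hr s₁ ⟨hf, h41, h42, hhead, hnext⟩
    set i := E.n - (r + 1) with hi
    have hin : E.n - r = i + 1 := by omega
    have hHi := E.H_lt i
    have hc₁ : E.Consts s₁ := hc.congr fun r hr => hf.regs r (by simp; omega)
    have d1 : s₁.mem (BitVec.ofNat w (i + i)) = BitVec.ofNat w (E.X i / 4) := by
      rw [← two_mul, ← addr_zero E.wA, hf.mem 0 (by norm_num) (by simp) _ (by omega)]
      exact hd.hi i (by omega)
    have d2 : s₁.mem (BitVec.ofNat w (i + i + 1)) = BitVec.ofNat w (E.X i % 4) := by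
      rw [← two_mul, ← addr_zero E.wA, hf.mem 0 (by norm_num) (by simp) _ (by omega)]
      exact hd.lo i (by omega)
    have hsub : BitVec.ofNat w (r + 1) - BitVec.ofNat w 1 = BitVec.ofNat w r := by
      rw [sub_ofNat (by omega), Nat.add_sub_cancel]
    have hH : ((4 * E.a + 1) * (E.X i / 4) + E.a * (E.X i % 4)) % 2 ^ w / 2 ^ (w - 2 * E.σ) =
        E.H i := rfl
    have hne : ¬ (addr w E.wA 7 (E.H i) = addr w E.wA 8 i) := by
      rw [addr_inj E.hw (by norm_num) (by norm_num) (by omega) (by omega)]; omega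
    obtain ⟨s₂, hs₂, e41, e42, emem, ereg, eio⟩ : ∃ s₂, det insertBody s₁ = s₂ ∧
        s₂.regs 41 = BitVec.ofNat w r ∧ s₂.regs 42 = BitVec.ofNat w (i + 1) ∧
        s₂.mem = ((s₁.upd (addr w E.wA 8 i) (enc w (E.chain (E.H i) i))).upd
          (addr w E.wA 7 (E.H i)) (BitVec.ofNat w (i + 1))).mem ∧
        (∀ r, r ∉ regsI → s₂.regs r = s₁.regs r) ∧
        (s₂.input = s₁.input ∧ s₂.consumed = s₁.consumed ∧ s₂.out = s₁.out) := by
      refine ⟨_, rfl, ?_, ?_, ?_, fun r hr => ?_, rfl, rfl, rfl⟩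
      · simp only [insertBody, block, det, BinOp.eval, State.set_regs, State.set_mem,
          State.upd_regs, Function.update_apply, Nat.reduceEqDiff, reduceIte, hc₁.r0, h41, hsub,
          OfNat.zero_ne_ofNat]
      · simp only [insertBody, block, det, BinOp.eval, State.set_regs, State.set_mem,
          State.upd_regs, Function.update_apply, Nat.reduceEqDiff, reduceIte, hc₁.r0, h42,
          add_ofNat, OfNat.zero_ne_ofNat]
      · simp only [insertBody, block, det, BinOp.eval, State.set_regs, State.set_mem,
          State.upd_regs, State.upd_mem, Function.update_apply, Nat.reduceEqDiff, reduceIte, hc₁.r0,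
          h42, add_ofNat, d1, d2, hc₁.r18, hc₁.r17, hc₁.r19, hc₁.r12, hc₁.r13, mul_ofNat,
          shr_hash (w := w) (k := w - 2 * E.σ) (by omega), hH, addr_add, zero_add,
          hhead _ hHi, OfNat.zero_ne_ofNat]
      · simp only [List.mem_cons, List.not_mem_nil, or_false, not_or] at hr
        simp only [insertBody, block, det, State.set_regs, State.upd_regs, Function.update_apply,
          hr, if_false]
    refine Runs.straight rfl ?_ (by norm_num [insertBody, block, Cmd.time])
    rw [hs₂]
    have hm : ∀ j < 16, ∀ v < 2 ^ (E.wA + 4), s₂.mem (addr w E.wA j v) =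
        if j = 7 ∧ v = E.H i then BitVec.ofNat w (i + 1) else if j = 8 ∧ v = i then
        enc w (E.chain (E.H i) i) else s₁.mem (addr w E.wA j v) := by
      intro j hj v hv
      rw [emem, upd_mem_addr E.hw _ (by norm_num) hj (by omega) hv,
        upd_mem_addr E.hw _ (by norm_num) hj (by omega) hv]
    refine ⟨hf.trans ⟨ereg, fun j hj hJ v hv => ?_, eio.1, eio.2.1, eio.2.2⟩, e41, by
      rw [e42, hin], fun h hh => ?_, fun i' hi' => ?_⟩
    · rw [hm j hj v hv, if_neg (fun e => hJ (by simp [e.1])), if_neg (fun e => hJ (by simp [e.1]))]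
    · rw [hm 7 (by norm_num) h (by omega), hin, chain]
      by_cases hhi : h = E.H i
      · rw [if_pos ⟨rfl, hhi⟩, if_pos hhi.symm]; rfl
      · rw [if_neg (fun e => hhi e.2), if_neg (by omega), if_neg (fun e => hhi e.symm)]
        exact hhead h hh
    · rw [hm 8 (by norm_num) i' (by omega), if_neg (by omega)]
      by_cases hii : i' = i
      · rw [if_pos ⟨rfl, hii⟩, hii]
      · rw [if_neg (fun e => hii e.2)]
        exact hnext i' (by omega)
  have hstart : Runs (.seq (.op .or 41 1 1) (.const 42 0)) s (Inv E.n) 3 := by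
    refine Runs.straight rfl ⟨?_, ?_, ?_, fun h hh => ?_, fun i hi => absurd hi (by omega)⟩
      (by norm_num [Cmd.time])
    · exact (((Agree.refl [41, 42] s).set (by simp) _).set (by simp) _).frame.mono (by simp)
        (List.nil_subset _)
    · simp [det, BinOp.eval, hc.r1]
    · simp [det]
    · rw [Nat.sub_self]; exact hz h (by omega)
  refine (hstart.seq fun s₁ hs₁ => Runs.downto (n := E.n) Inv (fun _ => 30) (by omega)
    (fun i s hs => hs.2.1) hbody hs₁).mono (fun s' hs' => ⟨⟨hc.congr fun r hr =>
      hs'.1.regs r (by simp; omega), fun i hi => ?_, fun i hi => ?_, hs'.2.2.2.1, hs'.2.2.2.2⟩,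
      hs'.1⟩) ?_
  · rw [hs'.1.mem 0 (by norm_num) (by simp) _ (by omega)]; exact hd.hi i hi
  · rw [hs'.1.mem 0 (by norm_num) (by simp) _ (by omega)]; exact hd.lo i hi
  · rw [Finset.sum_const, Finset.card_range, nsmul_eq_mul]
    rw [show (1 : ℝ≥0∞) + 3 + (E.n * (30 + 1) + 1) = (1 + 3 + 1) + (30 + 1) * E.n by ring]
    gcongr <;> norm_num

/-- The randomized part of the program. -/
def randCmd (M : ℕ) (pre query : Cmd) : Cmd :=
  .seq (.rand 17) (.seq hashCmd (.seq insertCmd (mainCmd M pre query)))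

noncomputable def mainCost (M : ℕ) (pre query : Cmd) : ℝ≥0∞ :=
  30 + 200 * E.Q + 30 * expTime pre (State.init (toWords E.wA E.dict.encode)) +
    ∑' sA, haltProb pre (State.init (toWords E.wA E.dict.encode)) sA *
      (4 + ∑ u ∈ Finset.range E.Q, (6 + E.queryCost M query sA u))

/-- The answer `P` is the same for every multiplier, so the program never errs; the multiplier
affects only the cost, which is averaged. -/
theorem runs_randCmd {M : ℕ} {pre query : Cmd} (hMp : pre.regBound ≤ M) (hM : query.regBound ≤ M)
    {mode : Mode} {S : State w} (hc₀ : E.Consts₀ S) (hd : E.Data S) (hfr : Fresh E.wA S)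
    {P : Prop} (hP : ∀ a < 2 ^ w, P ↔ ∃ u < E.Q, (E.withMul a).DirtyU u)
    (hc : ∀ a < 2 ^ w, Computes pre
      (State.init (toWords E.wA (E.withMul a).dict.encode)) fun sA => ∀ u < E.Q,
      Computes query (sA.feed (toWords E.wA ((E.withMul a).text u)))
        (Algorithm.Correct mode (E.withMul a).dict ((E.withMul a).text u))) :
    Runs (randCmd M pre query) S (fun S' => S'.out ≠ [] ↔ P)
      (2 + ∑ v : BitVec w, ((2 : ℝ≥0∞) ^ w)⁻¹ *
        (30 + 32 * E.n + (E.withMul v.toNat).mainCost M pre query)) := by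
  refine Runs.rand_seq fun v => ?_
  have hQ := E.eight_Q_le
  have hreg := E.region_eq
  have hn := E.n_le
  set E' := E.withMul v.toNat with hE'
  refine ((E.runs_hashCmd hc₀).seq fun S₁ ⟨h1, h2⟩ =>
    (E'.runs_insertCmd h1 ⟨?_, ?_⟩ ?_).seq fun S₂ ⟨h3, h4⟩ =>
    (E'.runs_mainCmd hMp hM h3 ?_ ?_ ?_ ?_ (hc v.toNat v.isLt)).mono (fun S₃ h => ?_) le_rfl).mono
    (fun _ h => h) ?_
  · rw [h2.mem]; exact hd.hi
  · rw [h2.mem]; exact hd.lo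
  · rw [h2.mem]; exact hfr.mem 7 (by norm_num) (by norm_num)
  · rw [h4.regs 39 (by simp), h2.regs 39 (by simp), hfr.r39]
  · intro r hr
    rw [h4.regs r (by simp; omega), h2.regs r (by simp; omega), hfr.regs r hr]
  · intro j hj v hv
    rw [h4.mem j (by simp at hj; omega) (by simp at hj ⊢; omega) v hv, h2.mem]
    exact hfr.mem j (by simp at hj; omega) (by simp at hj; omega) v hv
  · rw [h4.out, h2.out, hfr.out]
  · rw [h, hP v.toNat v.isLt]; rfl
  · change (1 : ℝ≥0∞) + 15 + (1 + (6 + 32 * (E.n : ℝ≥0∞)) + E'.mainCost M pre query) ≤ _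
    rw [show (1 : ℝ≥0∞) + 15 + (1 + (6 + 32 * (E.n : ℝ≥0∞)) + E'.mainCost M pre query) =
      (1 + 15 + 1 + 6) + 32 * E.n + E'.mainCost M pre query by ring]
    gcongr
    norm_num

end Env

end WordRAM

/-! ### Reading the numbers and computing the parameters -/

namespace WordRAM

open DMOG

variable {w : ℕ}

/-- The numbers, made nonnegative. -/
def offsetNum (xs : List (BitVec w)) (i : ℕ) : ℕ :=
  (xs.getD i 0 + BitVec.ofNat w (2 ^ (w - 1))).toNat

theorem runs_read_nil {s : State w} {x y : ℕ} {Post : State w → Prop} (h : s.input = [])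
    (hp : Post (s.set y 0)) : Runs (.read x y) s Post 1 := by
  intro f X hf
  simp only [ert, h]
  gcongr
  exact hf _ hp

theorem runs_read_cons {s : State w} {x y : ℕ} {Post : State w → Prop} {a : BitVec w}
    {rest : List (BitVec w)} (h : s.input = a :: rest)
    (hp : Post { (s.set x a).set y 1 with input := rest, consumed := s.consumed + 1 }) :
    Runs (.read x y) s Post 1 := by
  intro f X hf
  simp only [ert, h]
  gcongr
  exact hf _ hp

def readBody : Cmd := .seq (.read 41 42) (.ite 42 (block [.op .add 41 41 40, .op .shr 43 41 23,
  .op .and 44 41 22, .op .add 45 1 1, .store 45 43, .op .add 45 45 0, .store 45 44,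
  .op .add 1 1 0]) .skip)

/-- Read the input. -/
def readCmd : Cmd := .seq (block [.const 0 1, .const 22 3, .const 23 2, .wordSize 40,
  .op .sub 40 40 0, .op .shl 40 0 40, .const 42 1]) (.loop 42 readBody)

/-- The first `k` numbers have been read. -/
structure HasRead (xs : List (BitVec w)) (k : ℕ) (s : State w) : Prop where
  r0 : s.regs 0 = BitVec.ofNat w 1
  r1 : s.regs 1 = BitVec.ofNat w k
  r22 : s.regs 22 = BitVec.ofNat w 3
  r23 : s.regs 23 = BitVec.ofNat w 2
  r40 : s.regs 40 = BitVec.ofNat w (2 ^ (w - 1))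
  hi : ∀ i < k, s.mem (BitVec.ofNat w (2 * i)) = BitVec.ofNat w (offsetNum xs i / 4)
  lo : ∀ i < k, s.mem (BitVec.ofNat w (2 * i + 1)) = BitVec.ofNat w (offsetNum xs i % 4)
  zero : ∀ v, 2 * k ≤ v → v < 2 ^ w → s.mem (BitVec.ofNat w v) = 0
  regs : ∀ r, r ∉ [0, 1, 22, 23, 40, 41, 42, 43, 44, 45] → s.regs r = 0
  out : s.out = []

theorem runs_readLoop {xs : List (BitVec w)} (hw : 2 ≤ w) (hn : 2 * xs.length < 2 ^ w) (m : ℕ) :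
    ∀ (k : ℕ) (s : State w), k + m = xs.length → HasRead xs k s → s.input = xs.drop k →
      s.regs 42 = 1 → Runs (.loop 42 readBody) s (HasRead xs xs.length) (7 + 20 * m) := by
  have hww : w < 2 ^ w := Nat.lt_two_pow_self
  have h4 : 2 ^ 2 ≤ 2 ^ w := Nat.pow_le_pow_right (by norm_num) hw
  induction m with
  | zero =>
    intro k s hk h hin h42
    have hkn : k = xs.length := by omega
    subst hkn
    rw [List.drop_length] at hin
    have hbody : Runs readBody s (fun s' => HasRead xs xs.length s' ∧ s'.regs 42 = 0) 4 := by
      refine ((runs_read_nil (Post := fun s' => HasRead xs xs.length s' ∧ s'.regs 42 = 0) hin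
        ⟨⟨?_, ?_, ?_, ?_, ?_, h.hi, h.lo, h.zero, fun r hr => ?_, h.out⟩, ?_⟩).seq (B₂ := 2)
        fun s' hs' => (Runs.ite (B := 1) (fun h0 => absurd hs'.2 h0) fun _ =>
        Runs.straight rfl hs' (by simp [Cmd.time])).mono (fun _ h => h) (by norm_num)).mono
        (fun _ h => h) (by norm_num)
      · simp [h.r0]
      · simp [h.r1]
      · simp [h.r22]
      · simp [h.r23]
      · simp [h.r40]
      · rw [State.set_regs, Function.update_of_ne (fun e => hr (by simp [e]))]
        exact h.regs r hr
      · simp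
    refine (Runs.loop_step (by rw [h42]; exact one_ne_zero_word (by omega)) hbody
      fun s' hs' => Runs.loop_exit hs'.2 hs'.1).mono (fun _ h => h) (by norm_num)
  | succ m ih =>
    intro k s hk h hin h42
    have hkn : k < xs.length := by omega
    rw [List.drop_eq_getElem_cons hkn] at hin
    have hX : offsetNum xs k = (xs[k] + BitVec.ofNat w (2 ^ (w - 1))).toNat := by
      rw [offsetNum, List.getD_eq_getElem _ _ hkn]
    have hXlt : offsetNum xs k < 2 ^ w := BitVec.isLt _
    have hXw : xs[k] + BitVec.ofNat w (2 ^ (w - 1)) = BitVec.ofNat w (offsetNum xs k) := by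
      rw [hX, BitVec.ofNat_toNat, BitVec.setWidth_eq]
    have hshr : BitVec.ofNat w (offsetNum xs k) >>> BitVec.ofNat w 2 =
        BitVec.ofNat w (offsetNum xs k / 4) := shr_ofNat (k := 2) hXlt (by omega)
    have hand : BitVec.ofNat w (offsetNum xs k) &&& BitVec.ofNat w 3 =
        BitVec.ofNat w (offsetNum xs k % 4) := and_ofNat (k := 2) hw _
    have hbody : Runs readBody s (fun s' => HasRead xs (k + 1) s' ∧ s'.input = xs.drop (k + 1) ∧
        s'.regs 42 = 1) 19 := by
      refine ((runs_read_cons (Post := fun s' => s' = { (s.set 41 xs[k]).set 42 1 with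
        input := xs.drop (k + 1), consumed := s.consumed + 1 }) hin rfl).seq (B₂ := 17)
        fun s' hs' => ?_).mono (fun _ h => h) (by norm_num)
      subst hs'
      refine (Runs.ite (B := 16) (fun _ => ?_) fun h0 => ?_).mono (fun _ h => h) (by norm_num)
      swap
      · exact absurd h0 (by simpa using one_ne_zero_word (by omega))
      refine Runs.straight rfl ?_ (by norm_num [block, Cmd.time])
      have hm : (det (block [.op .add 41 41 40, .op .shr 43 41 23,
          .op .and 44 41 22, .op .add 45 1 1, .store 45 43, .op .add 45 45 0, .store 45 44,
          .op .add 1 1 0]) { (s.set 41 xs[k]).set 42 1 with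
          input := xs.drop (k + 1), consumed := s.consumed + 1 }).mem =
          Function.update (Function.update s.mem (BitVec.ofNat w (2 * k))
            (BitVec.ofNat w (offsetNum xs k / 4))) (BitVec.ofNat w (2 * k + 1))
            (BitVec.ofNat w (offsetNum xs k % 4)) := by
        simp only [block, det, BinOp.eval, State.set_regs, State.set_mem, State.upd_regs,
          State.upd_mem, Function.update_apply, Nat.reduceEqDiff, reduceIte, h.r0, h.r1, h.r22,
          h.r23, h.r40, hXw, hshr, hand, add_ofNat, ← Nat.two_mul, OfNat.zero_ne_ofNat,
          OfNat.one_ne_ofNat]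
      have hmv : ∀ v < 2 ^ w, Function.update (Function.update s.mem (BitVec.ofNat w (2 * k))
            (BitVec.ofNat w (offsetNum xs k / 4))) (BitVec.ofNat w (2 * k + 1))
            (BitVec.ofNat w (offsetNum xs k % 4)) (BitVec.ofNat w v) =
          if v = 2 * k + 1 then BitVec.ofNat w (offsetNum xs k % 4) else if v = 2 * k then
          BitVec.ofNat w (offsetNum xs k / 4) else s.mem (BitVec.ofNat w v) := by
        intro v hv
        simp only [Function.update_apply, ofNat_inj hv (show 2 * k + 1 < 2 ^ w by omega),
          ofNat_inj hv (show 2 * k < 2 ^ w by omega)]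
      refine ⟨⟨?_, ?_, ?_, ?_, ?_, fun i hi => ?_, fun i hi => ?_, fun v hv1 hv2 => ?_,
        fun r hr => ?_, h.out⟩, rfl, ?_⟩
      · simp [block, det, h.r0]
      · simp [block, det, BinOp.eval, h.r0, h.r1, BitVec.ofNat_add]
      · simp [block, det, h.r22]
      · simp [block, det, h.r23]
      · simp [block, det, h.r40]
      · rw [hm, hmv _ (by omega), if_neg (by omega)]
        rcases Nat.lt_succ_iff_lt_or_eq.1 hi with hi | rfl
        · rw [if_neg (by omega), h.hi i hi]
        · rw [if_pos rfl]
      · rw [hm, hmv _ (by omega)]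
        rcases Nat.lt_succ_iff_lt_or_eq.1 hi with hi | rfl
        · rw [if_neg (by omega), if_neg (by omega), h.lo i hi]
        · rw [if_pos rfl]
      · rw [hm, hmv _ hv2, if_neg (by omega), if_neg (by omega), h.zero v (by omega) hv2]
      · have := h.regs r hr
        simp only [List.mem_cons, List.not_mem_nil, or_false, not_or] at hr
        simp [block, det, hr, this]
      · simp [block, det]
    refine (Runs.loop_step (by rw [h42]; exact one_ne_zero_word (by omega)) hbody
      fun s' hs' => ih (k + 1) s' (by omega) hs'.1 hs'.2.1 hs'.2.2).mono (fun _ h => h) ?_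
    push_cast
    rw [show (1 : ℝ≥0∞) + 19 + (7 + 20 * m) = 7 + (1 + 19 + 20 * m) by ring,
      show (20 : ℝ≥0∞) * (m + 1) = 20 + 20 * m by ring]
    gcongr
    norm_num

theorem runs_readCmd {xs : List (BitVec w)} (hw : 2 ≤ w) (hn : 2 * xs.length < 2 ^ w) :
    Runs readCmd (State.init xs) (HasRead xs xs.length) (21 + 20 * xs.length) := by
  have hww : w < 2 ^ w := Nat.lt_two_pow_self
  have h1 : Runs (block [.const 0 1, .const 22 3, .const 23 2, .wordSize 40,
      .op .sub 40 40 0, .op .shl 40 0 40, .const 42 1]) (State.init xs) (fun s => HasRead xs 0 s ∧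
      s.input = xs ∧ s.regs 42 = 1) 13 := by
    refine Runs.straight rfl ⟨⟨?_, ?_, ?_, ?_, ?_, fun i hi => absurd hi (by omega),
      fun i hi => absurd hi (by omega), fun v _ _ => rfl, fun r hr => ?_, rfl⟩, rfl, ?_⟩
      (by norm_num [block, Cmd.time])
    · simp [block, det]
    · simp [block, det, State.init]
    · simp [block, det]
    · simp [block, det]
    · simp only [block, det, Function.update_apply, State.set_regs, BinOp.eval, Nat.reduceEqDiff,
        reduceIte, OfNat.zero_ne_ofNat]
      rw [sub_ofNat (by omega), shl_ofNat _ (by omega), one_mul]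
    · simp only [List.mem_cons, List.not_mem_nil, or_false, not_or] at hr
      simp [block, det, hr, State.init]
    · simp [block, det]
  refine (h1.seq fun s hs => runs_readLoop hw hn xs.length 0 s (by omega) hs.1
    (by rw [hs.2.1]; rfl) hs.2.2).mono (fun _ h => h) ?_
  rw [← add_assoc]
  gcongr
  norm_num

/-- The number of binary digits. -/
def digits (n : ℕ) : ℕ := if n = 0 then 0 else Nat.log 2 n + 1

theorem digits_pos {n : ℕ} (hn : n ≠ 0) : digits n = digits (n / 2) + 1 := by
  rw [digits, if_neg hn, digits]
  split_ifs with h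
  · have : n = 1 := by omega
    subst this; simp
  · rw [Nat.log_of_one_lt_of_le (by norm_num) (by omega : 2 ≤ n)]

theorem digits_le (n : ℕ) : digits n ≤ n := by
  induction n using Nat.strong_induction_on with
  | _ n ih =>
    rcases Nat.eq_zero_or_pos n with rfl | h
    · simp [digits]
    · rw [digits_pos (by omega)]
      have := ih (n / 2) (by omega)
      omega

def digitsCmd : Cmd := .seq (.seq (.op .or 40 1 1) (.const 41 0))
  (.loop 40 (.seq (.op .shr 40 40 0) (.op .add 41 41 0)))

theorem runs_digitsCmd {s : State w} {n : ℕ} (hw : w ≠ 0) (hn : n < 2 ^ w)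
    (h0 : s.regs 0 = BitVec.ofNat w 1) (h1 : s.regs 1 = BitVec.ofNat w n) :
    Runs digitsCmd s (fun s' => Agree [40, 41] s s' ∧ s'.regs 41 = BitVec.ofNat w (digits n))
      (5 + 4 * n) := by
  have hww : 1 < 2 ^ w := Nat.one_lt_two_pow hw
  have key : ∀ (n : ℕ), n < 2 ^ w → ∀ (l : ℕ) (s' : State w), Agree [40, 41] s s' →
      s'.regs 40 = BitVec.ofNat w n → s'.regs 41 = BitVec.ofNat w l →
      Runs (.loop 40 (.seq (.op .shr 40 40 0) (.op .add 41 41 0))) s'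
      (fun s' => Agree [40, 41] s s' ∧ s'.regs 41 = BitVec.ofNat w (l + digits n))
      (1 + 4 * digits n) := by
    intro n
    induction n using Nat.strong_induction_on with
    | _ n ih =>
      intro hn l s' hs' h40 h41
      rcases Nat.eq_zero_or_pos n with rfl | h
      · refine (Runs.loop_exit (by rw [h40]; rfl) ⟨hs', ?_⟩).mono (fun _ h => h) le_self_add
        rw [h41]; simp [digits]
      · have h0' : s'.regs 0 = BitVec.ofNat w 1 := (hs'.regs 0 (by simp)).trans h0
        have hbody : Runs (.seq (.op .shr 40 40 0) (.op .add 41 41 0)) s' (fun s'' =>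
            Agree [40, 41] s s'' ∧ s''.regs 40 = BitVec.ofNat w (n / 2) ∧
            s''.regs 41 = BitVec.ofNat w (l + 1)) 3 := by
          refine Runs.straight rfl ⟨?_, ?_, ?_⟩ (by norm_num [Cmd.time])
          · exact (hs'.set (by simp) _).set (by simp) _
          · simp only [det, Function.update_apply, State.set_regs, BinOp.eval, Nat.reduceEqDiff,
              reduceIte, h40, h0', shr_ofNat hn hww, pow_one]
          · simp only [det, Function.update_apply, State.set_regs, BinOp.eval, Nat.reduceEqDiff,
              reduceIte, h41, h0', add_ofNat, OfNat.zero_ne_ofNat]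
        refine (Runs.loop_step (by rw [h40]; exact ofNat_ne_zero h hn) hbody fun s'' hs'' =>
          ih (n / 2) (by omega) (by omega) (l + 1) s'' hs''.1 hs''.2.1 hs''.2.2).mono
          (fun s'' hs'' => ⟨hs''.1, ?_⟩) ?_
        · rw [hs''.2, digits_pos (by omega : n ≠ 0)]; congr 1; omega
        · rw [digits_pos (by omega : n ≠ 0)]
          push_cast
          rw [show (1 : ℝ≥0∞) + 3 + (1 + 4 * digits (n / 2)) = 1 + ((1 + 3) + 4 * digits (n / 2)) by
            ring, show (4 : ℝ≥0∞) * (digits (n / 2) + 1) = 4 + 4 * digits (n / 2) by ring]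
          gcongr; norm_num
  have hfirst : Runs (.seq (.op .or 40 1 1) (.const 41 0)) s (fun s' => Agree [40, 41] s s' ∧
      s'.regs 40 = BitVec.ofNat w n ∧ s'.regs 41 = BitVec.ofNat w 0) 3 := by
    refine Runs.straight rfl ⟨?_, ?_, ?_⟩ (by norm_num [Cmd.time])
    · exact ((Agree.refl _ _).set (by simp) _).set (by simp) _
    · simp [det, BinOp.eval, h1]
    · simp [det]
  refine (hfirst.seq fun s' hs' => key n hn 0 s' hs'.1 hs'.2.1 hs'.2.2).mono
    (fun s' hs' => ⟨hs'.1, by rw [hs'.2, zero_add]⟩) ?_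
  rw [← add_assoc]
  gcongr
  · norm_num
  · exact digits_le n

namespace Env

def gapCmd : Option ℕ → Cmd
  | none => .const 20 0
  | some _ => .seq (.op .add 20 2 2) (.op .add 20 20 0)

/-- Compute the parameters `σ = σ₀ + 1 + ⌊l (t + 1) / (2 t)⌋`, where `l` is in register `41`, and
`wA = κ (2 σ + 3)`. -/
def paramCmd (σ₀ t κ : ℕ) : Cmd := block [.const 42 (t + 1), .op .mul 42 41 42, .const 43 (2 * t),
  .op .div 42 42 43, .const 43 (σ₀ + 1), .op .add 42 43 42, .op .shl 2 0 42, .op .mul 3 2 2,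
  .op .sub 4 3 0, .op .add 43 42 42, .op .add 44 43 22, .const 45 κ, .op .mul 6 45 44,
  .op .shl 5 0 6, .op .sub 5 5 0]

def addrCmd : Cmd := block [.const 44 4, .op .add 44 6 44, .op .shl 44 0 44, .op .or 7 44 44,
  .op .add 14 7 44, .op .add 8 14 44, .op .add 9 8 44, .op .add 10 9 44, .op .add 11 10 44,
  .op .add 12 11 44, .op .add 13 12 44]

def constCmd (β : Option ℕ) : Cmd := block [.wordSize 45, .op .sub 46 45 22, .op .shl 46 0 46,
  .op .mul 15 22 46, .op .sub 19 45 43, .const 46 6, .op .mul 21 46 2, gapCmd β]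

def setupCmd (σ₀ t κ : ℕ) (β : Option ℕ) : Cmd :=
  .seq digitsCmd (.seq (paramCmd σ₀ t κ) (.seq addrCmd (constCmd β)))

/-- `ht` and `htn` keep the operands of the division below `2 ^ w`. Of the argument `β` only its
shape matters: the finite bound is computed from `q`. -/
theorem runs_setupCmd {xs : List (BitVec w)} (E : Env w) {σ₀ t κ : ℕ} {β : Option ℕ}
    (hn : E.n = xs.length)
    (hX : E.X = offsetNum xs) (hσ : E.σ = σ₀ + 1 + digits E.n * (t + 1) / (2 * t))
    (hwA : E.wA = κ * (2 * E.σ + 3)) (hβ : β.isSome = E.β.isSome)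
    (ht : 2 * t < 2 ^ w) (htn : digits E.n * (t + 1) < 2 ^ w)
    {s : State w} (h : HasRead xs xs.length s) :
    Runs (setupCmd σ₀ t κ β) s (fun s' => E.Consts₀ s' ∧ E.Data s' ∧ Fresh E.wA s')
      (100 + 4 * E.n) := by
  have hQ := E.eight_Q_le
  have hwd := E.word_ge
  have hreg := E.region_eq
  have hQ0 := E.Q_pos
  have hnQ := E.n_le
  have hw8 := E.hw
  have hσw := E.hσ
  have hww : w < 2 ^ w := Nat.lt_two_pow_self
  rw [← hn] at h
  refine ((runs_digitsCmd (n := E.n) E.w_ne_zero (by omega) h.r0 h.r1).seq (B₂ := 90)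
    fun s₁ ⟨a1, a41⟩ => ?_).mono (fun _ h => h) ?_
  swap
  · rw [show (1 : ℝ≥0∞) + (5 + 4 * E.n) + 90 = (1 + 5 + 90) + 4 * E.n by ring]
    gcongr; norm_num
  have hs₁ : ∀ r, r ∉ [40, 41] → s₁.regs r = s.regs r := a1.regs
  have r1 : Runs (paramCmd σ₀ t κ) s₁ (fun s' => Agree [2, 3, 4, 5, 6, 42, 43, 44, 45] s₁ s' ∧
      s'.regs 2 = BitVec.ofNat w E.q ∧ s'.regs 3 = BitVec.ofNat w E.Q ∧
      s'.regs 4 = BitVec.ofNat w (E.Q - 1) ∧ s'.regs 5 = BitVec.ofNat w (2 ^ E.wA - 1) ∧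
      s'.regs 6 = BitVec.ofNat w E.wA ∧ s'.regs 43 = BitVec.ofNat w (2 * E.σ)) 29 := by
    have e1 : BitVec.ofNat w (digits E.n * (t + 1)) / BitVec.ofNat w (2 * t) =
      BitVec.ofNat w (digits E.n * (t + 1) / (2 * t)) := div_ofNat htn ht
    have e2 : BitVec.ofNat w 1 <<< BitVec.ofNat w E.σ = BitVec.ofNat w E.q := by
      rw [shl_ofNat _ (by omega), one_mul, q]
    have e3 : BitVec.ofNat w 1 <<< BitVec.ofNat w E.wA = BitVec.ofNat w (2 ^ E.wA) := by
      rw [shl_ofNat _ (by omega), one_mul]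
    refine Runs.straight rfl ⟨?_, ?_, ?_, ?_, ?_, ?_, ?_⟩ (by norm_num [paramCmd, block, Cmd.time])
    · simp only [paramCmd, block, det]
      repeat refine Agree.set ?_ (by simp) _
      exact Agree.refl _ _
    all_goals
      simp only [paramCmd, block, det, Function.update_apply, State.set_regs, BinOp.eval,
        Nat.reduceEqDiff, reduceIte, a41, hs₁ 0 (by simp), hs₁ 22 (by simp), h.r0, h.r22, mul_ofNat,
        add_ofNat, e1, ← hσ, e2, OfNat.zero_ne_ofNat, ← Nat.two_mul, ← hwA, e3, ← Q_eq]
    · exact sub_ofNat hQ0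
    · exact sub_ofNat (by omega)
  refine (r1.seq (B₂ := 60) fun s₂ ⟨b, b2, b3, b4, b5, b6, b43⟩ => ?_).mono (fun _ h => h)
    (by norm_num)
  have c0 : s₂.regs 0 = BitVec.ofNat w 1 := (b.regs 0 (by simp)).trans ((hs₁ 0 (by simp)).trans h.r0)
  have c22 : s₂.regs 22 = BitVec.ofNat w 3 :=
    (b.regs 22 (by simp)).trans ((hs₁ 22 (by simp)).trans h.r22)
  have hB : BitVec.ofNat w 1 <<< BitVec.ofNat w (E.wA + 4) = BitVec.ofNat w (2 ^ (E.wA + 4)) := by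
    rw [shl_ofNat _ (by omega), one_mul]
  have haddr : ∀ j, BitVec.ofNat w (j * 2 ^ (E.wA + 4)) = addr w E.wA j 0 := fun j => rfl
  have r2 : Runs addrCmd s₂ (fun s' => Agree [7, 8, 9, 10, 11, 12, 13, 14, 44] s₂ s' ∧
      s'.regs 7 = addr w E.wA 1 0 ∧ s'.regs 8 = addr w E.wA 3 0 ∧ s'.regs 9 = addr w E.wA 4 0 ∧
      s'.regs 10 = addr w E.wA 5 0 ∧ s'.regs 11 = addr w E.wA 6 0 ∧ s'.regs 12 = addr w E.wA 7 0 ∧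
      s'.regs 13 = addr w E.wA 8 0 ∧ s'.regs 14 = addr w E.wA 2 0) 21 := by
    refine Runs.straight rfl ⟨?_, ?_, ?_, ?_, ?_, ?_, ?_, ?_, ?_⟩
      (by norm_num [addrCmd, block, Cmd.time])
    · simp only [addrCmd, block, det]
      repeat refine Agree.set ?_ (by simp) _
      exact Agree.refl _ _
    all_goals
      simp only [addrCmd, block, det, Function.update_apply, State.set_regs, BinOp.eval,
        Nat.reduceEqDiff, reduceIte, c0, b6, add_ofNat, hB, BitVec.or_self, OfNat.zero_ne_ofNat]
      rw [← haddr]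
      congr 1
      ring
  refine (r2.seq (B₂ := 30) fun s₃ ⟨d, d7, d8, d9, d10, d11, d12, d13, d14⟩ => ?_).mono
    (fun _ h => h) (by norm_num)
  have d0 : s₃.regs 0 = BitVec.ofNat w 1 := (d.regs 0 (by simp)).trans c0
  have d22 : s₃.regs 22 = BitVec.ofNat w 3 := (d.regs 22 (by simp)).trans c22
  have d2 : s₃.regs 2 = BitVec.ofNat w E.q := (d.regs 2 (by simp)).trans b2
  have d43 : s₃.regs 43 = BitVec.ofNat w (2 * E.σ) := (d.regs 43 (by simp)).trans b43
  have hw3 : BitVec.ofNat w 1 <<< BitVec.ofNat w (w - 3) = BitVec.ofNat w (2 ^ (w - 3)) := by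
    rw [shl_ofNat _ (by omega), one_mul]
  have hgap : ∀ s' : State w, s'.regs 0 = BitVec.ofNat w 1 → s'.regs 2 = BitVec.ofNat w E.q →
      (det (gapCmd β) s').regs 20 = BitVec.ofNat w (gapWord E.β) ∧
      Agree [20] s' (det (gapCmd β) s') ∧ (gapCmd β).straight = true ∧ (gapCmd β).time ≤ 3 := by
    intro s' h0 h2
    rcases β with _ | b
    · rcases E.hβ with hE | hE
      · refine ⟨?_, (Agree.refl _ _).set (by simp) _, rfl, by norm_num [gapCmd, Cmd.time]⟩
        simp [gapCmd, det, hE, gapWord]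
      · rw [hE] at hβ; simp at hβ
    · rcases E.hβ with hE | hE
      · rw [hE] at hβ; simp at hβ
      · refine ⟨?_, ((Agree.refl _ _).set (by simp) _).set (by simp) _, rfl,
          by norm_num [gapCmd, Cmd.time]⟩
        simp only [gapCmd, det, hE, gapWord, Function.update_apply, State.set_regs, BinOp.eval,
          reduceIte, h0, h2, add_ofNat, q, OfNat.zero_ne_ofNat, ← Nat.two_mul]
  -- Only the last command depends on the kind of gap; it is separated from the rest.
  have hsplit : ∀ s' : State w, ∃ s'', det (constCmd β) s' = det (gapCmd β) s'' ∧ s'' =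
      det (block [.wordSize 45, .op .sub 46 45 22, .op .shl 46 0 46,
  .op .mul 15 22 46, .op .sub 19 45 43, .const 46 6, .op .mul 21 46 2]) s' := fun s' =>
    ⟨_, rfl, rfl⟩
  obtain ⟨s₄, hs₄, hs₄'⟩ := hsplit s₃
  have f : Agree [15, 19, 21, 45, 46] s₃ s₄ := by
    rw [hs₄']
    simp only [block, det]
    repeat refine Agree.set ?_ (by simp) _
    exact Agree.refl _ _
  obtain ⟨g1, g2, g3, g4⟩ := hgap s₄ ((f.regs 0 (by simp)).trans d0) ((f.regs 2 (by simp)).trans d2)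
  have hstr : (constCmd β).straight = true := by
    simp [constCmd, block, Cmd.straight, g3]
  have htime : (constCmd β).time ≤ 30 := by
    simp only [constCmd, block, Cmd.time]; omega
  refine Runs.straight hstr ?_ (by exact_mod_cast htime)
  rw [hs₄]
  have k15 : s₄.regs 15 = BitVec.ofNat w (3 * 2 ^ (w - 3)) := by
    rw [hs₄']
    simp only [block, det, Function.update_apply, State.set_regs, BinOp.eval, Nat.reduceEqDiff,
      reduceIte, d0, d22, OfNat.zero_ne_ofNat]
    rw [sub_ofNat (by omega), hw3, mul_ofNat]
  have k19 : s₄.regs 19 = BitVec.ofNat w (w - 2 * E.σ) := by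
    rw [hs₄']
    simp only [block, det, Function.update_apply, State.set_regs, BinOp.eval, Nat.reduceEqDiff,
      reduceIte, d43, OfNat.zero_ne_ofNat]
    exact sub_ofNat (by omega)
  have k21 : s₄.regs 21 = BitVec.ofNat w (6 * E.q) := by
    rw [hs₄']
    simp only [block, det, Function.update_apply, State.set_regs, BinOp.eval, Nat.reduceEqDiff,
      reduceIte, d2, OfNat.zero_ne_ofNat, mul_ofNat]
  have gr : ∀ r ≠ 20, (det (gapCmd β) s₄).regs r = s₄.regs r := fun r hr =>
    g2.regs r (by simpa using hr)
  have mem_eq : (det (gapCmd β) s₄).mem = s.mem := by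
    rw [g2.mem, f.mem, d.mem, b.mem, a1.mem]
  refine ⟨⟨?_, ?_, ?_, ?_, ?_, ?_, ?_, ?_, ?_, ?_, ?_, ?_, ?_, ?_, ?_, ?_, ?_, g1, ?_, ?_, ?_⟩,
    ⟨fun i hi => ?_, fun i hi => ?_⟩, ⟨?_, fun r hr => ?_, fun j hj hj1 v hv => ?_, ?_⟩⟩
  · rw [gr 0 (by norm_num), f.regs 0 (by simp), d0]
  · rw [gr 1 (by norm_num), f.regs 1 (by simp), d.regs 1 (by simp), b.regs 1 (by simp),
      hs₁ 1 (by simp), h.r1]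
  · rw [gr 2 (by norm_num), f.regs 2 (by simp), d2]
  · rw [gr 3 (by norm_num), f.regs 3 (by simp), d.regs 3 (by simp), b3]
  · rw [gr 4 (by norm_num), f.regs 4 (by simp), d.regs 4 (by simp), b4]
  · rw [gr 5 (by norm_num), f.regs 5 (by simp), d.regs 5 (by simp), b5]
  · rw [gr 6 (by norm_num), f.regs 6 (by simp), d.regs 6 (by simp), b6]
  · rw [gr 7 (by norm_num), f.regs 7 (by simp), d7]
  · rw [gr 8 (by norm_num), f.regs 8 (by simp), d8]
  · rw [gr 9 (by norm_num), f.regs 9 (by simp), d9]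
  · rw [gr 10 (by norm_num), f.regs 10 (by simp), d10]
  · rw [gr 11 (by norm_num), f.regs 11 (by simp), d11]
  · rw [gr 12 (by norm_num), f.regs 12 (by simp), d12]
  · rw [gr 13 (by norm_num), f.regs 13 (by simp), d13]
  · rw [gr 14 (by norm_num), f.regs 14 (by simp), d14]
  · rw [gr 15 (by norm_num), k15]
  · rw [gr 19 (by norm_num), k19]
  · rw [gr 21 (by norm_num), k21]
  · rw [gr 22 (by norm_num), f.regs 22 (by simp), d22]
  · rw [gr 23 (by norm_num), f.regs 23 (by simp), d.regs 23 (by simp), b.regs 23 (by simp),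
      hs₁ 23 (by simp), h.r23]
  · rw [mem_eq, addr_zero, hX]; exact h.hi i hi
  · rw [mem_eq, addr_zero, hX]; exact h.lo i hi
  · rw [gr 39 (by norm_num), f.regs 39 (by simp), d.regs 39 (by simp), b.regs 39 (by simp),
      hs₁ 39 (by simp), h.regs 39 (by simp)]
  · rw [gr r (by omega), f.regs r (by simp; omega), d.regs r (by simp; omega),
      b.regs r (by simp; omega), hs₁ r (by simp; omega), h.regs r (by simp; omega)]
  · rw [mem_eq]
    refine h.zero _ ?_ ?_
    · have : 1 * 2 ^ (E.wA + 4) ≤ j * 2 ^ (E.wA + 4) := Nat.mul_le_mul_right _ hj1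
      omega
    · have : j * 2 ^ (E.wA + 4) ≤ 15 * 2 ^ (E.wA + 4) := Nat.mul_le_mul_right _ (by omega)
      omega
  · rw [g2.out, f.out, d.out, b.out, a1.out, h.out]

end Env

end WordRAM

/-! ### Correctness of the reduction and admissibility of its instances -/

namespace WordRAM

open DMOG

variable {w : ℕ}

namespace Env

variable (E : Env w)

/-- The hash sum gives `z`, and `u` is then solved from the hash value of `a`. The third position
marks `z`; the first two make both buckets nonempty. -/
theorem exists_candidate {a b c : ℕ} (ha : a < E.n) (hb : b < E.n) (hc : c < E.n)
    (hm : HashMatch w (2 * E.σ) E.a E.T (E.X a) (E.X b) (E.X c)) :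
    ∃ u < E.Q, ∃ z ∈ E.cand u, E.H a = E.hA u z ∧ E.H b = E.hB u z := by
  have hHa := E.H_lt a
  have hHb := E.H_lt b
  set z := (E.H a + E.H b) % E.Q with hz
  have hzQ : z < E.Q := Nat.mod_lt _ E.Q_pos
  have hdiv : z / E.q * E.q ≤ z := Nat.div_mul_le_self _ _
  set u := (E.H a + E.Q - z / E.q * E.q) % E.Q with hu
  have huQ : u < E.Q := Nat.mod_lt _ E.Q_pos
  have hA : E.H a = E.hA u z := by
    rw [hA, hu, Nat.mod_add_mod, show E.H a + E.Q - z / E.q * E.q + z / E.q * E.q = E.H a + E.Q by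
      omega, Nat.add_mod_right, Nat.mod_eq_of_lt hHa]
  have hB : E.H b = E.hB u z := by
    have h1 := E.hA_add_hB huQ.le hzQ
    rw [← hA] at h1
    have h2 : (E.H a + E.H b) % E.Q = (E.H a + E.hB u z) % E.Q := by rw [h1]
    have h3 := Nat.ModEq.add_left_cancel' (n := E.Q) (E.H a) h2
    rwa [Nat.ModEq, Nat.mod_eq_of_lt hHb, Nat.mod_eq_of_lt (E.hB_lt u z)] at h3
  obtain ⟨e, he, hH⟩ := (E.hashMatch_iff hz.symm).1 hm
  refine ⟨u, huQ, z, ?_, hA, hB⟩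
  simp only [cand, Finset.mem_filter, Finset.mem_range]
  simp only [mark, pA, pB, decide_eq_true_eq]
  exact ⟨hzQ, ⟨e, he, c, hc, hH⟩, ⟨a, ha, hA⟩, ⟨b, hb, hB⟩⟩

/-- Found triples have been tested exactly, and true triples always match by hash. The right side
does not mention the multiplier. -/
theorem exists_dirtyU_iff : (∃ u < E.Q, E.DirtyU u) ↔
    ∃ a < E.n, ∃ b < E.n, ∃ c < E.n, a ≠ b ∧ c ≠ a ∧ c ≠ b ∧ E.X a + E.X b + E.X c = E.T := by
  constructor
  · rintro ⟨u, _, z, _, a, ha, _, b, hb, _, hab, c, hc, hs, hca, hcb⟩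
    exact ⟨a, ha, b, hb, c, hc, hab, hca, hcb, hs⟩
  · rintro ⟨a, ha, b, hb, c, hc, hab, hca, hcb, hs⟩
    obtain ⟨u, hu, z, hz, hA, hB⟩ := E.exists_candidate ha hb hc
      (hashMatch_of_sum (by have := E.hw; have := E.hσ; omega) (by have := E.σ_pos; omega) _ hs)
    exact ⟨u, hu, z, hz, a, ha, hA, b, hb, hB, hab, c, hc, hs, hca, hcb⟩

end Env

/-- Adding `2 ^ (w - 1)` flips the sign bit, which turns two's complement into an unsigned number
shifted by a constant. -/
theorem offsetNum_eq (hw : 0 < w) (xs : List (BitVec w)) {i : ℕ} (hi : i < xs.length) :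
    (offsetNum xs i : ℤ) = xs[i].toInt + 2 ^ (w - 1) := by
  rw [offsetNum, List.getD_eq_getElem _ _ hi]
  have h2 : (2 : ℤ) ^ w = 2 * 2 ^ (w - 1) := by
    rw [← pow_succ']; congr 1; omega
  have h2' : 2 ^ w = 2 * 2 ^ (w - 1) := by
    rw [← pow_succ']; congr 1; omega
  have hlt := xs[i].isLt
  have hpos : 0 < 2 ^ (w - 1) := by positivity
  rw [BitVec.toInt_eq_toNat_cond, BitVec.toNat_add, toNat_ofNat_lt (by omega)]
  set v := xs[i].toNat
  set B := 2 ^ (w - 1) with hB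
  have hBz : ((2 : ℤ) ^ (w - 1)) = (B : ℤ) := by rw [hB]; push_cast; rfl
  rw [hBz, h2']
  split_ifs with h
  · rw [Nat.mod_eq_of_lt (by omega)]; push_cast; ring
  · have : (v + B) % (2 * B) = v + B - 2 * B := by
      rw [Nat.mod_eq_sub_mod (by omega), Nat.mod_eq_of_lt (by omega)]
    rw [this]
    omega

theorem exists_distinct_iff (hw : 0 < w) (xs : List (BitVec w)) :
    (∃ a < xs.length, ∃ b < xs.length, ∃ c < xs.length, a ≠ b ∧ c ≠ a ∧ c ≠ b ∧
      offsetNum xs a + offsetNum xs b + offsetNum xs c = 3 * 2 ^ (w - 1)) ↔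
    HasZeroTriple xs := by
  have key : ∀ (a b c : ℕ) (ha : a < xs.length) (hb : b < xs.length) (hc : c < xs.length),
      offsetNum xs a + offsetNum xs b + offsetNum xs c = 3 * 2 ^ (w - 1) ↔
      xs[a].toInt + xs[b].toInt + xs[c].toInt = 0 := by
    intro a b c ha hb hc
    have h1 := offsetNum_eq hw xs ha
    have h2 := offsetNum_eq hw xs hb
    have h3 := offsetNum_eq hw xs hc
    have hBz : ((2 : ℤ) ^ (w - 1)) = ((2 ^ (w - 1) : ℕ) : ℤ) := by push_cast; rfl
    rw [hBz] at h1 h2 h3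
    omega
  constructor
  · rintro ⟨a, ha, b, hb, c, hc, hab, hca, hcb, hs⟩
    rw [key a b c ha hb hc] at hs
    have sorted : ∀ (i j k : ℕ) (hi : i < xs.length) (hj : j < xs.length) (hk : k < xs.length),
        i < j → j < k → xs[i].toInt + xs[j].toInt + xs[k].toInt = 0 → HasZeroTriple xs :=
      fun i j k hi hj hk h1 h2 h => ⟨⟨i, hi⟩, ⟨j, hj⟩, ⟨k, hk⟩, h1, h2, h⟩
    -- Six of the eight cases are the orders of three positions; the two cyclic ones are
    -- contradictory.
    rcases lt_or_gt_of_ne hab with h1 | h1 <;> rcases lt_or_gt_of_ne hca with h2 | h2 <;>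
      rcases lt_or_gt_of_ne hcb with h3 | h3
    · exact sorted c a b hc ha hb h2 h1 (by linarith)
    · omega
    · exact sorted a c b ha hc hb h2 h3 (by linarith)
    · exact sorted a b c ha hb hc h1 h3 (by linarith)
    · exact sorted c b a hc hb ha h3 h1 (by linarith)
    · exact sorted b c a hb hc ha h3 h2 (by linarith)
    · omega
    · exact sorted b a c hb ha hc h1 h2 (by linarith)
  · rintro ⟨i, j, k, hij, hjk, h⟩
    have h1 : i.1 < j.1 := hij
    have h2 : j.1 < k.1 := hjk
    exact ⟨i, i.2, j, j.2, k, k.2, by omega, by omega, by omega, (key _ _ _ i.2 j.2 k.2).2 h⟩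

/-- The gap bound that is used for the dictionaries. -/
def gapBound (kind : GapKind) (q : ℕ) : Option ℕ :=
  match kind with
  | .unbounded => none
  | _ => some (2 * q)

/-- The program that reduces 3SUM to dictionary matching. -/
def reduction (A : DMOG.Algorithm) (kind : GapKind) (σ₀ t : ℕ) : Cmd :=
  .seq readCmd (.seq (Env.setupCmd σ₀ t A.κ₂ (gapBound kind 0))
    (Env.randCmd (A.pre.regBound + A.query.regBound) A.pre A.query))

/-- Chosen so that `2 ^ σ` is `n ^ ((1 + 1 / t) / 2)` up to a constant factor; `σ₀` makes even the
instances for small `n` as large as needed. -/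
def sigma (σ₀ t n : ℕ) : ℕ := σ₀ + 1 + digits n * (t + 1) / (2 * t)

theorem sigma_le {σ₀ t n : ℕ} (ht : 1 ≤ t) : sigma σ₀ t n ≤ σ₀ + 1 + digits n := by
  have : digits n * (t + 1) / (2 * t) ≤ digits n := by
    refine Nat.div_le_of_le_mul ?_
    rw [mul_comm]
    exact Nat.mul_le_mul_right _ (by omega)
  rw [sigma]; omega

/-- Guarantees that there are at least `n` hash values. -/
theorem le_sigma {σ₀ t n : ℕ} (ht : 1 ≤ t) : digits n + 1 ≤ 2 * sigma σ₀ t n := by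
  have : digits n / 2 ≤ digits n * (t + 1) / (2 * t) := by
    rw [Nat.le_div_iff_mul_le (by omega)]
    calc digits n / 2 * (2 * t) = (digits n / 2 * 2) * t := by ring
      _ ≤ digits n * (t + 1) := Nat.mul_le_mul (by omega) (by omega)
  rw [sigma]; omega

/-- The word size that the reduction needs is `wordFactor` times the length of the input size. -/
def wordFactor (A : DMOG.Algorithm) (σ₀ t : ℕ) : ℕ := A.κ₂ * (2 * σ₀ + 7) + 8 + (2 * t + 2)

theorem lt_two_pow_digits (n : ℕ) : n < 2 ^ digits n := by
  rw [digits]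
  split_ifs with h
  · simp [h]
  · exact Nat.lt_pow_succ_log_self (by norm_num) n

/-- The data of the reduction for the input `xs`. -/
def instanceEnv (A : DMOG.Algorithm) (kind : GapKind) {σ₀ t : ℕ} (ht : 1 ≤ t)
    (xs : List (BitVec w)) (hxs : xs ≠ [])
    (hw : wordFactor A σ₀ t * (Nat.log 2 xs.length + 1) ≤ w) : Env w where
  -- The largest admissible word size, since `⌊log₂ N⌋ + 1 = 2 σ + 3` by `log_instSize`.
  wA := A.κ₂ * (2 * sigma σ₀ t xs.length + 3)
  σ := sigma σ₀ t xs.length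
  n := xs.length
  X := offsetNum xs
  a := 0
  β := gapBound kind (2 ^ sigma σ₀ t xs.length)
  hw := by
    have h1 := sigma_le (σ₀ := σ₀) (n := xs.length) ht
    have hd : digits xs.length = Nat.log 2 xs.length + 1 := by
      rw [digits, if_neg (by simpa using hxs)]
    rw [hd] at h1
    set L := Nat.log 2 xs.length + 1 with hL
    have hL1 : 1 ≤ L := by omega
    have h2 : 2 * sigma σ₀ t xs.length + 3 ≤ (2 * σ₀ + 7) * L := by nlinarith
    calc A.κ₂ * (2 * sigma σ₀ t xs.length + 3) + 8 ≤ A.κ₂ * ((2 * σ₀ + 7) * L) + 8 * L := by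
          have := Nat.mul_le_mul_left A.κ₂ h2; omega
      _ ≤ wordFactor A σ₀ t * L := by rw [wordFactor]; nlinarith
      _ ≤ w := hw
  hσ := by
    have := A.lt
    exact Nat.le_mul_of_pos_left _ (by omega)
  σ_pos := by
    rw [sigma]
    exact Nat.le_add_right_of_le (Nat.le_add_left _ _)
  hn := by
    have h1 := le_sigma (σ₀ := σ₀) (n := xs.length) ht
    exact (lt_two_pow_digits _).le.trans (Nat.pow_le_pow_right (by norm_num) (by omega))
  hX := fun i => BitVec.isLt _
  hβ := by cases kind <;> simp [gapBound]

section Instance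

variable {A : DMOG.Algorithm} {kind : GapKind} {σ₀ t : ℕ} {ht : 1 ≤ t}
  {xs : List (BitVec w)} {hxs : xs ≠ []}
  {hw : wordFactor A σ₀ t * (Nat.log 2 xs.length + 1) ≤ w}

theorem instSize_dict (E : Env w) (u : ℕ) :
    instSize E.dict (E.text u) = 4 * E.Q + 2 * E.q + E.β.getD 0 := by
  rw [instSize, Env.dict, Env.text, gadget_size, gadgetText_length,
    gadget_bound (by have := E.two_le_q; omega), Env.Q_eq]

theorem instSize_bounds (E : Env w) (u : ℕ) :
    4 * E.Q ≤ instSize E.dict (E.text u) ∧ instSize E.dict (E.text u) < 8 * E.Q := by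
  rw [instSize_dict]
  have h1 := E.two_le_q
  have h2 : 2 * E.q ≤ E.Q := by rw [Env.Q_eq]; exact Nat.mul_le_mul_right _ h1
  have h3 : E.β.getD 0 ≤ 2 * E.q := by
    rcases E.hβ with h | h <;> rw [h] <;> simp [Env.q]
  omega

/-- `N` stays between `4 Q` and `8 Q` for all kinds of gaps and all texts, so one word size serves
the preprocessing and every query. -/
theorem log_instSize (E : Env w) (u : ℕ) : Nat.log 2 (instSize E.dict (E.text u)) = 2 * E.σ + 2 := by
  obtain ⟨h1, h2⟩ := instSize_bounds E u
  rw [Nat.log_eq_iff (Or.inl (by omega))]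
  constructor
  · rw [pow_add, ← Env.Q]; omega
  · rw [show 2 * E.σ + 2 + 1 = 2 * E.σ + 3 by ring, pow_add, ← Env.Q]; omega

theorem admissible (E : Env w) (hβ : E.β = gapBound kind E.q) (hwA : E.wA = A.κ₂ * (2 * E.σ + 3))
    (u : ℕ) : A.Admissible kind E.dict (E.text u) E.wA := by
  have hq := E.two_le_q
  refine ⟨?_, gadget_nodup (by omega), fun P => gadget_valid, ?_, fun P hP a ha => ?_,
    fun a ha => ?_, ?_, ?_⟩
  · intro h
    have := congrArg List.length h
    rw [Env.dict, gadget_length, ← Env.Q_eq] at this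
    have := E.Q_pos
    simp at *
    omega
  · cases kind with
    | unbounded =>
      intro p α β q h
      obtain ⟨j, _, hj⟩ := mem_gadget h
      rw [Pattern.gapped.injEq] at hj
      exact ⟨hj.2.1, hj.2.2.1.trans hβ⟩
    | uniform =>
      refine ⟨0, 2 * E.q, fun p α β q h => ?_⟩
      obtain ⟨j, _, hj⟩ := mem_gadget h
      rw [Pattern.gapped.injEq] at hj
      exact ⟨hj.2.1, hj.2.2.1.trans hβ⟩
    | nonuniform =>
      intro p α β q h
      obtain ⟨j, _, hj⟩ := mem_gadget h
      rw [Pattern.gapped.injEq] at hj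
      rw [hj.2.2.1, hβ]; simp [gapBound]
  · rw [Env.dict, gadget_size]; exact gadget_alphabet hq hP ha
  · rw [Env.dict, gadget_size]; exact gadgetText_alphabet hq ha
  · rw [log_instSize, hwA]; exact Nat.mul_le_mul_right _ A.lt.le
  · rw [log_instSize, hwA]

/-- `Solves` speaks of one text at a time. Postconditions hold in all reachable states, so those for
all texts can be combined, and one preprocessing serves all of them. -/
theorem computes_forall {wA : ℕ} {c : Cmd} {s : State wA} {Q : ℕ} {post : ℕ → State wA → Prop}
    (hQ : 0 < Q) (h : ∀ u < Q, Computes c s (post u)) :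
    Computes c s fun s' => ∀ u < Q, post u s' :=
  ⟨(h 0 hQ).1, fun s' hs' u hu => (h u hu).2 s' hs'⟩

theorem runs_reduction {mode : Mode} (hA : A.Solves kind mode) :
    Runs (reduction A kind σ₀ t) (State.init xs) (fun s => s.out ≠ [] ↔ HasZeroTriple xs)
      (200 + 60 * xs.length + ∑ v : BitVec w, ((2 : ℝ≥0∞) ^ w)⁻¹ *
        ((instanceEnv A kind ht xs hxs hw).withMul v.toNat).mainCost
          (A.pre.regBound + A.query.regBound) A.pre A.query) := by
  set E := instanceEnv A kind ht xs hxs hw with hE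
  have hwd := E.word_ge
  have hQ := E.eight_Q_le
  have hQ0 := E.Q_pos
  have hn := E.n_le
  have hEn : E.n = xs.length := rfl
  have hw8 := E.hw
  have hww : w < 2 ^ w := Nat.lt_two_pow_self
  have hd : digits xs.length = Nat.log 2 xs.length + 1 := by
    rw [digits, if_neg (by simpa using hxs)]
  -- The summand `2 * t + 2` of `wordFactor` is there to keep the computation of the parameters free
  -- of overflow.
  have hlog : (2 * t + 2) * (Nat.log 2 xs.length + 1) ≤ w := by
    refine le_trans (Nat.mul_le_mul_right _ ?_) hw
    rw [wordFactor]; omega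
  refine ((runs_readCmd (by omega) (by omega)).seq fun s₁ h₁ =>
    (Env.runs_setupCmd E (σ₀ := σ₀) (t := t) (κ := A.κ₂) (β := gapBound kind 0) rfl rfl rfl rfl
      (by simp only [hE, instanceEnv]; cases kind <;> rfl) ?_ ?_ h₁).seq fun s₂ ⟨h2, h3, h4⟩ =>
    E.runs_randCmd (mode := mode) (Nat.le_add_right _ _) (Nat.le_add_left _ _) h2 h3 h4
      (P := HasZeroTriple xs)
      (fun a _ => ?_) fun a _ => computes_forall hQ0 fun u _ =>
        hA _ _ _ (admissible (E.withMul a) rfl rfl u)).mono (fun _ h => h) ?_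
  · nlinarith
  · rw [hEn, hd]; nlinarith
  · rw [← exists_distinct_iff (by omega) xs]
    exact (Env.exists_dirtyU_iff (E.withMul a)).symm
  · have hc : Fintype.card (BitVec w) = 2 ^ w := by
      rw [Fintype.card_congr (BitVec.equivFin (m := w)).toEquiv, Fintype.card_fin]
    have h1 : ∀ X : ℝ≥0∞, ∑ v : BitVec w, ((2 : ℝ≥0∞) ^ w)⁻¹ * X = X := by
      intro X
      rw [Finset.sum_const, Finset.card_univ, hc, nsmul_eq_mul, ← mul_assoc]
      push_cast
      rw [ENNReal.mul_inv_cancel (by simp) (by simp), one_mul]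
    simp only [mul_add, Finset.sum_add_distrib, h1, hEn]
    rw [show ∀ n S : ℝ≥0∞, 1 + (21 + 20 * n) + (1 + (100 + 4 * n) + (2 + (30 + 32 * n + S))) =
      (1 + 21 + 1 + 100 + 2 + 30) + (20 + 4 + 32) * n + S from fun n S => by ring]
    gcongr <;> norm_num

end Instance

end WordRAM

/-! ### Charging reports and searches to matching triples -/

namespace WordRAM

open DMOG

variable {w : ℕ}

namespace Env

variable (E : Env w)

/-- Some third position has a matching hash value. -/
def Marked (a b : ℕ) : Prop := ∃ c < E.n, HashMatch w (2 * E.σ) E.a E.T (E.X a) (E.X b) (E.X c)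

-- A pair of positions belongs to at most one `(u, z)`: its hash sum forces `z`, and then the hash
-- value of `a` forces `u`. It contributes only if `z` is marked, that is, if some third position
-- matches.
open Classical in
theorem sum_cand_le (g : ℕ → ℕ → ℝ≥0∞) :
    ∑ u ∈ Finset.range E.Q, ∑ z ∈ E.cand u, ∑ a ∈ Finset.range E.n, ∑ b ∈ Finset.range E.n,
      (if E.H a = E.hA u z ∧ E.H b = E.hB u z then g a b else 0) ≤
    ∑ a ∈ Finset.range E.n, ∑ b ∈ Finset.range E.n, if E.Marked a b then g a b else 0 := by
  have h1 : ∀ u, ∑ z ∈ E.cand u, ∑ a ∈ Finset.range E.n, ∑ b ∈ Finset.range E.n,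
      (if E.H a = E.hA u z ∧ E.H b = E.hB u z then g a b else 0) =
      ∑ a ∈ Finset.range E.n, ∑ b ∈ Finset.range E.n, ∑ z ∈ E.cand u,
        (if E.H a = E.hA u z ∧ E.H b = E.hB u z then g a b else 0) := fun u => by
    rw [Finset.sum_comm]
    exact Finset.sum_congr rfl fun a _ => Finset.sum_comm
  simp only [h1]
  rw [Finset.sum_comm]
  refine Finset.sum_le_sum fun a ha => ?_
  rw [Finset.sum_comm]
  refine Finset.sum_le_sum fun b hb => ?_
  rw [Finset.sum_sigma']
  rw [← Finset.sum_filter, Finset.sum_const, nsmul_eq_mul]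
  set S := ((Finset.range E.Q).sigma fun u => E.cand u).filter
    fun x => E.H a = E.hA x.1 x.2 ∧ E.H b = E.hB x.1 x.2 with hS
  have hmem : ∀ x ∈ S, x.1 < E.Q ∧ x.2 ∈ E.cand x.1 ∧ E.H a = E.hA x.1 x.2 ∧
      E.H b = E.hB x.1 x.2 := by
    intro x hx
    simp only [hS, Finset.mem_filter, Finset.mem_sigma, Finset.mem_range] at hx
    exact ⟨hx.1.1, hx.1.2, hx.2⟩
  have hz : ∀ x ∈ S, x.2 = (E.H a + E.H b) % E.Q ∧ x.2 < E.Q := by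
    intro x hx
    obtain ⟨hu, hz, hA, hB⟩ := hmem x hx
    have hzQ : x.2 < E.Q := by
      simp only [cand, Finset.mem_filter, Finset.mem_range] at hz
      exact hz.1
    rw [hA, hB, E.hA_add_hB hu.le hzQ]
    exact ⟨rfl, hzQ⟩
  have hcard : S.card ≤ 1 := by
    refine Finset.card_le_one.2 fun x hx y hy => ?_
    have h2 : x.2 = y.2 := (hz x hx).1.trans (hz y hy).1.symm
    have h3 : x.1 = y.1 := by
      have hx' := hmem x hx
      have hy' := hmem y hy
      have h4 : (x.1 + x.2 / E.q * E.q) % E.Q = (y.1 + x.2 / E.q * E.q) % E.Q := by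
        have := hx'.2.2.1.symm.trans hy'.2.2.1
        rw [← h2] at this
        exact this
      have h5 := Nat.ModEq.add_right_cancel' (n := E.Q) (x.2 / E.q * E.q) h4
      rwa [Nat.ModEq, Nat.mod_eq_of_lt hx'.1, Nat.mod_eq_of_lt hy'.1] at h5
    exact Sigma.ext h3 (heq_of_eq h2)
  split_ifs with hm
  · calc (S.card : ℝ≥0∞) * g a b ≤ 1 * g a b := by gcongr; exact_mod_cast hcard
      _ = _ := one_mul _
  · have : S = ∅ := by
      refine Finset.eq_empty_of_forall_notMem fun x hx => hm ?_
      obtain ⟨hu, hzc, hA, hB⟩ := hmem x hx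
      have hzx := (hz x hx).1
      simp only [cand, Finset.mem_filter, Finset.mem_range] at hzc
      have hmark := hzc.2.1
      simp only [mark, decide_eq_true_eq] at hmark
      obtain ⟨e, he, c, hc, hH⟩ := hmark
      exact ⟨c, hc, (E.hashMatch_iff hzx.symm).2 ⟨e, he, hH⟩⟩
    rw [this]; simp

-- The constant is `174 = 32 + 32 + 110`: the overheads of the report, of the first position and of
-- the pair itself.
open Classical in
noncomputable def pairCost (a b : ℕ) : ℝ≥0∞ :=
  if E.Dirty a b then 0 else 174 + E.costP a b ((E.H a + E.H b) % E.Q)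

theorem exists_of_mem_cand {u z : ℕ} (hz : z ∈ E.cand u) :
    z < E.Q ∧ (∃ a < E.n, E.H a = E.hA u z) ∧ ∃ b < E.n, E.H b = E.hB u z := by
  simp only [cand, Finset.mem_filter, Finset.mem_range] at hz
  simp only [pA, pB, decide_eq_true_eq] at hz
  exact ⟨hz.1, hz.2.2⟩

-- Both buckets of a reported `z` are nonempty. If none of its pairs is dirty, there is a clean pair
-- that can pay the amount `k`.
open Classical in
theorem sum_clean_ge {u z : ℕ} (hz : z ∈ E.cand u) (hd : ¬ E.DirtyA u z) (k : ℝ≥0∞) :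
    k ≤ ∑ a ∈ Finset.range E.n, ∑ b ∈ Finset.range E.n,
      if E.H a = E.hA u z ∧ E.H b = E.hB u z then (if E.Dirty a b then 0 else k) else 0 := by
  obtain ⟨_, ⟨a, ha, hA⟩, b, hb, hB⟩ := E.exists_of_mem_cand hz
  have hab : ¬ E.Dirty a b := fun h => hd ⟨a, ha, hA, b, hb, hB, h⟩
  calc k = if E.H a = E.hA u z ∧ E.H b = E.hB u z then (if E.Dirty a b then 0 else k) else 0 := by
        rw [if_pos ⟨hA, hB⟩, if_neg hab]
    _ ≤ ∑ b ∈ Finset.range E.n, if E.H a = E.hA u z ∧ E.H b = E.hB u z then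
          (if E.Dirty a b then 0 else k) else 0 :=
        Finset.single_le_sum (f := fun b => if E.H a = E.hA u z ∧ E.H b = E.hB u z then
          (if E.Dirty a b then 0 else k) else 0) (fun _ _ => zero_le) (Finset.mem_range.2 hb)
    _ ≤ _ := Finset.single_le_sum (f := fun a => ∑ b ∈ Finset.range E.n,
          if E.H a = E.hA u z ∧ E.H b = E.hB u z then (if E.Dirty a b then 0 else k) else 0)
          (fun _ _ => zero_le) (Finset.mem_range.2 ha)

-- The overheads of reports and of first positions are shifted to clean pairs of the same buckets;
-- anything dirty is free at this level.
open Classical in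
theorem costU_le {u : ℕ} (hu : u ≤ E.Q) : E.costU u ≤
    ∑ z ∈ E.cand u, ∑ a ∈ Finset.range E.n, ∑ b ∈ Finset.range E.n,
      (if E.H a = E.hA u z ∧ E.H b = E.hB u z then E.pairCost a b else 0) := by
  rw [costU]
  refine Finset.sum_le_sum fun z hz => ?_
  obtain ⟨hzQ, _, b₀, hb₀, hB₀⟩ := E.exists_of_mem_cand hz
  have h1 : (if E.DirtyA u z then 0 else 32) ≤ ∑ a ∈ Finset.range E.n, ∑ b ∈ Finset.range E.n,
      if E.H a = E.hA u z ∧ E.H b = E.hB u z then (if E.Dirty a b then (0 : ℝ≥0∞) else 32)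
        else 0 := by
    split_ifs with hd
    · exact zero_le
    · exact E.sum_clean_ge hz hd 32
  have h2 : E.costA u z ≤ ∑ a ∈ Finset.range E.n, ∑ b ∈ Finset.range E.n,
      if E.H a = E.hA u z ∧ E.H b = E.hB u z then
        ((if E.Dirty a b then 0 else 32) + E.weight z a b) else 0 := by
    rw [costA]
    refine Finset.sum_le_sum fun a ha => ?_
    split_ifs with hA hd
    · rw [zero_add, costB]
      refine Finset.sum_le_sum fun b hb => ?_
      simp only [hA, true_and]
      split_ifs
      · simp
      · exact le_add_self
      · rfl
    · simp only [hA, true_and]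
      have h3 : (32 : ℝ≥0∞) ≤ ∑ b ∈ Finset.range E.n, if E.H b = E.hB u z then
          (if E.Dirty a b then 0 else 32) else 0 := by
        have hab : ¬ E.Dirty a b₀ := fun h => hd ⟨b₀, hb₀, hB₀, h⟩
        calc (32 : ℝ≥0∞) = if E.H b₀ = E.hB u z then (if E.Dirty a b₀ then 0 else 32) else 0 := by
              rw [if_pos hB₀, if_neg hab]
          _ ≤ _ := Finset.single_le_sum (f := fun b => if E.H b = E.hB u z then
              (if E.Dirty a b then (0 : ℝ≥0∞) else 32) else 0) (fun _ _ => zero_le)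
              (Finset.mem_range.2 hb₀)
      rw [costB]
      refine (add_le_add h3 le_rfl).trans ?_
      rw [← Finset.sum_add_distrib]
      refine Finset.sum_le_sum fun b _ => ?_
      by_cases hB : E.H b = E.hB u z
      · simp only [hB, if_true]; rfl
      · simp [hB]
    · exact zero_le
  refine (add_le_add h1 h2).trans ?_
  rw [← Finset.sum_add_distrib]
  refine Finset.sum_le_sum fun a _ => ?_
  rw [← Finset.sum_add_distrib]
  refine Finset.sum_le_sum fun b _ => ?_
  split_ifs with hAB hd
  · simp [weight, hd]
  · have hzz : (E.H a + E.H b) % E.Q = z := by rw [hAB.1, hAB.2, E.hA_add_hB hu hzQ]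
    rw [weight, if_neg hd, pairCost, if_neg hd, hzz, ← add_assoc, ← add_assoc]
    gcongr; norm_num
  · simp

open Classical in
theorem card_cand_le {u : ℕ} (hd : ¬ E.DirtyU u) : ((E.cand u).card : ℝ≥0∞) ≤
    ∑ z ∈ E.cand u, ∑ a ∈ Finset.range E.n, ∑ b ∈ Finset.range E.n,
      (if E.H a = E.hA u z ∧ E.H b = E.hB u z then (if E.Dirty a b then 0 else 1) else 0) := by
  rw [Finset.card_eq_sum_ones]
  push_cast
  exact Finset.sum_le_sum fun z hz => E.sum_clean_ge hz (fun h => hd ⟨z, hz, h⟩) 1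

open Classical in
/-- The number of third positions with a matching hash value. -/
noncomputable def matchCount (a b : ℕ) : ℕ := ∑ c ∈ Finset.range E.n,
  if HashMatch w (2 * E.σ) E.a E.T (E.X a) (E.X b) (E.X c) then 1 else 0

open Classical in
/-- The number of triples with matching hash values and wrong sum. -/
noncomputable def falseCount : ℕ := ∑ a ∈ Finset.range E.n, ∑ b ∈ Finset.range E.n,
  ∑ c ∈ Finset.range E.n, if E.X a + E.X b + E.X c ≠ E.T ∧
    HashMatch w (2 * E.σ) E.a E.T (E.X a) (E.X b) (E.X c) then 1 else 0

theorem matchCount_pos {a b : ℕ} (h : E.Marked a b) : 1 ≤ E.matchCount a b := by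
  classical
  obtain ⟨c, hc, hm⟩ := h
  have := Finset.single_le_sum (f := fun c =>
    if HashMatch w (2 * E.σ) E.a E.T (E.X a) (E.X b) (E.X c) then 1 else 0)
    (fun _ _ => Nat.zero_le _) (Finset.mem_range.2 hc)
  rw [if_pos hm] at this
  rw [matchCount]
  convert this

theorem costP_le_matchCount {a b : ℕ} (hab : a ≠ b) :
    E.costP a b ((E.H a + E.H b) % E.Q) ≤ 150 * E.matchCount a b := by
  classical
  have h : ∀ e < 3, E.costC e ((E.H a + E.H b) % E.Q) ≤ 50 * E.matchCount a b := by
    intro e he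
    rw [costC, matchCount]
    push_cast
    rw [Finset.mul_sum]
    refine Finset.sum_le_sum fun c _ => ?_
    split_ifs with h1 h2
    · simp
    · exact absurd ((E.hashMatch_iff rfl).2 ⟨e, he, h1⟩) h2
    · simp
    · simp
  rw [costP, if_neg hab]
  calc _ ≤ 50 * (E.matchCount a b : ℝ≥0∞) + 50 * E.matchCount a b + 50 * E.matchCount a b :=
        add_le_add (add_le_add (h 0 (by norm_num)) (h 1 (by norm_num))) (h 2 (by norm_num))
    _ = _ := by ring

open Classical in
/-- The matching triples that are visited without success. -/
noncomputable def cleanCount : ℕ := ∑ a ∈ Finset.range E.n, ∑ b ∈ Finset.range E.n,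
  if a ≠ b ∧ ¬ E.Dirty a b then E.matchCount a b else 0

/-- A clean pair has two sorts of matches: triples of wrong sum, and the degenerate ones with `c =
a` or `c = b`. The latter solve `2 X a + X b = T` or `X a + 2 X b = T`, and each equation
contributes at most `n` clean pairs. -/
theorem cleanCount_le : E.cleanCount ≤ E.falseCount + 2 * E.n := by
  classical
  have hclean : ∀ {a b c : ℕ}, c < E.n → a ≠ b → ¬ E.Dirty a b → E.X a + E.X b + E.X c = E.T →
      c = a ∨ c = b := by
    intro a b c hc hab hd hs
    by_contra h
    rw [not_or] at h
    exact hd ⟨hab, c, hc, hs, h.1, h.2⟩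
  set G : ℕ → ℕ → Prop := fun a b => a ≠ b ∧ ¬ E.Dirty a b ∧ E.X a + E.X b + E.X a = E.T with hG
  set G' : ℕ → ℕ → Prop := fun a b => a ≠ b ∧ ¬ E.Dirty a b ∧ E.X a + E.X b + E.X b = E.T with hG'
  have h1 : E.cleanCount ≤ ∑ a ∈ Finset.range E.n, ∑ b ∈ Finset.range E.n,
      (∑ c ∈ Finset.range E.n, (if E.X a + E.X b + E.X c ≠ E.T ∧
        HashMatch w (2 * E.σ) E.a E.T (E.X a) (E.X b) (E.X c) then 1 else 0) +
        (if G a b then 1 else 0) + (if G' a b then 1 else 0)) := by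
    refine Finset.sum_le_sum fun a ha => Finset.sum_le_sum fun b hb => ?_
    by_cases h0 : a ≠ b ∧ ¬ E.Dirty a b
    swap
    · rw [if_neg h0]; exact Nat.zero_le _
    rw [if_pos h0]
    rw [Finset.mem_range] at ha hb
    calc E.matchCount a b ≤ ∑ c ∈ Finset.range E.n, ((if E.X a + E.X b + E.X c ≠ E.T ∧
        HashMatch w (2 * E.σ) E.a E.T (E.X a) (E.X b) (E.X c) then 1 else 0) +
        (if c = a then (if G a b then 1 else 0) else 0) +
        (if c = b then (if G' a b then 1 else 0) else 0)) := by
          refine Finset.sum_le_sum fun c hc => ?_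
          rw [Finset.mem_range] at hc
          by_cases hm : HashMatch w (2 * E.σ) E.a E.T (E.X a) (E.X b) (E.X c)
          swap
          · rw [if_neg hm]; exact Nat.zero_le _
          rw [if_pos hm]
          by_cases hs : E.X a + E.X b + E.X c = E.T
          · rcases hclean hc h0.1 h0.2 hs with rfl | rfl
            · rw [if_pos (rfl : c = c), if_pos (⟨h0.1, h0.2, hs⟩ : G c b)]; omega
            · rw [if_pos (rfl : c = c), if_pos (⟨h0.1, h0.2, hs⟩ : G' a c)]; omega
          · rw [if_pos ⟨hs, hm⟩]; omega
      _ = _ := by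
          rw [Finset.sum_add_distrib, Finset.sum_add_distrib, Finset.sum_ite_eq',
            Finset.sum_ite_eq', if_pos (Finset.mem_range.2 ha), if_pos (Finset.mem_range.2 hb)]
  have h2 : ∑ a ∈ Finset.range E.n, ∑ b ∈ Finset.range E.n, (if G a b then 1 else 0) ≤ E.n := by
    rw [Finset.sum_comm]
    calc _ ≤ ∑ b ∈ Finset.range E.n, 1 := by
          refine Finset.sum_le_sum fun b _ => ?_
          rw [← Finset.card_filter]
          refine Finset.card_le_one.2 fun a ha a' ha' => ?_
          simp only [Finset.mem_filter, Finset.mem_range, hG] at ha ha'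
          by_contra hne
          -- Two solutions `a`, `a'` for the same `b` carry equal numbers, so `a'` would complete
          -- the pair `a`, `b` to a true triple.
          have hX : E.X a = E.X a' := by omega
          exact ha.2.2.1 ⟨ha.2.1, a', ha'.1, by omega, Ne.symm hne, ha'.2.1⟩
      _ = E.n := by simp
  have h3 : ∑ a ∈ Finset.range E.n, ∑ b ∈ Finset.range E.n, (if G' a b then 1 else 0) ≤ E.n := by
    calc _ ≤ ∑ a ∈ Finset.range E.n, 1 := by
          refine Finset.sum_le_sum fun a _ => ?_
          rw [← Finset.card_filter]
          refine Finset.card_le_one.2 fun b hb b' hb' => ?_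
          simp only [Finset.mem_filter, Finset.mem_range, hG'] at hb hb'
          by_contra hne
          have hX : E.X b = E.X b' := by omega
          exact hb.2.2.1 ⟨hb.2.1, b', hb'.1, by omega, fun h => hb'.2.1 h.symm, Ne.symm hne⟩
      _ = E.n := by simp
  have h4 : E.falseCount = ∑ a ∈ Finset.range E.n, ∑ b ∈ Finset.range E.n,
      ∑ c ∈ Finset.range E.n, (if E.X a + E.X b + E.X c ≠ E.T ∧
        HashMatch w (2 * E.σ) E.a E.T (E.X a) (E.X b) (E.X c) then 1 else 0) := by
    rw [falseCount]
  simp only [Finset.sum_add_distrib] at h1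
  omega

-- A marked pair has at least one match, so a constant charge per pair is absorbed by `matchCount`.
-- The diagonal is paid separately because no search takes place there.
open Classical in
theorem sum_marked_le (k l : ℕ) (g : ℕ → ℕ → ℝ≥0∞) (hg : ∀ a, g a a ≤ k)
    (hg' : ∀ a b, a ≠ b → g a b ≤ k + l * E.matchCount a b) :
    ∑ a ∈ Finset.range E.n, ∑ b ∈ Finset.range E.n, (if E.Marked a b then
      (if E.Dirty a b then 0 else g a b) else 0) ≤ k * E.n + (k + l) * E.cleanCount := by
  have h1 : ∀ a b, (if E.Marked a b then (if E.Dirty a b then 0 else g a b) else 0) ≤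
      (if a = b then (k : ℝ≥0∞) else 0) +
      (k + l) * ((if a ≠ b ∧ ¬ E.Dirty a b then E.matchCount a b else 0 : ℕ) : ℝ≥0∞) := by
    intro a b
    by_cases hm : E.Marked a b
    swap
    · rw [if_neg hm]; exact zero_le
    by_cases hd : E.Dirty a b
    · rw [if_pos hm, if_pos hd]; exact zero_le
    rw [if_pos hm, if_neg hd]
    by_cases hab : a = b
    · subst hab; rw [if_pos rfl]; exact (hg a).trans le_self_add
    · rw [if_neg hab, if_pos ⟨hab, hd⟩, zero_add]
      have h1 : (1 : ℝ≥0∞) ≤ E.matchCount a b := by exact_mod_cast E.matchCount_pos hm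
      calc g a b ≤ k * 1 + l * E.matchCount a b := by rw [mul_one]; exact hg' a b hab
        _ ≤ k * E.matchCount a b + l * E.matchCount a b := by gcongr
        _ = _ := by ring
  calc _ ≤ ∑ a ∈ Finset.range E.n, ∑ b ∈ Finset.range E.n, ((if a = b then (k : ℝ≥0∞) else 0) +
      (k + l) * ((if a ≠ b ∧ ¬ E.Dirty a b then E.matchCount a b else 0 : ℕ) : ℝ≥0∞)) :=
        Finset.sum_le_sum fun a _ => Finset.sum_le_sum fun b _ => h1 a b
    _ = (∑ a ∈ Finset.range E.n, ∑ b ∈ Finset.range E.n, if a = b then (k : ℝ≥0∞) else 0) +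
        (k + l) * E.cleanCount := by
        simp only [Finset.sum_add_distrib, ← Finset.mul_sum]
        rw [cleanCount]; push_cast; rfl
    _ ≤ _ := by
        gcongr
        calc _ ≤ ∑ a ∈ Finset.range E.n, (k : ℝ≥0∞) := by
              refine Finset.sum_le_sum fun a ha => ?_
              rw [Finset.sum_ite_eq, if_pos ha]
          _ = _ := by simp [mul_comm]

theorem sum_costU_le : ∑ u ∈ Finset.range E.Q, E.costU u ≤
    174 * E.n + 324 * (E.falseCount + 2 * E.n) := by
  classical
  calc _ ≤ _ := Finset.sum_le_sum fun u hu => E.costU_le (Finset.mem_range.1 hu).le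
    _ ≤ _ := E.sum_cand_le E.pairCost
    _ ≤ ((174 : ℕ) : ℝ≥0∞) * E.n + ((174 : ℕ) + (150 : ℕ)) * E.cleanCount := by
        refine E.sum_marked_le 174 150 (fun a b => 174 + E.costP a b ((E.H a + E.H b) % E.Q))
          (fun a => ?_) fun a b hab => ?_
        · simp [costP]
        · push_cast; gcongr; exact E.costP_le_matchCount hab
    _ ≤ _ := by
        have h := E.cleanCount_le
        have : (E.cleanCount : ℝ≥0∞) ≤ E.falseCount + 2 * E.n := by exact_mod_cast h
        calc _ = 174 * (E.n : ℝ≥0∞) + 324 * E.cleanCount := by push_cast; norm_num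
          _ ≤ _ := by gcongr

-- The first dirty text ends the search.
open Classical in
theorem card_visited_dirty_le :
    ((Finset.range E.Q).filter fun u => E.Visited u ∧ E.DirtyU u).card ≤ 1 := by
  refine Finset.card_le_one.2 fun u hu u' hu' => ?_
  simp only [Finset.mem_filter, Finset.mem_range] at hu hu'
  rcases lt_trichotomy u u' with h | h | h
  · exact absurd ⟨u', hu'.1, h, hu'.2.2⟩ hu.2.1
  · exact h
  · exact absurd ⟨u, hu.1, h, hu.2.2⟩ hu'.2.1

-- This bounds the output size of all queries, which the factor `r N` multiplies. On a clean text
-- each report contains a clean pair; the only dirty text that is visited has at most `Q` reports.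
open Classical in
theorem sum_card_cand_le : ∑ u ∈ Finset.range E.Q, (if E.Visited u then ((E.cand u).card : ℝ≥0∞)
    else 0) ≤ 3 * E.n + E.falseCount + E.Q := by
  have h1 : ∀ u, (if E.Visited u then ((E.cand u).card : ℝ≥0∞) else 0) ≤
      (∑ z ∈ E.cand u, ∑ a ∈ Finset.range E.n, ∑ b ∈ Finset.range E.n,
      (if E.H a = E.hA u z ∧ E.H b = E.hB u z then (if E.Dirty a b then 0 else 1) else 0)) +
      if E.Visited u ∧ E.DirtyU u then (E.Q : ℝ≥0∞) else 0 := by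
    intro u
    split_ifs with h1 h2 h2
    · refine le_add_left ?_
      have : (E.cand u).card ≤ E.Q := by
        rw [← Finset.card_range E.Q]; exact Finset.card_le_card (Finset.filter_subset _ _)
      exact_mod_cast this
    · exact (E.card_cand_le fun h => h2 ⟨h1, h⟩).trans le_self_add
    · exact zero_le
    · exact zero_le
  refine (Finset.sum_le_sum fun u _ => h1 u).trans ?_
  rw [Finset.sum_add_distrib]
  gcongr ?_ + ?_
  · calc _ ≤ _ := E.sum_cand_le fun a b => if E.Dirty a b then 0 else 1
      _ ≤ ((1 : ℕ) : ℝ≥0∞) * E.n + ((1 : ℕ) + (0 : ℕ)) * E.cleanCount :=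
          E.sum_marked_le 1 0 (fun _ _ => 1) (by simp) (by simp)
      _ ≤ _ := by
          have : (E.cleanCount : ℝ≥0∞) ≤ E.falseCount + 2 * E.n := by exact_mod_cast E.cleanCount_le
          calc _ ≤ ((1 : ℕ) : ℝ≥0∞) * E.n + ((1 : ℕ) + (0 : ℕ)) * (E.falseCount + 2 * E.n) := by gcongr
            _ = _ := by push_cast; ring
  · rw [← Finset.sum_filter, Finset.sum_const, nsmul_eq_mul]
    calc _ ≤ (1 : ℝ≥0∞) * E.Q := by
          gcongr
          exact_mod_cast E.card_visited_dirty_le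
      _ = _ := one_mul _

end Env

end WordRAM

/-! ### Expectation over the hash function -/

namespace WordRAM

open DMOG

variable {w : ℕ}

namespace Env

variable (E : Env w)

theorem two_mul_T : 2 * E.T = 3 * 2 ^ w := by
  have := E.hw
  obtain ⟨k, rfl⟩ : ∃ k, w = k + 1 := ⟨w - 1, by omega⟩
  rw [T, Nat.add_sub_cancel, pow_succ]; ring

/-- Each of the `n ^ 3` triples of wrong sum matches for at most `9 * 2 ^ (w + 2) / Q` of the `2 ^
w` multipliers. -/
theorem Q_mul_sum_falseCount_le :
    E.Q * ∑ i ∈ Finset.range (2 ^ w), (E.withMul i).falseCount ≤ 36 * E.n ^ 3 * 2 ^ w := by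
  classical
  have key : ∀ a b c : ℕ, E.Q * ∑ i ∈ Finset.range (2 ^ w), (if E.X a + E.X b + E.X c ≠ E.T ∧
      HashMatch w (2 * E.σ) i E.T (E.X a) (E.X b) (E.X c) then 1 else 0) ≤ 36 * 2 ^ w := by
    intro a b c
    by_cases hs : E.X a + E.X b + E.X c = E.T
    · simp [hs]
    have hσ := E.hσ
    have hw := E.hw
    rw [← Finset.card_filter]
    have h := card_hashMatch_le (w := w) (s := 2 * E.σ) (by omega) (by have := E.σ_pos; omega)
      (E.hX a) (E.hX b) (E.hX c) E.two_mul_T hs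
      ((Finset.range (2 ^ w)).filter fun i => E.X a + E.X b + E.X c ≠ E.T ∧
        HashMatch w (2 * E.σ) i E.T (E.X a) (E.X b) (E.X c)) fun i hi => by
          simp only [Finset.mem_filter, Finset.mem_range] at hi
          exact ⟨hi.1, hi.2.2⟩
    calc _ ≤ E.Q * (9 * 2 ^ (w + 2 - 2 * E.σ)) := Nat.mul_le_mul_left _ h
      _ = 9 * (2 ^ (2 * E.σ) * 2 ^ (w + 2 - 2 * E.σ)) := by rw [Q]; ring
      _ = 36 * 2 ^ w := by
        rw [← pow_add, show 2 * E.σ + (w + 2 - 2 * E.σ) = w + 2 by omega, pow_add]; ring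
  have h1 : ∑ i ∈ Finset.range (2 ^ w), (E.withMul i).falseCount =
      ∑ a ∈ Finset.range E.n, ∑ b ∈ Finset.range E.n, ∑ c ∈ Finset.range E.n,
        ∑ i ∈ Finset.range (2 ^ w), (if E.X a + E.X b + E.X c ≠ E.T ∧
          HashMatch w (2 * E.σ) i E.T (E.X a) (E.X b) (E.X c) then 1 else 0) := by
    have h2 : ∀ i, (E.withMul i).falseCount = ∑ a ∈ Finset.range E.n, ∑ b ∈ Finset.range E.n,
        ∑ c ∈ Finset.range E.n, (if E.X a + E.X b + E.X c ≠ E.T ∧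
          HashMatch w (2 * E.σ) i E.T (E.X a) (E.X b) (E.X c) then 1 else 0) := by
      intro i
      rw [falseCount]
      rfl
    simp only [h2]
    rw [Finset.sum_comm]
    refine Finset.sum_congr rfl fun a _ => ?_
    rw [Finset.sum_comm]
    refine Finset.sum_congr rfl fun b _ => ?_
    rw [Finset.sum_comm]
  rw [h1]
  simp only [Finset.mul_sum] at key ⊢
  calc _ ≤ ∑ a ∈ Finset.range E.n, ∑ b ∈ Finset.range E.n, ∑ c ∈ Finset.range E.n, 36 * 2 ^ w :=
        Finset.sum_le_sum fun a _ => Finset.sum_le_sum fun b _ => Finset.sum_le_sum fun c _ =>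
          key a b c
    _ = _ := by simp; ring

theorem expected_falseCount_le :
    ∑ v : BitVec w, ((2 : ℝ≥0∞) ^ w)⁻¹ * ((E.withMul v.toNat).falseCount : ℝ≥0∞) ≤
      36 * E.n ^ 3 / E.Q := by
  rw [← Finset.mul_sum, sum_bitVec w fun i => ((E.withMul i).falseCount : ℝ≥0∞)]
  have hQ : (E.Q : ℝ≥0∞) ≠ 0 := by exact_mod_cast E.Q_pos.ne'
  rw [ENNReal.le_div_iff_mul_le (Or.inl hQ) (Or.inl (by simp)), mul_comm, ← mul_assoc,
    mul_comm (E.Q : ℝ≥0∞), mul_assoc, mul_comm, ← div_eq_mul_inv]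
  refine ENNReal.div_le_of_le_mul ?_
  exact_mod_cast E.Q_mul_sum_falseCount_le

variable {M : ℕ} {A : DMOG.Algorithm} {c P R : ℝ≥0∞}

theorem mainCost_le
    (hc : ∑' sA, haltProb A.pre (State.init (toWords E.wA E.dict.encode)) sA = 1)
    (hP : A.preTime E.dict E.wA ≤ P)
    (hq : ∀ u < E.Q, A.queryTime E.dict (E.text u) E.wA ≤ 2 * E.q * c + (E.cand u).card * R) :
    E.mainCost M A.pre A.query ≤ 229 + 206 * E.Q + 30 * P +
      E.Q * (30 + 2 * M + 50 * E.q + 60 * E.q * c) + 30 * R * (3 * E.n + E.falseCount + E.Q) +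
      (174 * E.n + 324 * (E.falseCount + 2 * E.n)) + 150 * E.n := by
  classical
  set p := haltProb A.pre (State.init (toWords E.wA E.dict.encode)) with hp
  -- Averaging over the state left by the preprocessing turns the simulated time into `queryTime`.
  -- Whether `u` is visited depends on the numbers and the hash function only, not on that state.
  have hu : ∀ u < E.Q, ∑' sA, p sA * E.queryCost M A.query sA u ≤
      (30 + 2 * M + 50 * E.q + 60 * E.q * c) +
      30 * R * (if E.Visited u then ((E.cand u).card : ℝ≥0∞) else 0) + E.costU u +
      (if E.Visited u ∧ E.DirtyU u then E.costTop + 75 else 0) := by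
    intro u hu
    simp only [queryCost]
    by_cases hv : E.Visited u
    swap
    · simp [hv]
    simp only [hv, if_true, true_and]
    set Y : ℝ≥0∞ := if E.DirtyU u then E.costTop + 75 else 0
    have h1 : ∀ sA, p sA * (30 + 2 * M + 50 * E.q +
        30 * expTime A.query (sA.feed (toWords E.wA (E.text u))) + E.costU u + Y) =
        p sA * (30 + 2 * M + 50 * E.q + E.costU u + Y) +
        30 * (p sA * expTime A.query (sA.feed (toWords E.wA (E.text u)))) := fun sA => by ring
    simp only [h1]
    rw [ENNReal.tsum_add, ENNReal.tsum_mul_right, hc, one_mul, ENNReal.tsum_mul_left]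
    calc _ ≤ (30 + 2 * M + 50 * E.q + E.costU u + Y) + 30 *
          (2 * E.q * c + (E.cand u).card * R) := by gcongr; exact hq u hu
      _ = _ := by ring
  have hlast : ∑ u ∈ Finset.range E.Q, (if E.Visited u ∧ E.DirtyU u then E.costTop + 75 else 0) ≤
      E.costTop + 75 := by
    rw [← Finset.sum_filter, Finset.sum_const, nsmul_eq_mul]
    calc _ ≤ 1 * (E.costTop + 75) := by
          gcongr
          exact_mod_cast E.card_visited_dirty_le
      _ = _ := one_mul _
  have hsum : ∑' sA, p sA * (4 + ∑ u ∈ Finset.range E.Q, (6 + E.queryCost M A.query sA u)) =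
      4 + (E.Q * 6 + ∑ u ∈ Finset.range E.Q, ∑' sA, p sA * E.queryCost M A.query sA u) := by
    simp only [Finset.sum_add_distrib, Finset.sum_const, Finset.card_range, nsmul_eq_mul]
    simp only [mul_add (p _), ENNReal.tsum_add, ENNReal.tsum_mul_right, hc, one_mul,
      Finset.mul_sum]
    rw [Summable.tsum_finsetSum fun _ _ => ENNReal.summable]
  rw [mainCost, ← hp, hsum]
  have htot := Finset.sum_le_sum fun u (h : u ∈ Finset.range E.Q) => hu u (Finset.mem_range.1 h)
  rw [Finset.sum_add_distrib, Finset.sum_add_distrib, Finset.sum_add_distrib, ← Finset.mul_sum,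
    Finset.sum_const, Finset.card_range, nsmul_eq_mul] at htot
  have hP' : expTime A.pre (State.init (toWords E.wA E.dict.encode)) ≤ P := hP
  calc _ ≤ 30 + 200 * E.Q + 30 * P + (4 + (E.Q * 6 +
        (E.Q * (30 + 2 * M + 50 * E.q + 60 * E.q * c) +
        30 * R * (3 * E.n + E.falseCount + E.Q) +
        (174 * E.n + 324 * (E.falseCount + 2 * E.n)) + (E.costTop + 75)))) := by
        gcongr
        refine htot.trans ?_
        gcongr
        · exact E.sum_card_cand_le
        · exact E.sum_costU_le
    _ = (30 + 4 + 120 + 75) + (200 + 6) * E.Q + 30 * P +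
      E.Q * (30 + 2 * M + 50 * E.q + 60 * E.q * c) + 30 * R * (3 * E.n + E.falseCount + E.Q) +
      (174 * E.n + 324 * (E.falseCount + 2 * E.n)) + 150 * E.n := by rw [costTop]; ring
    _ = _ := by norm_num

/-- The expected cost over a random hash function. -/
theorem expected_mainCost_le
    (hc : ∀ a < 2 ^ w, ∑' sA, haltProb A.pre
      (State.init (toWords E.wA (E.withMul a).dict.encode)) sA = 1)
    (hP : ∀ a < 2 ^ w, A.preTime (E.withMul a).dict E.wA ≤ P)
    (hq : ∀ a < 2 ^ w, ∀ u < E.Q, A.queryTime (E.withMul a).dict ((E.withMul a).text u) E.wA ≤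
      2 * E.q * c + ((E.withMul a).cand u).card * R) :
    ∑ v : BitVec w, ((2 : ℝ≥0∞) ^ w)⁻¹ * (E.withMul v.toNat).mainCost M A.pre A.query ≤
      229 + 206 * E.Q + 30 * P + E.Q * (30 + 2 * M + 50 * E.q + 60 * E.q * c) +
      30 * R * (3 * E.n + 36 * E.n ^ 3 / E.Q + E.Q) +
      (174 * E.n + 324 * (36 * E.n ^ 3 / E.Q + 2 * E.n)) + 150 * E.n := by
  set Y : ℝ≥0∞ := 229 + 206 * E.Q + 30 * P + E.Q * (30 + 2 * M + 50 * E.q + 60 * E.q * c) +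
    30 * R * (3 * E.n + E.Q) + (174 * E.n + 324 * (2 * E.n)) + 150 * E.n with hY
  have hc' : Fintype.card (BitVec w) = 2 ^ w := by
    rw [Fintype.card_congr (BitVec.equivFin (m := w)).toEquiv, Fintype.card_fin]
  calc _ ≤ ∑ v : BitVec w, ((2 : ℝ≥0∞) ^ w)⁻¹ *
        (Y + (30 * R + 324) * (E.withMul v.toNat).falseCount) := by
        refine Finset.sum_le_sum fun v _ => ?_
        gcongr
        refine ((E.withMul v.toNat).mainCost_le (hc _ v.isLt) (hP _ v.isLt)
          (hq _ v.isLt)).trans (le_of_eq ?_)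
        rw [hY]
        simp only [show (E.withMul v.toNat).Q = E.Q from rfl,
          show (E.withMul v.toNat).q = E.q from rfl, show (E.withMul v.toNat).n = E.n from rfl]
        ring
    _ = Y + (30 * R + 324) *
        ∑ v : BitVec w, ((2 : ℝ≥0∞) ^ w)⁻¹ * ((E.withMul v.toNat).falseCount : ℝ≥0∞) := by
        simp only [mul_add (_⁻¹), Finset.sum_add_distrib]
        rw [Finset.sum_const, Finset.card_univ, hc', nsmul_eq_mul, ← mul_assoc]
        push_cast
        rw [ENNReal.mul_inv_cancel (by simp) (by simp), one_mul, Finset.mul_sum]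
        congr 1
        exact Finset.sum_congr rfl fun v _ => by ring
    _ ≤ Y + (30 * R + 324) * (36 * E.n ^ 3 / E.Q) := by
        gcongr; exact E.expected_falseCount_le
    _ = _ := by rw [hY]; ring

end Env

end WordRAM

/-! ### Exponents -/

namespace WordRAM

/-- `2 ^ digits n` lies between `n` and `2 n`, and rounding the exponent down costs a factor of at
most two, for which the `+ 1` in `sigma` makes up. -/
theorem sigma_bounds {t : ℕ} (ht : 1 ≤ t) (σ₀ : ℕ) {n : ℕ} (hn : 1 ≤ n) :
    (n : ℝ) ^ ((1 + 1 / (t : ℝ)) / 2) ≤ 2 ^ sigma σ₀ t n ∧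
    (2 : ℝ) ^ sigma σ₀ t n ≤ 2 ^ (σ₀ + 2) * (n : ℝ) ^ ((1 + 1 / (t : ℝ)) / 2) := by
  have ht' : (1 : ℝ) ≤ t := by exact_mod_cast ht
  have hn' : (1 : ℝ) ≤ n := by exact_mod_cast hn
  set τ : ℝ := (1 + 1 / (t : ℝ)) / 2 with hτ
  have hs : 1 / (t : ℝ) ≤ 1 := by rw [div_le_one (by linarith)]; exact ht'
  have hs0 : 0 < 1 / (t : ℝ) := by positivity
  have hτ0 : 0 ≤ τ := by rw [hτ]; linarith
  have hτ1 : τ ≤ 1 := by rw [hτ]; linarith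
  set d := digits n with hd
  set k := d * (t + 1) / (2 * t) with hk
  have hdn : (n : ℝ) ≤ 2 ^ d := by exact_mod_cast (lt_two_pow_digits n).le
  have hdn' : (2 : ℝ) ^ d ≤ 2 * n := by
    have h : 2 ^ Nat.log 2 n ≤ n := Nat.pow_log_le_self 2 (by omega)
    have h2 : (2 : ℝ) ^ Nat.log 2 n ≤ n := by exact_mod_cast h
    rw [hd, digits, if_neg (by omega), pow_succ]; linarith
  have hdτ : (d : ℝ) * τ = (d * (t + 1) : ℕ) / (2 * t : ℕ) := by
    rw [hτ]; push_cast; field_simp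
  have hk1 : (k : ℝ) ≤ d * τ := by rw [hdτ]; exact Nat.cast_div_le
  have hk2 : (d : ℝ) * τ ≤ k + 1 := by
    rw [hdτ, div_le_iff₀ (by positivity)]
    have := (Nat.lt_div_mul_add (a := d * (t + 1)) (b := 2 * t) (by omega)).le
    rw [← hk] at this
    have h2 : ((d * (t + 1) : ℕ) : ℝ) ≤ (k * (2 * t) + 2 * t : ℕ) := by exact_mod_cast this
    refine h2.trans (le_of_eq ?_)
    push_cast; ring
  have hpow : ((2 : ℝ) ^ d) ^ τ = (2 : ℝ) ^ ((d : ℝ) * τ) := by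
    rw [← Real.rpow_natCast, ← Real.rpow_mul (by norm_num)]
  have hσ : sigma σ₀ t n = σ₀ + (k + 1) := by rw [sigma, ← hd, ← hk]; ring
  have hone : (1 : ℝ) ≤ 2 ^ σ₀ := one_le_pow₀ (by norm_num)
  rw [hσ, pow_add]
  constructor
  · calc (n : ℝ) ^ τ ≤ ((2 : ℝ) ^ d) ^ τ := Real.rpow_le_rpow (by linarith) hdn hτ0
      _ = (2 : ℝ) ^ ((d : ℝ) * τ) := hpow
      _ ≤ (2 : ℝ) ^ ((k : ℝ) + 1) := Real.rpow_le_rpow_of_exponent_le (by norm_num) hk2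
      _ = 2 ^ (k + 1) := by rw [← Real.rpow_natCast]; push_cast; rfl
      _ ≤ _ := le_mul_of_one_le_left (by positivity) hone
  · have h1 : (2 : ℝ) ^ k ≤ 2 * (n : ℝ) ^ τ := by
      calc (2 : ℝ) ^ k = (2 : ℝ) ^ (k : ℝ) := by rw [Real.rpow_natCast]
        _ ≤ (2 : ℝ) ^ ((d : ℝ) * τ) := Real.rpow_le_rpow_of_exponent_le (by norm_num) hk1
        _ = ((2 : ℝ) ^ d) ^ τ := hpow.symm
        _ ≤ (2 * n) ^ τ := Real.rpow_le_rpow (by positivity) hdn' hτ0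
        _ = 2 ^ τ * (n : ℝ) ^ τ := Real.mul_rpow (by norm_num) (by linarith)
        _ ≤ 2 * (n : ℝ) ^ τ := by
          gcongr
          calc (2 : ℝ) ^ τ ≤ 2 ^ (1 : ℝ) := Real.rpow_le_rpow_of_exponent_le (by norm_num) hτ1
            _ = 2 := Real.rpow_one 2
    calc (2 : ℝ) ^ σ₀ * 2 ^ (k + 1) = 2 ^ (σ₀ + 1) * 2 ^ k := by ring
      _ ≤ 2 ^ (σ₀ + 1) * (2 * (n : ℝ) ^ τ) := by gcongr
      _ = _ := by ring

section Powers

variable {s n q B : ℝ}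

theorem rpow_le_of_le_mul (hn : 1 ≤ n) (hB : 1 ≤ B) (hq : 1 ≤ q)
    (hhi : q ≤ B * n ^ ((1 + s) / 2)) {e m f : ℝ} (he : 0 ≤ e) (hem : e ≤ m)
    (hf : (1 + s) / 2 * e ≤ f) : q ^ e ≤ B ^ m * n ^ f := by
  have hn0 : 0 ≤ n := by linarith
  calc q ^ e ≤ (B * n ^ ((1 + s) / 2)) ^ e := Real.rpow_le_rpow (by linarith) hhi he
    _ = B ^ e * n ^ ((1 + s) / 2 * e) := by
      rw [Real.mul_rpow (by linarith) (by positivity), ← Real.rpow_mul hn0]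
    _ ≤ B ^ m * n ^ f := by
      gcongr

/-- Here `s = 1 / t`. The exponent of `q ^ 3` is `3 (1 + s) / 2 ≤ 2 - s / 2` because `s ≤ 1 / 4`.
That of `q ^ (4 - η)` is `(1 + s) (4 - η) / 2 ≤ 2 - s / 2` because `η ≥ 8 s`. False triples and
reports are of order `n ^ (2 - s)`, which leaves a factor `n ^ (s / 2)` for the sub-polynomial `r`.
-/
theorem cost_le_rpow {η ρ k₁ k₂ : ℝ} (hs0 : 0 < s) (hs : s ≤ 1 / 4) (hη : 8 * s ≤ η) (hη1 : η ≤ 1)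
    (hn : 1 ≤ n) (hB : 1 ≤ B) (hq : 1 ≤ q) (hlo : n ^ ((1 + s) / 2) ≤ q)
    (hhi : q ≤ B * n ^ ((1 + s) / 2)) (hk₁ : 0 ≤ k₁) (hk₂ : 0 ≤ k₂) (hρ : 0 ≤ ρ) :
    q ^ 3 + k₁ * q ^ 3 + q ^ 3 * (k₂ * q ^ (1 - η)) +
      (ρ * (8 * q ^ 2) ^ (s / 4) + 1) * (q ^ 2 + n ^ 3 / q ^ 2) ≤
    ((1 + k₁) * B ^ 3 + k₂ * B ^ 4 + (8 * ρ * B + 1) * (B ^ 2 + 1)) * n ^ (2 - s / 2) := by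
  have hn0 : 0 < n := by linarith
  have hq0 : 0 < q := by linarith
  have hB0 : 0 < B := by linarith
  have h3 : q ^ 3 ≤ B ^ 3 * n ^ (2 - s / 2) := by
    have := rpow_le_of_le_mul hn hB hq hhi (e := 3) (m := 3) (f := 2 - s / 2) (by norm_num)
      le_rfl (by linarith)
    exact_mod_cast this
  have h4 : q ^ 3 * q ^ (1 - η) ≤ B ^ 4 * n ^ (2 - s / 2) := by
    have := rpow_le_of_le_mul hn hB hq hhi (e := 3 + (1 - η)) (m := 4) (f := 2 - s / 2)
      (by linarith) (by linarith) (by nlinarith)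
    rw [Real.rpow_add hq0] at this
    exact_mod_cast this
  have h2 : q ^ 2 ≤ B ^ 2 * n ^ (2 - s) := by
    have := rpow_le_of_le_mul hn hB hq hhi (e := 2) (m := 2) (f := 2 - s) (by norm_num)
      le_rfl (by linarith)
    exact_mod_cast this
  have h2' : n ^ 3 / q ^ 2 ≤ n ^ (2 - s) := by
    rw [div_le_iff₀ (by positivity)]
    calc n ^ 3 = n ^ (2 - s) * (n ^ ((1 + s) / 2)) ^ 2 := by
          rw [← Real.rpow_natCast, ← Real.rpow_natCast, ← Real.rpow_mul hn0.le,
            ← Real.rpow_add hn0]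
          congr 1; push_cast; ring
      _ ≤ _ := by gcongr
  have h22 : q ^ 2 + n ^ 3 / q ^ 2 ≤ (B ^ 2 + 1) * n ^ (2 - s) := by linarith
  have hr : (8 * q ^ 2) ^ (s / 4) ≤ 8 * B * n ^ (s / 2) := by
    have h8 : (8 : ℝ) ^ (s / 4) ≤ 8 := by
      calc (8 : ℝ) ^ (s / 4) ≤ 8 ^ (1 : ℝ) :=
            Real.rpow_le_rpow_of_exponent_le (by norm_num) (by linarith)
        _ = 8 := Real.rpow_one 8
    have hq2 : (q ^ 2) ^ (s / 4) ≤ B * n ^ (s / 2) := by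
      have := rpow_le_of_le_mul hn hB hq hhi (e := 2 * (s / 4)) (m := 1) (f := s / 2)
        (by linarith) (by linarith) (by nlinarith)
      rw [Real.rpow_mul hq0.le, Real.rpow_one] at this
      exact_mod_cast this
    rw [Real.mul_rpow (by norm_num) (by positivity), mul_assoc]
    gcongr
  have hsplit : n ^ (s / 2) * n ^ (2 - s) = n ^ (2 - s / 2) := by
    rw [← Real.rpow_add hn0]; congr 1; ring
  have hge : (1 : ℝ) ≤ n ^ (s / 2) := Real.one_le_rpow hn (by linarith)
  have h5 : ρ * (8 * q ^ 2) ^ (s / 4) + 1 ≤ (8 * ρ * B + 1) * n ^ (s / 2) := by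
    have := mul_le_mul_of_nonneg_left hr hρ
    linarith
  have h6 : (ρ * (8 * q ^ 2) ^ (s / 4) + 1) * (q ^ 2 + n ^ 3 / q ^ 2) ≤
      (8 * ρ * B + 1) * (B ^ 2 + 1) * n ^ (2 - s / 2) := by
    calc _ ≤ ((8 * ρ * B + 1) * n ^ (s / 2)) * ((B ^ 2 + 1) * n ^ (2 - s)) := by gcongr
      _ = (8 * ρ * B + 1) * (B ^ 2 + 1) * (n ^ (s / 2) * n ^ (2 - s)) := by ring
      _ = _ := by rw [hsplit]
  have h7 := mul_le_mul_of_nonneg_left h3 hk₁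
  have h8 := mul_le_mul_of_nonneg_left h4 hk₂
  linarith

theorem cost_le_sum {n Q q p c r M : ℝ} (hQ : Q = q * q) (hn : 1 ≤ n) (hnQ : n ≤ Q) (hq : 1 ≤ q)
    (hp : 0 ≤ p) (hc : 0 ≤ c) (hr : 0 ≤ r) (hM : 0 ≤ M) :
    200 + 60 * n + (229 + 206 * Q + 30 * p + Q * (30 + 2 * M + 50 * q + 60 * q * c) +
      30 * r * (3 * n + 36 * n ^ 3 / Q + Q) +
      (174 * n + 324 * (36 * n ^ 3 / Q + 2 * n)) + 150 * n) ≤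
    (12000 + 2 * M) * (q ^ 3 + p + q ^ 3 * c + (r + 1) * (q ^ 2 + n ^ 3 / q ^ 2)) := by
  have hq0 : 0 < q := by linarith
  have hF : 36 * n ^ 3 / Q = 36 * (n ^ 3 / q ^ 2) := by rw [hQ]; ring
  have hF0 : 0 ≤ n ^ 3 / q ^ 2 := by positivity
  rw [hF]
  set F := n ^ 3 / q ^ 2
  have h1 : q ^ 2 ≤ q ^ 3 := pow_le_pow_right₀ hq (by norm_num)
  have h2 : 1 ≤ q ^ 3 := one_le_pow₀ hq
  have h3 : Q = q ^ 2 := by rw [hQ]; ring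
  have h4 : Q * q = q ^ 3 := by rw [hQ]; ring
  rw [h3] at hnQ
  have h5 : r * n ≤ r * q ^ 2 := by gcongr
  have h6 : M * q ^ 2 ≤ M * q ^ 3 := by gcongr
  have h7 : 0 ≤ q ^ 3 * c := by positivity
  have h8 : 0 ≤ r * q ^ 2 := by positivity
  have h9 : 0 ≤ r * F := by positivity
  have h10 : 0 ≤ M * p := by positivity
  have h11 : 0 ≤ M * (q ^ 3 * c) := by positivity
  have h12 : 0 ≤ M * (r * q ^ 2) := by positivity
  have h13 : 0 ≤ M * (r * F) := by positivity
  have h14 : 0 ≤ M * q ^ 2 := by positivity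
  have h15 : 0 ≤ M * F := by positivity
  calc _ = 429 + 1032 * n + (236 * q ^ 2 + 2 * (M * q ^ 2) + 50 * q ^ 3 + 60 * (q ^ 3 * c)) +
        30 * p + (90 * (r * n) + 1080 * (r * F) + 30 * (r * q ^ 2)) + 11664 * F := by
        rw [h3]; ring
    _ ≤ 12000 * q ^ 3 + 12000 * p + 12000 * (q ^ 3 * c) + 12000 * (r * q ^ 2) + 12000 * (r * F) +
        12000 * q ^ 2 + 12000 * F + 2 * (M * q ^ 3) + 2 * (M * p) + 2 * (M * (q ^ 3 * c)) +
        2 * (M * (r * q ^ 2)) + 2 * (M * (r * F)) + 2 * (M * q ^ 2) + 2 * (M * F) := by linarith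
    _ = _ := by ring

end Powers

end WordRAM

/-! ### The resulting 3SUM algorithm and the contradiction -/

namespace WordRAM

theorem Runs.computes {w : ℕ} {c : Cmd} {s : State w} {post : State w → Prop} {B : ℝ≥0∞}
    (h : Runs c s post B) (hB : B ≠ ∞) : Computes c s post := by
  classical
  refine computes_of_ert (f := fun s' => if post s' then 0 else ∞) (fun s' hs' => if_neg hs') ?_
  refine ne_top_of_le_ne_top hB ((h _ 0 fun s' hs' => ?_).trans (by simp))
  rw [if_pos hs']

theorem Runs.expTime_le {w : ℕ} {c : Cmd} {s : State w} {post : State w → Prop} {B : ℝ≥0∞}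
    (h : Runs c s post B) : expTime c s ≤ B :=
  (expTime_le_ert (fun _ => 0) c s).trans ((h _ 0 fun _ _ => le_rfl).trans (by simp))

open DMOG

theorem ennreal_cost_le {n Q q M : ℕ} {p c r : ℝ} (hQ : Q = q * q) (hn : 1 ≤ n) (hnQ : n ≤ Q)
    (hq : 1 ≤ q) (hp : 0 ≤ p) (hc : 0 ≤ c) (hr : 0 ≤ r) :
    200 + 60 * (n : ℝ≥0∞) + (229 + 206 * Q + 30 * ENNReal.ofReal p +
      Q * (30 + 2 * M + 50 * q + 60 * q * ENNReal.ofReal c) +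
      30 * ENNReal.ofReal r * (3 * n + 36 * n ^ 3 / Q + Q) +
      (174 * n + 324 * (36 * n ^ 3 / Q + 2 * n)) + 150 * n) ≤
    ENNReal.ofReal ((12000 + 2 * M) * ((q : ℝ) ^ 3 + p + q ^ 3 * c +
      (r + 1) * (q ^ 2 + n ^ 3 / q ^ 2))) := by
  lift p to ℝ≥0 using hp
  lift c to ℝ≥0 using hc
  lift r to ℝ≥0 using hr
  simp only [ENNReal.ofReal_coe_nnreal]
  have hQ0 : (Q : ℝ≥0) ≠ 0 := by
    have : 0 < Q := by omega
    exact_mod_cast this.ne'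
  have h : ((200 + 60 * (n : ℝ≥0) + (229 + 206 * Q + 30 * p +
      Q * (30 + 2 * M + 50 * q + 60 * q * c) + 30 * r * (3 * n + 36 * n ^ 3 / Q + Q) +
      (174 * n + 324 * (36 * n ^ 3 / Q + 2 * n)) + 150 * n) : ℝ≥0) : ℝ≥0∞) =
      200 + 60 * (n : ℝ≥0∞) + (229 + 206 * Q + 30 * p +
      Q * (30 + 2 * M + 50 * q + 60 * q * c) + 30 * r * (3 * n + 36 * n ^ 3 / Q + Q) +
      (174 * n + 324 * (36 * n ^ 3 / Q + 2 * n)) + 150 * n) := by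
    push_cast [ENNReal.coe_div hQ0]
    rfl
  rw [← h, ← ENNReal.ofReal_coe_nnreal]
  refine ENNReal.ofReal_le_ofReal ?_
  push_cast
  exact cost_le_sum (by exact_mod_cast hQ) (by exact_mod_cast hn) (by exact_mod_cast hnQ)
    (by exact_mod_cast hq) p.2 c.2 r.2 (Nat.cast_nonneg M)

section Instance

variable {A : DMOG.Algorithm} {kind : GapKind} {mode : Mode}

/-- A bound for the time per text character on the dictionaries of the reduction makes the
reduction a fast algorithm for 3SUM. -/
theorem solvesThreeSum_reduction (hA : A.Solves kind mode) {σ₀ t : ℕ} {η ρ k₁ k₂ : ℝ}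
    (ht : 4 ≤ t) (hη : 8 / (t : ℝ) ≤ η) (hη1 : η ≤ 1) (hk₁ : 0 ≤ k₁) (hk₂ : 0 ≤ k₂) (hρ : 0 ≤ ρ)
    (hpre : ∀ (w : ℕ) (E : Env w), σ₀ ≤ E.σ → (∀ u, A.Admissible kind E.dict (E.text u) E.wA) →
      A.preTime E.dict E.wA ≤ ENNReal.ofReal (k₁ * (E.q : ℝ) ^ 3))
    (hquery : ∀ (w : ℕ) (E : Env w), σ₀ ≤ E.σ →
      (∀ u, A.Admissible kind E.dict (E.text u) E.wA) → ∀ u,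
      A.queryTime E.dict (E.text u) E.wA ≤
        2 * E.q * ENNReal.ofReal (k₂ * (E.q : ℝ) ^ (1 - η)) +
        (E.cand u).card * ENNReal.ofReal (ρ * (8 * (E.q : ℝ) ^ 2) ^ ((1 / (t : ℝ)) / 4))) :
    ∃ C : ℝ, SolvesThreeSum (reduction A kind σ₀ t) (wordFactor A σ₀ t)
      (fun n => C * (n : ℝ) ^ (2 - (1 / (t : ℝ)) / 2)) := by
  set M := A.pre.regBound + A.query.regBound with hM
  set B : ℝ := 2 ^ (σ₀ + 2) with hB
  refine ⟨(12000 + 2 * M) * ((1 + k₁) * B ^ 3 + k₂ * B ^ 4 + (8 * ρ * B + 1) * (B ^ 2 + 1)), ?_⟩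
  intro w xs hxs hw
  have ht1 : 1 ≤ t := by omega
  set E := instanceEnv A kind ht1 xs hxs hw with hE
  have hn : E.n = xs.length := rfl
  have hn1 : 1 ≤ E.n := by rw [hn]; exact List.length_pos_iff.2 hxs
  have hq1 : 1 ≤ E.q := by have := E.two_le_q; omega
  have hadm : ∀ a u, A.Admissible kind (E.withMul a).dict ((E.withMul a).text u) E.wA :=
    fun a u => admissible (E.withMul a) rfl rfl u
  have hσ : σ₀ ≤ E.σ := by
    change σ₀ ≤ sigma σ₀ t xs.length
    rw [sigma, add_assoc]; exact Nat.le_add_right _ _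
  have ht' : (4 : ℝ) ≤ t := by exact_mod_cast ht
  have hs : 1 / (t : ℝ) ≤ 1 / 4 := by gcongr
  have hs0 : 0 < 1 / (t : ℝ) := by positivity
  obtain ⟨hlo, hhi⟩ := sigma_bounds ht1 σ₀ hn1
  have hqσ : (E.q : ℝ) = 2 ^ sigma σ₀ t E.n := by
    change ((2 ^ sigma σ₀ t xs.length : ℕ) : ℝ) = _
    push_cast; rfl
  rw [← hqσ] at hlo hhi
  have hq1' : (1 : ℝ) ≤ E.q := by exact_mod_cast hq1
  have hruns := runs_reduction (kind := kind) (σ₀ := σ₀) (t := t) (ht := ht1) (hxs := hxs)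
    (hw := hw) hA
  rw [← hE, ← hn] at hruns
  have hexp := E.expected_mainCost_le (M := M) (A := A)
    (P := ENNReal.ofReal (k₁ * (E.q : ℝ) ^ 3)) (c := ENNReal.ofReal (k₂ * (E.q : ℝ) ^ (1 - η)))
    (R := ENNReal.ofReal (ρ * (8 * (E.q : ℝ) ^ 2) ^ ((1 / (t : ℝ)) / 4)))
    (fun a _ => (hA _ _ _ (hadm a 0)).1) (fun a _ => hpre w (E.withMul a) hσ (hadm a))
    (fun a _ u _ => hquery w (E.withMul a) hσ (hadm a) u)
  have hbound := (add_le_add_right hexp (200 + 60 * (E.n : ℝ≥0∞))).trans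
    (ennreal_cost_le (M := M) E.Q_eq hn1 E.n_le hq1 (by positivity) (by positivity) (by positivity))
  have hreal := cost_le_rpow hs0 hs (η := η) (ρ := ρ) (k₁ := k₁) (k₂ := k₂)
    (by rw [mul_one_div]; exact hη) hη1 (n := E.n) (by exact_mod_cast hn1)
    (B := B) (one_le_pow₀ (by norm_num)) hq1' hlo hhi hk₁ hk₂ hρ
  have hfin := hbound.trans (ENNReal.ofReal_le_ofReal
    (mul_le_mul_of_nonneg_left hreal (show (0 : ℝ) ≤ 12000 + 2 * M by positivity)))
  rw [← mul_assoc] at hfin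
  have hruns' := hruns.mono (fun _ h => h) hfin
  exact ⟨hruns'.computes ENNReal.ofReal_ne_top, hruns'.expTime_le⟩

theorem card_cand (E : Env w) (u : ℕ) : outSize E.dict (E.text u) = (E.cand u).card := by
  rw [Env.dict, Env.text, outSize_gadget E.two_le_q, ← Env.Q_eq]
  · rfl
  · intro b hb
    rcases E.hβ with h | h
    · rw [h] at hb; simp at hb
    · rw [h] at hb
      simp only [Option.mem_def, Option.some.injEq] at hb
      rw [← hb]; rfl

end Instance

end WordRAM

theorem theorem3
    (h3SUM : ThreeSumConjecture)
    (kind : GapKind) (mode : Mode) (A : DMOG.Algorithm) (hA : A.Solves kind mode)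
    (ε : ℝ) (hε : 0 < ε) (C : ℝ)
    (hpre : ∀ D T w, A.Admissible kind D T w → 1 ≤ D.degeneracy →
      A.preTime D w ≤ ENNReal.ofReal (C * D.size * (D.degeneracy : ℝ) ^ (1 - ε)))
    (c : Dictionary → List ℕ → ℕ → ℝ≥0∞) (r : ℕ → ℝ≥0) (hr : SubPolynomial r)
    (hquery : ∀ D T w, A.Admissible kind D T w → T ≠ [] →
      A.queryTime D T w ≤ T.length * c D T w + outSize D T * r (instSize D T)) :
    ∀ η : ℝ, 0 < η → ∀ x : ℝ, x < 1 / 2 → ∀ (K : ℝ) (Δ : ℕ),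
      ∃ D T w, A.Admissible kind D T w ∧ T ≠ [] ∧ instSize D T ≤ 3 * D.size ∧
        Δ ≤ D.degeneracy ∧ (D.size : ℝ) ^ x ≤ D.degeneracy ∧
        ENNReal.ofReal (K * (D.degeneracy : ℝ) ^ (1 - η)) < c D T w := by
  intro η hη x hx K Δ
  by_contra! hcon
  -- `s = 1 / t` has to be at most `1 / 4` and at most `min η 1 / 8`; the minimum with `1` keeps the
  -- exponent `1 - η` nonnegative.
  obtain ⟨t, ht⟩ := exists_nat_ge (max 4 (8 / min η 1))
  have hη' : 0 < min η 1 := lt_min hη one_pos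
  have ht4 : (4 : ℝ) ≤ t := (le_max_left _ _).trans ht
  have ht8 : 8 / (t : ℝ) ≤ min η 1 := by
    have := (le_max_right _ _).trans ht
    rw [div_le_iff₀ hη'] at this
    rw [div_le_iff₀ (by linarith), mul_comm]; exact this
  have ha : 0 < (1 / (t : ℝ)) / 4 := by positivity
  obtain ⟨ρ, hρ, hev⟩ := (hr _ ha).exists_pos
  rw [Asymptotics.IsBigOWith, Filter.eventually_atTop] at hev
  obtain ⟨N₀, hN₀⟩ := hev
  -- For `|D| = 2 ^ (2 + 2 σ)` and degeneracy `2 ^ σ` the condition `|D| ^ x ≤ δ` reads `2 x ≤ σ (1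
  -- - 2 x)`. As `2 x < 1`, it suffices that `σ ≥ 1 / (1 - 2 x)`.
  obtain ⟨m, hm⟩ := exists_nat_ge (1 / (1 - 2 * x))
  -- The three summands enforce the lower bound `Δ` on the degeneracy, the range in which the bound
  -- on `r` is valid, and the comparison with `|D| ^ x`.
  set σ₀ := Δ + N₀ + m with hσ₀
  have hq : ∀ {w : ℕ} (E : Env w), σ₀ ≤ E.σ → σ₀ ≤ E.q := fun E h =>
    h.trans (Nat.lt_two_pow_self).le
  have hdeg : ∀ {w : ℕ} (E : Env w), E.dict.degeneracy = E.q := fun E =>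
    degeneracy_gadget (by have := E.two_le_q; omega)
  have hsize : ∀ {w : ℕ} (E : Env w), E.dict.size = 4 * E.Q := fun E => by
    rw [Env.dict, gadget_size, Env.Q_eq]
  refine h3SUM ((1 / (t : ℝ)) / 2) (by positivity) ⟨_, _,
    solvesThreeSum_reduction hA (σ₀ := σ₀) (t := t) (η := min η 1) (ρ := ρ)
    (k₁ := 4 * max C 0) (k₂ := max K 0) (by exact_mod_cast ht4) ht8 (min_le_right _ _)
    (by positivity) (by positivity) hρ.le ?_ ?_⟩
  · intro w E hσ hadm
    have hq1 : (1 : ℝ) ≤ E.q := by exact_mod_cast (by have := E.two_le_q; omega : 1 ≤ E.q)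
    refine (hpre _ _ _ (hadm 0) ?_).trans (ENNReal.ofReal_le_ofReal ?_)
    · rw [hdeg]; exact_mod_cast hq1
    · rw [hdeg, hsize, E.Q_eq]
      push_cast
      -- Even `|D| δ = 4 q ^ 3` is cheap enough, so the exponent `1 - ε` may be replaced by `1`. A
      -- negative `C` is replaced by `0`.
      calc C * (4 * ((E.q : ℝ) * E.q)) * (E.q : ℝ) ^ (1 - ε) ≤
            max C 0 * (4 * ((E.q : ℝ) * E.q)) * (E.q : ℝ) ^ (1 : ℝ) := by
            gcongr
            · exact le_max_left _ _
            · linarith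
        _ = _ := by rw [Real.rpow_one]; ring
  · intro w E hσ hadm u
    have hq1 : (1 : ℝ) ≤ E.q := by exact_mod_cast (by have := E.two_le_q; omega : 1 ≤ E.q)
    have hlen : (E.text u).length = 2 * E.q := gadgetText_length _ _
    have hne : E.text u ≠ [] := by
      intro h
      rw [h] at hlen
      have := E.two_le_q
      simp at hlen; omega
    obtain ⟨hN1, hN2⟩ := instSize_bounds E u
    have hσq := hq E hσ
    have hqQ : E.q ≤ E.Q := by rw [E.Q_eq]; exact Nat.le_mul_of_pos_left _ (by have := E.two_le_q; omega)
    have hc : c E.dict (E.text u) E.wA ≤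
        ENNReal.ofReal (max K 0 * (E.q : ℝ) ^ (1 - min η 1)) := by
      -- The negated conclusion applies to every instance of the reduction and bounds its time per
      -- character.
      refine (hcon _ _ _ (hadm u) hne ?_ ?_ ?_).trans (ENNReal.ofReal_le_ofReal ?_)
      · rw [hsize]; omega
      · rw [hdeg]; omega
      · rw [hdeg, hsize]
        rcases le_or_gt x 0 with hx0 | hx0
        · refine le_trans (Real.rpow_le_one_of_one_le_of_nonpos ?_ hx0) hq1
          have := E.Q_pos
          exact_mod_cast (by omega : 1 ≤ 4 * E.Q)
        · have h4 : ((4 * E.Q : ℕ) : ℝ) = (2 : ℝ) ^ ((2 + 2 * E.σ : ℕ) : ℝ) := by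
            rw [Real.rpow_natCast, Env.Q, pow_add]; push_cast; ring
          have hqσ : (E.q : ℝ) = (2 : ℝ) ^ (E.σ : ℝ) := by
            rw [Real.rpow_natCast, Env.q]; push_cast; rfl
          rw [h4, hqσ, ← Real.rpow_mul (by norm_num)]
          refine Real.rpow_le_rpow_of_exponent_le (by norm_num) ?_
          push_cast
          have hσm : (m : ℝ) ≤ E.σ := by exact_mod_cast (by omega : m ≤ E.σ)
          have h5 := hm.trans hσm
          rw [div_le_iff₀ (by linarith)] at h5
          nlinarith
      · rw [hdeg]
        gcongr
        · exact le_max_left _ _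
        · exact min_le_left _ _
    have hr' : (r (instSize E.dict (E.text u)) : ℝ≥0∞) ≤
        ENNReal.ofReal (ρ * (8 * (E.q : ℝ) ^ 2) ^ ((1 / (t : ℝ)) / 4)) := by
      rw [← ENNReal.ofReal_coe_nnreal]
      refine ENNReal.ofReal_le_ofReal ?_
      have h6 := hN₀ (instSize E.dict (E.text u)) (by omega)
      rw [Real.norm_of_nonneg (NNReal.coe_nonneg _), Real.norm_of_nonneg (by positivity)] at h6
      refine h6.trans ?_
      gcongr
      have h7 : instSize E.dict (E.text u) ≤ 8 * E.q ^ 2 := by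
        rw [pow_two, ← E.Q_eq]; exact hN2.le
      exact_mod_cast h7
    refine (hquery _ _ _ (hadm u) hne).trans ?_
    rw [hlen, card_cand]
    push_cast
    gcongr
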